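/- **Setting.** Let $u_0(x)=\sum_{p=1}^P\frac{c_p}{x-z_p}+\mathrm{c.c.}$ with $c_p\neq0$, $\mathrm{Im}\,z_p>0$, $\mathrm{Re}\,z_1<\dots<\mathrm{Re}\,z_P$ and $\mathrm{Re}(c_1+\dots+c_P)=0$ (equivalently $u_0\in L^1(\mathbb R)$). Suppose $u_0>0$ on $\mathbb R$ and $u_0$ is strictly monotone on $(-\infty,x_{\mathrm c})$ and on $(x_{\mathrm c},\infty)$ for some $x_{\mathrm c}\in\mathbb R$ (a positive rational Klaus–Shaw potential). The bulk is $\mathcal B=(-\max u_0,0)$; for $\lambda\in\mathcal B$ let $x_-(\lambda)<x_+(\lambda)$ be the two real roots of $u_0(x)=-\lambda$. Put $$f(z)=\sum_p c_p\bigl(\mathrm{Log}(i(z-z_p))+\tfrac{\pi i}2\bigr)+\mathrm{c.c.},\qquad h(z;\lambda)=\lambda z+f(z),$$ where $\mathrm{Log}$ is the principal branch and "$+\,\mathrm{c.c.}$" means adding, for complex $z$, the complex conjugate of the same expression evaluated at $z^*$. **Eigenvalues.** For $\epsilon>0$ and $\lambda<0$ let $A_{mp}(\lambda)=\int_{C_m}\frac{e^{-ih(z;\lambda)/\epsilon}}{z-z_p}\,dz$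 ($1\le m,p\le P$), where $C_m$ lies in the domain of analyticity of $f$ (the plane cut vertically upwards from each $z_p$ and downwards from each $z_p^*$) and begins at $i\infty$ to the left of all the poles. If $ic_m/\epsilon$ is not a negative integer, $C_m$ ends at $i\infty$ to the right of $\mathrm{Re}\,z=\mathrm{Re}\,z_m$ and (if $m<P$) to the left of $\mathrm{Re}\,z=\mathrm{Re}\,z_{m+1}$; if $ic_m/\epsilon$ is a negative integer, $C_m$ ends at $z_m$. The eigenvalues are the negative zeros of the Evans function $D(\lambda)=\det\mathbf A(\lambda)$. **Suitability.** For $\lambda\in\mathcal B$, $\mathbf A(\lambda)$ is said to have a suitable modification if there are contours $W_1,\dots,W_P$, each with a continuous branch of $f$ (hence of $h$) along it, and an index $Q$, such that the following hold. 1. The $W_m$ are $C^1$ curves avoiding all $z_p,z_p^*$; each end goes to $i\infty$ (i.e. $\mathrm{Im}\,z\to+\infty$) or to some $z_p$ along which $\mathrm{Re}(-if)\to-\infty$. 2. The critical points of $h(\cdot;\lambda)$ in the open upper half-plane correspond bijectively to the indices $m\ne Q$ (so there are $P-1$ of them), in such a way that $\mathrm{Re}(-ih)$ restricted to $W_m$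 has its maximum only at the corresponding critical point $x_m$, where $W_m$ passes from one valley to the opposite one ($\mathrm{Re}(-ih''(x_m;\lambda)\tau^2)<0$, $\tau$ being the tangent vector). 3. $W_Q$ passes in the same sense, from left to right, over $x_-(\lambda)$ and $x_+(\lambda)$, where its branch of $f$ takes the values $f(x_\pm(\lambda))$; elsewhere on $W_Q$ one has $\mathrm{Re}(-ih)<0$. 4. For all sufficiently small $\epsilon>0$ the integrals $\int_{W_m}\frac{e^{-ih(z;\mu)/\epsilon}}{z-z_p}dz$ converge absolutely for all $\mu<0$, and there is an invertible matrix $\mathbf N$, independent of $\mu$, such that they are the entries of $\mathbf N\mathbf A(\mu)$ for all $\mu<0$. **Phase.** If $x_1,\dots,x_{P-1}$ are the (distinct) critical points of $h(\cdot;\lambda)$ in the upper half-plane, put $$\Psi^-(x;\lambda)=(x-x_-(\lambda))\frac{\prod_p(x-x_p)}{\prod_p(x-z_p)},\qquad \Psi^+(x;\lambda)=(x-x_+(\lambda))\frac{\prod_p(x-x_p^*)}{\prod_p(x-z_p^*)},$$ define real $\psi_\pm(\lambda)$ (modulo $2\pi$; any determination may be used) by $e^{\mp i\psi_\pm(\lambda)-i\pi/4}=\Psi^\mp(x_\pm(\lambda);\lambda)/|\Psi^\mp(x_\pm(\lambda);\lambda)|$,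 and let $$T_\epsilon(\lambda)=\frac1{2\pi\epsilon}\int_{-\max u_0}^{\lambda}(x_+(\eta)-x_-(\eta))\,d\eta+\frac1{2\pi}(\psi_+(\lambda)-\psi_-(\lambda)).$$ Let $[\cdot]$ be the nearest integer function, so that $|[T_\epsilon(\lambda)]-T_\epsilon(\lambda)|\le\frac12$. **Corollary (local approximation of eigenvalues).** Let $K\subset\mathcal B$ be a compact interval such that $\mathbf A(\lambda)$ has a suitable modification for every $\lambda\in K$, and let $J$ be a positive integer. Then there are $C>0$ and $\epsilon_0>0$, depending only on $u_0$, $K$ and $J$, such that for all $0<\epsilon<\epsilon_0$ and all $\Lambda\in K$ there are eigenvalues $\lambda_{-J}<\dots<\lambda_J$ with $$\left|\lambda_j-\Lambda-2\pi\epsilon\,\frac{j+[T_\epsilon(\Lambda)]-T_\epsilon(\Lambda)}{x_+(\Lambda)-x_-(\Lambda)}\right|\le C\epsilon^2,\qquad j=-J,\dots,J,$$ and these are the $2J+1$ eigenvalues closest to $\Lambda$, up to near-ties: every other eigenvalue $\mu$ satisfies $|\lambda_j-\Lambda|\le|\mu-\Lambda|+C\epsilon^2$ for all $|j|\le J$;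 and if $|[T_\epsilon(\Lambda)]-T_\epsilon(\Lambda)|\le\frac12-C\epsilon$, then $|\lambda_j-\Lambda|<|\mu-\Lambda|$ for all $|j|\le J$ and every other eigenvalue $\mu$. -/

import Mathlib

open scoped ComplexConjugate
open Filter Topology

/-- A rational real potential with simple poles,
`u₀(x) = ∑ p, c p / (x - z p) + c.c.`, where `c p ≠ 0` and the poles `z p` lie in the open upper
half-plane and have strictly increasing real parts.  The last condition says that `u₀ ∈ L¹(ℝ)`. -/
structure RationalPotential (P : ℕ) where
  c : Fin P → ℂ
  z : Fin P → ℂ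
  c_ne_zero : ∀ p, c p ≠ 0
  z_im_pos : ∀ p, 0 < (z p).im
  z_re_strictMono : StrictMono fun p => (z p).re
  re_sum_c : (∑ p, c p).re = 0

namespace RationalPotential

variable {P : ℕ} (u : RationalPotential P)

/-- The rational function `u₀` on the complex plane. -/
noncomputable def u0C (w : ℂ) : ℂ :=
  ∑ p, (u.c p / (w - u.z p) + conj (u.c p) / (w - conj (u.z p)))

/-- The potential `u₀ : ℝ → ℝ`. -/
noncomputable def u0 (x : ℝ) : ℝ := (u.u0C x).re

/-- `w` is not one of the poles of `u₀`. -/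
def NotPole (w : ℂ) : Prop := ∀ p, w ≠ u.z p ∧ w ≠ conj (u.z p)

/-- Klaus-Shaw potentials: strictly monotone on each side of some point `x_c` (a maximum or a
minimum, since `u₀` vanishes at `±∞`). -/
def IsKlausShaw : Prop :=
  ∃ xc : ℝ,
    (StrictMonoOn u.u0 (Set.Iio xc) ∨ StrictAntiOn u.u0 (Set.Iio xc)) ∧
    (StrictMonoOn u.u0 (Set.Ioi xc) ∨ StrictAntiOn u.u0 (Set.Ioi xc))

/-- Positive rational Klaus-Shaw potentials. -/
def IsPositiveKlausShaw : Prop := u.IsKlausShaw ∧ ∀ x, 0 < u.u0 x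

/-- The bulk `{λ : -sup u₀ < λ < -inf u₀}`. -/
def bulk : Set ℝ := {lam | -(⨆ x, u.u0 x) < lam ∧ lam < -(⨅ x, u.u0 x)}

/-- The left real turning point `x₋(λ)`.  (For `λ` in the bulk of a Klaus-Shaw potential the
equation `u₀(x) = -λ` has exactly two real roots.) -/
noncomputable def xMinus (lam : ℝ) : ℝ := sInf {x : ℝ | u.u0 x = -lam}

/-- The right real turning point `x₊(λ)`. -/
noncomputable def xPlus (lam : ℝ) : ℝ := sSup {x : ℝ | u.u0 x = -lam}

/-- The antiderivative `f` of `u₀` given by principal logarithms; its branch cuts are the vertical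
rays going up from the `z p` and down from the `conj (z p)`. -/
noncomputable def f (w : ℂ) : ℂ :=
  ∑ p, (u.c p * (Complex.log (Complex.I * (w - u.z p)) + Real.pi * Complex.I / 2) +
    conj (u.c p) *
      (Complex.log (-Complex.I * (w - conj (u.z p))) - Real.pi * Complex.I / 2))

/-- The exponent `h(w; λ) = λ w + f(w)`. -/
noncomputable def h (lam : ℝ) (w : ℂ) : ℂ := lam * w + u.f w

/-- The critical points of `h(·; λ)` in the open upper half-plane, i.e. the solutions of
`h'(w; λ) = λ + u₀(w) = 0` there. -/
def upperCritical (lam : ℝ) : Set ℂ :=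
  {w | 0 < w.im ∧ u.NotPole w ∧ (lam : ℂ) + u.u0C w = 0}

/-- `Ψ⁻(x; λ) = (x - x₋(λ)) ∏ (x - x_p(λ)) / ∏ (x - z_p)`, where the `x_p(λ)` are the critical
points in the upper half-plane (supposed distinct, i.e. simple). -/
noncomputable def PsiMinus (lam : ℝ) (x : ℂ) : ℂ :=
  (x - u.xMinus lam) * (∏ᶠ w ∈ u.upperCritical lam, (x - w)) / ∏ p, (x - u.z p)

/-- `Ψ⁺(x; λ) = (x - x₊(λ)) ∏ (x - conj x_p(λ)) / ∏ (x - conj z_p)`. -/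
noncomputable def PsiPlus (lam : ℝ) (x : ℂ) : ℂ :=
  (x - u.xPlus lam) * (∏ᶠ w ∈ u.upperCritical lam, (x - conj w)) / ∏ p, (x - conj (u.z p))

/-- The real numbers `a`, `b` are values of the phases `ψ₊(λ)`, `ψ₋(λ)`, which are defined
(modulo `2π`) by
`exp(-iψ₊ - iπ/4) = Ψ⁻(x₊)/|Ψ⁻(x₊)|` and `exp(iψ₋ - iπ/4) = Ψ⁺(x₋)/|Ψ⁺(x₋)|`. -/
def IsPhasePair (lam a b : ℝ) : Prop :=
  Complex.exp (-(Complex.I * a) - Complex.I * Real.pi / 4) =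
      u.PsiMinus lam (u.xPlus lam) / ‖u.PsiMinus lam (u.xPlus lam)‖ ∧
    Complex.exp (Complex.I * b - Complex.I * Real.pi / 4) =
      u.PsiPlus lam (u.xMinus lam) / ‖u.PsiPlus lam (u.xMinus lam)‖

/-- `T_ε(λ) = (2πε)⁻¹ ∫_{-max u₀}^λ (x₊ - x₋) dη + (ψ₊(λ) - ψ₋(λ)) / (2π)`, for given
determinations `psiP`, `psiM` of the phases `ψ₊`, `ψ₋`. -/
noncomputable def T (psiP psiM : ℝ → ℝ) (eps lam : ℝ) : ℝ :=
  1 / (2 * Real.pi * eps) * (∫ eta in (-(⨆ x, u.u0 x))..lam, (u.xPlus eta - u.xMinus eta)) +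
    1 / (2 * Real.pi) * (psiP lam - psiM lam)

/-! ### The Evans function -/

/-- Abscissa of the initial vertical ray of the contours: to the left of all poles. -/
noncomputable def leftAbscissa (m : Fin P) : ℝ := (u.z ⟨0, m.pos⟩).re - 1

/-- Abscissa of the final vertical ray of `U_m^<`: to the right of `z m` and, if `z m` is not the
last pole, to the left of the next one. -/
noncomputable def rightAbscissa (m : Fin P) : ℝ :=
  if hm : m.val + 1 < P then ((u.z m).re + (u.z ⟨m.val + 1, hm⟩).re) / 2 else (u.z m).re + 1

/-- `∫ g(w) dw` along the vertical ray from `i∞` down to the real point `a`. -/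
noncomputable def descendingRay (a : ℝ) (g : ℂ → ℂ) : ℂ :=
  -∫ y in Set.Ioi (0 : ℝ), g (a + Complex.I * y) * Complex.I

/-- `∫ g(w) dw` over the contour `U_m^<`: from `i∞` down to the real axis on the left of all poles,
along the real axis, and up to `i∞` between `z m` and the next pole. -/
noncomputable def integralU (m : Fin P) (g : ℂ → ℂ) : ℂ :=
  descendingRay (u.leftAbscissa m) g +
    (∫ x in (u.leftAbscissa m)..(u.rightAbscissa m), g (x : ℂ)) -
    descendingRay (u.rightAbscissa m) g

/-- `∫ g(w) dw` over the contour `ℓ₀(z m)`: from `i∞` down to the real axis on the left of all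
poles, along the real axis, and up to the pole `z m`. -/
noncomputable def integralL (m : Fin P) (g : ℂ → ℂ) : ℂ :=
  descendingRay (u.leftAbscissa m) g +
    (∫ x in (u.leftAbscissa m)..(u.z m).re, g (x : ℂ)) +
    ∫ y in (0 : ℝ)..(u.z m).im, g ((u.z m).re + Complex.I * y) * Complex.I

open Classical in
/-- `∫ g(w) dw` over `C_m`, which is `ℓ₀(z m)` if `i c_m / ε` is a negative integer and `U_m^<`
otherwise. -/
noncomputable def integralC (eps : ℝ) (m : Fin P) (g : ℂ → ℂ) : ℂ :=
  if ∃ n : ℕ, 0 < n ∧ Complex.I * u.c m / eps = -(n : ℂ) then u.integralL m g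
  else u.integralU m g

/-- The matrix `A(λ)` for `λ < 0`. -/
noncomputable def A (eps lam : ℝ) : Matrix (Fin P) (Fin P) ℂ := fun m p =>
  u.integralC eps m fun w => Complex.exp (-Complex.I * u.h lam w / eps) / (w - u.z p)

/-- The Evans function `D(λ) = det A(λ)`. -/
noncomputable def evans (eps lam : ℝ) : ℂ := (u.A eps lam).det

/-- The (negative) eigenvalues: the negative zeros of the Evans function. -/
def IsEigenvalue (eps lam : ℝ) : Prop := lam < 0 ∧ u.evans eps lam = 0

/-! ### Suitable modifications of the matrix `A(λ)` -/

/-- One end (`l = atBot` or `l = atTop`) of the contour `γ`, along which `F` is a branch of `f`: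
it goes to `i∞`, or it goes to a pole `z p` at which `Re (-i f) → -∞`. -/
def IsContourEnd (γ F : ℝ → ℂ) (l : Filter ℝ) : Prop :=
  Tendsto (fun t => (γ t).im) l atTop ∨
    ∃ p, Tendsto γ l (𝓝 (u.z p)) ∧ Tendsto (fun t => (F t).im) l atBot

/-- A contour `γ : ℝ → ℂ` with an analytic branch `F` of the multivalued function `f` along it.
Since `f' = u₀`, such a branch is an antiderivative of `u₀` along `γ`; an additive constant only
rescales the integrals over `γ` by a nonzero factor. -/
structure Contour where
  γ : ℝ → ℂ
  F : ℝ → ℂ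
  contDiff : ContDiff ℝ 1 γ
  notPole : ∀ t, u.NotPole (γ t)
  hasDerivAt : ∀ t, HasDerivAt F (u.u0C (γ t) * deriv γ t) t
  atBot_end : u.IsContourEnd γ F atBot
  atTop_end : u.IsContourEnd γ F atTop

variable {u}

/-- `h(·; λ)` along a contour, with the chosen branch. -/
noncomputable def Contour.H (W : u.Contour) (lam t : ℝ) : ℂ := lam * W.γ t + W.F t

/-- The integrand of `∫_W exp(-i h(w; λ)/ε) / (w - z p) dw`. -/
noncomputable def Contour.integrand (W : u.Contour) (eps lam : ℝ) (p : Fin P) (t : ℝ) : ℂ :=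
  Complex.exp (-Complex.I * W.H lam t / eps) / (W.γ t - u.z p) * deriv W.γ t

/-- At parameter `t` the contour passes over the critical point `γ t` of `h` from one valley of
`Re (-i h)` to the opposite one: `Re (-i h''(γ t) γ'(t)²) < 0`. -/
def Contour.PassesOver (W : u.Contour) (t : ℝ) : Prop :=
  (-Complex.I * deriv u.u0C (W.γ t) * deriv W.γ t ^ 2).re < 0

/-- `Re (-i h(·; λ))` attains its maximum along `W` only at the critical point `w`, and `W` passes
over `w` there. -/
def Contour.DominatedBy (W : u.Contour) (lam : ℝ) (w : ℂ) : Prop :=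
  ∃ t, W.γ t = w ∧ W.PassesOver t ∧
    ∀ s, s ≠ t → (-Complex.I * W.H lam s).re < (-Complex.I * W.H lam t).re

/-- `W` passes, from left to right, over the two real critical points `x₋(λ)`, `x₊(λ)` of `h`, both
on the zero level of `Re (-i h)`, and `Re (-i h) < 0` on the rest of `W`.  At `x₋` and `x₊` the
branch is that of `f` itself (real on the real axis). -/
def Contour.DominatedByReal (W : u.Contour) (lam : ℝ) : Prop :=
  ∃ t₁ t₂,
    (W.γ t₁ = u.xMinus lam ∧ W.F t₁ = u.f (u.xMinus lam) ∧ W.PassesOver t₁ ∧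
      0 < (deriv W.γ t₁).re) ∧
    (W.γ t₂ = u.xPlus lam ∧ W.F t₂ = u.f (u.xPlus lam) ∧ W.PassesOver t₂ ∧
      0 < (deriv W.γ t₂).re) ∧
    ∀ s, s ≠ t₁ → s ≠ t₂ → (-Complex.I * W.H lam s).re < 0

variable (u)

/-- For `λ` in the bulk, `A(λ)` has a suitable modification `Ã(λ) = N A(λ)`: there are contours
`W_m` such that
* for one index `Q` the contour `W_Q` passes over the two real critical points of `h(·; λ)`, and
  the others are dominated by exactly one critical point each, the association being a bijection
  between the indices `m ≠ Q` and the critical points in the upper half-plane;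
* for all small `ε > 0` there is an invertible matrix `N` such that the entries of `N A` are those
  of `A` with `C_m` replaced by `W_m`.  (This is a linear relation between contours, so it does not
  involve the spectral parameter.) -/
def HasSuitableModification (lam : ℝ) : Prop :=
  ∃ (W : Fin P → u.Contour) (Q : Fin P) (x : {m : Fin P // m ≠ Q} → ℂ),
    (W Q).DominatedByReal lam ∧
    (∀ m : {m : Fin P // m ≠ Q}, (W m).DominatedBy lam (x m)) ∧
    Function.Injective x ∧ Set.range x = u.upperCritical lam ∧
    ∃ eps₀ > 0, ∀ eps : ℝ, 0 < eps → eps < eps₀ →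
      (∀ mu < 0, ∀ m p, MeasureTheory.Integrable ((W m).integrand eps mu p)) ∧
      ∃ N : Matrix (Fin P) (Fin P) ℂ, IsUnit N ∧
        ∀ mu < 0, ∀ m p, (N * u.A eps mu) m p = ∫ t, (W m).integrand eps mu p t

end RationalPotential

/-! Rescale around `Λ` by `λ = Λ + ε s`, with `s` in a fixed complex disc. Up to nonvanishing
factors the Evans function becomes `exp(-i (s L + θ)) - 1 + g(s)`, where `L = x₊ - x₋`, `θ = 2π
T_ε(Λ)` and `g` is holomorphic of size `O(ε)` (`HasSuitableModification.exists_local`). The model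
has the equally spaced real zeros `2π (k - T) / L`. The perturbation moves them by `O(ε)` in `s`,
hence by `O(ε²)` in `λ`, and `k = j + [T]` numbers them starting from the one nearest to `Λ`.

Origin of the model: in the exponent at `Λ + ε s`, the term with `s` is not divided by `ε`, so
`exp(-i s w)` belongs to the amplitude, and Laplace's method at the critical points for the real
parameter `Λ` is uniform in complex bounded `s` (`exists_laplace_contour`,
`Contour.exists_asymptotics`). A row `m ≠ Q` of the modified matrix is to leading order a multiple
of `1 / (Y m - z p)`. The row `Q` is a combination of two such rows, at `x₋` and `x₊`; neither is
exponentially larger, because `h` is real on the real axis. The determinant is therefore a sum of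
two Cauchy determinants with an oscillating relative factor. Their quotient is an explicit product
(`cauchyDet_update_mul_prod_eq`), and the factorization of `λ + u₀` over its zeros gives `u₀'(x±)`.
Together they reduce the amplitude ratio to `-exp(-i (ψ₊ - ψ₋))`
(`CritSystem.laplaceCoeff_mul_cauchyDet`). The remaining phase `h(x₊) - h(x₋) = ∫ (Λ + u₀)` is the
integral of `x₊ - x₋` occurring in `T`, by comparing areas (`IsPeak.integral_turning`).

Reality of the zeros: the Evans function is complex-valued, so an approximation on the real line
alone would not produce real zeros. The matrix is continued to `Re λ < 0`, the zeros are found in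
complex discs by an open mapping argument (`exists_zero_near`), and they are real by a
self-adjointness argument (`im_eq_zero_of_det_eq_zero`). A kernel vector `v` of the matrix is
exactly what makes the solution of `φ' = (i/ε)(λ + u₀) φ + ∑ v_p / (w - z_p)` that decays at `i∞`
single-valued and holomorphic in the closed upper half-plane. On the real line such a `φ` is
orthogonal to the source term, by Cauchy's theorem, and integrating the derivative of `|φ|²` leaves
`Im λ ∫ |φ|² = 0`.

Completeness: an eigenvalue within the scale of the disc makes the model `O(ε)`, so it lies near a
model zero (`exists_int_of_norm_exp_sub_one_le`). By local uniqueness an unlisted one belongs to an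
index of modulus at least `J + 1`, and the distances to `Λ` then differ by a margin proportional to
`1/2 - |[T] - T|`, up to the errors. All constants are locally uniform in `Λ`, and compactness of
`K` finishes the proof. -/

/-! ### Parameter integrals and primitives along vertical rays. -/

open MeasureTheory Set Metric in
/-- An integral depending holomorphically on a parameter, with a locally uniform integrable bound,
is holomorphic. -/
theorem differentiableAt_integral_of_dominated {α : Type*} [MeasurableSpace α] {μ : Measure α}
    {F : ℂ → α → ℂ} {z₀ : ℂ} {r : ℝ} (hr : 0 < r) {B : α → ℝ} (hB : Integrable B μ)
    (hmeas : ∀ z ∈ ball z₀ r, AEStronglyMeasurable (F z) μ)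
    (hdiff : ∀ᵐ t ∂μ, DifferentiableOn ℂ (F · t) (ball z₀ r))
    (hb : ∀ᵐ t ∂μ, ∀ z ∈ ball z₀ r, ‖F z t‖ ≤ B t) :
    DifferentiableAt ℂ (fun z => ∫ t, F z t ∂μ) z₀ := by
  have hz₀ : z₀ ∈ ball z₀ r := mem_ball_self hr
  have hder : ∀ᵐ t ∂μ, ∀ z ∈ ball z₀ (r / 2), HasDerivAt (F · t) (deriv (F · t) z) z := by
    filter_upwards [hdiff] with t ht z hz
    exact (ht.differentiableAt (isOpen_ball.mem_nhds
      (ball_subset_ball (by linarith) hz))).hasDerivAt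
  -- The derivative in the parameter is measurable as a pointwise limit of difference quotients.
  have hmeas' : AEStronglyMeasurable (fun t => deriv (F · t) z₀) μ := by
    have hlim : Tendsto (fun n : ℕ => ((r / 2 / ((n : ℝ) + 1) : ℝ) : ℂ)) atTop (𝓝[≠] 0) := by
      refine tendsto_nhdsWithin_iff.2 ⟨?_, ?_⟩
      · have : Tendsto (fun n : ℕ => r / 2 / ((n : ℝ) + 1)) atTop (𝓝 0) :=
          tendsto_const_nhds.div_atTop
            (tendsto_atTop_add_const_right _ _ tendsto_natCast_atTop_atTop)
        exact_mod_cast (Complex.continuous_ofReal.tendsto 0).comp this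
      · refine Eventually.of_forall fun n => ?_
        simp only [mem_compl_iff, mem_singleton_iff, Complex.ofReal_eq_zero]
        positivity
    refine aestronglyMeasurable_of_tendsto_ae atTop
      (f := fun (n : ℕ) t => (((r / 2 / ((n : ℝ) + 1) : ℝ) : ℂ))⁻¹ •
        (F (z₀ + ((r / 2 / ((n : ℝ) + 1) : ℝ) : ℂ)) t - F z₀ t)) (fun n => ?_) ?_
    · refine AEStronglyMeasurable.const_smul (𝕜 := ℂ) ((hmeas _ ?_).sub (hmeas _ hz₀)) _
      rw [mem_ball, dist_eq_norm, add_sub_cancel_left, Complex.norm_real, Real.norm_eq_abs,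
        abs_of_pos (by positivity)]
      calc r / 2 / ((n : ℝ) + 1) ≤ r / 2 := div_le_self (by positivity) (by simp)
        _ < r := by linarith
    · filter_upwards [hder] with t ht
      exact (hasDerivAt_iff_tendsto_slope_zero.1 (ht z₀ (mem_ball_self (by positivity)))).comp hlim
  -- Cauchy's estimate on circles of radius `r / 4` about points of the half-radius ball bounds the
  -- derivative, so only the function itself has to be dominated.
  refine (hasDerivAt_integral_of_dominated_loc_of_deriv_le (ball_mem_nhds z₀ (half_pos hr))
    (F' := fun z t => deriv (F · t) z) (bound := fun t => B t / (r / 4)) ?_ ?_ hmeas' ?_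
    (hB.div_const _) hder).2.differentiableAt
  · exact eventually_of_mem (ball_mem_nhds z₀ hr) hmeas
  · refine hB.mono' (hmeas _ hz₀) ?_
    filter_upwards [hb] with t ht using ht _ hz₀
  · filter_upwards [hdiff, hb] with t ht hbt z hz
    have hsub : closedBall z (r / 4) ⊆ ball z₀ r := fun w hw => by
      rw [mem_ball] at *
      rw [mem_closedBall] at hw
      linarith [dist_triangle w z z₀]
    refine Complex.norm_deriv_le_of_forall_mem_sphere_norm_le (by positivity) ?_ fun w hw =>
      hbt w (hsub (sphere_subset_closedBall hw))
    refine DifferentiableOn.diffContOnCl ?_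
    rw [closure_ball _ (by positivity)]
    exact ht.mono hsub

/-- The integral of `g` along the vertical ray from `i∞` down to `z`. -/
noncomputable def upwardRay (g : ℂ → ℂ) (z : ℂ) : ℂ :=
  -∫ y in Set.Ioi (0 : ℝ), g (z + Complex.I * y) * Complex.I

theorem integrableOn_of_exp_decay {G : ℝ → ℂ} {C κ : ℝ} (hκ : 0 < κ)
    (hc : ContinuousOn G (Set.Ici 0))
    (hb : ∀ y, 0 ≤ y → ‖G y‖ ≤ C * Real.exp (-κ * y)) :
    MeasureTheory.IntegrableOn G (Set.Ioi 0) := by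
  have h1 : MeasureTheory.IntegrableOn (fun y => C * Real.exp (-κ * y)) (Set.Ioi 0) :=
    (exp_neg_integrableOn_Ioi 0 hκ).const_mul C
  refine MeasureTheory.Integrable.mono' h1
    ((hc.mono Set.Ioi_subset_Ici_self).aestronglyMeasurable measurableSet_Ioi) ?_
  filter_upwards [MeasureTheory.ae_restrict_mem measurableSet_Ioi] with y hy
  exact hb y (le_of_lt hy)

theorem hasDerivAt_add_I_mul (z : ℂ) (y : ℝ) :
    HasDerivAt (fun y : ℝ => z + Complex.I * y) Complex.I y := by
  simpa using ((Complex.ofRealCLM.hasDerivAt (x := y)).const_mul Complex.I).const_add z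

theorem continuousOn_upward {D : Set ℂ} {g : ℂ → ℂ} {z : ℂ} (hg : ContinuousOn g D)
    (hup : ∀ y : ℝ, 0 ≤ y → z + Complex.I * y ∈ D) :
    ContinuousOn (fun y : ℝ => g (z + Complex.I * y)) (Set.Ici 0) :=
  hg.comp (by fun_prop) fun y hy => hup y hy

open Metric in
/-- The integral from `i∞` along vertical rays is a primitive. -/
theorem hasDerivAt_upwardRay {D : Set ℂ} (hD : Convex ℝ D) (hDo : IsOpen D)
    (hup : ∀ z ∈ D, ∀ y : ℝ, 0 ≤ y → z + Complex.I * y ∈ D) {g : ℂ → ℂ}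
    (hg : DifferentiableOn ℂ g D) {κ : ℝ} (hκ : 0 < κ) {z₀ : ℂ} (hz₀ : z₀ ∈ D)
    (hb : ∃ r > 0, ∃ C, ∀ w ∈ ball z₀ r, w ∈ D → ∀ y : ℝ, 0 ≤ y →
      ‖g (w + Complex.I * y)‖ ≤ C * Real.exp (-κ * y)) :
    HasDerivAt (upwardRay g) (g z₀) z₀ := by
  obtain ⟨Γ, hΓ⟩ := hD.exists_forall_hasDerivWithinAt hg
  have hΓ' : ∀ z ∈ D, HasDerivAt Γ (g z) z := fun z hz => (hΓ z hz).hasDerivAt (hDo.mem_nhds hz)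
  obtain ⟨r, hr, C, hC⟩ := hb
  -- The fundamental theorem on a ray: up to the value of `Γ` at its top, the ray integral is `Γ w`.
  have hray : ∀ w ∈ ball z₀ r ∩ D,
      Tendsto (fun Y : ℝ => Γ (w + Complex.I * Y)) atTop (𝓝 (Γ w - upwardRay g w)) := by
    rintro w ⟨hw, hwD⟩
    have hint := (integrableOn_of_exp_decay hκ
      (continuousOn_upward hg.continuousOn (hup w hwD)) (hC w hw hwD)).mul_const Complex.I
    have h1 := MeasureTheory.intervalIntegral_tendsto_integral_Ioi 0 hint tendsto_id
    have h2 : ∀ᶠ Y : ℝ in atTop, (∫ y in (0 : ℝ)..id Y, g (w + Complex.I * y) * Complex.I) =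
        Γ (w + Complex.I * Y) - Γ w := by
      filter_upwards [eventually_ge_atTop 0] with Y hY
      rw [id, intervalIntegral.integral_eq_sub_of_hasDerivAt
        (f := fun y : ℝ => Γ (w + Complex.I * y))]
      · simp
      · intro y hy
        rw [Set.uIcc_of_le hY] at hy
        exact (hΓ' _ (hup w hwD y hy.1)).comp (𝕜 := ℝ) (𝕜' := ℂ) y (hasDerivAt_add_I_mul w y)
      · refine ContinuousOn.intervalIntegrable ?_
        rw [Set.uIcc_of_le hY]
        exact ((continuousOn_upward hg.continuousOn (hup w hwD)).mono
          Set.Icc_subset_Ici_self).mul continuousOn_const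
    have h3 := (h1.congr' h2).add_const (Γ w)
    simp only [sub_add_cancel] at h3
    convert h3 using 2
    rw [upwardRay]
    ring
  obtain ⟨r', hr', hsub⟩ := Metric.isOpen_iff.1 hDo z₀ hz₀
  have hev : ∀ᶠ w in 𝓝 z₀, w ∈ ball z₀ (min r r') := ball_mem_nhds _ (lt_min hr hr')
  -- The value of `Γ` at the top is the same for neighbouring rays: the difference at height `Y` is
  -- at most the bound of `g` there times `‖w - z₀‖`.
  have hconst : ∀ᶠ w in 𝓝 z₀, upwardRay g w = Γ w - (Γ z₀ - upwardRay g z₀) := by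
    filter_upwards [hev] with w hw
    have hcb : ∀ v ∈ ball z₀ (min r r'), v ∈ ball z₀ r ∩ D := fun v hv =>
      ⟨ball_subset_ball (min_le_left _ _) hv, hsub (ball_subset_ball (min_le_right _ _) hv)⟩
    have h1 := hray w (hcb w hw)
    have h2 := hray z₀ (hcb z₀ (mem_ball_self (lt_min hr hr')))
    have h3 : Tendsto (fun Y : ℝ => Γ (w + Complex.I * Y) - Γ (z₀ + Complex.I * Y)) atTop
        (𝓝 0) := by
      refine squeeze_zero_norm' (a := fun Y => C * Real.exp (-κ * Y) * ‖w - z₀‖) ?_ ?_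
      · filter_upwards [eventually_ge_atTop 0] with Y hY
        have := (convex_ball z₀ (min r r')).norm_image_sub_le_of_norm_hasDerivWithin_le
          (f := fun v => Γ (v + Complex.I * Y)) (f' := fun v => g (v + Complex.I * Y))
          (C := C * Real.exp (-κ * Y)) (x := z₀) (y := w) ?_ ?_ (mem_ball_self (lt_min hr hr')) hw
        · exact this
        · intro v hv
          exact ((hΓ' _ (hup v (hcb v hv).2 Y hY)).comp_add_const v _).hasDerivWithinAt
        · intro v hv
          exact hC v (hcb v hv).1 (hcb v hv).2 Y hY
      · have : Tendsto (fun Y : ℝ => Real.exp (-κ * Y)) atTop (𝓝 0) := by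
          refine Real.tendsto_exp_atBot.comp ?_
          exact tendsto_id.const_mul_atTop_of_neg (by linarith)
        simpa using (this.const_mul C).mul_const ‖w - z₀‖
    have := tendsto_nhds_unique h3 (h1.sub h2)
    linear_combination this
  exact ((hΓ' z₀ hz₀).sub_const _).congr_of_eventuallyEq hconst

/-! ### Partial fractions with too many zeros; primitives on convex sets. -/

open Polynomial in
/-- A partial fraction with simple poles that vanishes at as many points as it has poles has zero
coefficients. -/
theorem eq_zero_of_sum_div_sub_eq_zero {ι : Type*} [Fintype ι] {z v : ι → ℂ}
    (hz : Function.Injective z) {s : Finset ℂ} (hs : Fintype.card ι ≤ s.card)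
    (hne : ∀ y ∈ s, ∀ p, y ≠ z p) (h : ∀ y ∈ s, ∑ p, v p / (y - z p) = 0) : v = 0 := by
  classical
  set N : ℂ[X] := ∑ p, C (v p) * ∏ q ∈ Finset.univ.erase p, (X - C (z q)) with hN
  have hprod : ∀ p : ι, (∏ q ∈ Finset.univ.erase p, (X - C (z q))).degree <
      (Fintype.card ι : WithBot ℕ) := fun p => by
    rw [degree_prod]
    simp only [degree_X_sub_C, Finset.sum_const, Finset.card_erase_of_mem (Finset.mem_univ p),
      Finset.card_univ, nsmul_eq_mul, mul_one]
    have := Fintype.card_pos_iff.2 ⟨p⟩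
    exact_mod_cast Nat.sub_lt this one_pos
  have hdeg : N.degree < (Fintype.card ι : WithBot ℕ) := by
    refine (degree_sum_le _ _).trans_lt ?_
    rw [Finset.sup_lt_iff (WithBot.bot_lt_coe _)]
    intro p _
    refine lt_of_le_of_lt ?_ (hprod p)
    rw [← smul_eq_C_mul]
    exact degree_smul_le _ _
  have heval : ∀ y ∈ s, N.eval y = 0 := by
    intro y hy
    have h1 : N.eval y = (∑ p, v p / (y - z p)) * ∏ q, (y - z q) := by
      rw [hN, eval_finsetSum, Finset.sum_mul]
      refine Finset.sum_congr rfl fun p _ => ?_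
      rw [eval_mul, eval_C, eval_prod, ← Finset.mul_prod_erase _ _ (Finset.mem_univ p)]
      simp only [eval_sub, eval_X, eval_C]
      have := sub_ne_zero.2 (hne y hy p)
      field_simp
    rw [h1, h y hy, zero_mul]
  have hN0 : N = 0 :=
    eq_zero_of_degree_lt_of_eval_finset_eq_zero s
      (hdeg.trans_le (by exact_mod_cast hs)) heval
  -- At the pole `z p` only the summand with index `p` of the numerator survives.
  funext p
  have h2 : N.eval (z p) = v p * ∏ q ∈ Finset.univ.erase p, (z p - z q) := by
    rw [hN, eval_finsetSum, Finset.sum_eq_single p]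
    · simp [eval_prod]
    · intro q _ hqp
      rw [eval_mul, eval_prod, Finset.prod_eq_zero (i := p), mul_zero]
      · simp [Ne.symm hqp]
      · simp
    · simp
  rw [hN0, eval_zero] at h2
  have h3 : ∏ q ∈ Finset.univ.erase p, (z p - z q) ≠ 0 :=
    Finset.prod_ne_zero_iff.2 fun q hq => sub_ne_zero.2 fun h =>
      (Finset.ne_of_mem_erase hq) (hz h).symm
  simpa [h3] using h2.symm

theorem hasDerivAt_of_convex_primitive {D : Set ℂ} (hD : Convex ℝ D) (hDo : IsOpen D) {g : ℂ → ℂ}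
    (hg : DifferentiableOn ℂ g D) : ∃ Γ : ℂ → ℂ, ∀ z ∈ D, HasDerivAt Γ (g z) z := by
  obtain ⟨Γ, hΓ⟩ := hD.exists_forall_hasDerivWithinAt hg
  exact ⟨Γ, fun z hz => (hΓ z hz).hasDerivAt (hDo.mem_nhds hz)⟩

theorem eq_of_hasDerivAt_convex {D : Set ℂ} (hD : Convex ℝ D) (hDo : IsOpen D) {f g h : ℂ → ℂ}
    (hf : ∀ z ∈ D, HasDerivAt f (h z) z) (hg : ∀ z ∈ D, HasDerivAt g (h z) z) {z w : ℂ}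
    (hz : z ∈ D) (hw : w ∈ D) : f z - g z = f w - g w := by
  have := hD.is_const_of_fderivWithin_eq_zero (𝕜 := ℂ) (f := fun z => f z - g z)
    (fun x hx => ((hf x hx).sub (hg x hx)).differentiableAt.differentiableWithinAt)
    (fun x hx => by
      rw [fderivWithin_of_isOpen hDo hx]
      have := ((hf x hx).sub (hg x hx)).hasFDerivAt.fderiv
      rw [sub_self] at this
      exact this.trans (by ext; simp)) hz hw
  exact this

/-! ### Laplace's method, uniform in the critical point. -/

section Laplace

open Metric

/-- The Schwarz lemma, applied to a ball about `f x` whose radius depends only on `M`. Iterated, it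
bounds the higher divided differences and hence Taylor remainders by the bound of the function
alone. -/
theorem norm_dslope_le {f : ℂ → ℂ} {x : ℂ} {r M : ℝ} (hf : DifferentiableOn ℂ f (ball x r))
    (hM : ∀ w ∈ ball x r, ‖f w‖ ≤ M) {w : ℂ} (hw : w ∈ ball x r) :
    ‖dslope f x w‖ ≤ (2 * M + 1) / r := by
  have hr : 0 < r := dist_nonneg.trans_lt hw
  have hx := mem_ball_self (x := x) hr
  refine Complex.norm_dslope_le_div_of_mapsTo_ball hf (fun v hv => ?_) hw
  rw [mem_closedBall, dist_eq_norm]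
  linarith [norm_sub_le (f v) (f x), hM v hv, hM x hx]

theorem differentiableOn_dslope_ball {f : ℂ → ℂ} {x : ℂ} {r : ℝ} (hr : 0 < r)
    (hf : DifferentiableOn ℂ f (ball x r)) : DifferentiableOn ℂ (dslope f x) (ball x r) :=
  (Complex.differentiableOn_dslope (ball_mem_nhds x hr)).2 hf

theorem eq_add_dslope (f : ℂ → ℂ) (x w : ℂ) : f w = f x + (w - x) * dslope f x w := by
  have := sub_smul_dslope f x w
  rw [smul_eq_mul] at this
  rw [this]; ring

/-- Second order Taylor expansion with a remainder depending only on the bound of the function. -/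
theorem exists_taylor_two (r M : ℝ) (hr : 0 < r) : ∃ C > 0, ∀ (f : ℂ → ℂ) (x : ℂ),
    DifferentiableOn ℂ f (ball x r) → (∀ w ∈ ball x r, ‖f w‖ ≤ M) →
    ‖deriv f x‖ ≤ C ∧ ∃ b : ℂ, ‖b‖ ≤ C ∧ ∀ w ∈ ball x r,
      ‖f w - f x‖ ≤ C * ‖w - x‖ ∧
      ‖f w - f x - (w - x) * deriv f x‖ ≤ C * ‖w - x‖ ^ 2 ∧
      ‖f w - f x - (w - x) * deriv f x - b * (w - x) ^ 2‖ ≤ C * ‖w - x‖ ^ 3 := by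
  set M1 := (2 * M + 1) / r with hM1
  set M2 := (2 * M1 + 1) / r with hM2
  set M3 := (2 * M2 + 1) / r with hM3
  refine ⟨max (max (max M1 M2) M3) 1, lt_max_of_lt_right one_pos, fun f x hf hM => ?_⟩
  have hx := mem_ball_self (x := x) hr
  have d1 := differentiableOn_dslope_ball hr hf
  have b1 : ∀ w ∈ ball x r, ‖dslope f x w‖ ≤ M1 := fun w hw => norm_dslope_le hf hM hw
  have d2 := differentiableOn_dslope_ball hr d1
  have b2 : ∀ w ∈ ball x r, ‖dslope (dslope f x) x w‖ ≤ M2 := fun w hw => norm_dslope_le d1 b1 hw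
  have b3 : ∀ w ∈ ball x r, ‖dslope (dslope (dslope f x) x) x w‖ ≤ M3 :=
    fun w hw => norm_dslope_le d2 b2 hw
  have l1 : M1 ≤ max (max (max M1 M2) M3) 1 := by simp
  have l2 : M2 ≤ max (max (max M1 M2) M3) 1 := by simp
  have l3 : M3 ≤ max (max (max M1 M2) M3) 1 := by simp
  refine ⟨?_, dslope (dslope f x) x x, (b2 x hx).trans l2, fun w hw => ?_⟩
  · have := b1 x hx
    rw [dslope_same] at this
    exact this.trans l1
  have e1 := eq_add_dslope f x w
  have e2 := eq_add_dslope (dslope f x) x w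
  have e3 := eq_add_dslope (dslope (dslope f x) x) x w
  refine ⟨?_, ?_, ?_⟩
  · rw [e1, add_sub_cancel_left, norm_mul, mul_comm]
    gcongr
    exact (b1 w hw).trans l1
  · have : f w - f x - (w - x) * deriv f x = (w - x) ^ 2 * dslope (dslope f x) x w := by
      rw [e1, e2, dslope_same f x]; ring
    rw [this, norm_mul, norm_pow, mul_comm]
    gcongr
    exact (b2 w hw).trans l2
  · have : f w - f x - (w - x) * deriv f x - dslope (dslope f x) x x * (w - x) ^ 2 =
        (w - x) ^ 3 * dslope (dslope (dslope f x) x) x w := by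
      rw [e1, e2, e3, dslope_same f x]; ring
    rw [this, norm_mul, norm_pow, mul_comm]
    gcongr
    exact (b3 w hw).trans l3

/-- With `y = t ^ 2 / ε`, this lets a part of the Gaussian decay absorb the polynomial factors of
the Laplace errors. -/
theorem poly_le_exp {c : ℝ} (hc : 0 < c) : ∃ C > 0, ∀ y : ℝ, 0 ≤ y →
    y + y ^ 2 + y ^ 3 ≤ C * Real.exp (c * y) := by
  refine ⟨1 / c + 2 / c ^ 2 + 6 / c ^ 3, by positivity, fun y hy => ?_⟩
  have h : ∀ n : ℕ, y ^ n ≤ n.factorial / c ^ n * Real.exp (c * y) := fun n => by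
    have := Real.pow_div_factorial_le_exp (c * y) (by positivity) n
    rw [div_le_iff₀ (by positivity), mul_pow] at this
    rw [div_mul_eq_mul_div, le_div_iff₀ (by positivity)]
    linarith
  have h1 := h 1
  have h2 := h 2
  have h3 := h 3
  norm_num [Nat.factorial] at h1 h2 h3
  rw [add_mul, add_mul, one_div]
  linarith

/-- Pointwise comparison of a Laplace integrand with its Gaussian approximation. -/
theorem exists_laplace_pointwise {A ca : ℝ} (hA : 0 < A) (hca : 0 < ca) : ∃ C > 0,
    ∀ (a b k₀ k₁ S k : ℂ) (t ε : ℝ), 0 < ε → |t| ≤ 1 → 2 * A * |t| ≤ ca / 2 → ca ≤ a.re →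
    ‖b‖ ≤ A → ‖S + a * t ^ 2 - b * t ^ 3‖ ≤ A * t ^ 4 → ‖k‖ ≤ A → ‖k - k₀‖ ≤ A * |t| →
    ‖k - k₀ - k₁ * t‖ ≤ A * t ^ 2 →
    ‖Complex.exp (S / ε) * k - Complex.exp (-a * t ^ 2 / ε) * (k₀ + k₁ * t + k₀ * b * t ^ 3 / ε)‖
      ≤ C * (ε * Real.exp (-(ca / 4) * (t ^ 2 / ε))) := by
  obtain ⟨C, hC, hpoly⟩ := poly_le_exp (c := ca / 4) (by positivity)
  refine ⟨(A + A * A + A * A + 4 * A ^ 2 * A) * C, by positivity, ?_⟩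
  intro a b k₀ k₁ S k t ε hε ht htA ha hb hS hk hk0 hk1
  set y := t ^ 2 / ε with hy
  have hy0 : 0 ≤ y := by positivity
  set p := S + a * t ^ 2 with hp
  have hεc : (ε : ℂ) ≠ 0 := by exact_mod_cast hε.ne'
  have h4 : t ^ 4 ≤ |t| ^ 3 := by
    calc t ^ 4 = |t| ^ 3 * |t| := by
          rw [← pow_succ, ← abs_pow, abs_of_nonneg (show 0 ≤ t ^ (3 + 1) from (by positivity : 0 ≤ t ^ 4))]
      _ ≤ |t| ^ 3 * 1 := by gcongr
      _ = |t| ^ 3 := mul_one _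
  have hpn : ‖p‖ ≤ 2 * A * |t| ^ 3 := by
    calc ‖p‖ = ‖(p - b * t ^ 3) + b * t ^ 3‖ := by rw [sub_add_cancel]
      _ ≤ A * t ^ 4 + A * |t| ^ 3 := by
          refine (norm_add_le _ _).trans (add_le_add hS ?_)
          rw [norm_mul, norm_pow, Complex.norm_real, Real.norm_eq_abs]
          gcongr
      _ ≤ 2 * A * |t| ^ 3 := by nlinarith
  have hpn2 : ‖p / ε‖ ≤ ca / 2 * y := by
    rw [norm_div, Complex.norm_real, Real.norm_eq_abs, abs_of_pos hε, hy, mul_div_assoc',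
      div_le_div_iff_of_pos_right hε]
    calc ‖p‖ ≤ 2 * A * |t| * |t| ^ 2 := by rw [mul_assoc, ← pow_succ']; exact hpn
      _ ≤ ca / 2 * |t| ^ 2 := by gcongr
      _ = ca / 2 * t ^ 2 := by rw [sq_abs]
  set q := Complex.exp (p / ε) - (1 + p / ε) with hq
  have hqn : ‖q‖ ≤ 4 * A ^ 2 * (ε * y ^ 3) * Real.exp (ca / 2 * y) := by
    have h1 := Complex.norm_exp_sub_sum_le_norm_mul_exp (p / ε) 2
    simp only [Finset.sum_range_succ, Finset.sum_range_zero, zero_add, pow_zero, Nat.factorial,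
      Nat.cast_one, div_one, pow_one, mul_one] at h1
    refine h1.trans (mul_le_mul ?_ (Real.exp_le_exp.2 hpn2) (Real.exp_pos _).le (by positivity))
    rw [norm_div, Complex.norm_real, Real.norm_eq_abs, abs_of_pos hε, div_pow,
      div_le_iff₀ (by positivity)]
    calc ‖p‖ ^ 2 ≤ (2 * A * |t| ^ 3) ^ 2 := by gcongr
      _ = 4 * A ^ 2 * t ^ 6 := by rw [mul_pow, ← pow_mul, mul_comm 3 2, pow_mul, sq_abs]; ring
      _ = 4 * A ^ 2 * (ε * y ^ 3) * ε ^ 2 := by rw [hy]; field_simp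
  have hexp : Complex.exp (S / ε) = Complex.exp (-a * t ^ 2 / ε) * Complex.exp (p / ε) := by
    rw [← Complex.exp_add]; congr 1; rw [hp]; ring
  -- Besides the remainders of `k` and of the exponent, the model omits the product of the cubic
  -- term with `k - k₀` and the part `q` of `exp (p / ε)` of second order. Each of the four is `ε`
  -- times a power of `y = t ^ 2 / ε`, up to `exp (ca / 2 * y)`.
  have hid : Complex.exp (S / ε) * k -
      Complex.exp (-a * t ^ 2 / ε) * (k₀ + k₁ * t + k₀ * b * t ^ 3 / ε) =
      Complex.exp (-a * t ^ 2 / ε) * ((k - k₀ - k₁ * t) + (p - b * t ^ 3) / ε * k +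
        b * t ^ 3 / ε * (k - k₀) + q * k) := by
    rw [hexp, hq]; ring
  have hnexp : ‖Complex.exp (-a * t ^ 2 / ε)‖ ≤ Real.exp (-ca * y) := by
    rw [Complex.norm_exp, Real.exp_le_exp]
    have : (-a * t ^ 2 / ε : ℂ) = ((t ^ 2 / ε : ℝ) : ℂ) * (-a) := by push_cast; ring
    rw [this, Complex.re_ofReal_mul, Complex.neg_re]
    nlinarith
  have hb1 : ‖k - k₀ - k₁ * t‖ ≤ A * (ε * y) * Real.exp (ca / 2 * y) := by
    refine hk1.trans ?_
    have : A * t ^ 2 = A * (ε * y) := by rw [hy]; field_simp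
    rw [this]
    exact le_mul_of_one_le_right (by positivity) (Real.one_le_exp (by positivity))
  have hb2 : ‖(p - b * t ^ 3) / ε * k‖ ≤ A * A * (ε * y ^ 2) * Real.exp (ca / 2 * y) := by
    rw [norm_mul, norm_div, Complex.norm_real, Real.norm_eq_abs, abs_of_pos hε]
    calc ‖p - b * t ^ 3‖ / ε * ‖k‖ ≤ A * t ^ 4 / ε * A := by gcongr
      _ = A * A * (ε * y ^ 2) := by rw [hy]; field_simp
      _ ≤ _ := le_mul_of_one_le_right (by positivity) (Real.one_le_exp (by positivity))
  have hb3 : ‖b * t ^ 3 / ε * (k - k₀)‖ ≤ A * A * (ε * y ^ 2) * Real.exp (ca / 2 * y) := by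
    rw [norm_mul, norm_div, norm_mul, norm_pow, Complex.norm_real, Complex.norm_real,
      Real.norm_eq_abs, Real.norm_eq_abs, abs_of_pos hε]
    calc ‖b‖ * |t| ^ 3 / ε * ‖k - k₀‖ ≤ A * |t| ^ 3 / ε * (A * |t|) := by gcongr
      _ = A * A * (|t| ^ 4) / ε := by ring
      _ = A * A * (ε * y ^ 2) := by
        rw [hy, ← abs_pow, abs_of_nonneg (show 0 ≤ t ^ 4 by positivity)]; field_simp
      _ ≤ _ := le_mul_of_one_le_right (by positivity) (Real.one_le_exp (by positivity))
  have hb4 : ‖q * k‖ ≤ 4 * A ^ 2 * A * (ε * y ^ 3) * Real.exp (ca / 2 * y) := by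
    rw [norm_mul]
    calc ‖q‖ * ‖k‖ ≤ 4 * A ^ 2 * (ε * y ^ 3) * Real.exp (ca / 2 * y) * A := by gcongr
      _ = _ := by ring
  rw [hid, norm_mul]
  have hsum : ‖(k - k₀ - k₁ * t) + (p - b * t ^ 3) / ε * k + b * t ^ 3 / ε * (k - k₀) + q * k‖ ≤
      (A + A * A + A * A + 4 * A ^ 2 * A) * ε * (y + y ^ 2 + y ^ 3) * Real.exp (ca / 2 * y) := by
    refine (norm_add_le _ _).trans ((add_le_add ((norm_add_le _ _).trans
      (add_le_add ((norm_add_le _ _).trans (add_le_add hb1 hb2)) hb3)) hb4).trans ?_)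
    rw [← add_mul, ← add_mul, ← add_mul]
    refine mul_le_mul_of_nonneg_right ?_ (Real.exp_pos _).le
    have e1 : 0 ≤ A * ε * (y ^ 2 + y ^ 3) := by positivity
    have e2 : 0 ≤ A * A * ε * (y + y ^ 3) := by positivity
    have e3 : 0 ≤ 4 * A ^ 2 * A * ε * (y + y ^ 2) := by positivity
    linarith
  -- Of the decay rate `ca`, one half pays for `exp (p / ε)` and a quarter for the polynomial; a
  -- quarter is left.
  calc _ ≤ Real.exp (-ca * y) * ((A + A * A + A * A + 4 * A ^ 2 * A) * ε * (y + y ^ 2 + y ^ 3) *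
        Real.exp (ca / 2 * y)) := mul_le_mul hnexp hsum (norm_nonneg _) (Real.exp_pos _).le
    _ ≤ Real.exp (-ca * y) * ((A + A * A + A * A + 4 * A ^ 2 * A) * ε * (C * Real.exp (ca / 4 * y)) *
        Real.exp (ca / 2 * y)) := by
        have := hpoly y hy0
        gcongr
    _ = (A + A * A + A * A + 4 * A ^ 2 * A) * C * (ε * (Real.exp (-ca * y) * Real.exp (ca / 4 * y) *
        Real.exp (ca / 2 * y))) := by ring
    _ = _ := by
        rw [← Real.exp_add, ← Real.exp_add]
        congr 4
        ring

theorem integral_gaussian_div {c ε : ℝ} (hε : 0 < ε) :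
    ∫ t : ℝ, Real.exp (-c * (t ^ 2 / ε)) = √ε * √(Real.pi / c) := by
  have : ∀ t : ℝ, -c * (t ^ 2 / ε) = -(c / ε) * t ^ 2 := fun t => by ring
  simp_rw [this, integral_gaussian]
  rw [← Real.sqrt_mul hε.le]
  congr 1
  field_simp

theorem integrable_gaussian_div {c ε : ℝ} (hc : 0 < c) (hε : 0 < ε) :
    MeasureTheory.Integrable fun t : ℝ => Real.exp (-c * (t ^ 2 / ε)) := by
  have : ∀ t : ℝ, -c * (t ^ 2 / ε) = -(c / ε) * t ^ 2 := fun t => by ring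
  simp_rw [this]
  exact integrable_exp_neg_mul_sq (by positivity)

theorem integral_gaussian_complex_div {a : ℂ} (ha : 0 < a.re) {ε : ℝ} (hε : 0 < ε) :
    MeasureTheory.Integrable (fun t : ℝ => Complex.exp (-a * t ^ 2 / ε)) ∧
    ∫ t : ℝ, Complex.exp (-a * t ^ 2 / ε) = √ε * (Real.pi / a) ^ (1 / 2 : ℂ) := by
  have h : ∀ t : ℝ, (-a * t ^ 2 / ε : ℂ) = -(a / ε) * t ^ 2 := fun t => by ring
  have hre : 0 < (a / ε : ℂ).re := by
    rw [Complex.div_ofReal_re]; positivity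
  simp_rw [h]
  refine ⟨integrable_cexp_neg_mul_sq hre, ?_⟩
  rw [integral_gaussian_complex hre]
  have hεc : (ε : ℂ) ≠ 0 := by exact_mod_cast hε.ne'
  have : (Real.pi / (a / ε) : ℂ) = (ε : ℝ) * (Real.pi / a) := by field_simp
  have ha0 : (Real.pi / a : ℂ) ≠ 0 :=
    div_ne_zero (by exact_mod_cast Real.pi_ne_zero) fun h0 => by simp [h0] at ha
  rw [this, Complex.cpow_def_of_ne_zero (mul_ne_zero hεc ha0), Complex.log_ofReal_mul hε ha0,
    add_mul, Complex.exp_add, Complex.cpow_def_of_ne_zero ha0, Real.sqrt_eq_rpow,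
    Real.rpow_def_of_pos hε]
  push_cast
  rfl

/-- Laplace's method for an integral over a segment `[-ρ, ρ]` with parameters. -/
theorem exists_laplace_interval {A ca ρ : ℝ} (hA : 0 < A) (hca : 0 < ca) (hρ : 0 < ρ)
    (hρ1 : ρ ≤ 1) (hρA : 2 * A * ρ ≤ ca / 2) : ∃ C > 0,
    ∀ (a b k₀ k₁ : ℂ) (S k : ℝ → ℂ) (ε : ℝ), 0 < ε → ca ≤ a.re → ‖b‖ ≤ A → ‖k₀‖ ≤ A →
    ContinuousOn S (Set.Icc (-ρ) ρ) → ContinuousOn k (Set.Icc (-ρ) ρ) →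
    (∀ t ∈ Set.Icc (-ρ) ρ, ‖S t + a * t ^ 2 - b * t ^ 3‖ ≤ A * t ^ 4 ∧ ‖k t‖ ≤ A ∧
      ‖k t - k₀‖ ≤ A * |t| ∧ ‖k t - k₀ - k₁ * t‖ ≤ A * t ^ 2) →
    ‖(∫ t in (-ρ)..ρ, Complex.exp (S t / ε) * k t) - √ε * (k₀ * (Real.pi / a) ^ (1 / 2 : ℂ))‖
      ≤ C * (ε * √ε) := by
  obtain ⟨C, hC, hpt⟩ := exists_laplace_pointwise hA hca
  obtain ⟨C', hC', hpoly⟩ := poly_le_exp (c := ca / 2) (by positivity)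
  refine ⟨(C + A * (C' / ρ ^ 2)) * √(Real.pi / (ca / 4)), by positivity, ?_⟩
  intro a b k₀ k₁ S k ε hε ha hb hk0 hSc hkc hyp
  have hρρ : -ρ ≤ ρ := by linarith
  obtain ⟨hgi, hgauss⟩ := integral_gaussian_complex_div (a := a) (by linarith) hε
  have hbi := integrable_gaussian_div (c := ca / 4) (ε := ε) (by positivity) hε
  set m : ℝ → ℂ := fun t => Complex.exp (-a * t ^ 2 / ε) *
    (k₀ + k₁ * t + k₀ * b * t ^ 3 / ε) with hm
  have hmc : Continuous m := by fun_prop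
  have hEc : ContinuousOn (fun t => Complex.exp (S t / ε) * k t) (Set.Icc (-ρ) ρ) :=
    ((hSc.div_const _).cexp).mul hkc
  have hEi : IntervalIntegrable (fun t => Complex.exp (S t / ε) * k t) MeasureTheory.volume
      (-ρ) ρ := by
    refine ContinuousOn.intervalIntegrable ?_
    rwa [Set.uIcc_of_le hρρ]
  -- The corrections of relative order `√ε` are odd and integrate to zero. This is what makes the
  -- relative error `O(ε)`, and eventually the eigenvalue error `O(ε²)`.
  have hodd : ∫ t in (-ρ)..ρ, m t = k₀ * ∫ t in (-ρ)..ρ, Complex.exp (-a * t ^ 2 / ε) := by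
    have hm2 : ∀ t, m t = k₀ * Complex.exp (-a * t ^ 2 / ε) +
        Complex.exp (-a * t ^ 2 / ε) * (k₁ * t + k₀ * b * t ^ 3 / ε) := fun t => by
      rw [hm]; ring
    simp_rw [hm2]
    rw [intervalIntegral.integral_add, intervalIntegral.integral_const_mul]
    · have : ∫ t in (-ρ)..ρ, Complex.exp (-a * t ^ 2 / ε) * (k₁ * t + k₀ * b * t ^ 3 / ε) = 0 := by
        have h1 := intervalIntegral.integral_comp_neg (a := -ρ) (b := ρ) (fun t : ℝ =>
          Complex.exp (-a * t ^ 2 / ε) * (k₁ * t + k₀ * b * t ^ 3 / ε))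
        rw [neg_neg] at h1
        have h2 : ∀ t : ℝ, Complex.exp (-a * ((-t : ℝ) : ℂ) ^ 2 / ε) *
            (k₁ * ((-t : ℝ) : ℂ) + k₀ * b * ((-t : ℝ) : ℂ) ^ 3 / ε) =
            -(Complex.exp (-a * t ^ 2 / ε) * (k₁ * t + k₀ * b * t ^ 3 / ε)) := fun t => by
          push_cast
          rw [neg_sq]
          ring
        simp_rw [h2] at h1
        rw [intervalIntegral.integral_neg] at h1
        exact self_eq_neg.1 h1.symm
      rw [this, add_zero]
    · exact Continuous.intervalIntegrable (by fun_prop) _ _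
    · exact Continuous.intervalIntegrable (by fun_prop) _ _
  have hI1 : ‖(∫ t in (-ρ)..ρ, Complex.exp (S t / ε) * k t) - ∫ t in (-ρ)..ρ, m t‖ ≤
      C * (ε * (√ε * √(Real.pi / (ca / 4)))) := by
    rw [← intervalIntegral.integral_sub hEi (hmc.intervalIntegrable _ _)]
    refine (intervalIntegral.norm_integral_le_of_norm_le hρρ
      (g := fun t => C * (ε * Real.exp (-(ca / 4) * (t ^ 2 / ε)))) ?_ ?_).trans ?_
    · refine Eventually.of_forall fun t ht => ?_
      have ht' : t ∈ Set.Icc (-ρ) ρ := Set.Ioc_subset_Icc_self ht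
      obtain ⟨h1, h2, h3, h4⟩ := hyp t ht'
      have h5 : |t| ≤ ρ := abs_le.2 ht'
      exact hpt a b k₀ k₁ (S t) (k t) t ε hε (h5.trans hρ1)
        ((mul_le_mul_of_nonneg_left h5 (by positivity)).trans hρA) ha hb h1 h2 h3 h4
    · exact ((hbi.const_mul ε).const_mul C).intervalIntegrable
    · rw [intervalIntegral.integral_const_mul, intervalIntegral.integral_const_mul,
        ← integral_gaussian_div hε, intervalIntegral.integral_of_le hρρ]
      gcongr
      · exact Eventually.of_forall fun t => (Real.exp_pos _).le
      · exact MeasureTheory.Measure.restrict_le_self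
  -- Outside the interval `ρ ^ 2 ≤ ε * (t ^ 2 / ε)`, so part of the Gaussian decay can be traded for
  -- a factor `ε`.
  have hI2 : ‖(∫ t in (-ρ)..ρ, Complex.exp (-a * t ^ 2 / ε)) - √ε * (Real.pi / a) ^ (1 / 2 : ℂ)‖ ≤
      C' / ρ ^ 2 * (ε * (√ε * √(Real.pi / (ca / 4)))) := by
    rw [← hgauss, intervalIntegral.integral_of_le hρρ, norm_sub_rev,
      ← MeasureTheory.integral_add_compl (measurableSet_Ioc (a := -ρ) (b := ρ)) hgi,
      add_sub_cancel_left, ← integral_gaussian_div hε]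
    have hbd : ∀ t ∈ (Set.Ioc (-ρ) ρ)ᶜ, ‖Complex.exp (-a * t ^ 2 / ε)‖ ≤
        C' / ρ ^ 2 * (ε * Real.exp (-(ca / 4) * (t ^ 2 / ε))) := by
      intro t ht
      have ht2 : ρ ^ 2 ≤ t ^ 2 := by
        rw [Set.mem_compl_iff, Set.mem_Ioc, not_and_or, not_lt, not_le] at ht
        rcases ht with h | h <;> nlinarith
      have hy0 : 0 ≤ t ^ 2 / ε := by positivity
      have h1 : ‖Complex.exp (-a * t ^ 2 / ε)‖ ≤ Real.exp (-ca * (t ^ 2 / ε)) := by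
        rw [Complex.norm_exp, Real.exp_le_exp]
        have : (-a * t ^ 2 / ε : ℂ) = ((t ^ 2 / ε : ℝ) : ℂ) * (-a) := by push_cast; ring
        rw [this, Complex.re_ofReal_mul, Complex.neg_re]
        nlinarith
      have h2 : t ^ 2 / ε ≤ C' * Real.exp (ca / 2 * (t ^ 2 / ε)) := by
        refine le_trans ?_ (hpoly _ hy0)
        have : 0 ≤ (t ^ 2 / ε) ^ 2 + (t ^ 2 / ε) ^ 3 := by positivity
        linarith
      have h3 : ρ ^ 2 ≤ ε * (C' * Real.exp (ca / 2 * (t ^ 2 / ε))) := by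
        calc ρ ^ 2 ≤ ε * (t ^ 2 / ε) := by rw [mul_div_cancel₀ _ hε.ne']; exact ht2
          _ ≤ _ := by gcongr
      calc _ ≤ Real.exp (-ca * (t ^ 2 / ε)) := h1
        _ = ρ ^ 2 / ρ ^ 2 * Real.exp (-ca * (t ^ 2 / ε)) := by
          rw [div_self (by positivity), one_mul]
        _ ≤ ε * (C' * Real.exp (ca / 2 * (t ^ 2 / ε))) / ρ ^ 2 *
            Real.exp (-ca * (t ^ 2 / ε)) := by gcongr
        _ = C' / ρ ^ 2 * (ε * Real.exp (ca / 2 * (t ^ 2 / ε) + -ca * (t ^ 2 / ε))) := by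
          rw [Real.exp_add]; ring
        _ ≤ _ := by
          gcongr
          nlinarith
    refine (MeasureTheory.norm_integral_le_of_norm_le
      ((hbi.const_mul ε).const_mul (C' / ρ ^ 2)).integrableOn
      ((MeasureTheory.ae_restrict_mem measurableSet_Ioc.compl).mono hbd)).trans ?_
    rw [MeasureTheory.integral_const_mul, MeasureTheory.integral_const_mul]
    gcongr
    · exact Eventually.of_forall fun t => (Real.exp_pos _).le
    · exact MeasureTheory.Measure.restrict_le_self
  calc _ = ‖((∫ t in (-ρ)..ρ, Complex.exp (S t / ε) * k t) - ∫ t in (-ρ)..ρ, m t) +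
        k₀ * ((∫ t in (-ρ)..ρ, Complex.exp (-a * t ^ 2 / ε)) -
          √ε * (Real.pi / a) ^ (1 / 2 : ℂ))‖ := by rw [hodd]; congr 1; ring
    _ ≤ C * (ε * (√ε * √(Real.pi / (ca / 4)))) +
        A * (C' / ρ ^ 2 * (ε * (√ε * √(Real.pi / (ca / 4))))) := by
        refine (norm_add_le _ _).trans (add_le_add hI1 ?_)
        rw [norm_mul]
        gcongr
    _ = _ := by ring

end Laplace

section Laplace

open Metric

/-- Exponentially small contributions are negligible against the Laplace error `ε √ε`. -/
theorem exists_exp_neg_div_le {c : ℝ} (hc : 0 < c) : ∃ C > 0, ∀ ε : ℝ, 0 < ε → ε < 1 →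
    Real.exp (-c / ε) ≤ C * (ε * √ε) := by
  refine ⟨2 / c ^ 2, by positivity, fun ε hε hε1 => ?_⟩
  have h := Real.pow_div_factorial_le_exp (c / ε) (by positivity) 2
  norm_num [Nat.factorial] at h
  have h1 : ε ^ 2 ≤ ε * √ε := by
    rw [pow_two]
    gcongr
    exact Real.le_sqrt_of_sq_le (by nlinarith)
  rw [neg_div, Real.exp_neg]
  calc (Real.exp (c / ε))⁻¹ ≤ ((c / ε) ^ 2 / 2)⁻¹ := inv_anti₀ (by positivity) h
    _ = 2 / c ^ 2 * ε ^ 2 := by field_simp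
    _ ≤ _ := by gcongr

/-- The Taylor expansion of a primitive, with uniform remainder. -/
theorem norm_primitive_sub_taylor_le {u F : ℂ → ℂ} {x b : ℂ} {r C : ℝ}
    (hF : ∀ w ∈ ball x r, HasDerivAt F (u w) w)
    (hC : ∀ w ∈ ball x r, ‖u w - u x - (w - x) * deriv u x - b * (w - x) ^ 2‖ ≤ C * ‖w - x‖ ^ 3)
    (hC0 : 0 ≤ C) {w : ℂ} (hw : w ∈ ball x r) :
    ‖F w - F x - u x * (w - x) - deriv u x / 2 * (w - x) ^ 2 - b / 3 * (w - x) ^ 3‖ ≤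
      C * ‖w - x‖ ^ 4 := by
  set D : ℂ → ℂ := fun w => F w - u x * (w - x) - deriv u x / 2 * (w - x) ^ 2 -
    b / 3 * (w - x) ^ 3 with hD
  have hsub : closedBall x ‖w - x‖ ⊆ ball x r := by
    rw [mem_ball, dist_eq_norm] at hw
    exact closedBall_subset_ball hw
  have key := (convex_closedBall x ‖w - x‖).norm_image_sub_le_of_norm_hasDerivWithin_le
    (f := D) (f' := fun v => u v - u x - (v - x) * deriv u x - b * (v - x) ^ 2)
    (C := C * ‖w - x‖ ^ 3) (x := x) (y := w) ?_ ?_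
    (mem_closedBall_self (norm_nonneg _)) (by rw [mem_closedBall, dist_eq_norm])
  · have e : D w - D x = F w - F x - u x * (w - x) - deriv u x / 2 * (w - x) ^ 2 -
        b / 3 * (w - x) ^ 3 := by simp only [hD]; ring
    rw [e] at key
    calc _ ≤ _ := key
      _ = _ := by ring
  · intro v hv
    refine HasDerivAt.hasDerivWithinAt ?_
    have h1 : HasDerivAt (fun v : ℂ => v - x) 1 v := (hasDerivAt_id v).sub_const x
    have := (((hF v (hsub hv)).sub (h1.const_mul (u x))).sub
      ((h1.pow 2).const_mul (deriv u x / 2))).sub ((h1.pow 3).const_mul (b / 3))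
    refine this.congr_deriv ?_
    push_cast
    ring
  · intro v hv
    refine (hC v (hsub hv)).trans ?_
    rw [mem_closedBall, dist_eq_norm] at hv
    gcongr

/-- The exponent `-i(F(w) - F(x) - u(x)(w - x))`, for which `x` is a critical point. -/
noncomputable def phaseAt (u F : ℂ → ℂ) (x w : ℂ) : ℂ :=
  -Complex.I * (F w - F x - u x * (w - x))

/-- The value of `κ = e (π / a)^{1/2}`, `a = i u'(x) e² / 2`: the leading coefficient of the Laplace
integral over a contour through `x` in the direction `e`. -/
noncomputable def laplaceCoeff (u : ℂ → ℂ) (e x : ℂ) : ℂ :=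
  e * (Real.pi / (Complex.I * deriv u x * e ^ 2 / 2)) ^ (1 / 2 : ℂ)

set_option maxHeartbeats 1000000 in
/-- Laplace's method for a contour that passes over a point `x₀` in the direction of steepest
descent; the integrand may have its critical point at any `x` close to `x₀`. -/
theorem exists_laplace_contour {u F : ℂ → ℂ} {x₀ : ℂ} {r M : ℝ} (hr : 0 < r)
    (hu : DifferentiableOn ℂ u (ball x₀ r)) (hM : ∀ w ∈ ball x₀ r, ‖u w‖ ≤ M)
    (hF : ∀ w ∈ ball x₀ r, HasDerivAt F (u w) w) {γ : ℝ → ℂ} (hγ : ContDiff ℝ 1 γ) {t₀ : ℝ}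
    (h0 : γ t₀ = x₀) (hpass : (-Complex.I * deriv u x₀ * deriv γ t₀ ^ 2).re < 0) (Mk : ℝ) :
    ∃ ρ₀ > 0, ∀ ρ : ℝ, 0 < ρ → ρ ≤ ρ₀ → (∀ t ∈ Set.Icc (t₀ - ρ) (t₀ + ρ), γ t ∈ ball x₀ r) ∧
      ∃ δ > 0, ∃ C > 0, ∀ x ∈ ball x₀ δ, 0 < (Complex.I * deriv u x * deriv γ t₀ ^ 2 / 2).re ∧
        ∀ k : ℂ → ℂ, DifferentiableOn ℂ k (ball x₀ r) → (∀ w ∈ ball x₀ r, ‖k w‖ ≤ Mk) →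
        ∀ ε : ℝ, 0 < ε → ε < 1 →
        ‖(∫ t in (t₀ - ρ)..(t₀ + ρ), Complex.exp (phaseAt u F x (γ t) / ε) * k (γ t) * deriv γ t) -
          √ε * (k x * laplaceCoeff u (deriv γ t₀) x)‖ ≤ C * (ε * √ε) := by
  set e := deriv γ t₀ with he
  obtain ⟨CT, hCT, hT⟩ := exists_taylor_two (r / 2) M (by positivity)
  obtain ⟨Ck, hCk, hTk⟩ := exists_taylor_two (r / 2) Mk (by positivity)
  have hx₀ := mem_ball_self (x := x₀) hr
  have hsubball : ∀ x ∈ ball x₀ (r / 2), ball x (r / 2) ⊆ ball x₀ r := fun x hx =>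
    ball_subset_ball' (by rw [mem_ball] at hx; linarith)
  -- the valley condition near `(x₀, e)`
  set Θ : ℂ × ℂ → ℝ := fun q => (-Complex.I * (deriv u q.1 / 2 * q.2 ^ 2)).re with hΘ
  have hdu : ContinuousAt (deriv u) x₀ :=
    ((hu.analyticAt (isOpen_ball.mem_nhds hx₀)).deriv).continuousAt
  have hΘc : ContinuousAt Θ (x₀, e) := by
    refine Complex.continuous_re.continuousAt.comp (ContinuousAt.mul continuousAt_const ?_)
    refine ContinuousAt.mul (ContinuousAt.div_const ?_ _) (by fun_prop)
    exact ContinuousAt.comp (f := Prod.fst) (x := (x₀, e)) hdu continuousAt_fst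
  have hΘ0 : Θ (x₀, e) < 0 := by
    have : Θ (x₀, e) = (-Complex.I * deriv u x₀ * e ^ 2).re / 2 := by
      simp only [hΘ]
      rw [← Complex.div_ofNat_re]
      congr 1
      ring
    rw [this]
    linarith
  -- A quarter of the decay rate at `(x₀, e)`: one factor two is spent on moving the point and the
  -- direction, the other on the Taylor remainder.
  set c₁ := -Θ (x₀, e) / 4 with hc₁
  have hc₁0 : 0 < c₁ := by rw [hc₁]; linarith
  have hev : ∀ᶠ q in 𝓝 (x₀, e), Θ q < -(2 * c₁) :=
    hΘc.eventually_lt continuousAt_const (by rw [hc₁]; linarith)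
  obtain ⟨κ', hκ', hκball⟩ := Metric.eventually_nhds_iff.1 hev
  set κ := κ' / 2 with hκ
  have hκ0 : 0 < κ := by positivity
  have hvalley : ∀ x ∈ ball x₀ κ, ∀ ζ : ℂ, ‖ζ - e‖ ≤ κ → Θ (x, ζ) < -(2 * c₁) := by
    intro x hx ζ hζ
    refine hκball ?_
    rw [Prod.dist_eq, max_lt_iff, dist_eq_norm ζ]
    constructor
    · exact (mem_ball.1 hx).trans (by rw [hκ]; linarith)
    · exact hζ.trans_lt (by rw [hκ]; linarith)
  set Z := ‖e‖ + κ with hZ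
  have hZ0 : 0 < Z := by positivity
  set A := (CT + Ck + |Mk| + 1) * (1 + ‖e‖) ^ 4 with hA
  have hA0 : 0 < A := by positivity
  have hle : ∀ n ≤ 4, ∀ c : ℝ, 0 ≤ c → c ≤ CT + Ck + |Mk| + 1 → c * ‖e‖ ^ n ≤ A := by
    intro n hn c hc hc'
    have h1 : ‖e‖ ^ n ≤ (1 + ‖e‖) ^ 4 := by
      calc ‖e‖ ^ n ≤ (1 + ‖e‖) ^ n := by gcongr; linarith
        _ ≤ _ := pow_le_pow_right₀ (by linarith [norm_nonneg e]) hn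
    exact mul_le_mul hc' h1 (by positivity) (by positivity)
  have hMk := abs_nonneg Mk
  -- closeness of the curve to its tangent
  have hγd : HasDerivAt γ e t₀ := (hγ.differentiable (by norm_num) t₀).hasDerivAt
  obtain ⟨s₀, hs₀, htan⟩ : ∃ s₀ > 0, ∀ s : ℝ, |s| ≤ s₀ → ‖γ (t₀ + s) - x₀ - s * e‖ ≤ κ / 2 * |s| := by
    have := (hasDerivAt_iff_isLittleO_nhds_zero.1 hγd).def (half_pos hκ0)
    obtain ⟨s₀, hs₀, h⟩ := Metric.eventually_nhds_iff.1 this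
    refine ⟨s₀ / 2, by positivity, fun s hs => ?_⟩
    have := h (y := s) (by rw [Real.dist_eq, sub_zero]; linarith)
    rw [h0, Complex.real_smul, Real.norm_eq_abs] at this
    exact this
  obtain ⟨ρ₀, hρ₀, l1, l2, l3, l4, l5⟩ : ∃ ρ₀ > 0, ρ₀ ≤ 1 ∧ ρ₀ ≤ s₀ ∧ 2 * A * ρ₀ ≤ 2 * c₁ / 2 ∧
      ρ₀ * Z ≤ r / 4 ∧ (CT * Z ^ 3 + CT * Z ^ 4) * ρ₀ ≤ c₁ := by
    have hX : 0 < CT * Z ^ 3 + CT * Z ^ 4 := by positivity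
    refine ⟨min (min (min 1 s₀) (c₁ / (2 * A))) (min (r / 4 / Z) (c₁ / (CT * Z ^ 3 + CT * Z ^ 4))),
      by positivity, ?_, ?_, ?_, ?_, ?_⟩
    · simp
    · simp
    · have : min (min (min 1 s₀) (c₁ / (2 * A))) (min (r / 4 / Z) (c₁ / (CT * Z ^ 3 + CT * Z ^ 4)))
        ≤ c₁ / (2 * A) := by simp
      rw [le_div_iff₀ (by positivity)] at this
      linarith
    · rw [← le_div_iff₀ hZ0]; simp
    · rw [mul_comm, ← le_div_iff₀ hX]; simp
  refine ⟨ρ₀, hρ₀, fun ρ hρ hρρ₀ => ?_⟩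
  have hcurve : ∀ t ∈ Set.Icc (t₀ - ρ) (t₀ + ρ), γ t ∈ ball x₀ r := by
    intro t ht
    have h1 : |t - t₀| ≤ ρ := abs_le.2 ⟨by linarith [ht.1], by linarith [ht.2]⟩
    have h2 := htan (t - t₀) (h1.trans (hρρ₀.trans l2))
    rw [add_sub_cancel] at h2
    rw [mem_ball, dist_eq_norm]
    calc ‖γ t - x₀‖ = ‖(γ t - x₀ - (t - t₀ : ℝ) * e) + (t - t₀ : ℝ) * e‖ := by
          rw [sub_add_cancel]
      _ ≤ κ / 2 * |t - t₀| + |t - t₀| * ‖e‖ := by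
          refine (norm_add_le _ _).trans (add_le_add h2 ?_)
          rw [norm_mul, Complex.norm_real, Real.norm_eq_abs]
      _ ≤ ρ * Z := by rw [hZ]; nlinarith [norm_nonneg e]
      _ ≤ ρ₀ * Z := by gcongr
      _ < r := by linarith
  refine ⟨hcurve, ?_⟩
  obtain ⟨C₁, hC₁, hlap⟩ := exists_laplace_interval (A := A) (ca := 2 * c₁) (ρ := ρ) hA0
    (by positivity) hρ (hρρ₀.trans l1)
    ((mul_le_mul_of_nonneg_left hρρ₀ (by positivity)).trans l3)
  obtain ⟨C₂, hC₂, hexp⟩ := exists_exp_neg_div_le (c := c₁ * ρ ^ 2) (by positivity)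
  refine ⟨min (min κ (r / 4)) (κ * ρ / 2), by positivity,
    C₁ + 2 * (|Mk| * C₂ * (κ * ρ)), by positivity, fun x hx => ?_⟩
  have hx1 : x ∈ ball x₀ κ := ball_subset_ball ((min_le_left _ _).trans (min_le_left _ _)) hx
  have hx2 : x ∈ ball x₀ (r / 4) := ball_subset_ball ((min_le_left _ _).trans (min_le_right _ _)) hx
  have hx3 : ‖x - x₀‖ < κ * ρ / 2 := by
    rw [← dist_eq_norm, ← mem_ball]
    exact ball_subset_ball (min_le_right _ _) hx
  have hx4 : x ∈ ball x₀ (r / 2) := ball_subset_ball (by linarith) hx2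
  have hsub := hsubball x hx4
  have haΘ : (Complex.I * deriv u x * e ^ 2 / 2).re = -Θ (x, e) := by
    simp only [hΘ]
    rw [← Complex.neg_re]
    congr 1
    ring
  have hare : 2 * c₁ ≤ (Complex.I * deriv u x * e ^ 2 / 2).re := by
    rw [haΘ]
    linarith [hvalley x hx1 e (by simpa using hκ0.le)]
  refine ⟨by linarith, fun k hk hkM ε hε hε1 => ?_⟩
  obtain ⟨-, b, hb, hub⟩ := hT u x (hu.mono hsub) fun w hw => hM w (hsub hw)
  obtain ⟨-, bk, hbk, hkb⟩ := hTk k x (hk.mono hsub) fun w hw => hkM w (hsub hw)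
  have hS : ∀ w ∈ ball x (r / 2), ‖phaseAt u F x w - (-Complex.I) * (deriv u x / 2 * (w - x) ^ 2) -
      (-Complex.I) * (b / 3 * (w - x) ^ 3)‖ ≤ CT * ‖w - x‖ ^ 4 := by
    intro w hw
    have := norm_primitive_sub_taylor_le (fun w hw => hF w (hsub hw))
      (fun w hw => (hub w hw).2.2) hCT.le hw
    refine le_trans (le_of_eq ?_) this
    rw [phaseAt, ← mul_sub, ← mul_sub, norm_mul, norm_neg, Complex.norm_I, one_mul]
  have hmem : ∀ ζ : ℂ, ‖ζ - e‖ ≤ κ → ∀ t : ℝ, |t| ≤ ρ → x + t * ζ ∈ ball x (r / 2) := by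
    intro ζ hζ t ht
    rw [mem_ball, dist_eq_norm, add_sub_cancel_left, norm_mul, Complex.norm_real, Real.norm_eq_abs]
    have : ‖ζ‖ ≤ Z := by
      calc ‖ζ‖ = ‖(ζ - e) + e‖ := by rw [sub_add_cancel]
        _ ≤ κ + ‖e‖ := (norm_add_le _ _).trans (by gcongr)
        _ = Z := by rw [hZ]; ring
    calc |t| * ‖ζ‖ ≤ ρ₀ * Z := by gcongr; exact ht.trans hρρ₀
      _ < r / 2 := by linarith
  -- The exponent is negative on a whole sector of directions around `e`; the choice of `ρ₀` keeps
  -- the cubic and quartic terms below half of the quadratic decay.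
  have hneg : ∀ ζ : ℂ, ‖ζ - e‖ ≤ κ → ∀ t : ℝ, |t| ≤ ρ →
      (phaseAt u F x (x + t * ζ)).re ≤ -c₁ * t ^ 2 := by
    intro ζ hζ t ht
    have hζZ : ‖ζ‖ ≤ Z := by
      calc ‖ζ‖ = ‖(ζ - e) + e‖ := by rw [sub_add_cancel]
        _ ≤ κ + ‖e‖ := (norm_add_le _ _).trans (by gcongr)
        _ = Z := by rw [hZ]; ring
    have h1 := hS _ (hmem ζ hζ t ht)
    rw [add_sub_cancel_left] at h1
    have h2 : (-Complex.I * (deriv u x / 2 * (t * ζ) ^ 2)).re = t ^ 2 * Θ (x, ζ) := by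
      rw [hΘ, ← Complex.re_ofReal_mul]
      congr 1
      push_cast
      ring
    have h3 : ‖-Complex.I * (b / 3 * (t * ζ) ^ 3)‖ ≤ CT * Z ^ 3 * |t| ^ 3 := by
      rw [norm_mul, norm_neg, Complex.norm_I, one_mul, norm_mul, norm_div, norm_pow, norm_mul,
        Complex.norm_real, Real.norm_eq_abs, mul_pow]
      have : ‖b‖ / ‖(3 : ℂ)‖ ≤ CT := by
        rw [Complex.norm_ofNat, div_le_iff₀ (by norm_num)]; linarith
      calc ‖b‖ / ‖(3 : ℂ)‖ * (|t| ^ 3 * ‖ζ‖ ^ 3) ≤ CT * (|t| ^ 3 * Z ^ 3) := by gcongr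
        _ = _ := by ring
    have h4 : CT * ‖t * ζ‖ ^ 4 ≤ CT * Z ^ 4 * |t| ^ 4 := by
      rw [norm_mul, Complex.norm_real, Real.norm_eq_abs, mul_pow]
      calc CT * (|t| ^ 4 * ‖ζ‖ ^ 4) ≤ CT * (|t| ^ 4 * Z ^ 4) := by gcongr
        _ = _ := by ring
    have h5 := (Complex.re_le_norm _).trans h1
    have h6 := (Complex.re_le_norm _).trans h3
    rw [Complex.sub_re, Complex.sub_re, h2] at h5
    have h7 := hvalley x hx1 ζ hζ
    have ht1 : |t| ≤ 1 := ht.trans (hρρ₀.trans l1)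
    have h8 : CT * Z ^ 3 * |t| ^ 3 + CT * Z ^ 4 * |t| ^ 4 ≤ c₁ * t ^ 2 := by
      have h9 : |t| ^ 4 ≤ |t| ^ 3 := pow_le_pow_of_le_one (abs_nonneg _) ht1 (by norm_num)
      calc CT * Z ^ 3 * |t| ^ 3 + CT * Z ^ 4 * |t| ^ 4
          ≤ CT * Z ^ 3 * |t| ^ 3 + CT * Z ^ 4 * |t| ^ 3 := by gcongr
        _ = ((CT * Z ^ 3 + CT * Z ^ 4) * |t|) * |t| ^ 2 := by ring
        _ ≤ ((CT * Z ^ 3 + CT * Z ^ 4) * ρ₀) * |t| ^ 2 := by gcongr; exact ht.trans hρρ₀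
        _ ≤ c₁ * |t| ^ 2 := by gcongr
        _ = _ := by rw [sq_abs]
    have h9 := mul_le_mul_of_nonneg_left h7.le (sq_nonneg t)
    linarith
  -- primitive of the integrand
  set φ : ℂ → ℂ := fun w => Complex.exp (phaseAt u F x w / ε) * k w with hφ
  have hφd : DifferentiableOn ℂ φ (ball x₀ r) := by
    have h1 : DifferentiableOn ℂ F (ball x₀ r) := fun w hw =>
      (hF w hw).differentiableAt.differentiableWithinAt
    refine DifferentiableOn.mul (DifferentiableOn.cexp (DifferentiableOn.div_const ?_ _)) hk
    unfold phaseAt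
    fun_prop
  obtain ⟨Γ, hΓ⟩ := hasDerivAt_of_convex_primitive (convex_ball x₀ r) isOpen_ball hφd
  -- The end of the curve and the end of the straight segment through `x` lie in a common disc
  -- contained in that sector, where the integrand is exponentially small. So passing from one to
  -- the other costs nothing.
  have hend : ∀ σ : ℝ, |σ| = ρ → ‖Γ (γ (t₀ + σ)) - Γ (x + σ * e)‖ ≤ |Mk| * C₂ * (κ * ρ) * (ε * √ε) := by
    intro σ hσ
    have hσ0 : σ ≠ 0 := fun h => by rw [h, abs_zero] at hσ; linarith
    have hσc : (σ : ℂ) ≠ 0 := by exact_mod_cast hσ0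
    have hcl : ∀ w ∈ closedBall (x + σ * e) (κ * ρ), ∃ ζ : ℂ, ‖ζ - e‖ ≤ κ ∧ w = x + σ * ζ := by
      intro w hw
      refine ⟨(w - x) / σ, ?_, by field_simp; ring⟩
      rw [mem_closedBall, dist_eq_norm] at hw
      have : (w - x) / σ - e = (w - (x + σ * e)) / σ := by field_simp; ring
      rw [this, norm_div, Complex.norm_real, Real.norm_eq_abs, hσ, div_le_iff₀ hρ]
      exact hw
    have hmem' : γ (t₀ + σ) ∈ closedBall (x + σ * e) (κ * ρ) := by
      rw [mem_closedBall, dist_eq_norm]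
      have h1 := htan σ (by rw [hσ]; exact hρρ₀.trans l2)
      calc ‖γ (t₀ + σ) - (x + σ * e)‖ = ‖(γ (t₀ + σ) - x₀ - σ * e) - (x - x₀)‖ := by congr 1; ring
        _ ≤ κ / 2 * |σ| + κ * ρ / 2 := (norm_sub_le _ _).trans (add_le_add h1 hx3.le)
        _ = κ * ρ := by rw [hσ]; ring
    have key := (convex_closedBall (x + σ * e) (κ * ρ)).norm_image_sub_le_of_norm_hasDerivWithin_le
      (f := Γ) (f' := φ) (C := |Mk| * (C₂ * (ε * √ε))) (x := x + σ * e) (y := γ (t₀ + σ)) ?_ ?_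
      (mem_closedBall_self (by positivity)) hmem'
    · refine key.trans ?_
      rw [mem_closedBall, dist_eq_norm] at hmem'
      calc _ ≤ |Mk| * (C₂ * (ε * √ε)) * (κ * ρ) := by gcongr
        _ = _ := by ring
    · intro w hw
      obtain ⟨ζ, hζ, rfl⟩ := hcl w hw
      exact (hΓ _ (hsub (hmem ζ hζ σ hσ.le))).hasDerivWithinAt
    · intro w hw
      obtain ⟨ζ, hζ, rfl⟩ := hcl w hw
      have h1 := hneg ζ hζ σ hσ.le
      rw [hφ, norm_mul, Complex.norm_exp, Complex.div_ofReal_re, mul_comm]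
      refine mul_le_mul ((hkM _ (hsub (hmem ζ hζ σ hσ.le))).trans (le_abs_self _)) ?_
        (Real.exp_pos _).le (abs_nonneg _)
      refine le_trans (Real.exp_le_exp.2 ?_) (hexp ε hε hε1)
      rw [div_le_div_iff_of_pos_right hε, ← hσ, sq_abs]
      linarith
  have hball : ∀ t ∈ Set.Icc (-ρ) ρ, x + t * e ∈ ball x (r / 2) := fun t ht =>
    hmem e (by simpa using hκ0.le) t (abs_le.2 ht)
  -- The integrand has a primitive, so the integral over the curve is replaced by the one over the
  -- segment with direction `e` centred at the moved critical point `x`.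
  have hI1 : (∫ t in (t₀ - ρ)..(t₀ + ρ), Complex.exp (phaseAt u F x (γ t) / ε) * k (γ t) *
      deriv γ t) = Γ (γ (t₀ + ρ)) - Γ (γ (t₀ - ρ)) := by
    rw [intervalIntegral.integral_eq_sub_of_hasDerivAt (f := fun t => Γ (γ t))]
    · intro t ht
      rw [Set.uIcc_of_le (by linarith)] at ht
      exact (hΓ _ (hcurve t ht)).comp t (hγ.differentiable (by norm_num) t).hasDerivAt
    · refine ContinuousOn.intervalIntegrable ?_
      rw [Set.uIcc_of_le (by linarith)]
      exact (hφd.continuousOn.comp hγ.continuous.continuousOn hcurve).mul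
        (hγ.continuous_deriv (by norm_num)).continuousOn
  have hlin : ∀ t : ℝ, HasDerivAt (fun t : ℝ => x + t * e) e t := fun t => by
    simpa using ((Complex.ofRealCLM.hasDerivAt (x := t)).mul_const e).const_add x
  have hI2 : (∫ t in (-ρ)..ρ, Complex.exp (phaseAt u F x (x + t * e) / ε) * (k (x + t * e) * e)) =
      Γ (x + ρ * e) - Γ (x + (-ρ : ℝ) * e) := by
    rw [intervalIntegral.integral_eq_sub_of_hasDerivAt (f := fun t : ℝ => Γ (x + t * e))]
    · intro t ht
      rw [Set.uIcc_of_le (by linarith)] at ht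
      rw [← mul_assoc]
      exact (hΓ _ (hsub (hball t ht))).comp t (hlin t)
    · refine ContinuousOn.intervalIntegrable ?_
      rw [Set.uIcc_of_le (by linarith)]
      simp_rw [← mul_assoc]
      exact (hφd.continuousOn.comp (by fun_prop) fun t ht => hsub (hball t ht)).mul
        continuousOn_const
  have hmain := hlap (Complex.I * deriv u x * e ^ 2 / 2) (-Complex.I * (b / 3 * e ^ 3)) (k x * e)
    (deriv k x * e * e) (fun t => phaseAt u F x (x + t * e)) (fun t => k (x + t * e) * e) ε hε hare
    ?_ ?_ ?_ ?_ ?_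
  rotate_left
  · rw [norm_mul, norm_neg, Complex.norm_I, one_mul, norm_mul, norm_div, norm_pow]
    have : ‖b‖ / ‖(3 : ℂ)‖ ≤ CT := by
      rw [Complex.norm_ofNat, div_le_iff₀ (by norm_num)]; linarith
    exact (mul_le_mul_of_nonneg_right this (by positivity)).trans
      (hle 3 (by norm_num) CT hCT.le (by linarith))
  · rw [norm_mul, ← pow_one ‖e‖]
    exact (mul_le_mul_of_nonneg_right ((hkM x (hsub (mem_ball_self (by positivity)))).trans
      (le_abs_self _)) (by positivity)).trans (hle 1 (by norm_num) _ hMk (by linarith))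
  · have : ContinuousOn (phaseAt u F x) (ball x₀ r) := by
      have h1 : ContinuousOn F (ball x₀ r) := fun w hw =>
        (hF w hw).continuousAt.continuousWithinAt
      unfold phaseAt
      fun_prop
    exact this.comp (by fun_prop) fun t ht => hsub (hball t ht)
  · exact (hk.continuousOn.comp (by fun_prop) fun t ht => hsub (hball t ht)).mul continuousOn_const
  · intro t ht
    have hw := hball t ht
    obtain ⟨k1, k2, -⟩ := hkb _ hw
    have h1 := hS _ hw
    rw [add_sub_cancel_left] at h1 k1 k2
    have hn : ‖(t : ℂ) * e‖ = |t| * ‖e‖ := by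
      rw [norm_mul, Complex.norm_real, Real.norm_eq_abs]
    rw [hn] at h1 k1 k2
    refine ⟨?_, ?_, ?_, ?_⟩
    · calc ‖phaseAt u F x (x + t * e) + Complex.I * deriv u x * e ^ 2 / 2 * t ^ 2 -
          -Complex.I * (b / 3 * e ^ 3) * t ^ 3‖ = _ := by congr 1; ring
        _ ≤ CT * (|t| * ‖e‖) ^ 4 := h1
        _ = CT * ‖e‖ ^ 4 * |t| ^ 4 := by ring
        _ = CT * ‖e‖ ^ 4 * t ^ 4 := by rw [← abs_pow, abs_of_nonneg (by positivity : 0 ≤ t ^ 4)]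
        _ ≤ A * t ^ 4 := mul_le_mul_of_nonneg_right
          (hle 4 le_rfl CT hCT.le (by linarith)) (by positivity)
    · rw [norm_mul, ← pow_one ‖e‖]
      exact (mul_le_mul_of_nonneg_right ((hkM _ (hsub hw)).trans (le_abs_self _))
        (by positivity)).trans (hle 1 (by norm_num) _ hMk (by linarith))
    · rw [← sub_mul, norm_mul]
      calc _ ≤ Ck * (|t| * ‖e‖) * ‖e‖ := by gcongr
        _ = Ck * ‖e‖ ^ 2 * |t| := by ring
        _ ≤ A * |t| := mul_le_mul_of_nonneg_right
          (hle 2 (by norm_num) Ck hCk.le (by linarith)) (by positivity)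
    · calc ‖k (x + t * e) * e - k x * e - deriv k x * e * e * t‖ =
          ‖k (x + t * e) - k x - t * e * deriv k x‖ * ‖e‖ := by rw [← norm_mul]; congr 1; ring
        _ ≤ Ck * (|t| * ‖e‖) ^ 2 * ‖e‖ := by gcongr
        _ = Ck * ‖e‖ ^ 3 * t ^ 2 := by rw [mul_pow, sq_abs]; ring
        _ ≤ A * t ^ 2 := mul_le_mul_of_nonneg_right
          (hle 3 (by norm_num) Ck hCk.le (by linarith)) (by positivity)
  rw [hI2] at hmain
  have e1 := hend ρ (abs_of_pos hρ)
  have e2 := hend (-ρ) (by rw [abs_neg, abs_of_pos hρ])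
  rw [hI1]
  have hL : √ε * (k x * laplaceCoeff u e x) = √ε * (k x * e *
      (Real.pi / (Complex.I * deriv u x * e ^ 2 / 2)) ^ (1 / 2 : ℂ)) := by
    rw [laplaceCoeff]; ring
  rw [hL]
  calc _ = ‖(Γ (γ (t₀ + ρ)) - Γ (x + ρ * e)) - (Γ (γ (t₀ + -ρ)) - Γ (x + (-ρ : ℝ) * e)) +
      (Γ (x + ρ * e) - Γ (x + (-ρ : ℝ) * e) - √ε * (k x * e *
      (Real.pi / (Complex.I * deriv u x * e ^ 2 / 2)) ^ (1 / 2 : ℂ)))‖ := by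
        rw [← sub_eq_add_neg t₀ ρ]; congr 1; ring
    _ ≤ _ := (norm_add_le _ _).trans (add_le_add ((norm_sub_le _ _).trans (add_le_add e1 e2)) hmain)
    _ = _ := by ring

end Laplace

theorem sum_eq_add_sum_ite {ι : Type*} [Fintype ι] [DecidableEq ι] (m : ι) (g : ι → ℂ) :
    ∑ p, g p = g m + ∑ p, if p = m then 0 else g p := by
  rw [← Finset.sum_ite_eq' Finset.univ m g |>.trans (if_pos (Finset.mem_univ m)),
    ← Finset.sum_add_distrib]
  exact Finset.sum_congr rfl fun p _ => by split_ifs <;> simp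

/-! ### The potential, its antiderivative `f`, and their behaviour at infinity. -/

namespace RationalPotential

variable {P : ℕ} (u : RationalPotential P)

theorem differentiableAt_u0C {w : ℂ} (hw : u.NotPole w) : DifferentiableAt ℂ u.u0C w := by
  unfold u0C
  refine DifferentiableAt.fun_sum fun p _ => ?_
  have h1 := sub_ne_zero.2 (hw p).1
  have h2 := sub_ne_zero.2 (hw p).2
  fun_prop (disch := assumption)

theorem isOpen_notPole : IsOpen {w | u.NotPole w} := by
  have : {w | u.NotPole w} = ⋂ p, ({w | w ≠ u.z p} ∩ {w | w ≠ conj (u.z p)}) := by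
    ext w; simp [NotPole]
  rw [this]
  exact isOpen_iInter_of_finite fun p => isOpen_ne.inter isOpen_ne

theorem z_injective : Function.Injective u.z := fun p q h =>
  u.z_re_strictMono.injective (by simp [h])

theorem conj_z_im (p : Fin P) : (conj (u.z p)).im < 0 := by
  rw [Complex.conj_im]; linarith [u.z_im_pos p]

theorem notPole_ofReal (x : ℝ) : u.NotPole x := fun p => by
  have h := u.z_im_pos p
  constructor <;> intro h' <;> have := congrArg Complex.im h' <;> simp at this <;> linarith

/-- The logarithm `log (i w)` has its cut along the positive imaginary axis. -/
theorem hasDerivAt_log_I_mul {z w : ℂ} (h : w.im < z.im ∨ w.re ≠ z.re) :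
    HasDerivAt (fun w => Complex.log (Complex.I * (w - z))) (1 / (w - z)) w := by
  have hs : Complex.I * (w - z) ∈ Complex.slitPlane := by
    rw [Complex.mem_slitPlane_iff]
    simp only [Complex.mul_re, Complex.I_re, Complex.sub_re, zero_mul, Complex.I_im,
      Complex.sub_im, one_mul, zero_sub, Complex.mul_im, zero_add]
    rcases h with h | h
    · left; linarith
    · right; exact sub_ne_zero.2 h
  have hne : w - z ≠ 0 := fun h0 => Complex.slitPlane_ne_zero hs (by rw [h0, mul_zero])
  have h1 : HasDerivAt (fun w => Complex.I * (w - z)) Complex.I w := by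
    simpa using ((hasDerivAt_id w).sub_const z).const_mul Complex.I
  refine (h1.clog hs).congr_deriv ?_
  field_simp

/-- The logarithm `log (-i w)` has its cut along the negative imaginary axis. -/
theorem hasDerivAt_log_neg_I_mul {z w : ℂ} (h : z.im < w.im ∨ w.re ≠ z.re) :
    HasDerivAt (fun w => Complex.log (-Complex.I * (w - z))) (1 / (w - z)) w := by
  have hs : -Complex.I * (w - z) ∈ Complex.slitPlane := by
    rw [Complex.mem_slitPlane_iff]
    simp only [neg_mul, Complex.neg_re, Complex.neg_im, Complex.mul_re, Complex.I_re,
      Complex.sub_re, zero_mul, Complex.I_im,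
      Complex.sub_im, one_mul, zero_sub, Complex.mul_im, zero_add]
    rcases h with h | h
    · left; linarith
    · right; rw [neg_ne_zero]; exact sub_ne_zero.2 h
  have hne : w - z ≠ 0 := fun h0 => Complex.slitPlane_ne_zero hs (by rw [h0, mul_zero])
  have h1 : HasDerivAt (fun w => -Complex.I * (w - z)) (-Complex.I) w := by
    simpa using ((hasDerivAt_id w).sub_const z).const_mul (-Complex.I)
  refine (h1.clog hs).congr_deriv ?_
  field_simp

/-- The part of `f` singular at the pole `z p`. -/
noncomputable def logPart (p : Fin P) (w : ℂ) : ℂ :=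
  u.c p * (Complex.log (Complex.I * (w - u.z p)) + Real.pi * Complex.I / 2)

/-- `f` without its part singular at the pole `z m`. -/
noncomputable def regPart (m : Fin P) (w : ℂ) : ℂ := u.f w - u.logPart m w

theorem hasDerivAt_logPart {p : Fin P} {w : ℂ}
    (h : w.im < (u.z p).im ∨ w.re ≠ (u.z p).re) :
    HasDerivAt (u.logPart p) (u.c p / (w - u.z p)) w := by
  have := ((hasDerivAt_log_I_mul h).add_const (Real.pi * Complex.I / 2)).const_mul (u.c p)
  rwa [mul_one_div] at this

theorem hasDerivAt_conjLogPart {p : Fin P} {w : ℂ} (h : -(u.z p).im < w.im) :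
    HasDerivAt (fun w => conj (u.c p) * (Complex.log (-Complex.I * (w - conj (u.z p))) -
      Real.pi * Complex.I / 2)) (conj (u.c p) / (w - conj (u.z p))) w := by
  have h' : (conj (u.z p)).im < w.im := by rwa [Complex.conj_im]
  have := ((hasDerivAt_log_neg_I_mul (Or.inl h')).sub_const (Real.pi * Complex.I / 2)).const_mul
    (conj (u.c p))
  rwa [mul_one_div] at this

theorem hasDerivAt_f {w : ℂ} (hw : ∀ p, -(u.z p).im < w.im)
    (h : ∀ p, w.im < (u.z p).im ∨ w.re ≠ (u.z p).re) : HasDerivAt u.f (u.u0C w) w := by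
  unfold f u0C
  exact HasDerivAt.fun_sum fun p _ => (u.hasDerivAt_logPart (h p)).add
    (u.hasDerivAt_conjLogPart (hw p))

theorem regPart_eq (m : Fin P) (w : ℂ) : u.regPart m w =
    ∑ p, ((if p = m then 0 else u.logPart p w) +
      conj (u.c p) * (Complex.log (-Complex.I * (w - conj (u.z p))) - Real.pi * Complex.I / 2)) := by
  rw [Finset.sum_add_distrib, regPart, f, Finset.sum_add_distrib,
    sum_eq_add_sum_ite m fun p => u.c p * (Complex.log (Complex.I * (w - u.z p)) +
      Real.pi * Complex.I / 2)]
  simp only [logPart]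
  ring

theorem hasDerivAt_regPart {m : Fin P} {w : ℂ} (hw : ∀ p, -(u.z p).im < w.im)
    (h : ∀ p, p ≠ m → w.im < (u.z p).im ∨ w.re ≠ (u.z p).re) :
    HasDerivAt (u.regPart m)
      (∑ p, ((if p = m then 0 else u.c p / (w - u.z p)) + conj (u.c p) / (w - conj (u.z p)))) w := by
  have : u.regPart m = fun w => ∑ p, ((if p = m then 0 else u.logPart p w) +
      conj (u.c p) * (Complex.log (-Complex.I * (w - conj (u.z p))) -
        Real.pi * Complex.I / 2)) := funext fun w => u.regPart_eq m w
  rw [this]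
  refine HasDerivAt.fun_sum fun p _ => HasDerivAt.add ?_ (u.hasDerivAt_conjLogPart (hw p))
  by_cases hp : p = m
  · simpa [hp] using hasDerivAt_const w (0 : ℂ)
  · simpa [hp] using u.hasDerivAt_logPart (h p hp)

theorem u0C_eq_add (m : Fin P) (w : ℂ) : u.u0C w = u.c m / (w - u.z m) +
    ∑ p, ((if p = m then 0 else u.c p / (w - u.z p)) + conj (u.c p) / (w - conj (u.z p))) := by
  rw [u0C, Finset.sum_add_distrib, Finset.sum_add_distrib,
    sum_eq_add_sum_ite m fun p => u.c p / (w - u.z p)]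
  ring

/-- The coefficient of `1 / w` at infinity vanishes. Hence `f` stays bounded there and `u₀` is of
order `w⁻²`. -/
theorem sum_c_add_conj : ∑ p, (u.c p + conj (u.c p)) = 0 := by
  have h := u.re_sum_c
  simp_rw [Complex.add_conj]
  rw [← Complex.ofReal_sum, ← Finset.mul_sum, ← Complex.re_sum, h]
  simp

/-- A radius beyond twice the modulus of all poles. -/
noncomputable def bigRadius : ℝ := 2 * ∑ p, ‖u.z p‖ + 1

theorem two_mul_norm_z_lt (p : Fin P) : 2 * ‖u.z p‖ < u.bigRadius := by
  have := Finset.single_le_sum (f := fun p => ‖u.z p‖) (fun p _ => norm_nonneg _)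
    (Finset.mem_univ p)
  unfold bigRadius
  linarith

theorem bigRadius_pos : 0 < u.bigRadius := by
  unfold bigRadius
  positivity

theorem half_norm_le_norm_sub {w z : ℂ} {R : ℝ} (hz : 2 * ‖z‖ < R) (hw : R ≤ ‖w‖) :
    ‖w‖ / 2 ≤ ‖w - z‖ := by
  linarith [norm_sub_norm_le w z]

theorem abs_log_norm_sub_le {w z : ℂ} {R : ℝ} (hz : 2 * ‖z‖ < R) (hw : R ≤ ‖w‖) :
    |Real.log ‖w - z‖ - Real.log ‖w‖| ≤ Real.log 2 := by
  have h1 := half_norm_le_norm_sub hz hw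
  have hw0 : 0 < ‖w‖ := by linarith [norm_nonneg z]
  have h2 : ‖w - z‖ ≤ 2 * ‖w‖ := by linarith [norm_sub_le w z]
  rw [abs_le]
  constructor
  · have := Real.log_le_log (by positivity) h1
    rw [Real.log_div hw0.ne' (by norm_num)] at this
    linarith
  · have := Real.log_le_log (by linarith) h2
    rw [Real.log_mul (by norm_num) hw0.ne'] at this
    linarith

/-- `f` is bounded at infinity. -/
theorem exists_norm_f_le : ∃ M > 0, ∀ w, u.bigRadius ≤ ‖w‖ → ‖u.f w‖ ≤ M := by
  refine ⟨∑ p, 2 * (‖u.c p‖ * (Real.log 2 + 2 * Real.pi)) + 1, ?_, fun w hw => ?_⟩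
  · have := Real.log_pos one_lt_two
    positivity
  -- Since the residues sum to zero, `log ‖w‖` may be subtracted from every logarithm, which leaves
  -- bounded summands.
  have hkey : u.f w = ∑ p, (u.c p * (Complex.log (Complex.I * (w - u.z p)) -
      Real.log ‖w‖ + Real.pi * Complex.I / 2) +
      conj (u.c p) * (Complex.log (-Complex.I * (w - conj (u.z p))) - Real.log ‖w‖ -
        Real.pi * Complex.I / 2)) := by
    have : u.f w = u.f w - (∑ p, (u.c p + conj (u.c p))) * Real.log ‖w‖ := by
      rw [sum_c_add_conj]; ring
    rw [this, f, Finset.sum_mul, ← Finset.sum_sub_distrib]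
    exact Finset.sum_congr rfl fun p _ => by ring
  have hlog : ∀ (e z : ℂ), ‖e‖ = 1 → 2 * ‖z‖ < u.bigRadius →
      ‖Complex.log (e * (w - z)) - Real.log ‖w‖‖ ≤ Real.log 2 + Real.pi := by
    intro e z he hz
    have h1 : Complex.log (e * (w - z)) - Real.log ‖w‖ =
        ((Real.log ‖w - z‖ - Real.log ‖w‖ : ℝ) : ℂ) +
          (Complex.arg (e * (w - z)) : ℝ) * Complex.I := by
      rw [Complex.log, norm_mul, he, one_mul]
      push_cast
      ring
    rw [h1]
    refine (norm_add_le _ _).trans (add_le_add ?_ ?_)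
    · rw [Complex.norm_real, Real.norm_eq_abs]
      exact abs_log_norm_sub_le hz hw
    · rw [norm_mul, Complex.norm_I, mul_one, Complex.norm_real, Real.norm_eq_abs]
      exact Complex.abs_arg_le_pi _
  have hpi : ‖(Real.pi * Complex.I / 2 : ℂ)‖ ≤ Real.pi := by
    rw [norm_div, norm_mul, Complex.norm_I, Complex.norm_real, Real.norm_eq_abs,
      abs_of_pos Real.pi_pos, Complex.norm_ofNat]
    linarith [Real.pi_pos]
  rw [hkey]
  refine le_trans ?_ (le_add_of_nonneg_right zero_le_one)
  refine (norm_sum_le _ _).trans (Finset.sum_le_sum fun p _ => ?_)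
  rw [two_mul]
  refine (norm_add_le _ _).trans (add_le_add ?_ ?_)
  · rw [norm_mul]
    gcongr
    refine (norm_add_le _ _).trans ?_
    linarith [hlog Complex.I (u.z p) Complex.norm_I (u.two_mul_norm_z_lt p)]
  · rw [norm_mul, RCLike.norm_conj]
    gcongr
    refine (norm_sub_le _ _).trans ?_
    linarith [hlog (-Complex.I) (conj (u.z p)) (by simp)
      (by rw [RCLike.norm_conj]; exact u.two_mul_norm_z_lt p)]

/-- `u₀(w) = O(w⁻²)`. -/
theorem exists_norm_u0C_le : ∃ C > 0, ∀ w, u.bigRadius ≤ ‖w‖ → ‖u.u0C w‖ ≤ C / ‖w‖ ^ 2 := by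
  refine ⟨∑ p, 4 * (‖u.c p‖ * ‖u.z p‖) + 1, by positivity, fun w hw => ?_⟩
  have hw0 : 0 < ‖w‖ := u.bigRadius_pos.trans_le hw
  have hwne : w ≠ 0 := norm_pos_iff.1 hw0
  have hsub : ∀ (c z : ℂ), 2 * ‖z‖ < u.bigRadius →
      ‖c / (w - z) - c / w‖ ≤ 2 * (‖c‖ * ‖z‖) / ‖w‖ ^ 2 := by
    intro c z hz
    have h1 := half_norm_le_norm_sub hz hw
    have hne : w - z ≠ 0 := norm_pos_iff.1 (by linarith)
    have : c / (w - z) - c / w = c * z / ((w - z) * w) := by field_simp; ring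
    rw [this, norm_div, norm_mul, norm_mul]
    calc ‖c‖ * ‖z‖ / (‖w - z‖ * ‖w‖) ≤ ‖c‖ * ‖z‖ / (‖w‖ / 2 * ‖w‖) := by gcongr
      _ = _ := by field_simp
  have hkey : u.u0C w = ∑ p, ((u.c p / (w - u.z p) - u.c p / w) +
      (conj (u.c p) / (w - conj (u.z p)) - conj (u.c p) / w)) := by
    have : u.u0C w = u.u0C w - (∑ p, (u.c p + conj (u.c p))) / w := by
      rw [sum_c_add_conj]; ring
    rw [this, u0C, Finset.sum_div, ← Finset.sum_sub_distrib]
    exact Finset.sum_congr rfl fun p _ => by ring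
  rw [hkey, le_div_iff₀ (by positivity)]
  refine le_trans ?_ (le_add_of_nonneg_right zero_le_one)
  rw [← le_div_iff₀ (by positivity), Finset.sum_div]
  refine (norm_sum_le _ _).trans (Finset.sum_le_sum fun p _ => ?_)
  refine (norm_add_le _ _).trans ?_
  have h1 := hsub (u.c p) (u.z p) (u.two_mul_norm_z_lt p)
  have h2 := hsub (conj (u.c p)) (conj (u.z p))
    (by rw [RCLike.norm_conj]; exact u.two_mul_norm_z_lt p)
  rw [RCLike.norm_conj, RCLike.norm_conj] at h2
  calc _ ≤ _ := add_le_add h1 h2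
    _ = _ := by ring

/-! ### The Evans matrix for complex spectral parameter -/

/-- `exp(-i h(w; λ)/ε)` for complex `λ`. -/
noncomputable def expH (eps : ℝ) (lam w : ℂ) : ℂ :=
  Complex.exp (-Complex.I * (lam * w + u.f w) / eps)

/-- The integrand of the entries of the Evans matrix. -/
noncomputable def kern (eps : ℝ) (lam : ℂ) (p : Fin P) (w : ℂ) : ℂ :=
  u.expH eps lam w / (w - u.z p)

/-- The matrix `A(λ)` for complex `λ`. -/
noncomputable def AC (eps : ℝ) (lam : ℂ) : Matrix (Fin P) (Fin P) ℂ := fun m p =>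
  u.integralC eps m (u.kern eps lam p)

theorem AC_ofReal (eps lam : ℝ) : u.AC eps lam = u.A eps lam := rfl

theorem norm_expH (eps : ℝ) (lam w : ℂ) :
    ‖u.expH eps lam w‖ = Real.exp ((lam * w).im / eps) * Real.exp ((u.f w).im / eps) := by
  rw [expH, Complex.norm_exp, ← Real.exp_add, Complex.div_ofReal_re]
  congr 1
  simp only [neg_mul, Complex.neg_re, Complex.mul_re, Complex.I_re, zero_mul, Complex.I_im,
    Complex.add_im, one_mul, zero_sub, neg_neg]
  ring

theorem expH_ne_zero (eps : ℝ) (lam w : ℂ) : u.expH eps lam w ≠ 0 := Complex.exp_ne_zero _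

theorem hasDerivAt_exp_phase {F : ℂ → ℂ} {v w : ℂ} (eps : ℝ) (lam : ℂ) (hF : HasDerivAt F v w) :
    HasDerivAt (fun w => Complex.exp (-Complex.I * (lam * w + F w) / eps))
      (-Complex.I / eps * (lam + v) * Complex.exp (-Complex.I * (lam * w + F w) / eps)) w := by
  have h1 : HasDerivAt (fun w => -Complex.I * (lam * w + F w) / eps)
      (-Complex.I * (lam * 1 + v) / eps) w :=
    ((((hasDerivAt_id w).const_mul lam).add hF).const_mul (-Complex.I)).div_const _
  refine h1.cexp.congr_deriv ?_
  ring

end RationalPotential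

theorem im_mul_add_I_mul (lam w : ℂ) (y : ℝ) :
    (lam * (w + Complex.I * y)).im = (lam * w).im + lam.re * y := by
  simp [Complex.mul_im, Complex.mul_re]
  ring

open Metric in
/-- Upward rays of a function that decays like `exp(Im(λ w)/ε)` on a set invariant under upward
translations. -/
theorem hasDerivAt_upwardRay_of_decay {D : Set ℂ} (hD : Convex ℝ D) (hDo : IsOpen D)
    (hup : ∀ z ∈ D, ∀ y : ℝ, 0 ≤ y → z + Complex.I * y ∈ D) {K : ℂ → ℂ}
    (hK : DifferentiableOn ℂ K D) {eps : ℝ} (heps : 0 < eps) {lam : ℂ} (hlam : lam.re < 0)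
    (hb : ∃ R C : ℝ, ∀ w ∈ D, R ≤ w.im → ‖K w‖ ≤ C * Real.exp ((lam * w).im / eps))
    {z₀ : ℂ} (hz₀ : z₀ ∈ D) : HasDerivAt (upwardRay K) (K z₀) z₀ := by
  obtain ⟨R, C, hC⟩ := hb
  obtain ⟨r, hr, hsub⟩ := Metric.isOpen_iff.1 hDo z₀ hz₀
  have hcl : closedBall z₀ (r / 2) ⊆ D := (closedBall_subset_ball (by linarith)).trans hsub
  refine hasDerivAt_upwardRay hD hDo hup hK (κ := -lam.re / eps)
    (div_pos (by linarith) heps) hz₀ ⟨r / 2, by positivity, ?_⟩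
  -- Above height `Y` every ray starting in the ball has imaginary part at least `R`, so the assumed
  -- decay applies; below `Y` compactness suffices.
  set Y := |R - z₀.im| + r with hY
  have hY0 : 0 < Y := by positivity
  have hcomp : IsCompact (closedBall z₀ (r / 2) ×ˢ Set.Icc (0 : ℝ) Y) :=
    (isCompact_closedBall _ _).prod isCompact_Icc
  obtain ⟨B₁, hB₁⟩ := hcomp.exists_bound_of_continuousOn
    (f := fun q : ℂ × ℝ => K (q.1 + Complex.I * q.2) * Real.exp (-lam.re / eps * q.2))
    (by
      refine ContinuousOn.mul (hK.continuousOn.comp (by fun_prop) fun q hq => ?_) (by fun_prop)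
      exact hup _ (hcl hq.1) _ hq.2.1)
  obtain ⟨B₂, hB₂⟩ := (isCompact_closedBall z₀ (r / 2)).exists_bound_of_continuousOn
    (f := fun w : ℂ => Real.exp ((lam * w).im / eps)) (by fun_prop)
  refine ⟨max B₁ (|C| * B₂), fun w hw hwD y hy => ?_⟩
  have hw' := ball_subset_closedBall hw
  rw [neg_div, neg_neg]
  by_cases hyY : y ≤ Y
  · have h1 := hB₁ (w, y) ⟨hw', hy, hyY⟩
    rw [norm_mul, Complex.norm_real, Real.norm_eq_abs, abs_of_pos (Real.exp_pos _)] at h1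
    have h2 : ‖K (w + Complex.I * y)‖ = ‖K (w + Complex.I * y)‖ * Real.exp (-lam.re / eps * y) *
        Real.exp (lam.re / eps * y) := by
      rw [mul_assoc, ← Real.exp_add, neg_div, neg_mul, neg_add_cancel, Real.exp_zero, mul_one]
    rw [h2]
    gcongr
    exact h1.trans (le_max_left _ _)
  · have him : R ≤ (w + Complex.I * y).im := by
      have h1 : |(w - z₀).im| ≤ r / 2 := (Complex.abs_im_le_norm _).trans (by
        rw [mem_closedBall, dist_eq_norm] at hw'; exact hw')
      rw [abs_le, Complex.sub_im] at h1
      simp only [Complex.add_im, Complex.mul_im, Complex.I_re, Complex.ofReal_im, mul_zero,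
        Complex.I_im, Complex.ofReal_re, one_mul, zero_add]
      have h2 := le_abs_self (R - z₀.im)
      rw [not_le] at hyY
      linarith [h1.1]
    have h1 := hC _ (hup w hwD y hy) him
    rw [im_mul_add_I_mul, add_div, Real.exp_add] at h1
    have h2 := hB₂ w hw'
    rw [Real.norm_eq_abs, abs_of_pos (Real.exp_pos _)] at h2
    have h3 : lam.re * y / eps = lam.re / eps * y := by ring
    calc _ ≤ _ := h1
      _ ≤ |C| * (B₂ * Real.exp (lam.re / eps * y)) := by
        rw [h3]
        have := le_abs_self C
        gcongr
      _ = |C| * B₂ * Real.exp (lam.re / eps * y) := by ring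
      _ ≤ _ := by gcongr; exact le_max_right _ _

namespace RationalPotential

variable {P : ℕ} (u : RationalPotential P)

/-- A vertical half-strip above the line of the conjugate poles, to the right of the poles in `l`
and to the left of those in `r`. -/
def halfStrip (l r : Fin P → Prop) : Set ℂ :=
  {w | ∀ p, -(u.z p).im < w.im ∧ (l p → (u.z p).re < w.re) ∧ (r p → w.re < (u.z p).re)}

theorem halfStrip_eq (l r : Fin P → Prop) : u.halfStrip l r =
    ⋂ p, ({w : ℂ | -(u.z p).im < w.im} ∩ ((⋂ _ : l p, {w : ℂ | (u.z p).re < w.re}) ∩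
      ⋂ _ : r p, {w : ℂ | w.re < (u.z p).re})) := by
  ext w
  simp [halfStrip]

theorem convex_halfStrip (l r : Fin P → Prop) : Convex ℝ (u.halfStrip l r) := by
  rw [halfStrip_eq]
  exact convex_iInter fun p => (convex_halfSpace_im_gt _).inter
    ((convex_iInter fun _ => convex_halfSpace_re_gt _).inter
      (convex_iInter fun _ => convex_halfSpace_re_lt _))

theorem isOpen_halfStrip (l r : Fin P → Prop) : IsOpen (u.halfStrip l r) := by
  rw [halfStrip_eq]
  refine isOpen_iInter_of_finite fun p => (isOpen_lt continuous_const Complex.continuous_im).inter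
    (IsOpen.inter ?_ ?_)
  · by_cases h : l p
    · simpa [h] using isOpen_lt continuous_const Complex.continuous_re
    · simp [h]
  · by_cases h : r p
    · simpa [h] using isOpen_lt Complex.continuous_re continuous_const
    · simp [h]

theorem add_I_mul_im (z : ℂ) (y : ℝ) : (z + Complex.I * y).im = z.im + y := by simp

theorem add_I_mul_re (z : ℂ) (y : ℝ) : (z + Complex.I * y).re = z.re := by simp

theorem upward_halfStrip (l r : Fin P → Prop) : ∀ z ∈ u.halfStrip l r, ∀ y : ℝ, 0 ≤ y →
    z + Complex.I * y ∈ u.halfStrip l r := fun z hz y hy p => by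
  have := hz p
  rw [add_I_mul_im, add_I_mul_re]
  exact ⟨by linarith [this.1], this.2⟩

/-- Points on no vertical line through a pole. -/
def Generic (w : ℂ) : Prop := ∀ p, w.re ≠ (u.z p).re

theorem generic_of_halfStrip {l r : Fin P → Prop} (hlr : ∀ p, l p ∨ r p) {w : ℂ}
    (hw : w ∈ u.halfStrip l r) : u.Generic w := fun p => by
  rcases hlr p with h | h
  · exact ((hw p).2.1 h).ne'
  · exact ((hw p).2.2 h).ne

theorem Generic.hasDerivAt_f {u : RationalPotential P} {w : ℂ} (h : u.Generic w)
    (hw : ∀ p, -(u.z p).im < w.im) : HasDerivAt u.f (u.u0C w) w :=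
  u.hasDerivAt_f hw fun p => Or.inr (h p)

theorem hasDerivAt_expH {w : ℂ} (hw : ∀ p, -(u.z p).im < w.im)
    (h : ∀ p, w.im < (u.z p).im ∨ w.re ≠ (u.z p).re) (eps : ℝ) (lam : ℂ) :
    HasDerivAt (u.expH eps lam) (-Complex.I / eps * (lam + u.u0C w) * u.expH eps lam w) w :=
  hasDerivAt_exp_phase eps lam (u.hasDerivAt_f hw h)

theorem differentiableAt_kern {w : ℂ} (hw : ∀ p, -(u.z p).im < w.im)
    (h : ∀ p, w.im < (u.z p).im ∨ w.re ≠ (u.z p).re) (eps : ℝ) (lam : ℂ) (p : Fin P) :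
    DifferentiableAt ℂ (u.kern eps lam p) w := by
  refine (u.hasDerivAt_expH hw h eps lam).differentiableAt.div (by fun_prop) ?_
  intro h0
  have : w = u.z p := sub_eq_zero.1 h0
  rcases h p with h1 | h1 <;> simp [this] at h1

theorem norm_inv_sub_le {w : ℂ} (hw : u.bigRadius ≤ ‖w‖) (p : Fin P) :
    ‖w - u.z p‖⁻¹ ≤ 2 / ‖w‖ := by
  have h1 := half_norm_le_norm_sub (u.two_mul_norm_z_lt p) hw
  have h0 : 0 < ‖w‖ := u.bigRadius_pos.trans_le hw
  calc ‖w - u.z p‖⁻¹ ≤ (‖w‖ / 2)⁻¹ := inv_anti₀ (by positivity) h1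
    _ = 2 / ‖w‖ := by rw [inv_div]

/-- Since `F` is bounded at infinity, only `exp(Im(λ w)/ε)` matters there, and for `Re λ < 0` it
decays along upward rays. The function `F` will be `f` or a version of it with other cuts. -/
theorem exists_norm_exp_div_le {F : ℂ → ℂ} {M eps : ℝ} (heps : 0 < eps) (lam : ℂ)
    (hF : ∀ w, u.bigRadius ≤ ‖w‖ → ‖F w‖ ≤ M) (p : Fin P) (w : ℂ) (hw : u.bigRadius ≤ ‖w‖) :
    ‖Complex.exp (-Complex.I * (lam * w + F w) / eps) / (w - u.z p)‖ ≤
      Real.exp (M / eps) * (2 / u.bigRadius) * Real.exp ((lam * w).im / eps) := by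
  have h1 : ‖Complex.exp (-Complex.I * (lam * w + F w) / eps)‖ =
      Real.exp ((lam * w).im / eps) * Real.exp ((F w).im / eps) := by
    rw [Complex.norm_exp, ← Real.exp_add, Complex.div_ofReal_re]
    congr 1
    simp only [neg_mul, Complex.neg_re, Complex.mul_re, Complex.I_re, zero_mul, Complex.I_im,
      Complex.add_im, one_mul, zero_sub, neg_neg]
    ring
  have h2 : (F w).im ≤ M := (Complex.im_le_norm _).trans (hF w hw)
  have h3 : ‖w - u.z p‖⁻¹ ≤ 2 / u.bigRadius := (u.norm_inv_sub_le hw p).trans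
    (div_le_div_of_nonneg_left (by norm_num) u.bigRadius_pos hw)
  rw [div_eq_mul_inv, norm_mul, norm_inv, h1]
  calc _ ≤ Real.exp ((lam * w).im / eps) * Real.exp (M / eps) * (2 / u.bigRadius) := by gcongr
    _ = _ := by ring

theorem le_norm_of_le_im {w : ℂ} {R : ℝ} (h : R ≤ w.im) : R ≤ ‖w‖ :=
  h.trans (Complex.im_le_norm w)

theorem hasDerivAt_upwardRay_kern {eps : ℝ} (heps : 0 < eps) {lam : ℂ} (hlam : lam.re < 0)
    {l r : Fin P → Prop} (hlr : ∀ p, l p ∨ r p) {w : ℂ} (hw : w ∈ u.halfStrip l r) (p : Fin P) :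
    HasDerivAt (upwardRay (u.kern eps lam p)) (u.kern eps lam p w) w := by
  obtain ⟨M, hM, hf⟩ := u.exists_norm_f_le
  exact hasDerivAt_upwardRay_of_decay (u.convex_halfStrip l r) (u.isOpen_halfStrip l r)
    (u.upward_halfStrip l r)
    (fun z hz => (u.differentiableAt_kern (fun p => (hz p).1)
      (fun p => Or.inr (u.generic_of_halfStrip hlr hz p)) eps lam p).differentiableWithinAt) heps hlam
    ⟨u.bigRadius, _, fun z _ hz => u.exists_norm_exp_div_le heps lam hf p z (le_norm_of_le_im hz)⟩ hw

/-! ### The solution of the inhomogeneous equation given by upward rays -/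

/-- The right hand side `∑ v_p / (w - z_p)`. -/
noncomputable def source (v : Fin P → ℂ) (w : ℂ) : ℂ := ∑ p, v p / (w - u.z p)

/-- The solution of `φ' = (i/ε)(λ + u₀) φ + ∑ v_p / (w - z_p)` that decays at `i∞`. -/
noncomputable def raySol (eps : ℝ) (lam : ℂ) (v : Fin P → ℂ) (w : ℂ) : ℂ :=
  (∑ p, v p * upwardRay (u.kern eps lam p) w) / u.expH eps lam w

/-- `φ` solves the inhomogeneous equation at `w`. -/
def SolvesAt (eps : ℝ) (lam : ℂ) (v : Fin P → ℂ) (φ : ℂ → ℂ) (w : ℂ) : Prop :=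
  HasDerivAt φ (Complex.I / eps * (lam + u.u0C w) * φ w + u.source v w) w

-- Variation of constants: `1 / E` solves the homogeneous equation, and `H` is a primitive of `E`
-- times the source.
variable {u} in
theorem solvesAt_div {eps : ℝ} {lam : ℂ} {v : Fin P → ℂ} {H E : ℂ → ℂ} {w : ℂ}
    (hE : HasDerivAt E (-Complex.I / eps * (lam + u.u0C w) * E w) w)
    (hH : HasDerivAt H (∑ p, v p * (E w / (w - u.z p))) w) (hE0 : E w ≠ 0) :
    u.SolvesAt eps lam v (fun w => H w / E w) w := by
  refine (hH.div hE hE0).congr_deriv ?_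
  have : ∑ p, v p * (E w / (w - u.z p)) = E w * u.source v w := by
    rw [source, Finset.mul_sum]
    exact Finset.sum_congr rfl fun p _ => by ring
  rw [this]
  field_simp
  ring

theorem solvesAt_raySol {eps : ℝ} (heps : 0 < eps) {lam : ℂ} (hlam : lam.re < 0)
    (v : Fin P → ℂ) {w : ℂ} (hw : ∀ p, -(u.z p).im < w.im) (hg : u.Generic w) :
    u.SolvesAt eps lam v (u.raySol eps lam v) w := by
  refine solvesAt_div (u.hasDerivAt_expH hw (fun p => Or.inr (hg p)) eps lam) ?_
    (u.expH_ne_zero _ _ _)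
  refine HasDerivAt.fun_sum fun p _ => HasDerivAt.const_mul _ ?_
  exact u.hasDerivAt_upwardRay_kern heps hlam (l := fun p => (u.z p).re < w.re)
    (r := fun p => w.re < (u.z p).re) (fun p => (hg p).lt_or_gt.symm)
    (fun p => ⟨hw p, id, id⟩) p

theorem isOpen_generic : IsOpen {w | u.Generic w} := by
  have : {w | u.Generic w} = ⋂ p, {w | w.re ≠ (u.z p).re} := by ext w; simp [Generic]
  rw [this]
  exact isOpen_iInter_of_finite fun p => isOpen_ne_fun Complex.continuous_re continuous_const

theorem isOpen_upper : IsOpen {w : ℂ | ∀ p, -(u.z p).im < w.im} := by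
  have : {w : ℂ | ∀ p, -(u.z p).im < w.im} = ⋂ p, {w | -(u.z p).im < w.im} := by ext w; simp
  rw [this]
  exact isOpen_iInter_of_finite fun p => isOpen_lt continuous_const Complex.continuous_im

/-- Near `z₀` the ray solution extends to a solution. -/
def ExtendsNear (eps : ℝ) (lam : ℂ) (v : Fin P → ℂ) (z₀ : ℂ) : Prop :=
  ∃ φ : ℂ → ℂ, ∀ᶠ w in 𝓝 z₀, u.SolvesAt eps lam v φ w ∧
    (u.Generic w → u.raySol eps lam v w = φ w)

theorem extendsNear_of_generic {eps : ℝ} (heps : 0 < eps) {lam : ℂ} (hlam : lam.re < 0)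
    (v : Fin P → ℂ) {w : ℂ} (hw : ∀ p, -(u.z p).im < w.im) (hg : u.Generic w) :
    u.ExtendsNear eps lam v w := by
  refine ⟨u.raySol eps lam v, ?_⟩
  filter_upwards [u.isOpen_generic.mem_nhds hg, u.isOpen_upper.mem_nhds hw] with z hz hz'
  exact ⟨u.solvesAt_raySol heps hlam v hz' hz, fun _ => rfl⟩

/-- Abscissa between `z (m-1)` and `z m`. -/
noncomputable def prevAbscissa (m : Fin P) : ℝ :=
  if m.val = 0 then u.leftAbscissa m else u.rightAbscissa ⟨m.val - 1, by omega⟩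

/-- The vertical half-strip containing only the pole `z m`. -/
def strip (m : Fin P) : Set ℂ := u.halfStrip (· < m) (m < ·)

theorem re_lt_re {p q : Fin P} (h : p < q) : (u.z p).re < (u.z q).re := u.z_re_strictMono h

theorem re_le_re {p q : Fin P} (h : p ≤ q) : (u.z p).re ≤ (u.z q).re :=
  u.z_re_strictMono.monotone h

theorem rightAbscissa_gt {m p : Fin P} (h : p ≤ m) : (u.z p).re < u.rightAbscissa m := by
  have h1 := u.re_le_re h
  unfold rightAbscissa
  split_ifs with hm
  · have := u.re_lt_re (p := m) (q := ⟨m.val + 1, hm⟩) (by simp [Fin.lt_def])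
    linarith
  · linarith

theorem rightAbscissa_lt {m p : Fin P} (h : m < p) : u.rightAbscissa m < (u.z p).re := by
  have hm : m.val + 1 < P := by have := p.isLt; rw [Fin.lt_def] at h; omega
  have h1 := u.re_lt_re (p := m) (q := ⟨m.val + 1, hm⟩) (by simp [Fin.lt_def])
  have h2 := u.re_le_re (p := ⟨m.val + 1, hm⟩) (q := p) (by rw [Fin.le_def]; exact h)
  unfold rightAbscissa
  rw [dif_pos hm]
  linarith

theorem prevAbscissa_gt {m p : Fin P} (h : p < m) : (u.z p).re < u.prevAbscissa m := by
  unfold prevAbscissa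
  have h' : p.val < m.val := h
  rw [if_neg (by omega)]
  exact u.rightAbscissa_gt (by rw [Fin.le_def]; simp; omega)

theorem prevAbscissa_lt {m p : Fin P} (h : m ≤ p) : u.prevAbscissa m < (u.z p).re := by
  unfold prevAbscissa
  have h' : m.val ≤ p.val := h
  split_ifs with h0
  · have := u.re_le_re (p := ⟨0, m.pos⟩) (q := p) (by rw [Fin.le_def]; simp)
    unfold leftAbscissa
    linarith
  · exact u.rightAbscissa_lt (by rw [Fin.lt_def]; simp; omega)

theorem neg_im_lt_ofReal (x : ℝ) (p : Fin P) : -(u.z p).im < (x : ℂ).im := by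
  simpa using u.z_im_pos p

theorem ofReal_im_lt (x : ℝ) (p : Fin P) : (x : ℂ).im < (u.z p).im := by
  simpa using u.z_im_pos p

/-- The part of a half-strip left of `z m`. -/
theorem prevAbscissa_mem (m : Fin P) :
    (u.prevAbscissa m : ℂ) ∈ u.halfStrip (· < m) (m ≤ ·) := fun p =>
  ⟨u.neg_im_lt_ofReal _ p, fun h => u.prevAbscissa_gt h, fun h => u.prevAbscissa_lt h⟩

theorem rightAbscissa_mem (m : Fin P) :
    (u.rightAbscissa m : ℂ) ∈ u.halfStrip (· ≤ m) (m < ·) := fun p =>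
  ⟨u.neg_im_lt_ofReal _ p, fun h => u.rightAbscissa_gt h, fun h => u.rightAbscissa_lt h⟩

theorem left_or_right {m : Fin P} {w : ℂ} (hw : w ∈ u.strip m) (hg : u.Generic w) :
    w ∈ u.halfStrip (· < m) (m ≤ ·) ∨ w ∈ u.halfStrip (· ≤ m) (m < ·) := by
  rcases (hg m).lt_or_gt with h | h
  · left
    exact fun p => ⟨(hw p).1, (hw p).2.1, fun hp => h.trans_le (u.re_le_re hp)⟩
  · right
    exact fun p => ⟨(hw p).1, fun hp => (u.re_le_re hp).trans_lt h, (hw p).2.2⟩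

theorem left_subset_strip (m : Fin P) : u.halfStrip (· < m) (m ≤ ·) ⊆ u.strip m :=
  fun _ hw p => ⟨(hw p).1, (hw p).2.1, fun h => (hw p).2.2 (le_of_lt h)⟩

theorem right_subset_strip (m : Fin P) : u.halfStrip (· ≤ m) (m < ·) ⊆ u.strip m :=
  fun _ hw p => ⟨(hw p).1, fun h => (hw p).2.1 (le_of_lt h), (hw p).2.2⟩

theorem mem_strip_of_re_eq {m : Fin P} {w : ℂ} (hw : ∀ p, -(u.z p).im < w.im)
    (h : w.re = (u.z m).re) : w ∈ u.strip m := fun p =>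
  ⟨hw p, fun hp => h ▸ u.re_lt_re hp, fun hp => h ▸ u.re_lt_re hp⟩

theorem strip_re_ne {m p : Fin P} (hp : p ≠ m) {w : ℂ} (hw : w ∈ u.strip m) :
    w.re ≠ (u.z p).re := by
  rcases lt_or_gt_of_ne hp with h | h
  · exact ((hw p).2.1 h).ne'
  · exact ((hw p).2.2 h).ne

/-- The integral from `i∞` to `i∞` around the cut above `z m`. -/
noncomputable def integralAround (m : Fin P) (g : ℂ → ℂ) : ℂ :=
  upwardRay g (u.prevAbscissa m) + (∫ x in (u.prevAbscissa m)..(u.rightAbscissa m), g (x : ℂ)) -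
    upwardRay g (u.rightAbscissa m)

/-- Below the pole there is no cut, so the integrand has a primitive across the vertical line, from
which the ray integrals differ by a constant on each side. The two constants, weighted with `v`,
agree exactly when the weighted integral around the cut vanishes. -/
theorem extendsNear_below {eps : ℝ} (heps : 0 < eps) {lam : ℂ} (hlam : lam.re < 0)
    {v : Fin P → ℂ} {m : Fin P} (hd : ∑ p, v p * u.integralAround m (u.kern eps lam p) = 0)
    {z₀ : ℂ} (hz₀ : ∀ p, -(u.z p).im < z₀.im) (hre : z₀.re = (u.z m).re)
    (him : z₀.im < (u.z m).im) : u.ExtendsNear eps lam v z₀ := by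
  set B : Set ℂ := u.strip m ∩ {w | w.im < (u.z m).im} with hB
  have hBc : Convex ℝ B := (u.convex_halfStrip _ _).inter (convex_halfSpace_im_lt _)
  have hBo : IsOpen B := (u.isOpen_halfStrip _ _).inter
    (isOpen_lt Complex.continuous_im continuous_const)
  have hcut : ∀ w ∈ B, ∀ p, w.im < (u.z p).im ∨ w.re ≠ (u.z p).re := fun w hw p => by
    by_cases hp : p = m
    · rw [hp]; exact Or.inl hw.2
    · exact Or.inr (u.strip_re_ne hp hw.1)
  have hex : ∀ p, ∃ Γ : ℂ → ℂ, ∀ z ∈ B, HasDerivAt Γ (u.kern eps lam p z) z := fun p =>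
    hasDerivAt_of_convex_primitive hBc hBo fun w hw =>
      (u.differentiableAt_kern (fun p => (hw.1 p).1) (hcut w hw) eps lam p).differentiableWithinAt
  choose Γ hΓ using hex
  have hprev : (u.prevAbscissa m : ℂ) ∈ B :=
    ⟨u.left_subset_strip m (u.prevAbscissa_mem m), u.ofReal_im_lt _ _⟩
  have hright : (u.rightAbscissa m : ℂ) ∈ B :=
    ⟨u.right_subset_strip m (u.rightAbscissa_mem m), u.ofReal_im_lt _ _⟩
  have hFTC : ∀ p, (∫ x in (u.prevAbscissa m)..(u.rightAbscissa m), u.kern eps lam p (x : ℂ)) =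
      Γ p (u.rightAbscissa m) - Γ p (u.prevAbscissa m) := fun p => by
    have hmem : ∀ x ∈ Set.uIcc (u.prevAbscissa m) (u.rightAbscissa m), (x : ℂ) ∈ B := fun x hx => by
      have := (hBc.linear_preimage Complex.ofRealCLM.toLinearMap).ordConnected.uIcc_subset
        (x := u.prevAbscissa m) (y := u.rightAbscissa m) hprev hright hx
      exact this
    refine intervalIntegral.integral_eq_sub_of_hasDerivAt (f := fun x : ℝ => Γ p x) (fun x hx => ?_) ?_
    · exact (hΓ p x (hmem x hx)).comp_ofReal
    · refine ContinuousOn.intervalIntegrable fun x hx => ?_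
      exact ((u.differentiableAt_kern (fun p => ((hmem x hx).1 p).1) (hcut _ (hmem x hx)) eps lam
        p).continuousAt.comp Complex.continuous_ofReal.continuousAt).continuousWithinAt
  have hL : ∀ w ∈ B ∩ u.halfStrip (· < m) (m ≤ ·), ∀ p,
      upwardRay (u.kern eps lam p) w - Γ p w =
        upwardRay (u.kern eps lam p) (u.prevAbscissa m) - Γ p (u.prevAbscissa m) := fun w hw p =>
    eq_of_hasDerivAt_convex (hBc.inter (u.convex_halfStrip _ _)) (hBo.inter (u.isOpen_halfStrip _ _))
      (fun z hz => u.hasDerivAt_upwardRay_kern heps hlam (fun p => lt_or_ge p m) hz.2 p)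
      (fun z hz => hΓ p z hz.1) hw ⟨hprev, u.prevAbscissa_mem m⟩
  have hR : ∀ w ∈ B ∩ u.halfStrip (· ≤ m) (m < ·), ∀ p,
      upwardRay (u.kern eps lam p) w - Γ p w =
        upwardRay (u.kern eps lam p) (u.rightAbscissa m) - Γ p (u.rightAbscissa m) := fun w hw p =>
    eq_of_hasDerivAt_convex (hBc.inter (u.convex_halfStrip _ _)) (hBo.inter (u.isOpen_halfStrip _ _))
      (fun z hz => u.hasDerivAt_upwardRay_kern heps hlam (fun p => le_or_gt p m) hz.2 p)
      (fun z hz => hΓ p z hz.1) hw ⟨hright, u.rightAbscissa_mem m⟩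
  set Cst : ℂ := ∑ p, v p * (upwardRay (u.kern eps lam p) (u.prevAbscissa m) -
    Γ p (u.prevAbscissa m)) with hCst
  have hCst' : Cst = ∑ p, v p * (upwardRay (u.kern eps lam p) (u.rightAbscissa m) -
      Γ p (u.rightAbscissa m)) := by
    have : Cst - ∑ p, v p * (upwardRay (u.kern eps lam p) (u.rightAbscissa m) -
        Γ p (u.rightAbscissa m)) = ∑ p, v p * u.integralAround m (u.kern eps lam p) := by
      rw [hCst, ← Finset.sum_sub_distrib]
      refine Finset.sum_congr rfl fun p _ => ?_
      rw [integralAround, hFTC p]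
      ring
    rw [hd] at this
    exact sub_eq_zero.1 this
  refine ⟨fun w => ((∑ p, v p * Γ p w) + Cst) / u.expH eps lam w, ?_⟩
  filter_upwards [hBo.mem_nhds (⟨u.mem_strip_of_re_eq hz₀ hre, him⟩ : z₀ ∈ B)] with w hw
  refine ⟨solvesAt_div (u.hasDerivAt_expH (fun p => (hw.1 p).1) (hcut w hw) eps lam) ?_
    (u.expH_ne_zero _ _ _), fun hg => ?_⟩
  · exact (HasDerivAt.fun_sum fun p _ => (hΓ p w hw).const_mul (v p)).add_const _
  · rw [raySol]
    congr 1
    rw [← sub_eq_iff_eq_add', ← Finset.sum_sub_distrib]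
    simp_rw [← mul_sub]
    rcases u.left_or_right hw.1 hg with h | h
    · exact Finset.sum_congr rfl fun p _ => by rw [hL w ⟨hw, h⟩ p]
    · rw [hCst']
      exact Finset.sum_congr rfl fun p _ => by rw [hR w ⟨hw, h⟩ p]

/-- `f` with the cut of its part singular at `z m` turned downwards. -/
noncomputable def fDown (m : Fin P) (w : ℂ) : ℂ :=
  u.regPart m w + u.c m * Complex.log (-Complex.I * (w - u.z m))

theorem hasDerivAt_fDown {m : Fin P} {w : ℂ} (hw : w ∈ u.strip m) (him : (u.z m).im < w.im) :
    HasDerivAt (u.fDown m) (u.u0C w) w := by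
  refine ((u.hasDerivAt_regPart (fun p => (hw p).1) fun p hp => Or.inr (u.strip_re_ne hp hw)).add
    ((hasDerivAt_log_neg_I_mul (Or.inl him)).const_mul (u.c m))).congr_deriv ?_
  rw [u.u0C_eq_add m]
  ring

theorem exists_norm_fDown_le (m : Fin P) : ∃ M > 0, ∀ w, u.bigRadius ≤ ‖w‖ → ‖u.fDown m w‖ ≤ M := by
  obtain ⟨M, hM, hf⟩ := u.exists_norm_f_le
  have hpi := Real.pi_pos
  refine ⟨M + ‖u.c m‖ * (3 * Real.pi), by positivity, fun w hw => ?_⟩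
  have h1 : u.fDown m w = u.f w + u.c m * (((Complex.arg (-Complex.I * (w - u.z m)) -
      Complex.arg (Complex.I * (w - u.z m)) - Real.pi / 2 : ℝ) : ℂ) * Complex.I) := by
    rw [fDown, regPart, logPart, Complex.log, Complex.log, norm_mul, norm_mul, norm_neg]
    push_cast
    ring
  rw [h1]
  refine (norm_add_le _ _).trans (add_le_add (hf w hw) ?_)
  rw [norm_mul, norm_mul, Complex.norm_I, mul_one, Complex.norm_real, Real.norm_eq_abs]
  gcongr
  have h2 := abs_le.1 (Complex.abs_arg_le_pi (-Complex.I * (w - u.z m)))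
  have h3 := abs_le.1 (Complex.abs_arg_le_pi (Complex.I * (w - u.z m)))
  rw [abs_le]
  constructor <;> linarith

/-- Above the pole no condition on `v` is needed. Turning the cut of the `m`-th logarithm downwards
changes `f` by a constant on each side of the line. The exponential then changes by a constant
factor, which cancels in the quotient defining the ray solution. -/
theorem extendsNear_above {eps : ℝ} (heps : 0 < eps) {lam : ℂ} (hlam : lam.re < 0)
    {v : Fin P → ℂ} {m : Fin P} {z₀ : ℂ} (hz₀ : ∀ p, -(u.z p).im < z₀.im)
    (hre : z₀.re = (u.z m).re) (him : (u.z m).im < z₀.im) : u.ExtendsNear eps lam v z₀ := by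
  set B : Set ℂ := u.strip m ∩ {w | (u.z m).im < w.im} with hB
  have hBc : Convex ℝ B := (u.convex_halfStrip _ _).inter (convex_halfSpace_im_gt _)
  have hBo : IsOpen B := (u.isOpen_halfStrip _ _).inter
    (isOpen_lt continuous_const Complex.continuous_im)
  have hBup : ∀ z ∈ B, ∀ y : ℝ, 0 ≤ y → z + Complex.I * y ∈ B := fun z hz y hy =>
    ⟨u.upward_halfStrip _ _ z hz.1 y hy, by
      rw [Set.mem_ofPred_eq, add_I_mul_im]; linarith [Set.mem_ofPred_eq ▸ hz.2]⟩
  obtain ⟨M, hM, hfD⟩ := u.exists_norm_fDown_le m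
  set E : ℂ → ℂ := fun w => Complex.exp (-Complex.I * (lam * w + u.fDown m w) / eps) with hE
  have hEd : ∀ w ∈ B, HasDerivAt E (-Complex.I / eps * (lam + u.u0C w) * E w) w := fun w hw =>
    hasDerivAt_exp_phase eps lam (u.hasDerivAt_fDown hw.1 hw.2)
  have hne : ∀ w ∈ B, ∀ p, w - u.z p ≠ 0 := fun w hw p h0 => by
    have h1 : w = u.z p := sub_eq_zero.1 h0
    by_cases hp : p = m
    · have := Set.mem_ofPred_eq ▸ hw.2
      rw [h1, hp] at this
      exact lt_irrefl _ this
    · exact u.strip_re_ne hp hw.1 (by rw [h1])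
  have hU : ∀ w ∈ B, ∀ p, HasDerivAt (upwardRay fun w => E w / (w - u.z p)) (E w / (w - u.z p)) w :=
    fun w hw p => hasDerivAt_upwardRay_of_decay hBc hBo hBup (fun z hz =>
      ((hEd z hz).differentiableAt.div (by fun_prop) (hne z hz p)).differentiableWithinAt) heps hlam
      ⟨u.bigRadius, _, fun z _ hz => u.exists_norm_exp_div_le heps lam hfD p z (le_norm_of_le_im hz)⟩
      hw
  refine ⟨fun w => (∑ p, v p * upwardRay (fun w => E w / (w - u.z p)) w) / E w, ?_⟩
  filter_upwards [hBo.mem_nhds (⟨u.mem_strip_of_re_eq hz₀ hre, him⟩ : z₀ ∈ B)] with w hw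
  refine ⟨solvesAt_div (hEd w hw) (HasDerivAt.fun_sum fun p _ => (hU w hw p).const_mul (v p))
    (Complex.exp_ne_zero _), fun hg => ?_⟩
  obtain ⟨κ, hκ⟩ : ∃ κ : ℂ, ∀ y : ℝ, 0 ≤ y →
      u.fDown m (w + Complex.I * y) = u.f (w + Complex.I * y) + κ := by
    obtain ⟨l, r, hlr, hwlr⟩ : ∃ l r : Fin P → Prop, (∀ p, l p ∨ r p) ∧ w ∈ u.halfStrip l r := by
      rcases u.left_or_right hw.1 hg with h | h
      · exact ⟨_, _, fun p => lt_or_ge p m, h⟩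
      · exact ⟨_, _, fun p => le_or_gt p m, h⟩
    refine ⟨u.fDown m w - u.f w, fun y hy => ?_⟩
    have := eq_of_hasDerivAt_convex (hBc.inter (u.convex_halfStrip l r))
      (hBo.inter (u.isOpen_halfStrip l r)) (f := u.fDown m) (g := u.f) (h := u.u0C)
      (fun z hz => u.hasDerivAt_fDown hz.1.1 hz.1.2)
      (fun z hz => (u.generic_of_halfStrip hlr hz.2).hasDerivAt_f fun p => (hz.2 p).1)
      (z := w + Complex.I * y) (w := w) ⟨hBup w hw y hy, u.upward_halfStrip l r w hwlr y hy⟩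
      ⟨hw, hwlr⟩
    rw [← this]; ring
  have hEκ : ∀ y : ℝ, 0 ≤ y → E (w + Complex.I * y) =
      Complex.exp (-Complex.I * κ / eps) * u.expH eps lam (w + Complex.I * y) := fun y hy => by
    simp only [hE, expH, hκ y hy, ← Complex.exp_add]
    congr 1
    ring
  have hUκ : ∀ p, upwardRay (fun w => E w / (w - u.z p)) w =
      Complex.exp (-Complex.I * κ / eps) * upwardRay (u.kern eps lam p) w := fun p => by
    rw [upwardRay, upwardRay, mul_neg, ← MeasureTheory.integral_const_mul]
    congr 1
    refine MeasureTheory.setIntegral_congr_fun measurableSet_Ioi fun y hy => ?_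
    simp only [hEκ y (le_of_lt hy), kern]
    ring
  have hE0 := hEκ 0 le_rfl
  rw [Complex.ofReal_zero, mul_zero, add_zero] at hE0
  simp only [raySol, hUκ, hE0]
  have h1 : ∑ p, v p * (Complex.exp (-Complex.I * κ / eps) * upwardRay (u.kern eps lam p) w) =
      Complex.exp (-Complex.I * κ / eps) * ∑ p, v p * upwardRay (u.kern eps lam p) w := by
    rw [Finset.mul_sum]
    exact Finset.sum_congr rfl fun p _ => by ring
  rw [h1, mul_div_mul_left _ _ (Complex.exp_ne_zero _)]

end RationalPotential

/-! ### Solutions near the poles, which are regular singular points. -/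

namespace RationalPotential

variable {P : ℕ} (u : RationalPotential P)

theorem tendsto_sub_self (z : ℂ) : Tendsto (fun w => w - z) (𝓝[≠] z) (𝓝 0) := by
  have : Tendsto (fun w => w - z) (𝓝 z) (𝓝 (z - z)) := tendsto_id.sub_const z
  rw [sub_self] at this
  exact this.mono_left nhdsWithin_le_nhds

theorem tendsto_sub_mul_u0C (lam : ℂ) (m : Fin P) :
    Tendsto (fun w => (w - u.z m) * (lam + u.u0C w)) (𝓝[≠] (u.z m)) (𝓝 (u.c m)) := by
  set g : ℂ → ℂ := fun w => lam + ∑ p, ((if p = m then 0 else u.c p / (w - u.z p)) +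
    conj (u.c p) / (w - conj (u.z p))) with hg
  have hc : ContinuousAt g (u.z m) := by
    refine continuousAt_const.add (tendsto_finsetSum _ fun p _ => ?_)
    refine ContinuousAt.add ?_ ?_
    · by_cases hp : p = m
      · simpa [hp] using continuousAt_const
      · simp only [hp, if_false]
        refine continuousAt_const.div (by fun_prop) (sub_ne_zero.2 fun h => hp (u.z_injective h.symm))
    · refine continuousAt_const.div (by fun_prop) (sub_ne_zero.2 fun h => ?_)
      have h1 := congrArg Complex.im h
      linarith [u.conj_z_im p, u.z_im_pos m]
  have h1 : Tendsto (fun w => u.c m + (w - u.z m) * g w) (𝓝[≠] (u.z m))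
      (𝓝 (u.c m + 0 * g (u.z m))) :=
    ((tendsto_sub_self _).mul (hc.tendsto.mono_left nhdsWithin_le_nhds)).const_add _
  rw [zero_mul, add_zero] at h1
  refine h1.congr' ?_
  filter_upwards [self_mem_nhdsWithin] with w hw
  have hw' : w - u.z m ≠ 0 := sub_ne_zero.2 hw
  rw [u.u0C_eq_add m, hg]
  field_simp
  ring

theorem tendsto_sub_mul_source (v : Fin P → ℂ) (m : Fin P) :
    Tendsto (fun w => (w - u.z m) * u.source v w) (𝓝[≠] (u.z m)) (𝓝 (v m)) := by
  set g : ℂ → ℂ := fun w => ∑ p, (if p = m then 0 else v p / (w - u.z p)) with hg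
  have hc : ContinuousAt g (u.z m) := by
    refine tendsto_finsetSum _ fun p _ => ?_
    by_cases hp : p = m
    · simp [hp]
    · simp only [hp, if_false]
      exact tendsto_const_nhds.div (tendsto_id.sub_const _)
        (sub_ne_zero.2 fun h => hp (u.z_injective h.symm))
  have h1 : Tendsto (fun w => v m + (w - u.z m) * g w) (𝓝[≠] (u.z m))
      (𝓝 (v m + 0 * g (u.z m))) :=
    ((tendsto_sub_self _).mul (hc.tendsto.mono_left nhdsWithin_le_nhds)).const_add _
  rw [zero_mul, add_zero] at h1
  refine h1.congr' ?_
  filter_upwards [self_mem_nhdsWithin] with w hw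
  have hw' : w - u.z m ≠ 0 := sub_ne_zero.2 hw
  rw [source, sum_eq_add_sum_ite m, hg]
  field_simp

theorem exists_removable {z : ℂ} {H : ℂ → ℂ} (hd : ∀ᶠ w in 𝓝[≠] z, DifferentiableAt ℂ H w)
    {C : ℝ} (hb : ∀ᶠ w in 𝓝[≠] z, ‖H w‖ ≤ C) :
    ∃ G : ℂ → ℂ, AnalyticAt ℂ G z ∧ ∀ w, w ≠ z → G w = H w := by
  obtain ⟨s, hs, hsub⟩ := mem_nhdsWithin_iff_exists_mem_nhds_inter.1 (hd.and hb)
  refine ⟨Function.update H z (limUnder (𝓝[≠] z) H), ?_, fun w hw => Function.update_of_ne hw _ _⟩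
  refine DifferentiableOn.analyticAt (s := s) ?_ hs
  refine Complex.differentiableOn_update_limUnder_of_bddAbove hs ?_ ?_
  · exact fun w hw => (hsub ⟨hw.1, hw.2⟩).1.differentiableWithinAt
  · refine ⟨C, ?_⟩
    rintro _ ⟨w, hw, rfl⟩
    exact (hsub ⟨hw.1, hw.2⟩).2

/-- A solution near the regular singular point `z m` of polynomial growth is bounded unless the
exponent is resonant. -/
theorem bounded_of_pow_mul_bounded {eps : ℝ} {lam : ℂ} {v : Fin P → ℂ} {m : Fin P} {Φ : ℂ → ℂ}
    (hΦ : ∀ᶠ w in 𝓝[≠] (u.z m), u.SolvesAt eps lam v Φ w) (N : ℕ)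
    (hN : ∀ j : ℕ, 0 < j → j ≤ N → Complex.I * u.c m / eps ≠ -(j : ℂ))
    (hb : ∃ C : ℝ, ∀ᶠ w in 𝓝[≠] (u.z m), ‖(w - u.z m) ^ N * Φ w‖ ≤ C) :
    ∃ C : ℝ, ∀ᶠ w in 𝓝[≠] (u.z m), ‖Φ w‖ ≤ C := by
  induction N with
  | zero => simpa using hb
  | succ N ih =>
    refine ih (fun j h1 h2 => hN j h1 (by omega)) ?_
    obtain ⟨C, hC⟩ := hb
    obtain ⟨G, hGa, hG⟩ := exists_removable (H := fun w => (w - u.z m) ^ (N + 1) * Φ w)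
      (by
        filter_upwards [hΦ] with w hw
        exact DifferentiableAt.mul (by fun_prop) hw.differentiableAt) hC
    -- The equation for `G = (w - z m) ^ (N + 1) Φ`, multiplied by `w - z m` so that all
    -- coefficients have limits at the pole.
    have hODE : ∀ᶠ w in 𝓝[≠] (u.z m), (w - u.z m) * deriv G w = (N + 1) * G w +
        Complex.I / eps * ((w - u.z m) * (lam + u.u0C w)) * G w +
          (w - u.z m) ^ (N + 1) * ((w - u.z m) * u.source v w) := by
      filter_upwards [hΦ, self_mem_nhdsWithin] with w hw hne
      have hGw : G =ᶠ[𝓝 w] fun w => (w - u.z m) ^ (N + 1) * Φ w := by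
        filter_upwards [isOpen_ne.mem_nhds hne] with x hx using hG x hx
      have h1 : HasDerivAt (fun w : ℂ => w - u.z m) 1 w := (hasDerivAt_id w).sub_const _
      have h2 := ((h1.pow (N + 1)).mul hw).congr_of_eventuallyEq hGw
      have hne' : w - u.z m ≠ 0 := sub_ne_zero.2 hne
      rw [h2.deriv, hG w hne]
      simp only [Nat.add_sub_cancel, Pi.pow_apply]
      push_cast
      ring
    have hlim1 : Tendsto (fun w => (w - u.z m) * deriv G w) (𝓝[≠] (u.z m))
        (𝓝 (0 * deriv G (u.z m))) :=
      (tendsto_sub_self _).mul (hGa.deriv.continuousAt.tendsto.mono_left nhdsWithin_le_nhds)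
    have hGt : Tendsto G (𝓝[≠] (u.z m)) (𝓝 (G (u.z m))) :=
      hGa.continuousAt.tendsto.mono_left nhdsWithin_le_nhds
    have hlim2 := ((hGt.const_mul ((N : ℂ) + 1)).add
      (((u.tendsto_sub_mul_u0C lam m).const_mul (Complex.I / eps)).mul hGt)).add
      (((tendsto_sub_self (u.z m)).pow (N + 1)).mul (u.tendsto_sub_mul_source v m))
    -- In the limit `(i c_m / ε + N + 1) G(z m) = 0`. Without resonance `G` vanishes at the pole,
    -- and one power of `w - z m` can be dropped.
    have heq := tendsto_nhds_unique (hlim1.congr' hODE) hlim2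
    have hG0 : G (u.z m) = 0 := by
      have h3 : (Complex.I * u.c m / eps + ((N + 1 : ℕ) : ℂ)) * G (u.z m) = 0 := by
        push_cast
        rw [zero_mul, zero_pow (by omega), zero_mul, add_zero] at heq
        linear_combination -heq
      rcases mul_eq_zero.1 h3 with h | h
      · exact absurd (eq_neg_of_add_eq_zero_left h) (hN (N + 1) (by omega) le_rfl)
      · exact h
    have hds : ContinuousAt (dslope G (u.z m)) (u.z m) :=
      continuousAt_dslope_same.2 hGa.differentiableAt
    refine ⟨‖dslope G (u.z m) (u.z m)‖ + 1, ?_⟩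
    have hev : ∀ᶠ w in 𝓝 (u.z m), ‖dslope G (u.z m) w‖ < ‖dslope G (u.z m) (u.z m)‖ + 1 :=
      hds.norm.eventually_lt continuousAt_const (by simp)
    filter_upwards [nhdsWithin_le_nhds hev, self_mem_nhdsWithin] with w hw hne
    have hne' : w - u.z m ≠ 0 := sub_ne_zero.2 hne
    have : dslope G (u.z m) w = (w - u.z m) ^ N * Φ w := by
      rw [dslope_of_ne _ hne, slope_def_field, hG w hne, hG0, pow_succ]
      field_simp
      ring
    rw [← this]
    exact hw.le

/-- Solutions near the regular singular point `z m` have polynomial growth. -/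
theorem exists_pow_mul_bounded {eps : ℝ} {lam : ℂ} {v : Fin P → ℂ} {m : Fin P} {Φ : ℂ → ℂ}
    (hΦ : ∀ᶠ w in 𝓝[≠] (u.z m), u.SolvesAt eps lam v Φ w) :
    ∃ N : ℕ, ∃ C : ℝ, ∀ᶠ w in 𝓝[≠] (u.z m), ‖(w - u.z m) ^ N * Φ w‖ ≤ C := by
  set z := u.z m with hz
  have h1 := ((u.tendsto_sub_mul_u0C lam m).const_mul (Complex.I / eps)).norm
  set K₁ := ‖Complex.I / eps * u.c m‖ + ‖v m‖ + 1 with hK₁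
  have hK0 : 0 < K₁ := by positivity
  have h2 : ∀ᶠ w in 𝓝[≠] z, ‖Complex.I / eps * ((w - z) * (lam + u.u0C w))‖ < K₁ :=
    h1.eventually_lt_const (by rw [hK₁]; linarith [norm_nonneg (v m)])
  have h3 : ∀ᶠ w in 𝓝[≠] z, ‖(w - z) * u.source v w‖ < K₁ :=
    (u.tendsto_sub_mul_source v m).norm.eventually_lt_const
      (by rw [hK₁]; linarith [norm_nonneg (Complex.I / eps * u.c m)])
  obtain ⟨r, hr, hsub⟩ := Metric.mem_nhdsWithin_iff.1 (hΦ.and (h2.and h3))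
  set r₀ := r / 2 with hr₀
  have hr₀0 : 0 < r₀ := by positivity
  have hpt : ∀ w, w ≠ z → ‖w - z‖ ≤ r₀ → u.SolvesAt eps lam v Φ w ∧
      ‖Complex.I / eps * ((w - z) * (lam + u.u0C w))‖ < K₁ ∧ ‖(w - z) * u.source v w‖ < K₁ := by
    intro w hw hwr
    refine hsub ⟨?_, hw⟩
    rw [Metric.mem_ball, dist_eq_norm]
    linarith
  obtain ⟨M₀, hM₀⟩ := (isCompact_sphere z r₀).exists_bound_of_continuousOn (f := Φ)
    (fun w hw => by
      have hw' : ‖w - z‖ = r₀ := by rw [← dist_eq_norm]; exact hw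
      exact (hpt w (fun h => by rw [h, sub_self, norm_zero] at hw'; linarith)
        hw'.le).1.continuousAt.continuousWithinAt)
  refine ⟨⌈K₁⌉₊, (|M₀| + 1) * r₀ ^ ⌈K₁⌉₊, ?_⟩
  rw [eventually_nhdsWithin_iff, Metric.eventually_nhds_iff]
  refine ⟨r₀, hr₀0, fun w hw hne => ?_⟩
  rw [dist_eq_norm] at hw
  have hne' : w - z ≠ 0 := sub_ne_zero.2 hne
  have hn0 : 0 < ‖w - z‖ := norm_pos_iff.2 hne'
  set T := Real.log (r₀ / ‖w - z‖) with hT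
  have hT0 : 0 ≤ T := Real.log_nonneg (by rw [le_div_iff₀ hn0]; linarith)
  have hexpT : Real.exp T = r₀ / ‖w - z‖ := Real.exp_log (by positivity)
  set d : ℂ := Real.exp T * (w - z) with hd
  have hdn : ‖d‖ = r₀ := by
    rw [hd, norm_mul, Complex.norm_real, Real.norm_eq_abs, abs_of_pos (Real.exp_pos _), hexpT]
    field_simp
  have hd0 : d ≠ 0 := norm_pos_iff.1 (by rw [hdn]; exact hr₀0)
  -- The radial path towards the pole in logarithmic time: `c' = -(c - z)` cancels the simple poles
  -- of the coefficients. Grönwall's inequality then gives growth `exp (K₁ τ)`, a power of `1 / ‖w -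
  -- z‖`.
  set c : ℝ → ℂ := fun τ => z + (Real.exp (-τ) : ℝ) * d with hc
  have hcz : ∀ τ, c τ - z = (Real.exp (-τ) : ℝ) * d := fun τ => by simp [hc]
  have hcne : ∀ τ, c τ ≠ z := fun τ h => by
    have := hcz τ
    rw [h, sub_self] at this
    rcases mul_eq_zero.1 this.symm with h | h
    · exact (Real.exp_pos (-τ)).ne' (by exact_mod_cast h)
    · exact hd0 h
  have hcle : ∀ τ, 0 ≤ τ → ‖c τ - z‖ ≤ r₀ := fun τ hτ => by
    rw [hcz, norm_mul, hdn, Complex.norm_real, Real.norm_eq_abs, abs_of_pos (Real.exp_pos _)]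
    exact mul_le_of_le_one_left hr₀0.le (Real.exp_le_one_iff.2 (by linarith))
  have hcd : ∀ τ, HasDerivAt c (-(c τ - z)) τ := fun τ => by
    have h1 : HasDerivAt (fun τ : ℝ => Real.exp (-τ)) (-Real.exp (-τ)) τ := by
      simpa using (hasDerivAt_neg τ).exp
    have h2 := ((h1.ofReal_comp).mul_const d).const_add z
    refine h2.congr_deriv ?_
    rw [hcz]
    push_cast
    ring
  have hψ : ∀ τ, 0 ≤ τ → HasDerivAt (fun τ => Φ (c τ))
      ((Complex.I / eps * (lam + u.u0C (c τ)) * Φ (c τ) + u.source v (c τ)) * (-(c τ - z))) τ :=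
    fun τ hτ => (hpt _ (hcne τ) (hcle τ hτ)).1.comp τ (hcd τ)
  have key := norm_le_gronwallBound_of_norm_deriv_right_le (f := fun τ => Φ (c τ))
    (δ := |M₀|) (K := K₁) (ε := K₁) (a := 0) (b := T)
    (fun τ hτ => (hψ τ hτ.1).continuousAt.continuousWithinAt)
    (fun τ hτ => (hψ τ hτ.1).hasDerivWithinAt)
    ((hM₀ _ (by
      rw [mem_sphere_iff_norm, hcz, neg_zero, Real.exp_zero, Complex.ofReal_one, one_mul,
        hdn])).trans (le_abs_self _)) ?_ T ⟨hT0, le_rfl⟩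
  · have hcT : c T = w := by
      rw [hc, hd]
      simp only
      rw [← mul_assoc, ← Complex.ofReal_mul, ← Real.exp_add, neg_add_cancel, Real.exp_zero]
      simp
    simp only [hcT] at key
    rw [sub_zero, gronwallBound_of_K_ne_0 hK0.ne', div_self hK0.ne'] at key
    simp only [one_mul] at key
    have hle : Real.exp (K₁ * T) ≤ (r₀ / ‖w - z‖) ^ ⌈K₁⌉₊ := by
      rw [← hexpT, ← Real.exp_nat_mul]
      exact Real.exp_le_exp.2 (mul_le_mul_of_nonneg_right (Nat.le_ceil _) hT0)
    rw [norm_mul, norm_pow]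
    calc ‖w - z‖ ^ ⌈K₁⌉₊ * ‖Φ w‖ ≤ ‖w - z‖ ^ ⌈K₁⌉₊ * ((|M₀| + 1) * (r₀ / ‖w - z‖) ^ ⌈K₁⌉₊) := by
          gcongr
          nlinarith [abs_nonneg M₀, Real.exp_pos (K₁ * T)]
      _ = _ := by rw [div_pow]; field_simp
  · intro τ hτ
    obtain ⟨-, b1, b2⟩ := hpt _ (hcne τ) (hcle τ hτ.1)
    have : (Complex.I / eps * (lam + u.u0C (c τ)) * Φ (c τ) + u.source v (c τ)) * (-(c τ - z)) =
        -(Complex.I / eps * ((c τ - z) * (lam + u.u0C (c τ))) * Φ (c τ)) -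
          (c τ - z) * u.source v (c τ) := by ring
    rw [this]
    refine (norm_sub_le _ _).trans (add_le_add ?_ b2.le)
    rw [norm_neg, norm_mul]
    gcongr

/-! ### Consequences of a vector in the kernel of the Evans matrix -/

theorem continuous_kern_ofReal (eps : ℝ) (lam : ℂ) (p : Fin P) :
    Continuous fun x : ℝ => u.kern eps lam p x :=
  continuous_iff_continuousAt.2 fun x => (u.differentiableAt_kern (fun p => u.neg_im_lt_ofReal x p)
    (fun p => Or.inl (u.ofReal_im_lt x p)) eps lam p).continuousAt.comp
      Complex.continuous_ofReal.continuousAt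

/-- The integral over the contour to the left of the cut above `z m`. -/
noncomputable def integralBefore (m : Fin P) (g : ℂ → ℂ) : ℂ :=
  upwardRay g (u.leftAbscissa m) + (∫ x in (u.leftAbscissa m)..(u.prevAbscissa m), g (x : ℂ)) -
    upwardRay g (u.prevAbscissa m)

theorem integralU_eq (m : Fin P) (eps : ℝ) (lam : ℂ) (p : Fin P) :
    u.integralU m (u.kern eps lam p) = u.integralBefore m (u.kern eps lam p) +
      u.integralAround m (u.kern eps lam p) := by
  have h := u.continuous_kern_ofReal eps lam p
  rw [integralBefore, integralAround, integralU, ← intervalIntegral.integral_add_adjacent_intervals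
    (h.intervalIntegrable _ (u.prevAbscissa m)) (h.intervalIntegrable _ _)]
  simp only [descendingRay, upwardRay]
  ring

theorem integralBefore_zero {m : Fin P} (hm : m.val = 0) (g : ℂ → ℂ) : u.integralBefore m g = 0 := by
  rw [integralBefore, prevAbscissa, if_pos hm]
  simp

theorem integralBefore_succ {m k : Fin P} (hm : m.val = k.val + 1) (g : ℂ → ℂ) :
    u.integralBefore m g = u.integralU k g := by
  have h1 : u.prevAbscissa m = u.rightAbscissa k := by
    rw [prevAbscissa, if_neg (by omega)]
    congr 1
    ext
    simp [hm]
  rw [integralBefore, h1]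
  rfl

/-- The resonance condition under which the contour `C_m` ends at `z m`. -/
def Resonant (eps : ℝ) (m : Fin P) (n : ℕ) : Prop := 0 < n ∧ Complex.I * u.c m / eps = -(n : ℂ)

/-- The regular factor of `exp(-ih/ε)` at a resonant pole. -/
noncomputable def regExp (eps : ℝ) (lam : ℂ) (m : Fin P) (n : ℕ) (w : ℂ) : ℂ :=
  Complex.exp (-Complex.I * (lam * w + u.regPart m w) / eps) *
    (Complex.exp (n * (Real.pi * Complex.I / 2)) * Complex.I ^ n)

/-- The analytic continuation of the integrand through a resonant pole. -/
noncomputable def regKern (eps : ℝ) (lam : ℂ) (m : Fin P) (n : ℕ) (p : Fin P) (w : ℂ) : ℂ :=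
  if p = m then u.regExp eps lam m n w * (w - u.z m) ^ (n - 1)
  else u.regExp eps lam m n w * (w - u.z m) ^ n / (w - u.z p)

-- At resonance `exp(-i c_m log / ε) = exp(n log)` is an honest power: the cut above `z m`
-- disappears, and since `n` is positive the integrand is regular at `z m` even after division by `w
-- - z m`.
variable {u} in
theorem Resonant.expH_eq {eps : ℝ} {m : Fin P} {n : ℕ} (h : u.Resonant eps m n) (lam : ℂ) {w : ℂ}
    (hw : w ≠ u.z m) : u.expH eps lam w = u.regExp eps lam m n w * (w - u.z m) ^ n := by
  have h1 : -Complex.I * (lam * w + u.f w) / eps = -Complex.I * (lam * w + u.regPart m w) / eps +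
      (n * (Real.pi * Complex.I / 2) + n * Complex.log (Complex.I * (w - u.z m))) := by
    have : (n : ℂ) = -(Complex.I * u.c m / eps) := by rw [h.2, neg_neg]
    rw [this, regPart, logPart]
    ring
  have h2 : Complex.I * (w - u.z m) ≠ 0 := mul_ne_zero Complex.I_ne_zero (sub_ne_zero.2 hw)
  rw [expH, h1, Complex.exp_add, Complex.exp_add, Complex.exp_nat_mul (Complex.log _),
    Complex.exp_log h2, mul_pow, regExp]
  ring

variable {u} in
theorem Resonant.regKern_eq {eps : ℝ} {m : Fin P} {n : ℕ} (h : u.Resonant eps m n) (lam : ℂ)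
    (p : Fin P) {w : ℂ} (hw : w ≠ u.z m) : u.regKern eps lam m n p w = u.kern eps lam p w := by
  have hw' := sub_ne_zero.2 hw
  rw [kern, h.expH_eq lam hw, regKern]
  split_ifs with hp
  · rw [hp, ← Nat.succ_pred_eq_of_pos h.1, pow_succ]
    field_simp
    simp
  · rfl

theorem differentiableAt_regExp (eps : ℝ) (lam : ℂ) (m : Fin P) (n : ℕ) {w : ℂ}
    (hw : w ∈ u.strip m) : DifferentiableAt ℂ (u.regExp eps lam m n) w := by
  have h1 := (u.hasDerivAt_regPart (m := m) (fun p => (hw p).1)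
    fun p hp => Or.inr (u.strip_re_ne hp hw)).differentiableAt
  unfold regExp
  fun_prop

theorem regExp_ne_zero (eps : ℝ) (lam : ℂ) (m : Fin P) (n : ℕ) (w : ℂ) :
    u.regExp eps lam m n w ≠ 0 :=
  mul_ne_zero (Complex.exp_ne_zero _)
    (mul_ne_zero (Complex.exp_ne_zero _) (pow_ne_zero _ Complex.I_ne_zero))

theorem differentiableAt_regKern (eps : ℝ) (lam : ℂ) (m : Fin P) (n : ℕ) (p : Fin P) {w : ℂ}
    (hw : w ∈ u.strip m) : DifferentiableAt ℂ (u.regKern eps lam m n p) w := by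
  have h1 := u.differentiableAt_regExp eps lam m n hw
  by_cases hp : p = m
  · have : u.regKern eps lam m n p = fun w => u.regExp eps lam m n w * (w - u.z m) ^ (n - 1) :=
      funext fun w => if_pos hp
    rw [this]
    fun_prop
  · have : u.regKern eps lam m n p =
        fun w => u.regExp eps lam m n w * (w - u.z m) ^ n / (w - u.z p) := funext fun w => if_neg hp
    rw [this]
    refine DifferentiableAt.div (by fun_prop) (by fun_prop) (sub_ne_zero.2 fun h => ?_)
    exact u.strip_re_ne hp hw (by rw [h])

variable {u} in
theorem Resonant.hasDerivAt_upwardRay {eps : ℝ} (heps : 0 < eps) {lam : ℂ} (hlam : lam.re < 0)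
    {m : Fin P} {n : ℕ} (h : u.Resonant eps m n) (p : Fin P) {w : ℂ} (hw : w ∈ u.strip m) :
    HasDerivAt (upwardRay (u.regKern eps lam m n p)) (u.regKern eps lam m n p w) w := by
  obtain ⟨M, hM, hf⟩ := u.exists_norm_f_le
  refine hasDerivAt_upwardRay_of_decay (u.convex_halfStrip _ _) (u.isOpen_halfStrip _ _)
    (u.upward_halfStrip _ _)
    (fun z hz => (u.differentiableAt_regKern eps lam m n p hz).differentiableWithinAt) heps hlam
    ⟨u.bigRadius, Real.exp (M / eps) * (2 / u.bigRadius), fun z _ hz => ?_⟩ hw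
  have hz' := le_norm_of_le_im hz
  rw [h.regKern_eq lam p (fun e => by
    have := u.two_mul_norm_z_lt m
    rw [e] at hz'
    linarith [norm_nonneg (u.z m)])]
  exact u.exists_norm_exp_div_le heps lam hf p z hz'

variable {u} in
theorem Resonant.upwardRay_eq {eps : ℝ} {m : Fin P} {n : ℕ} (h : u.Resonant eps m n) (lam : ℂ)
    (p : Fin P) {w : ℂ} (hw : w.re ≠ (u.z m).re) :
    upwardRay (u.regKern eps lam m n p) w = upwardRay (u.kern eps lam p) w := by
  rw [upwardRay, upwardRay]
  congr 1
  refine MeasureTheory.integral_congr_ae (Eventually.of_forall fun y => ?_)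
  simp only
  rw [h.regKern_eq lam p fun e => hw (by rw [← add_I_mul_re w y, e])]

variable {u} in
theorem Resonant.integral_ofReal_eq {eps : ℝ} (heps : 0 < eps) {lam : ℂ} (hlam : lam.re < 0)
    {m : Fin P} {n : ℕ} (h : u.Resonant eps m n) (p : Fin P) {a b : ℝ}
    (ha : (a : ℂ) ∈ u.strip m) (hb : (b : ℂ) ∈ u.strip m) :
    ∫ x in a..b, u.kern eps lam p (x : ℂ) =
      upwardRay (u.regKern eps lam m n p) b - upwardRay (u.regKern eps lam m n p) a := by
  have hmem : ∀ x ∈ Set.uIcc a b, (x : ℂ) ∈ u.strip m := fun x hx =>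
    ((u.convex_halfStrip _ _).linear_preimage Complex.ofRealCLM.toLinearMap).ordConnected.uIcc_subset
      (x := a) (y := b) ha hb hx
  refine intervalIntegral.integral_eq_sub_of_hasDerivAt
    (f := fun x : ℝ => upwardRay (u.regKern eps lam m n p) x) (fun x hx => ?_)
    ((u.continuous_kern_ofReal eps lam p).intervalIntegrable _ _)
  rw [← h.regKern_eq lam p fun e => by
    have := congrArg Complex.im e
    rw [Complex.ofReal_im] at this
    linarith [u.z_im_pos m]]
  exact (h.hasDerivAt_upwardRay heps hlam p (hmem x hx)).comp_ofReal

theorem prevAbscissa_re_ne (m : Fin P) : ((u.prevAbscissa m : ℝ) : ℂ).re ≠ (u.z m).re := by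
  rw [Complex.ofReal_re]; exact (u.prevAbscissa_lt le_rfl).ne

theorem rightAbscissa_re_ne (m : Fin P) : ((u.rightAbscissa m : ℝ) : ℂ).re ≠ (u.z m).re := by
  rw [Complex.ofReal_re]; exact (u.rightAbscissa_gt le_rfl).ne'

-- Without a cut, the contour around it can be contracted to `i∞`. This is why a resonant pole needs
-- a contour ending at `z m`: the usual one would give no new condition.
variable {u} in
theorem Resonant.integralAround_eq_zero {eps : ℝ} (heps : 0 < eps) {lam : ℂ} (hlam : lam.re < 0)
    {m : Fin P} {n : ℕ} (h : u.Resonant eps m n) (p : Fin P) :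
    u.integralAround m (u.kern eps lam p) = 0 := by
  rw [integralAround, h.integral_ofReal_eq heps hlam p
    (u.left_subset_strip m (u.prevAbscissa_mem m)) (u.right_subset_strip m (u.rightAbscissa_mem m)),
    h.upwardRay_eq lam p (u.prevAbscissa_re_ne m), h.upwardRay_eq lam p (u.rightAbscissa_re_ne m)]
  ring

-- The integrand continues analytically to the whole strip, so the part of the contour after the
-- previous gap may be replaced by the vertical ray from `i∞` down to `z m`.
variable {u} in
theorem Resonant.integralL_eq {eps : ℝ} (heps : 0 < eps) {lam : ℂ} (hlam : lam.re < 0)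
    {m : Fin P} {n : ℕ} (h : u.Resonant eps m n) (p : Fin P) :
    u.integralL m (u.kern eps lam p) = u.integralBefore m (u.kern eps lam p) +
      upwardRay (u.regKern eps lam m n p) (u.z m) := by
  have hc := u.continuous_kern_ofReal eps lam p
  have hzre : (((u.z m).re : ℝ) : ℂ) ∈ u.strip m :=
    u.mem_strip_of_re_eq (u.neg_im_lt_ofReal _) (Complex.ofReal_re _)
  have h1 := h.integral_ofReal_eq heps hlam p
    (u.left_subset_strip m (u.prevAbscissa_mem m)) hzre
  have hline : ∀ y : ℝ, 0 ≤ y → ((u.z m).re : ℂ) + Complex.I * y ∈ u.strip m := fun y hy =>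
    u.upward_halfStrip _ _ _ hzre y hy
  have h2 : (∫ y in (0 : ℝ)..(u.z m).im,
      u.kern eps lam p ((u.z m).re + Complex.I * y) * Complex.I) =
      upwardRay (u.regKern eps lam m n p) (u.z m) -
        upwardRay (u.regKern eps lam m n p) (u.z m).re := by
    have h3 : (∫ y in (0 : ℝ)..(u.z m).im,
        u.kern eps lam p ((u.z m).re + Complex.I * y) * Complex.I) =
        ∫ y in (0 : ℝ)..(u.z m).im,
          u.regKern eps lam m n p ((u.z m).re + Complex.I * y) * Complex.I := by
      refine intervalIntegral.integral_congr_ae ?_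
      have hne : ∀ᵐ y : ℝ, y ≠ (u.z m).im := by
        simp [MeasureTheory.ae_iff, MeasureTheory.measure_singleton]
      filter_upwards [hne] with y hy _
      rw [h.regKern_eq lam p fun e => hy (by
        have := congrArg Complex.im e
        rwa [add_I_mul_im, Complex.ofReal_im, zero_add] at this)]
    have hz : u.z m = (u.z m).re + Complex.I * (u.z m).im := by
      rw [mul_comm, Complex.re_add_im]
    rw [h3, intervalIntegral.integral_eq_sub_of_hasDerivAt
      (f := fun y : ℝ => upwardRay (u.regKern eps lam m n p) ((u.z m).re + Complex.I * y))]
    · rw [← hz]; simp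
    · intro y hy
      rw [Set.uIcc_of_le (u.z_im_pos m).le] at hy
      exact HasDerivAt.comp (h₂ := upwardRay (u.regKern eps lam m n p))
        (h := fun y : ℝ => ((u.z m).re : ℂ) + Complex.I * y) y
        (h.hasDerivAt_upwardRay heps hlam p (hline y hy.1)) (hasDerivAt_add_I_mul _ y)
    · refine ContinuousOn.intervalIntegrable fun y hy => ?_
      rw [Set.uIcc_of_le (u.z_im_pos m).le] at hy
      refine ContinuousAt.continuousWithinAt (ContinuousAt.mul ?_ continuousAt_const)
      exact ((u.differentiableAt_regKern eps lam m n p (hline y hy.1)).continuousAt).comp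
        (f := fun y : ℝ => ((u.z m).re : ℂ) + Complex.I * y) (by fun_prop)
  rw [integralL, integralBefore, ← intervalIntegral.integral_add_adjacent_intervals
    (hc.intervalIntegrable _ (u.prevAbscissa m)) (hc.intervalIntegrable _ _), h1, h2,
    h.upwardRay_eq lam p (u.prevAbscissa_re_ne m)]
  simp only [descendingRay, upwardRay]
  ring

/-- Induction from left to right. The contour before the `m`-th cut is the contour `U` of the
preceding pole, already known to give zero. The integral around the `m`-th cut then vanishes by
resonance, or by the `m`-th equation of the kernel. -/
theorem sum_integralU_eq_zero {eps : ℝ} (heps : 0 < eps) {lam : ℂ} (hlam : lam.re < 0)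
    {v : Fin P → ℂ} (hv : ∀ m, ∑ p, v p * u.integralC eps m (u.kern eps lam p) = 0) :
    ∀ m, ∑ p, v p * u.integralBefore m (u.kern eps lam p) = 0 ∧
      ∑ p, v p * u.integralAround m (u.kern eps lam p) = 0 := by
  have main : ∀ k : ℕ, ∀ m : Fin P, m.val = k →
      ∑ p, v p * u.integralBefore m (u.kern eps lam p) = 0 ∧
      ∑ p, v p * u.integralAround m (u.kern eps lam p) = 0 := by
    intro k
    induction k with
    | zero =>
      intro m hm
      have hB : ∑ p, v p * u.integralBefore m (u.kern eps lam p) = 0 :=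
        Finset.sum_eq_zero fun p _ => by rw [u.integralBefore_zero hm, mul_zero]
      refine ⟨hB, ?_⟩
      by_cases hr : ∃ n : ℕ, 0 < n ∧ Complex.I * u.c m / eps = -(n : ℂ)
      · obtain ⟨n, hn⟩ := hr
        exact Finset.sum_eq_zero fun p _ => by
          rw [Resonant.integralAround_eq_zero heps hlam (n := n) hn, mul_zero]
      · have h1 := hv m
        simp only [integralC, if_neg hr, integralU_eq, mul_add, Finset.sum_add_distrib, hB,
          zero_add] at h1
        exact h1
    | succ k ih =>
      intro m hm
      have hk : k < P := by have := m.isLt; omega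
      have hB : ∑ p, v p * u.integralBefore m (u.kern eps lam p) = 0 := by
        simp_rw [u.integralBefore_succ (k := ⟨k, hk⟩) hm, integralU_eq, mul_add,
          Finset.sum_add_distrib]
        rw [(ih ⟨k, hk⟩ rfl).1, (ih ⟨k, hk⟩ rfl).2, add_zero]
      refine ⟨hB, ?_⟩
      by_cases hr : ∃ n : ℕ, 0 < n ∧ Complex.I * u.c m / eps = -(n : ℂ)
      · obtain ⟨n, hn⟩ := hr
        exact Finset.sum_eq_zero fun p _ => by
          rw [Resonant.integralAround_eq_zero heps hlam (n := n) hn, mul_zero]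
      · have h1 := hv m
        simp only [integralC, if_neg hr, integralU_eq, mul_add, Finset.sum_add_distrib, hB,
          zero_add] at h1
        exact h1
  exact fun m => main m.val m rfl

end RationalPotential

/-! ### Kernel vectors give solutions holomorphic in the upper half-plane. -/

namespace RationalPotential

variable {P : ℕ} (u : RationalPotential P)

theorem nhdsWithin_generic_neBot (w : ℂ) : (𝓝[{z | u.Generic z}] w).NeBot := by
  have h1 : Tendsto (fun t : ℝ => w + t) (𝓝[≠] 0) (𝓝[{z | u.Generic z}] w) := by
    refine tendsto_nhdsWithin_iff.2 ⟨?_, ?_⟩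
    · have : Tendsto (fun t : ℝ => w + (t : ℂ)) (𝓝 0) (𝓝 (w + (0 : ℝ))) :=
        (continuous_const.add Complex.continuous_ofReal).tendsto 0
      rw [Complex.ofReal_zero, add_zero] at this
      exact this.mono_left nhdsWithin_le_nhds
    · have : ∀ p : Fin P, ∀ᶠ t : ℝ in 𝓝[≠] 0, (w + (t : ℂ)).re ≠ (u.z p).re := fun p => by
        by_cases hp : (u.z p).re - w.re = 0
        · filter_upwards [self_mem_nhdsWithin] with t ht h
          rw [Complex.add_re, Complex.ofReal_re] at h
          exact ht (by rw [Set.mem_singleton_iff]; linarith)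
        · filter_upwards [nhdsWithin_le_nhds (isOpen_ne.mem_nhds (Ne.symm hp))] with t ht h
          rw [Complex.add_re, Complex.ofReal_re] at h
          exact ht (by linarith)
      exact eventually_all.2 this
  exact h1.neBot

/-- The extension by continuity of the ray solution. -/
noncomputable def extSol (eps : ℝ) (lam : ℂ) (v : Fin P → ℂ) (w : ℂ) : ℂ :=
  limUnder (𝓝[{z | u.Generic z}] w) (u.raySol eps lam v)

theorem extSol_eq {eps : ℝ} {lam : ℂ} {v : Fin P → ℂ} {φ : ℂ → ℂ} {w : ℂ} (hφ : ContinuousAt φ w)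
    (h : ∀ᶠ z in 𝓝[{z | u.Generic z}] w, u.raySol eps lam v z = φ z) :
    u.extSol eps lam v w = φ w := by
  have := u.nhdsWithin_generic_neBot w
  exact Tendsto.limUnder_eq ((hφ.tendsto.mono_left nhdsWithin_le_nhds).congr'
    (h.mono fun z hz => hz.symm))

theorem solvesAt_extSol {eps : ℝ} {lam : ℂ} {v : Fin P → ℂ} {w : ℂ}
    (h : u.ExtendsNear eps lam v w) : u.SolvesAt eps lam v (u.extSol eps lam v) w := by
  obtain ⟨φ, hφ⟩ := h
  have heq : u.extSol eps lam v =ᶠ[𝓝 w] φ := by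
    filter_upwards [hφ.eventually_nhds] with z hz
    refine u.extSol_eq hz.self_of_nhds.1.continuousAt ?_
    filter_upwards [nhdsWithin_le_nhds hz, self_mem_nhdsWithin] with y h1 h2 using h1.2 h2
  have h1 := hφ.self_of_nhds.1
  unfold SolvesAt at h1 ⊢
  rw [heq.self_of_nhds]
  exact h1.congr_of_eventuallyEq heq

theorem extSol_eq_raySol {eps : ℝ} (heps : 0 < eps) {lam : ℂ} (hlam : lam.re < 0) {v : Fin P → ℂ}
    {w : ℂ} (hw : ∀ p, -(u.z p).im < w.im) (hg : u.Generic w) :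
    u.extSol eps lam v w = u.raySol eps lam v w :=
  u.extSol_eq (u.solvesAt_raySol heps hlam v hw hg).continuousAt (Eventually.of_forall fun _ => rfl)

theorem extendsNear_of_kernel {eps : ℝ} (heps : 0 < eps) {lam : ℂ} (hlam : lam.re < 0)
    {v : Fin P → ℂ} (hv : ∀ m, ∑ p, v p * u.integralC eps m (u.kern eps lam p) = 0)
    {w : ℂ} (hw : ∀ p, -(u.z p).im < w.im) (hp : ∀ p, w ≠ u.z p) :
    u.ExtendsNear eps lam v w := by
  by_cases hg : u.Generic w
  · exact u.extendsNear_of_generic heps hlam v hw hg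
  · unfold Generic at hg
    push Not at hg
    obtain ⟨m, hm⟩ := hg
    rcases lt_trichotomy w.im (u.z m).im with h | h | h
    · exact u.extendsNear_below heps hlam (u.sum_integralU_eq_zero heps hlam hv m).2 hw hm h
    · exact absurd (Complex.ext hm h) (hp m)
    · exact u.extendsNear_above heps hlam hw hm h

theorem eventually_solvesAt_extSol {eps : ℝ} (heps : 0 < eps) {lam : ℂ} (hlam : lam.re < 0)
    {v : Fin P → ℂ} (hv : ∀ m, ∑ p, v p * u.integralC eps m (u.kern eps lam p) = 0)
    (m : Fin P) :
    ∀ᶠ w in 𝓝[≠] (u.z m), u.SolvesAt eps lam v (u.extSol eps lam v) w := by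
  have h1 : ∀ᶠ w in 𝓝 (u.z m), ∀ p, -(u.z p).im < w.im :=
    u.isOpen_upper.mem_nhds fun p => by linarith [u.z_im_pos p, u.z_im_pos m]
  have h2 : ∀ᶠ w in 𝓝 (u.z m), ∀ p, p ≠ m → w ≠ u.z p := by
    refine eventually_all.2 fun p => ?_
    by_cases hp : p = m
    · exact Eventually.of_forall fun w h => absurd hp h
    · filter_upwards [isOpen_ne.mem_nhds fun h => hp (u.z_injective h).symm] with w hw _ using hw
  filter_upwards [nhdsWithin_le_nhds h1, nhdsWithin_le_nhds h2, self_mem_nhdsWithin] with w a b c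
  refine u.solvesAt_extSol (u.extendsNear_of_kernel heps hlam hv a fun p => ?_)
  by_cases hp : p = m
  · rw [hp]; exact c
  · exact b p hp

-- The equation for the contour ending at `z m` says that the numerator, regular at `z m`, vanishes
-- there. This gains one power and rules out precisely the resonant order `n`.
variable {u} in
theorem Resonant.exists_pow_mul_extSol_le {eps : ℝ} (heps : 0 < eps) {lam : ℂ} (hlam : lam.re < 0)
    {v : Fin P → ℂ} (hv : ∀ m, ∑ p, v p * u.integralC eps m (u.kern eps lam p) = 0)
    {m : Fin P} {n : ℕ}
    (h : u.Resonant eps m n) :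
    ∃ C : ℝ, ∀ᶠ w in 𝓝[≠] (u.z m), ‖(w - u.z m) ^ (n - 1) * u.extSol eps lam v w‖ ≤ C := by
  set H : ℂ → ℂ := fun w => ∑ p, v p * upwardRay (u.regKern eps lam m n p) w with hH
  have hzs : u.z m ∈ u.strip m :=
    u.mem_strip_of_re_eq (fun p => by linarith [u.z_im_pos p, u.z_im_pos m]) rfl
  have hstrip : u.strip m ∈ 𝓝 (u.z m) := (u.isOpen_halfStrip _ _).mem_nhds hzs
  have hHd : ∀ w ∈ u.strip m, DifferentiableAt ℂ H w := fun w hw =>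
    DifferentiableAt.fun_sum fun p _ =>
      ((h.hasDerivAt_upwardRay heps hlam p hw).differentiableAt).const_mul (v p)
  have hH0 : H (u.z m) = 0 := by
    have h1 := hv m
    simp only [integralC, if_pos (⟨n, h⟩ : ∃ n : ℕ, 0 < n ∧ Complex.I * u.c m / eps = -(n : ℂ)),
      h.integralL_eq heps hlam, mul_add, Finset.sum_add_distrib,
      (u.sum_integralU_eq_zero heps hlam hv m).1, zero_add] at h1
    exact h1
  have hΦ : ∀ᶠ w in 𝓝[≠] (u.z m),
      (w - u.z m) ^ (n - 1) * u.extSol eps lam v w = dslope H (u.z m) w / u.regExp eps lam m n w := by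
    filter_upwards [nhdsWithin_le_nhds hstrip, self_mem_nhdsWithin] with w hw hne
    have hne' : w - u.z m ≠ 0 := sub_ne_zero.2 hne
    have h1 : u.extSol eps lam v w = H w / (u.regExp eps lam m n w * (w - u.z m) ^ n) := by
      refine u.extSol_eq (φ := fun w => H w / (u.regExp eps lam m n w * (w - u.z m) ^ n)) ?_ ?_
      · refine ContinuousAt.div (hHd w hw).continuousAt
          ((u.differentiableAt_regExp eps lam m n hw).continuousAt.mul (by fun_prop))
          (mul_ne_zero (u.regExp_ne_zero _ _ _ _ _) (pow_ne_zero _ hne'))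
      · filter_upwards [self_mem_nhdsWithin] with x hx
        have hxne : x ≠ u.z m := fun e => hx m (by rw [e])
        rw [raySol, h.expH_eq lam hxne, hH]
        congr 1
        exact Finset.sum_congr rfl fun p _ => by rw [h.upwardRay_eq lam p (hx m)]
    rw [h1, dslope_of_ne _ hne, slope_def_field, hH0, sub_zero]
    obtain ⟨k, rfl⟩ := Nat.exists_eq_succ_of_ne_zero h.1.ne'
    have := u.regExp_ne_zero eps lam m k.succ w
    rw [Nat.succ_sub_one, pow_succ]
    field_simp
  have hc : ContinuousAt (fun w => dslope H (u.z m) w / u.regExp eps lam m n w) (u.z m) :=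
    (continuousAt_dslope_same.2 (hHd _ hzs)).div
      (u.differentiableAt_regExp eps lam m n hzs).continuousAt (u.regExp_ne_zero _ _ _ _ _)
  have hev := hc.norm.eventually_lt (continuousAt_const (y :=
    ‖dslope H (u.z m) (u.z m) / u.regExp eps lam m n (u.z m)‖ + 1)) (lt_add_one _)
  refine ⟨‖dslope H (u.z m) (u.z m) / u.regExp eps lam m n (u.z m)‖ + 1, ?_⟩
  filter_upwards [hΦ, nhdsWithin_le_nhds hev] with w h1 h2
  rw [h1]
  exact h2.le

/-- Without resonance every pole order is excluded. With resonance at `n`, the order is already at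
most `n - 1`, and these orders are not resonant. -/
theorem exists_extSol_bounded {eps : ℝ} (heps : 0 < eps) {lam : ℂ} (hlam : lam.re < 0)
    {v : Fin P → ℂ} (hv : ∀ m, ∑ p, v p * u.integralC eps m (u.kern eps lam p) = 0)
    (m : Fin P) :
    ∃ C : ℝ, ∀ᶠ w in 𝓝[≠] (u.z m), ‖u.extSol eps lam v w‖ ≤ C := by
  have hs := u.eventually_solvesAt_extSol heps hlam hv m
  by_cases hr : ∃ n : ℕ, u.Resonant eps m n
  · obtain ⟨n, hn⟩ := hr
    refine u.bounded_of_pow_mul_bounded hs (n - 1) (fun j _ hj2 h => ?_)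
      (hn.exists_pow_mul_extSol_le heps hlam hv)
    rw [hn.2, neg_inj, Nat.cast_inj] at h
    have := hn.1
    omega
  · obtain ⟨N, hN⟩ := u.exists_pow_mul_bounded hs
    exact u.bounded_of_pow_mul_bounded hs N (fun j hj _ h => hr ⟨j, hj, h⟩) hN

theorem differentiableAt_extSol {eps : ℝ} (heps : 0 < eps) {lam : ℂ} (hlam : lam.re < 0)
    {v : Fin P → ℂ} (hv : ∀ m, ∑ p, v p * u.integralC eps m (u.kern eps lam p) = 0)
    {w : ℂ} (hw : ∀ p, -(u.z p).im < w.im) :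
    DifferentiableAt ℂ (u.extSol eps lam v) w := by
  by_cases hp : ∀ p, w ≠ u.z p
  · exact (u.solvesAt_extSol (u.extendsNear_of_kernel heps hlam hv hw hp)).differentiableAt
  push Not at hp
  obtain ⟨m, rfl⟩ := hp
  obtain ⟨C, hC⟩ := u.exists_extSol_bounded heps hlam hv m
  obtain ⟨G, hGa, hG⟩ := exists_removable
    ((u.eventually_solvesAt_extSol heps hlam hv m).mono fun z hz => hz.differentiableAt) hC
  have heq : u.extSol eps lam v =ᶠ[𝓝 (u.z m)] G := by
    refine Eventually.of_forall fun z => ?_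
    by_cases hz : z = u.z m
    · rw [hz]
      refine u.extSol_eq hGa.continuousAt ?_
      filter_upwards [self_mem_nhdsWithin, nhdsWithin_le_nhds (u.isOpen_upper.mem_nhds hw)]
        with y h1 h2
      rw [hG y fun e => h1 m (by rw [e])]
      exact (u.extSol_eq_raySol heps hlam h2 h1).symm
    · exact (hG z hz).symm
  exact hGa.differentiableAt.congr_of_eventuallyEq heq

/-- Decay of the ray solution in the closed upper half-plane. -/
theorem exists_norm_raySol_le {eps : ℝ} (heps : 0 < eps) {lam : ℂ} (hlam : lam.re < 0)
    (v : Fin P → ℂ) : ∃ C > 0, ∀ w : ℂ, 0 ≤ w.im → u.bigRadius ≤ ‖w‖ →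
      ‖u.raySol eps lam v w‖ ≤ C / ‖w‖ := by
  obtain ⟨M, hM, hf⟩ := u.exists_norm_f_le
  set κ := -lam.re / eps with hκ
  have hκ0 : 0 < κ := div_pos (by linarith) heps
  refine ⟨(∑ p, ‖v p‖) * (Real.exp (2 * M / eps) * 2 / κ) + 1, by positivity, fun w him hw => ?_⟩
  have hw0 : 0 < ‖w‖ := u.bigRadius_pos.trans_le hw
  have hnorm : ∀ y : ℝ, 0 ≤ y → ‖w‖ ≤ ‖w + Complex.I * y‖ := fun y hy => by
    rw [Complex.norm_def, Complex.norm_def]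
    refine Real.sqrt_le_sqrt ?_
    rw [Complex.normSq_apply, Complex.normSq_apply, add_I_mul_im, add_I_mul_re]
    nlinarith
  have hU : ∀ p, ‖upwardRay (u.kern eps lam p) w‖ ≤
      Real.exp (2 * M / eps) * 2 / κ / ‖w‖ * ‖u.expH eps lam w‖ := by
    intro p
    have hb : ∀ y ∈ Set.Ioi (0 : ℝ), ‖u.kern eps lam p (w + Complex.I * y) * Complex.I‖ ≤
        Real.exp (2 * M / eps) * (2 / ‖w‖) * ‖u.expH eps lam w‖ * Real.exp (-κ * y) := by
      intro y hy
      have hy' : (0 : ℝ) ≤ y := le_of_lt hy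
      have h1 := hnorm y hy'
      have h2 := hf (w + Complex.I * y) (hw.trans h1)
      have h3 := hf w hw
      have h4 := u.norm_inv_sub_le (hw.trans h1) p
      have h5 : (2 : ℝ) / ‖w + Complex.I * y‖ ≤ 2 / ‖w‖ := by gcongr
      have h6 := (Complex.im_le_norm _).trans h2
      have h7 := (abs_le.1 ((Complex.abs_im_le_norm _).trans h3)).1
      rw [norm_mul, Complex.norm_I, mul_one, kern, div_eq_mul_inv, norm_mul, norm_inv, norm_expH,
        norm_expH, im_mul_add_I_mul]
      calc _ ≤ Real.exp (((lam * w).im + lam.re * y) / eps) *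
            Real.exp ((u.f (w + Complex.I * y)).im / eps) * (2 / ‖w‖) := by
            gcongr; exact h4.trans h5
        _ ≤ Real.exp (((lam * w).im + lam.re * y) / eps) *
            Real.exp ((2 * M + (u.f w).im) / eps) * (2 / ‖w‖) := by
            gcongr; linarith
        _ = _ := by
            rw [add_div, Real.exp_add, add_div, Real.exp_add,
              show lam.re * y / eps = -κ * y by rw [hκ]; ring]
            ring
    have hint : MeasureTheory.IntegrableOn (fun y : ℝ => Real.exp (2 * M / eps) * (2 / ‖w‖) *
        ‖u.expH eps lam w‖ * Real.exp (-κ * y)) (Set.Ioi 0) :=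
      (exp_neg_integrableOn_Ioi 0 hκ0).const_mul _
    rw [upwardRay, norm_neg]
    refine (MeasureTheory.norm_integral_le_of_norm_le hint
      ((MeasureTheory.ae_restrict_mem measurableSet_Ioi).mono hb)).trans (le_of_eq ?_)
    rw [MeasureTheory.integral_const_mul, integral_exp_mul_Ioi (by linarith) 0]
    simp only [mul_zero, Real.exp_zero]
    field_simp
  have hE0 : 0 < ‖u.expH eps lam w‖ := norm_pos_iff.2 (u.expH_ne_zero _ _ _)
  rw [raySol, norm_div, div_le_iff₀ hE0]
  refine (norm_sum_le _ _).trans ?_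
  calc ∑ p, ‖v p * upwardRay (u.kern eps lam p) w‖ ≤
      ∑ p, ‖v p‖ * (Real.exp (2 * M / eps) * 2 / κ / ‖w‖ * ‖u.expH eps lam w‖) :=
        Finset.sum_le_sum fun p _ => by
          rw [norm_mul]
          exact mul_le_mul_of_nonneg_left (hU p) (norm_nonneg _)
    _ = (∑ p, ‖v p‖) * (Real.exp (2 * M / eps) * 2 / κ) / ‖w‖ * ‖u.expH eps lam w‖ := by
        rw [← Finset.sum_mul]; ring
    _ ≤ _ := by gcongr; linarith

end RationalPotential

open MeasureTheory in
/-- A function holomorphic in the closed upper half-plane with decay `O(z⁻²)` has vanishing integral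
over the real line. -/
theorem integral_eq_zero_of_upper {g : ℂ → ℂ} (hg : ∀ w : ℂ, 0 ≤ w.im → DifferentiableAt ℂ g w)
    {C R : ℝ} (hb : ∀ w : ℂ, 0 ≤ w.im → R ≤ ‖w‖ → ‖g w‖ ≤ C / ‖w‖ ^ 2)
    (hint : Integrable fun x : ℝ => g x) : ∫ x : ℝ, g x = 0 := by
  have hlim : Tendsto (fun X : ℝ => ∫ x in (-X)..X, g x) atTop (𝓝 (∫ x : ℝ, g x)) :=
    intervalIntegral_tendsto_integral hint tendsto_neg_atTop_atBot tendsto_id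
  refine tendsto_nhds_unique hlim ?_
  refine squeeze_zero_norm' (a := fun X => 4 * |C| / X) ?_ (tendsto_const_nhds.div_atTop tendsto_id)
  filter_upwards [eventually_ge_atTop R, eventually_gt_atTop 0] with X hX hX0
  -- Cauchy's theorem on the rectangle with sides `[-X, X]` and `[0, X]`; the other three sides have
  -- total length `4 X`, and there the integrand is `O(X⁻²)`.
  have hrect := Complex.integral_boundary_rect_eq_zero_of_differentiableOn g (-X : ℝ)
    ((X : ℝ) + (X : ℝ) * Complex.I) (fun w hw => by
      refine (hg w ?_).differentiableWithinAt
      rw [Complex.mem_reProdIm] at hw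
      have := hw.2
      simp only [Complex.ofReal_im, Complex.add_im, Complex.mul_im, Complex.ofReal_re,
        Complex.I_im, mul_one, Complex.I_re, mul_zero, add_zero, zero_add] at this
      rw [Set.uIcc_of_le hX0.le] at this
      exact this.1)
  simp only [Complex.ofReal_im, Complex.add_im, Complex.mul_im, Complex.ofReal_re,
    Complex.I_im, mul_one, Complex.I_re, mul_zero, add_zero, zero_add, Complex.add_re,
    Complex.mul_re, sub_self, Complex.ofReal_zero, zero_mul] at hrect
  have hbd : ∀ w : ℂ, 0 ≤ w.im → X ≤ ‖w‖ → ‖g w‖ ≤ |C| / X ^ 2 := fun w h1 h2 => by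
    refine (hb w h1 (hX.trans h2)).trans ?_
    calc C / ‖w‖ ^ 2 ≤ |C| / ‖w‖ ^ 2 := by gcongr; exact le_abs_self C
      _ ≤ |C| / X ^ 2 := by gcongr
  have htop : ‖∫ x in (-X)..X, g (x + X * Complex.I)‖ ≤ |C| / X ^ 2 * |X - -X| := by
    refine intervalIntegral.norm_integral_le_of_norm_le_const fun x _ => hbd _ (by simp [hX0.le]) ?_
    have := Complex.abs_im_le_norm (x + X * Complex.I)
    simp at this
    exact (le_abs_self X).trans this
  have hside : ∀ a : ℝ, |a| = X →
      ‖∫ y in (0 : ℝ)..X, g (a + y * Complex.I)‖ ≤ |C| / X ^ 2 * |X - 0| := by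
    intro a ha
    refine intervalIntegral.norm_integral_le_of_norm_le_const fun y hy => hbd _ ?_ ?_
    · rw [Set.uIoc_of_le hX0.le] at hy
      simpa using hy.1.le
    · have := Complex.abs_re_le_norm (a + y * Complex.I)
      simp at this
      rw [← ha]
      exact this
  have h1 := hside X (abs_of_pos hX0)
  have h2 := hside (-X) (by rw [abs_neg, abs_of_pos hX0])
  have hI : ∫ x in (-X)..X, g x = (∫ x in (-X)..X, g (x + X * Complex.I)) -
      Complex.I • (∫ y in (0 : ℝ)..X, g (X + y * Complex.I)) +
      Complex.I • (∫ y in (0 : ℝ)..X, g ((-X : ℝ) + y * Complex.I)) := by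
    linear_combination hrect
  rw [hI]
  calc _ ≤ |C| / X ^ 2 * |X - -X| + |C| / X ^ 2 * |X - 0| + |C| / X ^ 2 * |X - 0| := by
        refine (norm_add_le _ _).trans (add_le_add ((norm_sub_le _ _).trans (add_le_add htop ?_)) ?_)
        · rwa [norm_smul, Complex.norm_I, one_mul]
        · rwa [norm_smul, Complex.norm_I, one_mul]
    _ = 4 * |C| / X := by
        rw [sub_neg_eq_add, sub_zero, abs_of_pos (by linarith : 0 < X + X), abs_of_pos hX0]
        field_simp
        ring

open MeasureTheory in
theorem integrable_of_continuous_of_le_div_sq {g : ℝ → ℂ} (hg : Continuous g) {C R : ℝ}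
    (hb : ∀ x : ℝ, R ≤ |x| → ‖g x‖ ≤ C / |x| ^ 2) : Integrable g := by
  set R' := max R 1 with hR'
  have hR1 : 1 ≤ R' := le_max_right _ _
  obtain ⟨B, hB⟩ := (isCompact_Icc (a := -R') (b := R')).exists_bound_of_continuousOn hg.continuousOn
  refine ((integrable_inv_one_add_sq).const_mul (max (B * (1 + R' ^ 2)) (2 * |C|))).mono'
    hg.aestronglyMeasurable (Eventually.of_forall fun x => ?_)
  have hpos : 0 < 1 + x ^ 2 := by positivity
  rw [← div_eq_mul_inv, le_div_iff₀ hpos]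
  rcases le_or_gt |x| R' with h | h
  · have h1 := hB x (abs_le.1 h)
    have h2 : x ^ 2 ≤ R' ^ 2 := by rw [← sq_abs]; gcongr
    calc ‖g x‖ * (1 + x ^ 2) ≤ B * (1 + R' ^ 2) := by gcongr; exact (norm_nonneg _).trans h1
      _ ≤ _ := le_max_left _ _
  · have h1 := hb x ((le_max_left _ _).trans h.le)
    have hx1 : 1 ≤ |x| := hR1.trans h.le
    have hx0 : 0 < |x| := by linarith
    calc ‖g x‖ * (1 + x ^ 2) ≤ |C| / |x| ^ 2 * (2 * |x| ^ 2) := by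
          rw [← sq_abs x]
          gcongr
          · exact h1.trans (by gcongr; exact le_abs_self C)
          · nlinarith
      _ = 2 * |C| := by field_simp
      _ ≤ _ := le_max_right _ _

/-! ### Reality of the zeros of the Evans function. -/

namespace RationalPotential

variable {P : ℕ} (u : RationalPotential P)

theorem conj_u0C (w : ℂ) : conj (u.u0C w) = u.u0C (conj w) := by
  simp only [u0C, map_sum, map_add, map_div₀, map_sub, Complex.conj_conj]
  exact Finset.sum_congr rfl fun p _ => add_comm _ _

theorem u0C_ofReal (x : ℝ) : u.u0C x = u.u0 x := by
  have := u.conj_u0C x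
  rw [Complex.conj_ofReal] at this
  rw [u0]
  exact (Complex.conj_eq_iff_re.1 this).symm

open MeasureTheory in
/-- Zeros of the Evans function in the left half-plane are real. -/
theorem im_eq_zero_of_det_eq_zero {eps : ℝ} (heps : 0 < eps) {lam : ℂ} (hlam : lam.re < 0)
    (hdet : (u.AC eps lam).det = 0) : lam.im = 0 := by
  obtain ⟨v, hv0, hAv⟩ := Matrix.exists_mulVec_eq_zero_iff.2 hdet
  have hv : ∀ m, ∑ p, v p * u.integralC eps m (u.kern eps lam p) = 0 := fun m => by
    have := congrFun hAv m
    simp only [Matrix.mulVec, dotProduct, Pi.zero_apply] at this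
    rw [← this]
    exact Finset.sum_congr rfl fun p _ => mul_comm _ _
  set Φ := u.extSol eps lam v with hΦ
  have hΦd : ∀ w : ℂ, 0 ≤ w.im → DifferentiableAt ℂ Φ w := fun w hw =>
    u.differentiableAt_extSol heps hlam hv fun p => by linarith [u.z_im_pos p]
  have hΦc : Continuous fun x : ℝ => Φ x := continuous_iff_continuousAt.2 fun x =>
    (hΦd x (by simp)).continuousAt.comp Complex.continuous_ofReal.continuousAt
  obtain ⟨C, hC, hray⟩ := u.exists_norm_raySol_le heps hlam v
  -- Real points of large modulus lie on no vertical line through a pole; at other points the bound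
  -- for the ray solution passes to the limit.
  have hΦb : ∀ w : ℂ, 0 ≤ w.im → u.bigRadius + 1 ≤ ‖w‖ → ‖Φ w‖ ≤ C / ‖w‖ := by
    intro w him hw
    have hwne : ‖w‖ ≠ 0 := by have := u.bigRadius_pos; linarith
    rcases him.eq_or_lt with h0 | h0
    · have hg : u.Generic w := fun p hp => by
        have h1 : ‖w‖ = |w.re| := by
          have : w = (w.re : ℂ) := Complex.ext (by simp) (by simp [← h0])
          rw [this, Complex.norm_real, Real.norm_eq_abs, Complex.ofReal_re]
        have h2 := Complex.abs_re_le_norm (u.z p)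
        rw [hp] at h1
        linarith [u.two_mul_norm_z_lt p, norm_nonneg (u.z p)]
      rw [hΦ, u.extSol_eq_raySol heps hlam (fun p => by linarith [u.z_im_pos p]) hg]
      exact hray w him (by linarith)
    · have := u.nhdsWithin_generic_neBot w
      have hwc := hΦd w him
      refine le_of_tendsto_of_tendsto (b := 𝓝[{z | u.Generic z}] w) (f := fun z => ‖Φ z‖)
        (g := fun z => C / ‖z‖)
        (hwc.continuousAt.norm.tendsto.mono_left nhdsWithin_le_nhds) ?_ ?_
      · exact ((continuousAt_const.div continuous_norm.continuousAt hwne).tendsto).mono_left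
          nhdsWithin_le_nhds
      · have e1 : ∀ᶠ z in 𝓝 w, 0 < z.im := Complex.continuous_im.continuousAt.eventually_const_lt h0
        have e2 : ∀ᶠ z in 𝓝 w, u.bigRadius < ‖z‖ :=
          continuous_norm.continuousAt.eventually_const_lt (by linarith)
        filter_upwards [nhdsWithin_le_nhds e1, nhdsWithin_le_nhds e2, self_mem_nhdsWithin]
          with z a b c
        rw [hΦ, u.extSol_eq_raySol heps hlam (fun p => by linarith [u.z_im_pos p]) c]
        exact hray z a.le b.le
  have hΦbr : ∀ x : ℝ, u.bigRadius + 1 ≤ |x| → ‖Φ x‖ ≤ C / |x| := fun x hx => by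
    have := hΦb x (by simp) (by rwa [Complex.norm_real, Real.norm_eq_abs])
    rwa [Complex.norm_real, Real.norm_eq_abs] at this
  -- orthogonality to the right hand side
  have horth : ∀ p, Integrable (fun x : ℝ => Φ x / (x - conj (u.z p))) ∧
      ∫ x : ℝ, Φ x / (x - conj (u.z p)) = 0 := by
    intro p
    have hne : ∀ w : ℂ, 0 ≤ w.im → w - conj (u.z p) ≠ 0 := fun w hw h0 => by
      have := congrArg Complex.im (sub_eq_zero.1 h0)
      linarith [u.conj_z_im p]
    have hbb : ∀ w : ℂ, 0 ≤ w.im → u.bigRadius + 1 ≤ ‖w‖ →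
        ‖Φ w / (w - conj (u.z p))‖ ≤ C * 2 / ‖w‖ ^ 2 := by
      intro w him hw
      have hw0 : 0 < ‖w‖ := by have := u.bigRadius_pos; linarith
      have h1 := half_norm_le_norm_sub (z := conj (u.z p)) (w := w)
        (by rw [RCLike.norm_conj]; exact u.two_mul_norm_z_lt p) (by linarith)
      rw [norm_div]
      calc ‖Φ w‖ / ‖w - conj (u.z p)‖ ≤ (C / ‖w‖) / (‖w‖ / 2) := by
            gcongr
            exact hΦb w him hw
        _ = _ := by field_simp
    have hint : Integrable (fun x : ℝ => Φ x / (x - conj (u.z p))) := by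
      refine integrable_of_continuous_of_le_div_sq (C := C * 2) (R := u.bigRadius + 1)
        (hΦc.div (by fun_prop) fun x => hne x (by simp)) fun x hx => ?_
      have := hbb x (by simp) (by rwa [Complex.norm_real, Real.norm_eq_abs])
      rwa [Complex.norm_real, Real.norm_eq_abs] at this
    exact ⟨hint, integral_eq_zero_of_upper (g := fun w => Φ w / (w - conj (u.z p)))
      (fun w hw => (hΦd w hw).div (by fun_prop) (hne w hw)) hbb hint⟩
  set s : ℝ → ℂ := fun x => u.source v x with hs
  -- On the real axis the conjugate of the source continues to a function with poles only in the
  -- lower half-plane, so its product with `Φ` integrates to zero.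
  have hcs : ∀ x : ℝ, conj (s x) * Φ x = ∑ p, conj (v p) * (Φ x / (x - conj (u.z p))) := fun x => by
    simp only [hs, source, map_sum, map_div₀, map_sub, Complex.conj_ofReal, Finset.sum_mul]
    exact Finset.sum_congr rfl fun p _ => by ring
  have hI1 : Integrable (fun x => conj (s x) * Φ x) := by
    simp_rw [hcs]
    exact integrable_finsetSum _ fun p _ => (horth p).1.const_mul _
  have hI1z : ∫ x, conj (s x) * Φ x = 0 := by
    simp_rw [hcs]
    rw [integral_finsetSum _ fun p _ => (horth p).1.const_mul _]
    exact Finset.sum_eq_zero fun p _ => by rw [integral_const_mul, (horth p).2, mul_zero]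
  have hconj : ∀ x, s x * conj (Φ x) = conj (conj (s x) * Φ x) := fun x => by simp
  have hI2 : Integrable (fun x => s x * conj (Φ x)) := by
    simp_rw [hconj]
    exact (RCLike.conjLIE.toContinuousLinearEquiv.toContinuousLinearMap).integrable_comp hI1
  have hI2z : ∫ x, s x * conj (Φ x) = 0 := by
    simp_rw [hconj]
    rw [integral_conj, hI1z, map_zero]
  have hNc : Continuous fun x : ℝ => Φ x * conj (Φ x) := hΦc.mul (Complex.continuous_conj.comp hΦc)
  have hNb : ∀ x : ℝ, u.bigRadius + 1 ≤ |x| → ‖Φ x * conj (Φ x)‖ ≤ C ^ 2 / |x| ^ 2 := fun x hx => by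
    rw [norm_mul, RCLike.norm_conj, ← pow_two, ← div_pow]
    gcongr
    exact hΦbr x hx
  have hNi : Integrable fun x : ℝ => Φ x * conj (Φ x) := integrable_of_continuous_of_le_div_sq hNc hNb
  have hder : ∀ x : ℝ, HasDerivAt (fun x : ℝ => Φ x)
      (Complex.I / eps * (lam + u.u0C x) * Φ x + s x) x := fun x =>
    (u.solvesAt_extSol (u.extendsNear_of_kernel heps hlam hv (fun p => u.neg_im_lt_ofReal x p)
      fun p => (u.notPole_ofReal x p).1)).comp_ofReal
  -- Because `u₀` is real on the axis, it drops out of the derivative of `|Φ|²`, and only `Im λ`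
  -- remains from the homogeneous part.
  have hNd : ∀ x : ℝ, HasDerivAt (fun x : ℝ => Φ x * conj (Φ x))
      ((-(2 * lam.im / eps) : ℝ) * (Φ x * conj (Φ x)) + (s x * conj (Φ x) + conj (s x) * Φ x)) x := by
    intro x
    have h1 := hder x
    have h2 : HasDerivAt (fun x : ℝ => conj (Φ x))
        (conj (Complex.I / eps * (lam + u.u0C x) * Φ x + s x)) x :=
      (Complex.conjCLE.toContinuousLinearMap.hasFDerivAt).comp_hasDerivAt x h1
    refine (h1.mul h2).congr_deriv ?_
    have h3 : conj (u.u0C x) = u.u0C x := by rw [conj_u0C, Complex.conj_ofReal]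
    have h4 : conj lam = lam - 2 * lam.im * Complex.I := by
      apply Complex.ext <;> simp; ring
    simp only [map_add, map_mul, map_div₀, Complex.conj_I, Complex.conj_ofReal, h3, h4]
    push_cast
    linear_combination (Φ x * conj (Φ x) / eps * 2 * lam.im) * Complex.I_sq
  have hlimN : ∀ l : Filter ℝ, Tendsto (fun x => |x|) l atTop →
      Tendsto (fun x : ℝ => Φ x * conj (Φ x)) l (𝓝 0) := fun l hl => by
    refine squeeze_zero_norm' (a := fun x => C ^ 2 / |x| ^ 2) ?_ ?_
    · filter_upwards [hl.eventually_ge_atTop (u.bigRadius + 1)] with x hx using hNb x hx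
    · exact tendsto_const_nhds.div_atTop ((tendsto_pow_atTop two_ne_zero).comp hl)
  have hI12 : Integrable (fun x : ℝ => s x * conj (Φ x) + conj (s x) * Φ x) := hI2.add hI1
  have hFTC := integral_of_hasDerivAt_of_tendsto hNd
    ((hNi.const_mul _).add hI12) (hlimN atBot tendsto_abs_atBot_atTop)
    (hlimN atTop tendsto_abs_atTop_atTop)
  rw [integral_add (hNi.const_mul _) hI12, integral_add hI2 hI1, hI1z, hI2z,
    integral_const_mul, sub_zero, add_zero, add_zero] at hFTC
  -- Either `Im λ = 0`, or `Φ` and with it the source vanish on the real line, which would force `v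
  -- = 0`.
  rcases mul_eq_zero.1 hFTC with h | h
  · have h' : -(2 * lam.im / eps) = 0 := by exact_mod_cast h
    have h2 : 2 * lam.im / eps = 0 := neg_eq_zero.1 h'
    rcases div_eq_zero_iff.1 h2 with h3 | h3
    · linarith
    · exact absurd h3 heps.ne'
  · exfalso
    apply hv0
    have h1 : ∀ x : ℝ, Φ x * conj (Φ x) = ((‖Φ x‖ ^ 2 : ℝ) : ℂ) := fun x => by
      rw [Complex.mul_conj, Complex.normSq_eq_norm_sq]
    simp_rw [h1] at h hNi
    rw [integral_complex_ofReal] at h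
    have h2 : ∫ x : ℝ, ‖Φ x‖ ^ 2 = 0 := by exact_mod_cast h
    have hNi' : Integrable fun x : ℝ => ‖Φ x‖ ^ 2 := by
      exact hNi.re
    have h3 := (integral_eq_zero_iff_of_nonneg (fun x => by positivity) hNi').1 h2
    have h4 := (Continuous.ae_eq_iff_eq volume (hΦc.norm.pow 2) continuous_const).1 h3
    have h5 : ∀ x : ℝ, Φ x = 0 := fun x => by
      have h6 : ‖Φ x‖ ^ 2 = 0 := congrFun h4 x
      simpa using h6
    have h6 : ∀ x : ℝ, s x = 0 := fun x => by
      have h7 := hder x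
      have h8 : (fun x : ℝ => Φ x) = fun _ => 0 := funext h5
      rw [h8] at h7
      have h9 := h7.unique (hasDerivAt_const x (0 : ℂ))
      rw [h5 x, mul_zero, zero_add] at h9
      exact h9
    -- The source has `P` simple poles; its vanishing at the `P` points `0, …, P - 1` suffices.
    refine eq_zero_of_sum_div_sub_eq_zero u.z_injective
      (s := (Finset.range P).map ⟨fun n : ℕ => ((n : ℝ) : ℂ), fun a b h => by
        have h' : ((a : ℝ) : ℂ) = ((b : ℝ) : ℂ) := h
        exact_mod_cast h'⟩) (by simp) ?_ ?_
    · intro y hy p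
      obtain ⟨n, -, rfl⟩ := Finset.mem_map.1 hy
      exact (u.notPole_ofReal n p).1
    · intro y hy
      obtain ⟨n, -, rfl⟩ := Finset.mem_map.1 hy
      exact h6 n

end RationalPotential

/-! ### Turning points and the area identity. -/

namespace RationalPotential

variable {P : ℕ} (u : RationalPotential P)

theorem hasDerivAt_u0 (x : ℝ) : HasDerivAt u.u0 (deriv u.u0C x).re x := by
  exact Complex.reCLM.hasFDerivAt.comp_hasDerivAt x
    (u.differentiableAt_u0C (u.notPole_ofReal x)).hasDerivAt.comp_ofReal

theorem continuous_u0 : Continuous u.u0 :=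
  continuous_iff_continuousAt.2 fun x => (u.hasDerivAt_u0 x).continuousAt

theorem tendsto_u0 {l : Filter ℝ} (hl : Tendsto (fun x : ℝ => |x|) l atTop) :
    Tendsto u.u0 l (𝓝 0) := by
  obtain ⟨C, -, hC⟩ := u.exists_norm_u0C_le
  refine squeeze_zero_norm' (a := fun x : ℝ => C / |x| ^ 2) ?_
    (tendsto_const_nhds.div_atTop ((tendsto_pow_atTop two_ne_zero).comp hl))
  filter_upwards [hl.eventually_ge_atTop u.bigRadius] with x hx
  have := hC x (by rwa [Complex.norm_real, Real.norm_eq_abs])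
  rwa [u0C_ofReal, Complex.norm_real, Complex.norm_real, Real.norm_eq_abs x] at this

/-- `u₀` is positive, increasing up to `xc` and decreasing after it. -/
structure IsPeak (xc : ℝ) : Prop where
  pos : ∀ x, 0 < u.u0 x
  mono : StrictMonoOn u.u0 (Set.Iic xc)
  anti : StrictAntiOn u.u0 (Set.Ici xc)

/-- A positive function tending to zero at both ends can neither decrease from `-∞` nor increase
towards `+∞`. Continuity includes the point `xc` in both intervals of monotonicity. -/
theorem IsPositiveKlausShaw.exists_isPeak (hu : u.IsPositiveKlausShaw) : ∃ xc, u.IsPeak xc := by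
  obtain ⟨⟨xc, hl, hr⟩, hpos⟩ := hu
  have hl' : StrictMonoOn u.u0 (Set.Iio xc) := hl.resolve_right fun h => by
    have h1 : ∀ᶠ x in atBot, u.u0 (xc - 1) ≤ u.u0 x := by
      filter_upwards [eventually_lt_atBot (xc - 1)] with x hx
      exact (h (show x < xc by linarith) (show xc - 1 < xc by linarith) hx).le
    exact absurd (ge_of_tendsto (u.tendsto_u0 tendsto_abs_atBot_atTop) h1) (hpos _).not_ge
  have hr' : StrictAntiOn u.u0 (Set.Ioi xc) := hr.resolve_left fun h => by
    have h1 : ∀ᶠ x in atTop, u.u0 (xc + 1) ≤ u.u0 x := by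
      filter_upwards [eventually_gt_atTop (xc + 1)] with x hx
      exact (h (show xc < xc + 1 by linarith) (show xc < x by linarith) hx).le
    exact absurd (ge_of_tendsto (u.tendsto_u0 tendsto_abs_atTop_atTop) h1) (hpos _).not_ge
  have hlc : ∀ x < xc, u.u0 x < u.u0 xc := fun x hx => by
    obtain ⟨y, hxy, hy⟩ := exists_between hx
    refine (hl' hx hy hxy).trans_le (ge_of_tendsto
      (u.continuous_u0.continuousAt.tendsto.mono_left nhdsWithin_le_nhds : Tendsto _ (𝓝[<] xc) _) ?_)
    filter_upwards [Ioo_mem_nhdsLT hy] with t ht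
    exact (hl' hy ht.2 ht.1).le
  have hrc : ∀ x > xc, u.u0 x < u.u0 xc := fun x hx => by
    obtain ⟨y, hxy, hy⟩ := exists_between hx
    refine (hr' hxy hx hy).trans_le (ge_of_tendsto
      (u.continuous_u0.continuousAt.tendsto.mono_left nhdsWithin_le_nhds : Tendsto _ (𝓝[>] xc) _) ?_)
    filter_upwards [Ioo_mem_nhdsGT hxy] with t ht
    exact (hr' ht.1 hxy ht.2).le
  refine ⟨xc, hpos, fun x hx y hy hxy => ?_, fun x hx y hy hxy => ?_⟩
  · rcases (show y ≤ xc from hy).eq_or_lt with rfl | h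
    · exact hlc x hxy
    · exact hl' (hxy.trans h) h hxy
  · rcases (show xc ≤ x from hx).eq_or_lt with rfl | h
    · exact hrc y hxy
    · exact hr' h (h.trans hxy) hxy

variable {u}

theorem IsPeak.le {xc : ℝ} (h : u.IsPeak xc) (x : ℝ) : u.u0 x ≤ u.u0 xc := by
  rcases le_total x xc with hx | hx
  · exact h.mono.monotoneOn hx Set.self_mem_Iic hx
  · exact h.anti.antitoneOn Set.self_mem_Ici hx hx

theorem IsPeak.iSup_eq {xc : ℝ} (h : u.IsPeak xc) : ⨆ x, u.u0 x = u.u0 xc :=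
  le_antisymm (ciSup_le h.le) (le_ciSup (f := u.u0) ⟨u.u0 xc, by rintro _ ⟨x, rfl⟩; exact h.le x⟩ xc)

theorem IsPeak.mem_bulk {xc lam : ℝ} (h : u.IsPeak xc) (hlam : lam ∈ u.bulk) :
    -u.u0 xc < lam ∧ lam < 0 := by
  refine ⟨h.iSup_eq ▸ hlam.1, hlam.2.trans_le ?_⟩
  linarith [Real.iInf_nonneg fun x => (h.pos x).le]

/-- The turning points. -/
theorem IsPeak.turning {xc lam : ℝ} (h : u.IsPeak xc) (h1 : -u.u0 xc < lam) (h2 : lam < 0) :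
    u.u0 (u.xMinus lam) = -lam ∧ u.u0 (u.xPlus lam) = -lam ∧ u.xMinus lam < xc ∧
      xc < u.xPlus lam := by
  have hl : ∃ x < xc, u.u0 x = -lam := by
    obtain ⟨y, hy1, hy2⟩ := (((u.tendsto_u0 tendsto_abs_atBot_atTop).eventually_lt_const
      (show 0 < -lam by linarith)).and (eventually_lt_atBot xc)).exists
    obtain ⟨x, hx, hx'⟩ := intermediate_value_Icc hy2.le u.continuous_u0.continuousOn
      (show -lam ∈ Set.Icc _ _ from ⟨hy1.le, by linarith⟩)
    refine ⟨x, lt_of_le_of_ne hx.2 ?_, hx'⟩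
    rintro rfl
    linarith
  have hr : ∃ x > xc, u.u0 x = -lam := by
    obtain ⟨y, hy1, hy2⟩ := (((u.tendsto_u0 tendsto_abs_atTop_atTop).eventually_lt_const
      (show 0 < -lam by linarith)).and (eventually_gt_atTop xc)).exists
    obtain ⟨x, hx, hx'⟩ := intermediate_value_Icc' hy2.le u.continuous_u0.continuousOn
      (show -lam ∈ Set.Icc _ _ from ⟨hy1.le, by linarith⟩)
    refine ⟨x, lt_of_le_of_ne hx.1 ?_, hx'⟩
    rintro rfl
    linarith
  obtain ⟨a, ha, hau⟩ := hl
  obtain ⟨b, hb, hbu⟩ := hr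
  have hset : {x : ℝ | u.u0 x = -lam} = {a, b} := by
    ext x
    simp only [Set.mem_ofPred_eq, Set.mem_insert_iff, Set.mem_singleton_iff]
    refine ⟨fun hx => ?_, by rintro (rfl | rfl) <;> assumption⟩
    rcases le_total x xc with hxc | hxc
    · exact Or.inl (h.mono.injOn hxc ha.le (hx.trans hau.symm))
    · exact Or.inr (h.anti.injOn hxc hb.le (hx.trans hbu.symm))
  have hab : a ≤ b := (ha.trans hb).le
  have e1 : u.xMinus lam = a := by rw [xMinus, hset, csInf_pair, min_eq_left hab]
  have e2 : u.xPlus lam = b := by rw [xPlus, hset, csSup_pair, max_eq_right hab]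
  rw [e1, e2]
  exact ⟨hau, hbu, ha, hb⟩

theorem IsPeak.lt_iff {xc lam : ℝ} (h : u.IsPeak xc) (h1 : -u.u0 xc < lam) (h2 : lam < 0) (x : ℝ) :
    -lam < u.u0 x ↔ u.xMinus lam < x ∧ x < u.xPlus lam := by
  obtain ⟨ha, hb, hac, hcb⟩ := h.turning h1 h2
  rcases le_total x xc with hx | hx
  · rw [← ha, h.mono.lt_iff_lt hac.le hx]
    exact ⟨fun h' => ⟨h', hx.trans_lt hcb⟩, fun h' => h'.1⟩
  · rw [← hb, h.anti.lt_iff_gt hcb.le hx]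
    exact ⟨fun h' => ⟨hac.trans_le hx, h'⟩, fun h' => h'.2⟩

theorem IsPeak.continuousAt_xPlus {xc lam : ℝ} (h : u.IsPeak xc) (h1 : -u.u0 xc < lam)
    (h2 : lam < 0) : ContinuousAt u.xPlus lam := by
  obtain ⟨-, hb, -, hcb⟩ := h.turning h1 h2
  have ev : ∀ᶠ mu in 𝓝 lam, -u.u0 xc < mu ∧ mu < 0 := Ioo_mem_nhds h1 h2
  refine tendsto_order.2 ⟨fun y hy => ?_, fun y hy => ?_⟩
  · have h3 : -lam < u.u0 (max y xc) := by
      rw [← hb]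
      exact h.anti (Set.mem_Ici.2 (le_max_right _ _)) hcb.le (max_lt hy hcb)
    filter_upwards [ev, lt_mem_nhds (show -u.u0 (max y xc) < lam by linarith)] with mu hmu hmu'
    exact (le_max_left _ _).trans_lt ((h.lt_iff hmu.1 hmu.2 _).1 (by linarith)).2
  · have h3 : u.u0 y < -lam := by
      rw [← hb]
      exact h.anti hcb.le (hcb.trans hy).le hy
    filter_upwards [ev, gt_mem_nhds (show lam < -u.u0 y by linarith)] with mu hmu hmu'
    obtain ⟨-, hb', -, hcb'⟩ := h.turning hmu.1 hmu.2
    exact (h.anti.lt_iff_gt (hcb.trans hy).le hcb'.le).1 (by rw [hb']; linarith)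

theorem IsPeak.continuousAt_xMinus {xc lam : ℝ} (h : u.IsPeak xc) (h1 : -u.u0 xc < lam)
    (h2 : lam < 0) : ContinuousAt u.xMinus lam := by
  obtain ⟨hb, -, hcb, -⟩ := h.turning h1 h2
  have ev : ∀ᶠ mu in 𝓝 lam, -u.u0 xc < mu ∧ mu < 0 := Ioo_mem_nhds h1 h2
  refine tendsto_order.2 ⟨fun y hy => ?_, fun y hy => ?_⟩
  · have h3 : u.u0 y < -lam := by
      rw [← hb]
      exact h.mono (hy.trans hcb).le hcb.le hy
    filter_upwards [ev, gt_mem_nhds (show lam < -u.u0 y by linarith)] with mu hmu hmu'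
    obtain ⟨hb', -, hcb', -⟩ := h.turning hmu.1 hmu.2
    exact (h.mono.lt_iff_lt (hy.trans hcb).le hcb'.le).1 (by rw [hb']; linarith)
  · have h3 : -lam < u.u0 (min y xc) := by
      rw [← hb]
      exact h.mono hcb.le (Set.mem_Iic.2 (min_le_right _ _)) (lt_min hy hcb)
    filter_upwards [ev, lt_mem_nhds (show -u.u0 (min y xc) < lam by linarith)] with mu hmu hmu'
    exact ((h.lt_iff hmu.1 hmu.2 _).1 (by linarith)).1.trans_le (min_le_left _ _)

variable (u)

theorem hasDerivAt_f_ofReal (x : ℝ) : HasDerivAt u.f (u.u0C x) x :=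
  u.hasDerivAt_f (fun p => u.neg_im_lt_ofReal x p) fun p => Or.inl (u.ofReal_im_lt x p)

theorem f_ofReal_im (x : ℝ) : (u.f x).im = 0 := by
  rw [← Complex.conj_eq_iff_im, f, map_sum]
  refine Finset.sum_congr rfl fun p _ => ?_
  have h1 : conj (Complex.log (Complex.I * (x - u.z p))) =
      Complex.log (-Complex.I * (x - conj (u.z p))) := by
    rw [← Complex.log_conj]
    · simp
    · intro h
      have h3 := u.z_im_pos p
      have := Complex.arg_eq_pi_iff.1 h
      simp at this
      linarith [this.1]
  have h2 : conj (Complex.log (-Complex.I * (x - conj (u.z p)))) =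
      Complex.log (Complex.I * (x - u.z p)) := by
    rw [← h1, Complex.conj_conj]
  simp only [map_add, map_mul, map_sub, map_div₀, h1, h2, Complex.conj_conj, Complex.conj_ofReal,
    Complex.conj_I, Complex.conj_ofNat]
  ring

theorem h_sub_h (lam x y : ℝ) :
    u.h lam y - u.h lam x = ((∫ t in x..y, (lam + u.u0 t) : ℝ) : ℂ) := by
  have hd : ∀ t : ℝ, HasDerivAt (fun t : ℝ => u.h lam t) ((lam + u.u0 t : ℝ) : ℂ) t := fun t => by
    have h1 := (((hasDerivAt_id (t : ℂ)).const_mul (lam : ℂ)).add (u.hasDerivAt_f_ofReal t)).comp_ofReal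
    simpa [u0C_ofReal, h] using h1
  rw [← intervalIntegral.integral_ofReal]
  refine (intervalIntegral.integral_eq_sub_of_hasDerivAt (fun t _ => hd t) ?_).symm
  exact (Complex.continuous_ofReal.comp (continuous_const.add u.continuous_u0)).intervalIntegrable _ _

-- Both sides are the area between the graph of `u₀` and the level `-λ`. The layer-cake formula
-- computes it by horizontal slices, and the slice at height `t` is the interval between the turning
-- points of `λ - t`. No differentiability of the turning points is used.
open MeasureTheory in
variable {u} in
theorem IsPeak.integral_turning {xc lam : ℝ} (h : u.IsPeak xc) (h1 : -u.u0 xc < lam)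
    (h2 : lam < 0) :
    ∫ eta in (-(⨆ x, u.u0 x))..lam, (u.xPlus eta - u.xMinus eta) =
      ∫ t in (u.xMinus lam)..(u.xPlus lam), (lam + u.u0 t) := by
  obtain ⟨ha, hb, hac, hcb⟩ := h.turning h1 h2
  set g : ℝ → ℝ := fun x => max (lam + u.u0 x) 0 with hg
  have hgc : Continuous g := (continuous_const.add u.continuous_u0).max continuous_const
  have hg0 : ∀ x, x ∉ Set.Ioo (u.xMinus lam) (u.xPlus lam) → g x = 0 := fun x hx => by
    refine max_eq_right ?_
    by_contra hc
    exact hx ((h.lt_iff h1 h2 x).1 (by linarith))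
  have hgI : ∀ x ∈ Set.Ioo (u.xMinus lam) (u.xPlus lam), g x = lam + u.u0 x := fun x hx =>
    max_eq_left (by linarith [(h.lt_iff h1 h2 x).2 hx])
  have hsupp : HasCompactSupport g := HasCompactSupport.intro (isCompact_Icc (a := u.xMinus lam)
    (b := u.xPlus lam)) fun x hx => hg0 x fun h' => hx (Set.Ioo_subset_Icc_self h')
  have hgint : Integrable g := hgc.integrable_of_hasCompactSupport hsupp
  have hlc := hgint.integral_eq_integral_meas_lt (Eventually.of_forall fun x => le_max_right _ _)
  have e1 : ∫ x, g x = ∫ t in (u.xMinus lam)..(u.xPlus lam), (lam + u.u0 t) := by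
    rw [intervalIntegral.integral_of_le (hac.trans hcb).le, integral_Ioc_eq_integral_Ioo,
      ← setIntegral_congr_fun measurableSet_Ioo hgI]
    exact (setIntegral_eq_integral_of_forall_compl_eq_zero hg0).symm
  have e2 : ∀ t ∈ Set.Ioi (0 : ℝ), volume.real {a | t < g a} =
      (Set.Ioo 0 (lam + u.u0 xc)).indicator
        (fun t => u.xPlus (lam - t) - u.xMinus (lam - t)) t := fun t ht => by
    have ht0 : 0 < t := ht
    have hset : {a | t < g a} = {a | t < lam + u.u0 a} := by
      ext a
      simp only [hg, Set.mem_ofPred_eq, lt_max_iff, or_iff_left ht0.not_gt]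
    rw [hset]
    by_cases htc : t < lam + u.u0 xc
    · have hl1 : -u.u0 xc < lam - t := by linarith
      have hl2 : lam - t < 0 := by linarith
      have : {a | t < lam + u.u0 a} = Set.Ioo (u.xMinus (lam - t)) (u.xPlus (lam - t)) := by
        ext a
        rw [Set.mem_Ioo, ← h.lt_iff hl1 hl2, Set.mem_ofPred_eq]
        constructor <;> intro <;> linarith
      obtain ⟨-, -, q1, q2⟩ := h.turning hl1 hl2
      rw [this, Set.indicator_of_mem (show t ∈ Set.Ioo 0 _ from ⟨ht0, htc⟩),
        Real.volume_real_Ioo_of_le (q1.trans q2).le]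
    · have : {a | t < lam + u.u0 a} = ∅ := by
        ext a
        simp only [Set.mem_ofPred_eq, Set.mem_empty_iff_false, iff_false, not_lt]
        linarith [h.le a]
      rw [this, Set.indicator_of_notMem (fun h' => htc h'.2), measureReal_empty]
  rw [← e1, hlc, setIntegral_congr_fun measurableSet_Ioi e2,
    setIntegral_indicator measurableSet_Ioo,
    Set.inter_eq_right.2 (show Set.Ioo 0 (lam + u.u0 xc) ⊆ Set.Ioi 0 from fun t ht => ht.1),
    ← integral_Ioc_eq_integral_Ioo, ← intervalIntegral.integral_of_le (by linarith),
    intervalIntegral.integral_comp_sub_left (fun t => u.xPlus t - u.xMinus t), h.iSup_eq]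
  congr 1 <;> ring

end RationalPotential

/-! ### Holomorphy of the Evans matrix in the spectral parameter. -/

open MeasureTheory Metric in
/-- Laplace type integrals are holomorphic in the spectral parameter. -/
theorem differentiableAt_integral_cexp {α : Type*} [MeasurableSpace α] {μ : Measure α}
    {w k : α → ℂ} {eps : ℝ} (heps : 0 < eps) {B : ℝ}
    (hB : ∀ᵐ t ∂μ, |(w t).re| ≤ B ∧ -B ≤ (w t).im) (hw : AEStronglyMeasurable w μ)
    (hint : ∀ x : ℝ, x < 0 → Integrable (fun t => Complex.exp (-Complex.I * (x * w t) / eps) * k t) μ)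
    {lam : ℂ} (hlam : lam.re < 0) :
    DifferentiableAt ℂ (fun lam => ∫ t, Complex.exp (-Complex.I * (lam * w t) / eps) * k t ∂μ) lam := by
  -- All `l` in the ball of radius `-x₀` about `lam` have `Re l ≤ x₀`. As `Im w` is bounded below
  -- and `Re w` is bounded, the integrand at the real parameter `x₀` dominates.
  set x₀ : ℝ := lam.re / 2 with hx₀
  have hx₀neg : x₀ < 0 := by rw [hx₀]; linarith
  have hexp : ∀ l : ℂ, AEStronglyMeasurable (fun t => Complex.exp (-Complex.I * (l * w t) / eps)) μ :=
    fun l => (by fun_prop : Continuous fun z => Complex.exp (-Complex.I * (l * z) / eps)).comp_aestronglyMeasurable hw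
  -- Measurability of `k` is recovered from that of the integrand at `x₀` by dividing out the
  -- exponential.
  have hk : AEStronglyMeasurable k μ := by
    have h1 := (hexp (-x₀ : ℂ)).mul (hint x₀ hx₀neg).aestronglyMeasurable
    refine h1.congr (Eventually.of_forall fun t => ?_)
    simp only [Pi.mul_apply]
    rw [← mul_assoc, ← Complex.exp_add]
    have : -Complex.I * (-(x₀ : ℂ) * w t) / eps + -Complex.I * (x₀ * w t) / eps = 0 := by ring
    rw [this, Complex.exp_zero, one_mul]
  have hnorm : ∀ (l z : ℂ), ‖Complex.exp (-Complex.I * (l * z) / eps)‖ = Real.exp ((l * z).im / eps) := by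
    intro l z
    rw [Complex.norm_exp, Complex.div_ofReal_re]
    simp
  set M := ‖lam‖ + |x₀| with hM
  refine differentiableAt_integral_of_dominated (r := -x₀) (by linarith)
    ((hint x₀ hx₀neg).norm.const_mul (Real.exp (M * |B| * 4 / eps))) (fun l _ => (hexp l).mul hk) ?_ ?_
  · refine Eventually.of_forall fun t => ?_
    fun_prop
  · filter_upwards [hB] with t ht l hl
    rw [norm_mul, norm_mul, hnorm, hnorm, ← mul_assoc, ← Real.exp_add, ← add_div]
    gcongr
    rw [mem_ball, dist_eq_norm] at hl
    have h1 := (Complex.abs_re_le_norm (l - lam)).trans hl.le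
    have h2 := (Complex.abs_im_le_norm (l - lam)).trans hl.le
    rw [Complex.sub_re, abs_le] at h1
    rw [Complex.sub_im, abs_le] at h2
    have h3 := Complex.abs_im_le_norm lam
    have h4 := Complex.abs_re_le_norm lam
    rw [abs_le] at h3 h4
    have hx₀' : |x₀| = -x₀ := abs_of_neg hx₀neg
    have hM0 : 0 ≤ M := by positivity
    have hBB := le_abs_self B
    have h5 : |l.im| ≤ M := abs_le.2 ⟨by linarith, by linarith⟩
    have h6 : l.re ≤ x₀ := by linarith
    have h7 : l.im * (w t).re ≤ M * |B| := by
      refine (le_abs_self _).trans ?_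
      rw [abs_mul]
      exact mul_le_mul h5 (ht.1.trans hBB) (abs_nonneg _) hM0
    have h8 : (l.re - x₀) * (w t).im ≤ 3 * (M * |B|) := by
      have h9 : (l.re - x₀) * ((w t).im + |B|) ≤ 0 :=
        mul_nonpos_of_nonpos_of_nonneg (by linarith) (by linarith [ht.2])
      have h10 : (x₀ - l.re) * |B| ≤ (3 * M) * |B| := by gcongr; linarith
      nlinarith
    have h11 : (x₀ * w t).im = x₀ * (w t).im := by simp
    rw [h11, Complex.mul_im]
    linarith

open MeasureTheory in
theorem differentiableAt_upwardRay_cexp {K₀ : ℂ → ℂ} {eps : ℝ} (heps : 0 < eps) {w₀ : ℂ}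
    (hc : ContinuousOn (fun y : ℝ => K₀ (w₀ + Complex.I * y)) (Set.Ici 0)) {R C : ℝ}
    (hb : ∀ x : ℝ, x < 0 → ∀ w : ℂ, R ≤ w.im →
      ‖Complex.exp (-Complex.I * (x * w) / eps) * K₀ w‖ ≤ C * Real.exp ((x * w : ℂ).im / eps))
    {lam : ℂ} (hlam : lam.re < 0) :
    DifferentiableAt ℂ (fun lam =>
      upwardRay (fun w => Complex.exp (-Complex.I * (lam * w) / eps) * K₀ w) w₀) lam := by
  unfold upwardRay
  simp_rw [mul_assoc (Complex.exp _)]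
  refine (differentiableAt_integral_cexp (k := fun y : ℝ => K₀ (w₀ + Complex.I * y) * Complex.I)
    (w := fun y : ℝ => w₀ + Complex.I * y) heps
    (B := |w₀.re| + |w₀.im|) ?_ (by fun_prop) ?_ hlam).neg
  · filter_upwards [ae_restrict_mem measurableSet_Ioi] with y hy
    rw [RationalPotential.add_I_mul_im, RationalPotential.add_I_mul_re]
    have := neg_abs_le w₀.im
    have h2 := abs_nonneg w₀.re
    exact ⟨by linarith [abs_nonneg w₀.im], by linarith [show (0 : ℝ) < y from hy]⟩
  · intro x hx
    have hcont : ContinuousOn (fun y : ℝ => Complex.exp (-Complex.I * (x * (w₀ + Complex.I * y)) / eps) *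
        (K₀ (w₀ + Complex.I * y) * Complex.I)) (Set.Ici 0) :=
      ContinuousOn.mul (by fun_prop) (hc.mul continuousOn_const)
    refine (integrable_norm_iff ((hcont.mono Set.Ioi_subset_Ici_self).aestronglyMeasurable
      measurableSet_Ioi)).1 ?_
    rw [← IntegrableOn]
    refine integrable_of_isBigO_exp_neg (b := -x / eps) (div_pos (by linarith) heps) hcont.norm ?_
    · refine Asymptotics.IsBigO.of_bound (|C| * Real.exp ((x * w₀ : ℂ).im / eps)) ?_
      filter_upwards [eventually_ge_atTop (R - w₀.im)] with y hy
      have := hb x hx (w₀ + Complex.I * y) (by rw [RationalPotential.add_I_mul_im]; linarith)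
      rw [norm_norm, ← mul_assoc, norm_mul, Complex.norm_I, mul_one, Real.norm_eq_abs,
        abs_of_pos (Real.exp_pos _)]
      refine this.trans ?_
      rw [im_mul_add_I_mul, Complex.ofReal_re, mul_assoc, ← Real.exp_add]
      have h1 : ((x * w₀ : ℂ).im + x * y) / eps = (x * w₀ : ℂ).im / eps + -(-x / eps) * y := by ring
      rw [h1]
      gcongr
      exact le_abs_self C

open MeasureTheory in
theorem differentiableAt_intervalIntegral_cexp {w K₀ : ℝ → ℂ} {eps : ℝ} (heps : 0 < eps) {a b : ℝ}
    (hw : Continuous w) (hc : ContinuousOn K₀ (Set.uIcc a b)) {lam : ℂ} (hlam : lam.re < 0) :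
    DifferentiableAt ℂ (fun lam =>
      ∫ t in a..b, Complex.exp (-Complex.I * (lam * w t) / eps) * K₀ t) lam := by
  have key : ∀ c d : ℝ, Set.Icc c d ⊆ Set.uIcc a b → DifferentiableAt ℂ (fun lam =>
      ∫ t in Set.Ioc c d, Complex.exp (-Complex.I * (lam * w t) / eps) * K₀ t) lam := by
    intro c d hcd
    obtain ⟨B, hB⟩ := (isCompact_Icc (a := c) (b := d)).exists_bound_of_continuousOn hw.continuousOn
    refine differentiableAt_integral_cexp heps (B := B) ?_ (by fun_prop) (fun x _ => ?_) hlam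
    · filter_upwards [ae_restrict_mem measurableSet_Ioc] with t ht
      have := hB t (Set.Ioc_subset_Icc_self ht)
      exact ⟨(Complex.abs_re_le_norm _).trans this,
        (abs_le.1 ((Complex.abs_im_le_norm _).trans this)).1⟩
    · refine (ContinuousOn.integrableOn_Icc ?_).mono_set Set.Ioc_subset_Icc_self
      exact ContinuousOn.mul (by fun_prop) (hc.mono hcd)
  unfold intervalIntegral
  exact (key a b Set.Icc_subset_uIcc).sub (key b a Set.Icc_subset_uIcc')

open Metric in
/-- Holomorphic functions that agree on a real interval agree on the ball around it. -/
theorem eqOn_ball_of_eq_ofReal {f g : ℂ → ℂ} {x₀ r : ℝ} (hr : 0 < r)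
    (hf : DifferentiableOn ℂ f (ball (x₀ : ℂ) r)) (hg : DifferentiableOn ℂ g (ball (x₀ : ℂ) r))
    (h : ∀ x : ℝ, |x - x₀| < r → f x = g x) : Set.EqOn f g (ball (x₀ : ℂ) r) := by
  refine (hf.analyticOnNhd isOpen_ball).eqOn_of_preconnected_of_frequently_eq
    (hg.analyticOnNhd isOpen_ball) (convex_ball _ _).isPreconnected (mem_ball_self hr) ?_
  have hlim : Tendsto (fun x : ℝ => (x : ℂ)) (𝓝[≠] x₀) (𝓝[≠] (x₀ : ℂ)) :=
    tendsto_nhdsWithin_iff.2 ⟨Complex.continuous_ofReal.continuousAt.tendsto.mono_left nhdsWithin_le_nhds,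
      by filter_upwards [self_mem_nhdsWithin] with x hx using by simpa using hx⟩
  refine hlim.frequently (Eventually.frequently ?_)
  filter_upwards [nhdsWithin_le_nhds (ball_mem_nhds x₀ hr)] with x hx
  exact h x (by rwa [mem_ball, Real.dist_eq] at hx)

namespace RationalPotential

variable {P : ℕ} (u : RationalPotential P)

theorem kern_eq (eps : ℝ) (lam : ℂ) (p : Fin P) : u.kern eps lam p =
    fun w => Complex.exp (-Complex.I * (lam * w) / eps) * u.kern eps 0 p w := by
  ext w
  simp only [kern, expH]
  rw [← mul_div_assoc, ← Complex.exp_add]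
  ring_nf

theorem regKern_eq_cexp (eps : ℝ) (lam : ℂ) (m : Fin P) (n : ℕ) (p : Fin P) :
    u.regKern eps lam m n p =
      fun w => Complex.exp (-Complex.I * (lam * w) / eps) * u.regKern eps 0 m n p w := by
  ext w
  have : u.regExp eps lam m n w =
      Complex.exp (-Complex.I * (lam * w) / eps) * u.regExp eps 0 m n w := by
    have h : -Complex.I * (lam * w + u.regPart m w) / eps = -Complex.I * (lam * w) / eps +
        -Complex.I * (0 * w + u.regPart m w) / eps := by ring
    rw [regExp, regExp, h, Complex.exp_add, mul_assoc]
  simp only [regKern, this]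
  split_ifs <;> ring

theorem differentiableAt_upwardRay_kern {eps : ℝ} (heps : 0 < eps) (p : Fin P) {a : ℝ}
    (ha : u.Generic (a : ℂ)) {lam : ℂ} (hlam : lam.re < 0) :
    DifferentiableAt ℂ (fun lam => upwardRay (u.kern eps lam p) a) lam := by
  obtain ⟨M, hM, hf⟩ := u.exists_norm_f_le
  have h := differentiableAt_upwardRay_cexp (K₀ := u.kern eps 0 p) heps (w₀ := a) ?_
    (R := u.bigRadius) (C := Real.exp (M / eps) * (2 / u.bigRadius)) ?_ hlam
  · refine h.congr_of_eventuallyEq (Eventually.of_forall fun l => ?_)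
    simp only [u.kern_eq eps l]
  · intro y hy
    refine ContinuousAt.continuousWithinAt ?_
    refine ContinuousAt.comp (f := fun y : ℝ => (a : ℂ) + Complex.I * y) (g := u.kern eps 0 p) ?_
      (by fun_prop)
    refine (u.differentiableAt_kern (fun q => ?_) (fun q => Or.inr ?_) eps 0 p).continuousAt
    · rw [add_I_mul_im, Complex.ofReal_im]
      linarith [u.z_im_pos q, show (0 : ℝ) ≤ y from hy]
    · rw [add_I_mul_re]
      exact ha q
  · intro x _ w hw
    have := u.exists_norm_exp_div_le heps x hf p w (le_norm_of_le_im hw)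
    have h2 := congrFun (u.kern_eq eps x p) w
    rw [← h2]
    exact this

variable {u} in
theorem Resonant.differentiableAt_upwardRay_regKern {eps : ℝ} (heps : 0 < eps) {m : Fin P} {n : ℕ}
    (h : u.Resonant eps m n) (p : Fin P) {lam : ℂ} (hlam : lam.re < 0) :
    DifferentiableAt ℂ (fun lam => upwardRay (u.regKern eps lam m n p) (u.z m)) lam := by
  obtain ⟨M, hM, hf⟩ := u.exists_norm_f_le
  have h' := differentiableAt_upwardRay_cexp (K₀ := u.regKern eps 0 m n p) heps (w₀ := u.z m) ?_
    (R := u.bigRadius) (C := Real.exp (M / eps) * (2 / u.bigRadius)) ?_ hlam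
  · refine h'.congr_of_eventuallyEq (Eventually.of_forall fun l => ?_)
    simp only [u.regKern_eq_cexp eps l]
  · intro y hy
    refine ContinuousAt.continuousWithinAt ?_
    refine ContinuousAt.comp (f := fun y : ℝ => u.z m + Complex.I * y) (g := u.regKern eps 0 m n p) ?_
      (by fun_prop)
    have hzm : u.z m ∈ u.strip m := u.mem_strip_of_re_eq
      (fun q => by linarith [u.z_im_pos q, u.z_im_pos m]) rfl
    exact (u.differentiableAt_regKern eps 0 m n p
      (u.upward_halfStrip _ _ _ hzm y hy)).continuousAt
  · intro x _ w hw
    have hw' := le_norm_of_le_im hw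
    have := u.exists_norm_exp_div_le heps x hf p w hw'
    have h2 := congrFun (u.regKern_eq_cexp eps x m n p) w
    rw [← h2, h.regKern_eq x p fun e => by
      have := u.two_mul_norm_z_lt m
      rw [e] at hw'
      linarith [norm_nonneg (u.z m)]]
    exact this

theorem differentiableAt_integral_kern_ofReal {eps : ℝ} (heps : 0 < eps) (p : Fin P) (a b : ℝ)
    {lam : ℂ} (hlam : lam.re < 0) :
    DifferentiableAt ℂ (fun lam => ∫ x in a..b, u.kern eps lam p (x : ℂ)) lam := by
  have h := differentiableAt_intervalIntegral_cexp (w := fun x : ℝ => (x : ℂ))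
    (K₀ := fun x : ℝ => u.kern eps 0 p x) heps (a := a) (b := b) (by fun_prop)
    (u.continuous_kern_ofReal eps 0 p).continuousOn hlam
  refine h.congr_of_eventuallyEq (Eventually.of_forall fun l => ?_)
  simp only [u.kern_eq eps l]

theorem generic_leftAbscissa (m : Fin P) : u.Generic (u.leftAbscissa m : ℂ) := fun p => by
  rw [Complex.ofReal_re]
  have : (u.z ⟨0, m.pos⟩).re ≤ (u.z p).re := u.re_le_re (Fin.le_def.2 (Nat.zero_le _))
  rw [leftAbscissa]
  linarith

/-- The Evans matrix is holomorphic in the spectral parameter. -/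
theorem differentiableAt_AC {eps : ℝ} (heps : 0 < eps) (m p : Fin P) {lam : ℂ} (hlam : lam.re < 0) :
    DifferentiableAt ℂ (fun lam => u.AC eps lam m p) lam := by
  have hU : ∀ b : ℝ, u.Generic (b : ℂ) → DifferentiableAt ℂ (fun lam =>
      upwardRay (u.kern eps lam p) (u.leftAbscissa m) +
        (∫ x in (u.leftAbscissa m)..b, u.kern eps lam p (x : ℂ)) -
        upwardRay (u.kern eps lam p) b) lam := fun b hb =>
    ((u.differentiableAt_upwardRay_kern heps p (u.generic_leftAbscissa m) hlam).add
      (u.differentiableAt_integral_kern_ofReal heps p _ _ hlam)).sub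
      (u.differentiableAt_upwardRay_kern heps p hb hlam)
  have hneg : ∀ᶠ l : ℂ in 𝓝 lam, l.re < 0 :=
    Complex.continuous_re.continuousAt.eventually_lt_const hlam
  by_cases h : ∃ n : ℕ, 0 < n ∧ Complex.I * u.c m / eps = -(n : ℂ)
  · obtain ⟨n, hn⟩ := h
    have hres : u.Resonant eps m n := hn
    have h2 := (hU (u.prevAbscissa m) (u.generic_of_halfStrip (fun p => lt_or_ge p m)
      (u.prevAbscissa_mem m))).add (hres.differentiableAt_upwardRay_regKern heps p hlam)
    refine h2.congr_of_eventuallyEq ?_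
    filter_upwards [hneg] with l hl
    rw [AC, integralC, if_pos ⟨n, hn⟩, hres.integralL_eq heps hl]
    rfl
  · refine (hU (u.rightAbscissa m) (u.generic_of_halfStrip (fun p => le_or_gt p m)
      (u.rightAbscissa_mem m))).congr_of_eventuallyEq (Eventually.of_forall fun l => ?_)
    simp only [AC]
    rw [integralC, if_neg h]
    rfl

-- Suitability relates the contours to `N A` only for real parameters; the identity theorem extends
-- the relation to complex ones, where the zeros are sought.
open Metric in
theorem mul_AC_eqOn_ball {eps : ℝ} (heps : 0 < eps) (N : Matrix (Fin P) (Fin P) ℂ) (m p : Fin P)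
    {row : ℂ → ℂ} {x₀ r : ℝ} (hr : 0 < r) (hx : x₀ + r ≤ 0)
    (hrow : DifferentiableOn ℂ row (ball (x₀ : ℂ) r))
    (h : ∀ mu : ℝ, |mu - x₀| < r → (N * u.A eps mu) m p = row mu) {lam : ℂ}
    (hlam : lam ∈ ball (x₀ : ℂ) r) : (N * u.AC eps lam) m p = row lam := by
  have hneg : ∀ l ∈ ball (x₀ : ℂ) r, l.re < 0 := fun l hl => by
    rw [mem_ball, dist_eq_norm] at hl
    have := (abs_lt.1 ((Complex.abs_re_le_norm (l - x₀)).trans_lt hl)).2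
    rw [Complex.sub_re, Complex.ofReal_re] at this
    linarith
  refine eqOn_ball_of_eq_ofReal (f := fun l => (N * u.AC eps l) m p) hr (fun l hl => ?_) hrow h hlam
  simp only [Matrix.mul_apply]
  exact (DifferentiableAt.fun_sum fun q _ =>
    (u.differentiableAt_AC heps q p (hneg l hl)).const_mul _).differentiableWithinAt

end RationalPotential

/-! ### The tails of the contours. -/

namespace RationalPotential

variable {P : ℕ} (u : RationalPotential P)

/-- The antiderivative of `u₀` above all poles. -/
noncomputable def fAbove (w : ℂ) : ℂ :=
  ∑ p, (u.c p * (Complex.log (-Complex.I * (w - u.z p)) + Real.pi * Complex.I / 2) +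
    conj (u.c p) *
      (Complex.log (-Complex.I * (w - conj (u.z p))) - Real.pi * Complex.I / 2))

theorem im_z_lt_bigRadius (p : Fin P) : (u.z p).im < u.bigRadius := by
  have := u.two_mul_norm_z_lt p
  linarith [Complex.im_le_norm (u.z p), norm_nonneg (u.z p)]

theorem hasDerivAt_fAbove {w : ℂ} (hw : u.bigRadius < w.im) : HasDerivAt u.fAbove (u.u0C w) w := by
  unfold fAbove u0C
  refine HasDerivAt.fun_sum fun p _ => HasDerivAt.add ?_ (u.hasDerivAt_conjLogPart ?_)
  · have h := ((hasDerivAt_log_neg_I_mul (z := u.z p)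
      (Or.inl ((u.im_z_lt_bigRadius p).trans hw))).add_const (Real.pi * Complex.I / 2)).const_mul (u.c p)
    rwa [mul_one_div] at h
  · linarith [u.z_im_pos p, u.bigRadius_pos]

theorem exists_norm_fAbove_le : ∃ M > 0, ∀ w, u.bigRadius ≤ ‖w‖ → ‖u.fAbove w‖ ≤ M := by
  obtain ⟨M, hM, hf⟩ := u.exists_norm_f_le
  have hpi := Real.pi_pos
  refine ⟨M + ∑ p, ‖u.c p‖ * (2 * Real.pi), by positivity, fun w hw => ?_⟩
  have h1 : u.fAbove w = u.f w + ∑ p, u.c p * (((Complex.arg (-Complex.I * (w - u.z p)) -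
      Complex.arg (Complex.I * (w - u.z p)) : ℝ) : ℂ) * Complex.I) := by
    rw [fAbove, f, ← Finset.sum_add_distrib]
    refine Finset.sum_congr rfl fun p _ => ?_
    rw [Complex.log.eq_def (-Complex.I * (w - u.z p)), Complex.log.eq_def (Complex.I * (w - u.z p)),
      norm_mul, norm_mul, norm_neg]
    push_cast
    ring
  rw [h1]
  refine (norm_add_le _ _).trans (add_le_add (hf w hw) ((norm_sum_le _ _).trans
    (Finset.sum_le_sum fun p _ => ?_)))
  rw [norm_mul, norm_mul, Complex.norm_I, mul_one, Complex.norm_real, Real.norm_eq_abs]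
  gcongr
  have h2 := abs_le.1 (Complex.abs_arg_le_pi (-Complex.I * (w - u.z p)))
  have h3 := abs_le.1 (Complex.abs_arg_le_pi (Complex.I * (w - u.z p)))
  rw [abs_le]
  constructor <;> linarith

theorem convex_im_gt (R : ℝ) : Convex ℝ {w : ℂ | R < w.im} :=
  (convex_Ioi R).linear_preimage Complex.imLm

theorem isOpen_im_gt (R : ℝ) : IsOpen {w : ℂ | R < w.im} :=
  isOpen_lt continuous_const Complex.continuous_im

/-- The integrand above all poles, for the branch `fAbove + k`. -/
noncomputable def kernAbove (k : ℂ) (eps : ℝ) (lam : ℂ) (p : Fin P) (w : ℂ) : ℂ :=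
  Complex.exp (-Complex.I * (lam * w + (u.fAbove w + k)) / eps) / (w - u.z p)

theorem differentiableAt_kernAbove (k : ℂ) (eps : ℝ) (lam : ℂ) (p : Fin P) {w : ℂ}
    (hw : u.bigRadius < w.im) : DifferentiableAt ℂ (u.kernAbove k eps lam p) w := by
  refine (hasDerivAt_exp_phase eps lam
    ((u.hasDerivAt_fAbove hw).add_const k)).differentiableAt.div (by fun_prop) fun h => ?_
  rw [sub_eq_zero.1 h] at hw
  exact hw.not_gt (u.im_z_lt_bigRadius p)

theorem exists_norm_kernAbove_le (k : ℂ) : ∃ M > 0, ∀ eps : ℝ, 0 < eps → ∀ (lam : ℂ) (p : Fin P)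
    (w : ℂ), u.bigRadius ≤ ‖w‖ → ‖u.kernAbove k eps lam p w‖ ≤
      Real.exp (M / eps) * (2 / u.bigRadius) * Real.exp ((lam * w).im / eps) := by
  obtain ⟨M, hM, hf⟩ := u.exists_norm_fAbove_le
  refine ⟨M + ‖k‖, by positivity, fun eps heps lam p w hw => ?_⟩
  exact u.exists_norm_exp_div_le (F := fun w => u.fAbove w + k) heps lam
    (fun w hw => (norm_add_le _ _).trans (add_le_add (hf w hw) le_rfl)) p w hw

theorem hasDerivAt_upwardRay_kernAbove (k : ℂ) {eps : ℝ} (heps : 0 < eps) {lam : ℂ}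
    (hlam : lam.re < 0) (p : Fin P) {w : ℂ} (hw : u.bigRadius < w.im) :
    HasDerivAt (upwardRay (u.kernAbove k eps lam p)) (u.kernAbove k eps lam p w) w := by
  obtain ⟨M, hM, hb⟩ := u.exists_norm_kernAbove_le k
  refine hasDerivAt_upwardRay_of_decay (convex_im_gt u.bigRadius) (isOpen_im_gt _)
    (fun z hz y hy => ?_)
    (fun z hz => (u.differentiableAt_kernAbove k eps lam p hz).differentiableWithinAt) heps hlam
    ⟨u.bigRadius, _, fun z _ hz => hb eps heps lam p z (le_norm_of_le_im hz)⟩ hw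
  have hz' : u.bigRadius < z.im := hz
  change u.bigRadius < (z + Complex.I * y).im
  rw [add_I_mul_im]
  linarith

-- Since `M` depends neither on `ε` nor on `λ`, the bound is as small exponentially as desired once
-- `Im w` is large.
open MeasureTheory in
theorem exists_norm_upwardRay_kernAbove_le (k : ℂ) : ∃ M > 0, ∀ eps : ℝ, 0 < eps → ∀ lam : ℂ,
    lam.re < 0 → ∀ (p : Fin P) (w : ℂ), u.bigRadius ≤ w.im →
      ‖upwardRay (u.kernAbove k eps lam p) w‖ ≤
        (2 / u.bigRadius) * (eps / -lam.re) * Real.exp ((M + (lam * w).im) / eps) := by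
  obtain ⟨M, hM, hb⟩ := u.exists_norm_kernAbove_le k
  refine ⟨M, hM, fun eps heps lam hlam p w hw => ?_⟩
  have hκ : 0 < -lam.re / eps := div_pos (by linarith) heps
  rw [upwardRay, norm_neg]
  have h1 : ∀ y ∈ Set.Ioi (0 : ℝ), ‖u.kernAbove k eps lam p (w + Complex.I * y) * Complex.I‖ ≤
      Real.exp ((M + (lam * w).im) / eps) * (2 / u.bigRadius) * Real.exp (-(-lam.re / eps) * y) := by
    intro y hy
    have hy' : 0 < y := hy
    have := hb eps heps lam p (w + Complex.I * y)
      (le_norm_of_le_im (by rw [add_I_mul_im]; linarith))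
    rw [norm_mul, Complex.norm_I, mul_one]
    refine this.trans (le_of_eq ?_)
    have e : ((lam * (w + Complex.I * y)).im) / eps = (lam * w).im / eps + -(-lam.re / eps) * y := by
      rw [im_mul_add_I_mul]; ring
    rw [e, add_div, Real.exp_add, Real.exp_add]
    ring
  have h2 : IntegrableOn (fun y : ℝ => Real.exp ((M + (lam * w).im) / eps) * (2 / u.bigRadius) *
      Real.exp (-(-lam.re / eps) * y)) (Set.Ioi 0) := (exp_neg_integrableOn_Ioi 0 hκ).const_mul _
  refine (norm_integral_le_of_norm_le h2 ?_).trans (le_of_eq ?_)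
  · filter_upwards [ae_restrict_mem measurableSet_Ioi] with y hy using h1 y hy
  · rw [integral_const_mul, integral_exp_mul_Ioi (neg_lt_zero.2 hκ), mul_zero, Real.exp_zero]
    have : lam.re ≠ 0 := hlam.ne
    field_simp

variable {u}

/-- The integrand along a contour for complex spectral parameter. -/
noncomputable def Contour.integrandC (W : u.Contour) (eps : ℝ) (lam : ℂ) (p : Fin P) (t : ℝ) : ℂ :=
  Complex.exp (-Complex.I * (lam * W.γ t + W.F t) / eps) / (W.γ t - u.z p) * deriv W.γ t

theorem Contour.integrandC_ofReal (W : u.Contour) (eps lam : ℝ) (p : Fin P) :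
    W.integrandC eps lam p = W.integrand eps lam p := rfl

theorem Contour.integrandC_eq (W : u.Contour) (eps : ℝ) (l : ℂ) (p : Fin P) :
    W.integrandC eps l p = fun t =>
      Complex.exp (-Complex.I * (l * W.γ t) / eps) * W.integrandC eps 0 p t := by
  ext t
  simp only [integrandC]
  rw [← mul_assoc, ← mul_div_assoc, ← Complex.exp_add]
  ring_nf

theorem norm_cexp_neg_I_mul (z : ℂ) (e : ℝ) :
    ‖Complex.exp (-Complex.I * z / e)‖ = Real.exp (z.im / e) := by
  rw [Complex.norm_exp, Complex.div_ofReal_re]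
  simp

theorem Contour.norm_integrandC (W : u.Contour) (e : ℝ) (l : ℂ) (p : Fin P) (t : ℝ) :
    ‖W.integrandC e l p t‖ =
      Real.exp ((l * W.γ t + W.F t).im / e) * (‖W.γ t - u.z p‖⁻¹ * ‖deriv W.γ t‖) := by
  rw [integrandC, norm_mul, norm_div, norm_cexp_neg_I_mul, div_eq_mul_inv, mul_assoc]

/-- The contour traversed backwards. -/
noncomputable def Contour.reverse (W : u.Contour) : u.Contour where
  γ t := W.γ (-t)
  F t := W.F (-t)
  contDiff := W.contDiff.comp contDiff_neg
  notPole t := W.notPole (-t)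
  hasDerivAt t := by
    have h := (W.hasDerivAt (-t)).scomp t (hasDerivAt_neg t)
    refine h.congr_deriv ?_
    rw [deriv_comp_neg]
    simp
  atBot_end := by
    rcases W.atTop_end with h | ⟨p, h1, h2⟩
    · exact Or.inl (h.comp tendsto_neg_atBot_atTop)
    · exact Or.inr ⟨p, h1.comp tendsto_neg_atBot_atTop, h2.comp tendsto_neg_atBot_atTop⟩
  atTop_end := by
    rcases W.atBot_end with h | ⟨p, h1, h2⟩
    · exact Or.inl (h.comp tendsto_neg_atTop_atBot)
    · exact Or.inr ⟨p, h1.comp tendsto_neg_atTop_atBot, h2.comp tendsto_neg_atTop_atBot⟩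

theorem Contour.reverse_integrand (W : u.Contour) (eps lam : ℝ) (p : Fin P) (t : ℝ) :
    W.reverse.integrand eps lam p t = -W.integrand eps lam p (-t) := by
  have : deriv W.reverse.γ t = -deriv W.γ (-t) := deriv_comp_neg _ _
  rw [integrand, integrand, this, mul_neg]
  rfl

theorem Contour.continuous (W : u.Contour) : Continuous W.γ := W.contDiff.continuous

theorem Contour.hasDerivAt_γ (W : u.Contour) (t : ℝ) : HasDerivAt W.γ (deriv W.γ t) t :=
  (W.contDiff.differentiable one_ne_zero t).hasDerivAt

theorem Contour.continuous_deriv (W : u.Contour) : Continuous (deriv W.γ) :=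
  W.contDiff.continuous_deriv le_rfl

theorem Contour.continuous_F (W : u.Contour) : Continuous W.F :=
  continuous_iff_continuousAt.2 fun t => (W.hasDerivAt t).continuousAt

theorem Contour.continuous_integrandC (W : u.Contour) (eps : ℝ) (lam : ℂ) (p : Fin P) :
    Continuous (W.integrandC eps lam p) := by
  have h1 := W.continuous
  have h2 := W.continuous_F
  have h3 := W.continuous_deriv
  have h4 : ∀ t, W.γ t - u.z p ≠ 0 := fun t => sub_ne_zero.2 (W.notPole t p).1
  unfold integrandC
  fun_prop (disch := assumption)

-- Above all poles the integrand is exact, so for real parameters the tail equals minus the vertical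
-- ray integral from `γ T`. For complex parameters the tail itself may diverge, as `Re γ` is not
-- controlled, while the ray integral is its holomorphic continuation. Its exponent `M + Im(λ γ T)`
-- falls below any `K` for large `T`.
open MeasureTheory Metric in
theorem Contour.exists_tail_infinity (W : u.Contour) {eps₀ : ℝ}
    (hint : ∀ eps : ℝ, 0 < eps → eps < eps₀ → ∀ mu < 0, ∀ p, Integrable (W.integrand eps mu p))
    {Lam₀ : ℝ} (hLam : Lam₀ < 0) (h : Tendsto (fun t => (W.γ t).im) atTop atTop) (K T₀ : ℝ) :
    ∃ T ≥ T₀, ∃ δ > 0, ∃ C > 0, ∀ eps : ℝ, 0 < eps → eps < eps₀ → eps < 1 → ∀ p, ∃ τ : ℂ → ℂ,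
      DifferentiableOn ℂ τ (ball (Lam₀ : ℂ) δ) ∧
      (∀ mu : ℝ, |mu - Lam₀| < δ → ∫ t in Set.Ioi T, W.integrand eps mu p t = τ mu) ∧
      ∀ lam ∈ ball (Lam₀ : ℂ) δ, ‖τ lam‖ ≤ C * Real.exp (K / eps) := by
  obtain ⟨T₁, hT₁⟩ := eventually_atTop.1 (h.eventually_gt_atTop u.bigRadius)
  -- the branch differs from `fAbove` by a constant
  set k := W.F T₁ - u.fAbove (W.γ T₁) with hk
  have hdF : ∀ t ≥ T₁, HasDerivAt (fun t => W.F t - u.fAbove (W.γ t)) 0 t := fun t ht => by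
    have h1 := (W.hasDerivAt t).sub ((u.hasDerivAt_fAbove (hT₁ t ht)).comp t (W.hasDerivAt_γ t))
    rwa [sub_self] at h1
  have hF : ∀ t ≥ T₁, W.F t = u.fAbove (W.γ t) + k := fun t ht => by
    have := (convex_Ici T₁).norm_image_sub_le_of_norm_hasDerivWithin_le (C := 0)
      (fun x hx => (hdF x hx).hasDerivWithinAt) (fun x _ => by simp) Set.self_mem_Ici ht
    rw [zero_mul] at this
    have h2 := sub_eq_zero.1 (norm_le_zero_iff.1 this)
    rw [hk, ← h2]
    ring
  obtain ⟨M, hM, hb⟩ := u.exists_norm_upwardRay_kernAbove_le k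
  have hlim : Tendsto (fun t => M + 1 + Lam₀ / 2 * (W.γ t).im) atTop atBot :=
    tendsto_atBot_add_const_left _ _ ((tendsto_const_mul_atBot_of_neg (by linarith)).2 h)
  obtain ⟨T, ⟨hTK, hTT⟩, hTT₀⟩ := ((hlim.eventually_le_atBot K).and (eventually_ge_atTop T₁)).and
    (eventually_ge_atTop T₀) |>.exists
  -- The first bound keeps `Re λ` below `Lam₀ / 2`, the second keeps `Im λ * Re (γ T)` below `1`.
  refine ⟨T, hTT₀, min (-Lam₀ / 2) (1 / (1 + |(W.γ T).re|)), by
    have : 0 < -Lam₀ / 2 := by linarith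
    positivity, (2 / u.bigRadius) * (1 / (-Lam₀ / 2)), ?_, ?_⟩
  · have := u.bigRadius_pos
    have : 0 < -Lam₀ / 2 := by linarith
    positivity
  intro eps heps heps₀ heps1 p
  have hre : ∀ lam ∈ ball (Lam₀ : ℂ) (min (-Lam₀ / 2) (1 / (1 + |(W.γ T).re|))), lam.re < Lam₀ / 2 ∧
      lam.im * (W.γ T).re ≤ 1 := by
    intro lam hl
    rw [mem_ball, dist_eq_norm, lt_min_iff] at hl
    have h1 := (abs_le.1 ((Complex.abs_re_le_norm (lam - Lam₀)).trans hl.1.le))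
    have h1' := ((Complex.abs_re_le_norm (lam - Lam₀)).trans_lt hl.1)
    have h2 := ((Complex.abs_im_le_norm (lam - Lam₀)).trans hl.2.le)
    rw [Complex.sub_re, Complex.ofReal_re, abs_lt] at h1'
    rw [Complex.sub_im, Complex.ofReal_im, sub_zero] at h2
    refine ⟨by linarith, (le_abs_self _).trans ?_⟩
    rw [abs_mul]
    calc |lam.im| * |(W.γ T).re| ≤ 1 / (1 + |(W.γ T).re|) * (1 + |(W.γ T).re|) := by
          gcongr; linarith
      _ = 1 := by field_simp
  have hTim : u.bigRadius < (W.γ T).im := hT₁ T hTT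
  refine ⟨fun lam => -upwardRay (u.kernAbove k eps lam p) (W.γ T), ?_, ?_, ?_⟩
  · intro lam hl
    refine DifferentiableAt.differentiableWithinAt (DifferentiableAt.neg ?_)
    have hlam : lam.re < 0 := by linarith [(hre lam hl).1]
    obtain ⟨M', hM', hb'⟩ := u.exists_norm_kernAbove_le k
    have hK : ∀ l : ℂ, u.kernAbove k eps l p =
        fun w => Complex.exp (-Complex.I * (l * w) / eps) * u.kernAbove k eps 0 p w := fun l => by
      ext w
      simp only [kernAbove]
      rw [← mul_div_assoc, ← Complex.exp_add]
      ring_nf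
    have h1 := differentiableAt_upwardRay_cexp (K₀ := u.kernAbove k eps 0 p) heps (w₀ := W.γ T) ?_
      (R := u.bigRadius) (C := Real.exp (M' / eps) * (2 / u.bigRadius)) ?_ hlam
    · refine h1.congr_of_eventuallyEq (Eventually.of_forall fun l => ?_)
      simp only [hK l]
    · intro y hy
      refine ContinuousAt.continuousWithinAt ?_
      refine ContinuousAt.comp (f := fun y : ℝ => W.γ T + Complex.I * y)
        (g := u.kernAbove k eps 0 p) ?_ (by fun_prop)
      refine (u.differentiableAt_kernAbove k eps 0 p ?_).continuousAt
      rw [add_I_mul_im]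
      linarith [show (0 : ℝ) ≤ y from hy]
    · intro x _ w hw
      have h2 := congrFun (hK x) w
      rw [← h2]
      exact hb' eps heps x p w (le_norm_of_le_im hw)
  · intro mu hmu
    have hmem : (mu : ℂ) ∈ ball (Lam₀ : ℂ) (min (-Lam₀ / 2) (1 / (1 + |(W.γ T).re|))) := by
      rwa [mem_ball, dist_eq_norm, ← Complex.ofReal_sub, Complex.norm_real]
    have hmu0 : mu < 0 := by have := (hre _ hmem).1; rw [Complex.ofReal_re] at this; linarith
    have hder : ∀ t ≥ T, HasDerivAt (fun t => upwardRay (u.kernAbove k eps mu p) (W.γ t))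
        (W.integrand eps mu p t) t := fun t ht => by
      refine ((u.hasDerivAt_upwardRay_kernAbove k heps (lam := mu) (by simpa using hmu0) p
        (hT₁ t (hTT.trans ht))).comp t (W.hasDerivAt_γ t)).congr_deriv ?_
      rw [integrand, H, hF t (hTT.trans ht)]
      rfl
    have hto : Tendsto (fun t => upwardRay (u.kernAbove k eps mu p) (W.γ t)) atTop (𝓝 0) := by
      refine squeeze_zero_norm' (a := fun t => (2 / u.bigRadius) * (eps / -mu) *
        Real.exp ((M + mu * (W.γ t).im) / eps)) ?_ ?_
      · filter_upwards [eventually_ge_atTop T₁] with t ht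
        have := hb eps heps mu (by simpa using hmu0) p (W.γ t) (hT₁ t ht).le
        simpa using this
      · rw [← mul_zero ((2 / u.bigRadius) * (eps / -mu))]
        refine Tendsto.const_mul _ (Real.tendsto_exp_atBot.comp ?_)
        refine Tendsto.atBot_div_const heps ?_
        exact tendsto_atBot_add_const_left _ _ ((tendsto_const_mul_atBot_of_neg hmu0).2 h)
    rw [integral_Ioi_of_hasDerivAt_of_tendsto (hder T le_rfl).continuousAt.continuousWithinAt
      (fun t ht => hder t (le_of_lt ht)) (hint eps heps heps₀ mu hmu0 p).integrableOn hto, zero_sub]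
  · intro lam hl
    obtain ⟨h1, h2⟩ := hre lam hl
    rw [norm_neg]
    refine (hb eps heps lam (by linarith) p (W.γ T) hTim.le).trans ?_
    have h3 : 0 < -Lam₀ / 2 := by linarith
    have hR := u.bigRadius_pos
    have h4 : (M + (lam * W.γ T).im) ≤ K := by
      rw [Complex.mul_im]
      have : lam.re * (W.γ T).im ≤ Lam₀ / 2 * (W.γ T).im := by
        have : 0 < (W.γ T).im := by linarith
        gcongr
      linarith
    have h5 : eps / -lam.re ≤ 1 / (-Lam₀ / 2) := by
      gcongr
      linarith
    gcongr

-- Near a pole `γ` is bounded and `Im F → -∞`, so the exponent is eventually below any `K`.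
-- Splitting `1 / ε` into `1 / ε - 1 / e` and `1 / e`, the first part yields the smallness and the
-- second the integrability, known for the fixed value `e`.
open MeasureTheory Metric in
theorem Contour.exists_tail_pole (W : u.Contour) {eps₀ : ℝ} (heps₀ : 0 < eps₀)
    (hint : ∀ eps : ℝ, 0 < eps → eps < eps₀ → ∀ mu < 0, ∀ p, Integrable (W.integrand eps mu p))
    {Lam₀ : ℝ} (hLam : Lam₀ < 0) {q : Fin P} (h : Tendsto W.γ atTop (𝓝 (u.z q)))
    (hF : Tendsto (fun t => (W.F t).im) atTop atBot) (K T₀ : ℝ) :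
    ∃ T ≥ T₀, ∃ δ > 0, ∃ C > 0, ∀ eps : ℝ, 0 < eps → eps < eps₀ / 2 → ∀ p, ∃ τ : ℂ → ℂ,
      DifferentiableOn ℂ τ (ball (Lam₀ : ℂ) δ) ∧
      (∀ mu : ℝ, |mu - Lam₀| < δ → ∫ t in Set.Ioi T, W.integrand eps mu p t = τ mu) ∧
      ∀ lam ∈ ball (Lam₀ : ℂ) δ, ‖τ lam‖ ≤ C * Real.exp (K / eps) := by
  set B := ‖u.z q‖ + 1 with hB
  have hB0 : 0 < B := by positivity
  have hev : ∀ᶠ t in atTop, ‖W.γ t‖ < B := h.norm.eventually_lt_const (by rw [hB]; linarith)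
  set L := (‖(Lam₀ : ℂ)‖ + -Lam₀) * B with hL
  obtain ⟨T₁, hT₁⟩ := eventually_atTop.1 (hev.and (hF.eventually_le_atBot (K - L)))
  set T := max T₀ T₁ with hT
  set e := eps₀ / 2 with he
  have he0 : 0 < e := by positivity
  set C₁ : Fin P → ℝ := fun p => ∫ t, ‖W.integrand e Lam₀ p t‖ with hC₁
  have hC₁0 : ∀ p, 0 ≤ C₁ p := fun p => integral_nonneg fun t => norm_nonneg _
  have hball : ∀ lam ∈ ball (Lam₀ : ℂ) (-Lam₀), lam.re < 0 ∧ ‖lam - Lam₀‖ < -Lam₀ ∧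
      ‖lam‖ ≤ ‖(Lam₀ : ℂ)‖ + -Lam₀ := fun lam hl => by
    rw [mem_ball, dist_eq_norm] at hl
    have h1 := abs_lt.1 ((Complex.abs_re_le_norm (lam - Lam₀)).trans_lt hl)
    rw [Complex.sub_re, Complex.ofReal_re] at h1
    refine ⟨by linarith, hl, ?_⟩
    calc ‖lam‖ = ‖(Lam₀ : ℂ) + (lam - Lam₀)‖ := by congr 1; ring
      _ ≤ _ := (norm_add_le _ _).trans (by linarith)
  refine ⟨T, le_max_left _ _, -Lam₀, by linarith,
    Real.exp (-(K / e)) * Real.exp (-Lam₀ * B / e) * (∑ p, C₁ p) + 1, by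
      have := Finset.sum_nonneg fun p (_ : p ∈ Finset.univ) => hC₁0 p
      positivity, ?_⟩
  intro eps heps heps' p
  refine ⟨fun lam => ∫ t in Set.Ioi T, W.integrandC eps lam p t, ?_, ?_, ?_⟩
  · intro lam hl
    refine DifferentiableAt.differentiableWithinAt ?_
    have hsplit := fun l => W.integrandC_eq eps l p
    have h1 := differentiableAt_integral_cexp (μ := volume.restrict (Set.Ioi T)) (w := W.γ)
      (k := W.integrandC eps 0 p) heps (B := B) ?_ W.continuous.aestronglyMeasurable ?_
      (hball lam hl).1
    · refine h1.congr_of_eventuallyEq (Eventually.of_forall fun l => ?_)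
      simp only [hsplit l]
    · filter_upwards [ae_restrict_mem measurableSet_Ioi] with t ht
      have h2 := (hT₁ t ((le_max_right _ _).trans (le_of_lt ht))).1.le
      exact ⟨(Complex.abs_re_le_norm _).trans h2, (abs_le.1 ((Complex.abs_im_le_norm _).trans h2)).1⟩
    · intro x hx
      have h2 := hsplit x
      rw [← h2, integrandC_ofReal]
      exact (hint eps heps (by linarith) x hx p).integrableOn
  · intro mu _
    rfl
  · intro lam hl
    obtain ⟨-, hl1, hl2⟩ := hball lam hl
    have hnorm := fun e l t => W.norm_integrandC e l p t
    have hpt : ∀ t ∈ Set.Ioi T, ‖W.integrandC eps lam p t‖ ≤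
        Real.exp (K / eps) * (Real.exp (-(K / e)) * Real.exp (-Lam₀ * B / e)) *
          ‖W.integrand e Lam₀ p t‖ := by
      intro t ht
      obtain ⟨h2, h3⟩ := hT₁ t ((le_max_right _ _).trans (le_of_lt ht))
      rw [← integrandC_ofReal, hnorm, hnorm, ← mul_assoc (Real.exp (K / eps) * _), ← Real.exp_add,
        ← Real.exp_add, ← Real.exp_add]
      have h4 : (lam * W.γ t + W.F t).im ≤ K := by
        rw [Complex.add_im]
        have : (lam * W.γ t).im ≤ L := (Complex.im_le_norm _).trans (by
          rw [norm_mul]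
          exact mul_le_mul hl2 h2.le (norm_nonneg _) (by linarith [norm_nonneg (Lam₀ : ℂ)]))
        linarith
      have h5 : (lam * W.γ t + W.F t).im ≤ (Lam₀ * W.γ t + W.F t).im + -Lam₀ * B := by
        have : ((lam - Lam₀) * W.γ t).im ≤ -Lam₀ * B := (Complex.im_le_norm _).trans (by
          rw [norm_mul]
          exact mul_le_mul hl1.le h2.le (norm_nonneg _) (by linarith))
        rw [sub_mul, Complex.sub_im] at this
        rw [Complex.add_im, Complex.add_im]
        linarith
      gcongr
      have h6 : (lam * W.γ t + W.F t).im / eps = (lam * W.γ t + W.F t).im * (1 / eps - 1 / e) +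
          (lam * W.γ t + W.F t).im / e := by ring
      have h7 : 0 ≤ 1 / eps - 1 / e := by
        rw [sub_nonneg]
        exact one_div_le_one_div_of_le heps heps'.le
      rw [h6]
      have h8 := mul_le_mul_of_nonneg_right h4 h7
      have h9 := div_le_div_of_nonneg_right h5 he0.le
      calc _ ≤ K * (1 / eps - 1 / e) + ((Lam₀ * W.γ t + W.F t).im + -Lam₀ * B) / e :=
            add_le_add h8 h9
        _ = _ := by ring
    have hI := hint e he0 (by rw [he]; linarith) Lam₀ hLam p
    refine (norm_integral_le_of_norm_le (hI.norm.integrableOn.const_mul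
      (Real.exp (K / eps) * (Real.exp (-(K / e)) * Real.exp (-Lam₀ * B / e)))) ?_).trans ?_
    · filter_upwards [ae_restrict_mem measurableSet_Ioi] with t ht using hpt t ht
    · rw [integral_const_mul]
      have h10 : ∫ t in Set.Ioi T, ‖W.integrand e Lam₀ p t‖ ≤ ∑ p, C₁ p :=
        (setIntegral_le_integral hI.norm (Eventually.of_forall fun t => norm_nonneg _)).trans
          (Finset.single_le_sum (f := C₁) (fun p _ => hC₁0 p) (Finset.mem_univ p))
      have h11 := Real.exp_pos (K / eps)
      calc _ ≤ Real.exp (K / eps) * (Real.exp (-(K / e)) * Real.exp (-Lam₀ * B / e)) *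
              (∑ p, C₁ p) := by gcongr
        _ ≤ _ := by nlinarith

open MeasureTheory Metric in
theorem Contour.exists_tail (W : u.Contour) {eps₀ : ℝ} (heps₀ : 0 < eps₀)
    (hint : ∀ eps : ℝ, 0 < eps → eps < eps₀ → ∀ mu < 0, ∀ p, Integrable (W.integrand eps mu p))
    {Lam₀ : ℝ} (hLam : Lam₀ < 0) (K T₀ : ℝ) :
    ∃ T ≥ T₀, ∃ δ > 0, ∃ C > 0, ∃ eps₁ > 0, ∀ eps : ℝ, 0 < eps → eps < eps₁ → ∀ p, ∃ τ : ℂ → ℂ,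
      DifferentiableOn ℂ τ (ball (Lam₀ : ℂ) δ) ∧
      (∀ mu : ℝ, |mu - Lam₀| < δ → ∫ t in Set.Ioi T, W.integrand eps mu p t = τ mu) ∧
      ∀ lam ∈ ball (Lam₀ : ℂ) δ, ‖τ lam‖ ≤ C * Real.exp (K / eps) := by
  rcases W.atTop_end with h | ⟨q, h1, h2⟩
  · obtain ⟨T, hT, δ, hδ, C, hC, H⟩ := W.exists_tail_infinity hint hLam h K T₀
    exact ⟨T, hT, δ, hδ, C, hC, min eps₀ 1, by positivity, fun eps h1 h2 => H eps h1
      (h2.trans_le (min_le_left _ _)) (h2.trans_le (min_le_right _ _))⟩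
  · obtain ⟨T, hT, δ, hδ, C, hC, H⟩ := W.exists_tail_pole heps₀ hint hLam h1 h2 K T₀
    exact ⟨T, hT, δ, hδ, C, hC, eps₀ / 2, by positivity, H⟩

open MeasureTheory Metric in
theorem Contour.exists_tail_atBot (W : u.Contour) {eps₀ : ℝ} (heps₀ : 0 < eps₀)
    (hint : ∀ eps : ℝ, 0 < eps → eps < eps₀ → ∀ mu < 0, ∀ p, Integrable (W.integrand eps mu p))
    {Lam₀ : ℝ} (hLam : Lam₀ < 0) (K T₀ : ℝ) :
    ∃ T ≤ T₀, ∃ δ > 0, ∃ C > 0, ∃ eps₁ > 0, ∀ eps : ℝ, 0 < eps → eps < eps₁ → ∀ p, ∃ τ : ℂ → ℂ,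
      DifferentiableOn ℂ τ (ball (Lam₀ : ℂ) δ) ∧
      (∀ mu : ℝ, |mu - Lam₀| < δ → ∫ t in Set.Iic T, W.integrand eps mu p t = τ mu) ∧
      ∀ lam ∈ ball (Lam₀ : ℂ) δ, ‖τ lam‖ ≤ C * Real.exp (K / eps) := by
  obtain ⟨T, hT, δ, hδ, C, hC, eps₁, he, H⟩ := W.reverse.exists_tail heps₀ (fun eps h1 h2 mu hmu p => by
    have h3 := (hint eps h1 h2 mu hmu p).comp_neg.neg
    exact h3.congr (Eventually.of_forall fun t => (W.reverse_integrand eps mu p t).symm)) hLam K (-T₀)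
  refine ⟨-T, by linarith, δ, hδ, C, hC, eps₁, he, fun eps h1 h2 p => ?_⟩
  obtain ⟨τ, h3, h4, h5⟩ := H eps h1 h2 p
  refine ⟨fun l => -τ l, h3.neg, fun mu hmu => ?_, fun l hl => by rw [norm_neg]; exact h5 l hl⟩
  change _ = -τ mu
  rw [← h4 mu hmu]
  simp_rw [W.reverse_integrand]
  rw [integral_neg, neg_neg, integral_comp_neg_Ioi]

end RationalPotential

/-! ### Asymptotics of the integrals over a contour. -/

theorem Finset.exists_pos_forall_le {ι : Type*} (S : Finset ι) {f : ι → ℝ} (hf : ∀ i ∈ S, 0 < f i) :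
    ∃ δ > 0, ∀ i ∈ S, δ ≤ f i := by
  classical
  induction S using Finset.induction_on with
  | empty => exact ⟨1, one_pos, by simp⟩
  | insert a S ha ih =>
    obtain ⟨δ, hδ, h⟩ := ih fun i hi => hf i (Finset.mem_insert_of_mem hi)
    refine ⟨min δ (f a), lt_min hδ (hf a (Finset.mem_insert_self _ _)), fun i hi => ?_⟩
    rcases Finset.mem_insert.1 hi with rfl | hi
    · exact min_le_right _ _
    · exact (min_le_left _ _).trans (h i hi)

namespace RationalPotential

variable {P : ℕ} {u : RationalPotential P}

-- At the parameter `Lam + eps * s` the summand with `s` loses the factor `1 / eps` and becomes the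
-- amplitude factor `exp(-i s w)`. Laplace's method can therefore be applied with the critical point
-- of the real parameter `Lam`, uniformly in bounded complex `s`.
open Metric in
theorem Contour.exists_laplace (W : u.Contour) {t₀ : ℝ} (hpass : W.PassesOver t₀) {Φ : ℂ → ℂ} {r : ℝ}
    (hr : 0 < r) (hΦ : ∀ w ∈ ball (W.γ t₀) r, HasDerivAt Φ (u.u0C w) w) (hΦ₀ : Φ (W.γ t₀) = W.F t₀)
    (S : ℝ) :
    ∃ ρ₀ > 0, ∀ ρ : ℝ, 0 < ρ → ρ ≤ ρ₀ → ∃ δ > 0, ∃ C > 0, ∀ y ∈ ball (W.γ t₀) δ,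
      0 < (Complex.I * deriv u.u0C y * deriv W.γ t₀ ^ 2 / 2).re ∧
      ∀ Lam : ℝ, (Lam : ℂ) + u.u0C y = 0 → ∀ s : ℂ, ‖s‖ ≤ S → ∀ eps : ℝ, 0 < eps → eps < 1 → ∀ p,
        ‖(∫ t in (t₀ - ρ)..(t₀ + ρ), W.integrandC eps (Lam + eps * s) p t) -
            √eps * (Complex.exp (-Complex.I * (Lam * y + Φ y) / eps) *
              (Complex.exp (-Complex.I * s * y) / (y - u.z p) *
                laplaceCoeff u.u0C (deriv W.γ t₀) y))‖ ≤
          C * (eps * √eps) * Real.exp ((Lam * y + Φ y).im / eps) := by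
  obtain ⟨r₁, hr₁, hnp⟩ := Metric.isOpen_iff.1 u.isOpen_notPole (W.γ t₀) (W.notPole t₀)
  set r₂ := min r r₁ / 2 with hr₂
  have hr₂0 : 0 < r₂ := by positivity
  have hsub : closedBall (W.γ t₀) r₂ ⊆ ball (W.γ t₀) r ∩ ball (W.γ t₀) r₁ := fun w hw => by
    have h1 : r₂ < r := by rw [hr₂]; linarith [min_le_left r r₁]
    have h2 : r₂ < r₁ := by rw [hr₂]; linarith [min_le_right r r₁]
    rw [mem_closedBall] at hw
    exact ⟨by rw [mem_ball]; linarith, by rw [mem_ball]; linarith⟩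
  have hud : ∀ w ∈ closedBall (W.γ t₀) r₂, DifferentiableAt ℂ u.u0C w := fun w hw =>
    u.differentiableAt_u0C (hnp (hsub hw).2)
  obtain ⟨M, hM⟩ := (isCompact_closedBall (W.γ t₀) r₂).exists_bound_of_continuousOn
    fun w hw => (hud w hw).continuousAt.continuousWithinAt
  have hzp : ∀ p, ∀ w ∈ closedBall (W.γ t₀) r₂, w - u.z p ≠ 0 := fun p w hw =>
    sub_ne_zero.2 (hnp (hsub hw).2 p).1
  have hinv : ∀ p, ∃ B : ℝ, ∀ w ∈ closedBall (W.γ t₀) r₂, ‖(w - u.z p)⁻¹‖ ≤ B := fun p =>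
    (isCompact_closedBall (W.γ t₀) r₂).exists_bound_of_continuousOn
      (ContinuousOn.inv₀ (by fun_prop) (hzp p))
  choose B hB using hinv
  have hB0 : ∀ p, 0 ≤ B p := fun p => (norm_nonneg _).trans (hB p _ (mem_closedBall_self hr₂0.le))
  set Mk := Real.exp (S * (‖W.γ t₀‖ + r₂)) * ∑ p, B p with hMk
  obtain ⟨ρ₀, hρ₀, H⟩ := exists_laplace_contour (u := u.u0C) (F := Φ) hr₂0
    (fun w hw => (hud w (ball_subset_closedBall hw)).differentiableWithinAt)
    (fun w hw => hM w (ball_subset_closedBall hw))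
    (fun w hw => hΦ w (hsub (ball_subset_closedBall hw)).1) W.contDiff rfl hpass Mk
  refine ⟨ρ₀, hρ₀, fun ρ hρ hρ' => ?_⟩
  obtain ⟨hmem, δ, hδ, C, hC, HH⟩ := H ρ hρ hρ'
  have hFΦ : ∀ t ∈ Set.Icc (t₀ - ρ) (t₀ + ρ), W.F t = Φ (W.γ t) := by
    intro t ht
    have hd : ∀ t ∈ Set.Icc (t₀ - ρ) (t₀ + ρ), HasDerivAt (fun t => W.F t - Φ (W.γ t)) 0 t :=
      fun t ht => by
        have h1 := (W.hasDerivAt t).sub ((hΦ _ (hsub (ball_subset_closedBall (hmem t ht))).1).comp t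
          (W.hasDerivAt_γ t))
        rwa [sub_self] at h1
    have := (convex_Icc _ _).norm_image_sub_le_of_norm_hasDerivWithin_le (C := 0)
      (fun x hx => (hd x hx).hasDerivWithinAt) (fun x _ => by simp)
      (show t₀ ∈ Set.Icc (t₀ - ρ) (t₀ + ρ) from ⟨by linarith, by linarith⟩) ht
    rw [zero_mul, hΦ₀, sub_self, sub_zero] at this
    exact sub_eq_zero.1 (norm_le_zero_iff.1 this)
  refine ⟨δ, hδ, C, hC, fun y hy => ⟨(HH y hy).1, fun Lam hcrit s hs eps heps heps1 p => ?_⟩⟩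
  have hk1 : ∀ w ∈ ball (W.γ t₀) r₂, ‖Complex.exp (-Complex.I * s * w) / (w - u.z p)‖ ≤ Mk := by
    intro w hw
    rw [norm_div, div_eq_mul_inv, ← norm_inv, hMk]
    gcongr ?_ * ?_
    · rw [Complex.norm_exp]
      refine Real.exp_le_exp.2 ((Complex.re_le_norm _).trans ?_)
      rw [norm_mul, norm_mul, norm_neg, Complex.norm_I, one_mul]
      have : ‖w‖ ≤ ‖W.γ t₀‖ + r₂ := by
        rw [mem_ball, dist_eq_norm] at hw
        calc ‖w‖ = ‖W.γ t₀ + (w - W.γ t₀)‖ := by congr 1; ring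
          _ ≤ _ := (norm_add_le _ _).trans (by linarith)
      gcongr
      exact (norm_nonneg s).trans hs
    · exact (hB p w (ball_subset_closedBall hw)).trans
        (Finset.single_le_sum (fun p _ => hB0 p) (Finset.mem_univ p))
  have hmain := (HH y hy).2 (fun w => Complex.exp (-Complex.I * s * w) / (w - u.z p))
    (fun w hw => DifferentiableAt.differentiableWithinAt (DifferentiableAt.div (by fun_prop)
      (by fun_prop) (hzp p w (ball_subset_closedBall hw)))) hk1 eps heps heps1
  have hepsC : (eps : ℂ) ≠ 0 := by exact_mod_cast heps.ne'
  have hint : (∫ t in (t₀ - ρ)..(t₀ + ρ), W.integrandC eps (Lam + eps * s) p t) =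
      Complex.exp (-Complex.I * (Lam * y + Φ y) / eps) * ∫ t in (t₀ - ρ)..(t₀ + ρ),
        Complex.exp (phaseAt u.u0C Φ y (W.γ t) / eps) *
          (Complex.exp (-Complex.I * s * W.γ t) / (W.γ t - u.z p)) * deriv W.γ t := by
    rw [← intervalIntegral.integral_const_mul]
    refine intervalIntegral.integral_congr fun t ht => ?_
    rw [Set.uIcc_of_le (by linarith)] at ht
    simp only [integrandC, hFΦ t ht, phaseAt]
    have hu0 : u.u0C y = -Lam := by linear_combination hcrit
    have he : -Complex.I * ((Lam + eps * s) * W.γ t + Φ (W.γ t)) / eps =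
        -Complex.I * (Lam * y + Φ y) / eps +
        (-Complex.I * (Φ (W.γ t) - Φ y - u.u0C y * (W.γ t - y)) / eps + -Complex.I * s * W.γ t) := by
      rw [hu0]
      field_simp
      ring
    rw [he, Complex.exp_add, Complex.exp_add]
    ring
  rw [hint, ← norm_cexp_neg_I_mul, mul_left_comm (√eps : ℂ), ← mul_sub, norm_mul, mul_comm]
  gcongr

open MeasureTheory Metric in
/-- Asymptotics of the integrals over a contour dominated by finitely many critical points. -/
theorem Contour.exists_asymptotics (W : u.Contour) {eps₀ : ℝ} (heps₀ : 0 < eps₀)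
    (hint : ∀ eps : ℝ, 0 < eps → eps < eps₀ → ∀ mu < 0, ∀ p, Integrable (W.integrand eps mu p))
    {Lam₀ : ℝ} (hLam : Lam₀ < 0) {S : Finset ℝ} (hS : S.Nonempty) {L₀ : ℝ}
    (hL : ∀ t ∈ S, (W.H Lam₀ t).im = L₀) (hlt : ∀ t ∉ S, (W.H Lam₀ t).im < L₀)
    (hpass : ∀ t ∈ S, W.PassesOver t) {Φ : ℝ → ℂ → ℂ} {r : ℝ} (hr : 0 < r)
    (hΦ : ∀ t ∈ S, ∀ w ∈ ball (W.γ t) r, HasDerivAt (Φ t) (u.u0C w) w)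
    (hΦ₀ : ∀ t ∈ S, Φ t (W.γ t) = W.F t) (B : ℝ) :
    ∃ δ > 0, ∃ C > 0, ∃ eps₁ > 0,
      (∀ t ∈ S, ∀ y ∈ ball (W.γ t) δ, 0 < (Complex.I * deriv u.u0C y * deriv W.γ t ^ 2 / 2).re) ∧
      ∀ eps : ℝ, 0 < eps → eps < eps₁ → ∃ R : Fin P → ℂ → ℂ,
        (∀ p, DifferentiableOn ℂ (R p) (ball (Lam₀ : ℂ) δ)) ∧
        (∀ p, ∀ mu : ℝ, |mu - Lam₀| < δ → ∫ t, W.integrand eps mu p t = R p mu) ∧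
        ∀ Lam : ℝ, |Lam - Lam₀| < δ / 2 → ∀ y : ℝ → ℂ,
          (∀ t ∈ S, y t ∈ ball (W.γ t) δ ∧ (Lam : ℂ) + u.u0C (y t) = 0) →
          ∀ s : ℂ, ‖s‖ ≤ B → ∀ p,
            ‖R p (Lam + eps * s) - ∑ t ∈ S, √eps *
                (Complex.exp (-Complex.I * (Lam * y t + Φ t (y t)) / eps) *
                  (Complex.exp (-Complex.I * s * y t) / (y t - u.z p) *
                    laplaceCoeff u.u0C (deriv W.γ t) (y t)))‖ ≤
              C * (eps * √eps) * ∑ t ∈ S, Real.exp ((Lam * y t + Φ t (y t)).im / eps) := by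
  choose! ρ₀ hρ₀ Hloc using fun t ht => W.exists_laplace (hpass t ht) hr (hΦ t ht) (hΦ₀ t ht) B
  -- small disjoint intervals around the critical parameters
  obtain ⟨ρ₁, hρ₁, hρ₁'⟩ := S.exists_pos_forall_le hρ₀
  obtain ⟨ρ₂, hρ₂, hρ₂'⟩ := S.offDiag.exists_pos_forall_le (f := fun q => |q.1 - q.2|) fun q hq =>
    abs_pos.2 (sub_ne_zero.2 (Finset.mem_offDiag.1 hq).2.2)
  set ρ := min (min ρ₁ (ρ₂ / 2)) 1 with hρdef
  have hρ : 0 < ρ := by positivity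
  have hρρ₁ : ρ ≤ ρ₁ := (min_le_left _ _).trans (min_le_left _ _)
  have hρρ₂ : ρ ≤ ρ₂ / 2 := (min_le_left _ _).trans (min_le_right _ _)
  have hρ1 : ρ ≤ 1 := min_le_right _ _
  choose! δ' hδ' C' hC' Hl using fun t ht => Hloc t ht ρ hρ (hρρ₁.trans (hρ₁' t ht))
  obtain ⟨δ₁, hδ₁, hδ₁'⟩ := S.exists_pos_forall_le hδ'
  set I : ℝ → Set ℝ := fun t => Set.Ioc (t - ρ) (t + ρ) with hI
  have hdisj : (S : Set ℝ).Pairwise (Function.onFun Disjoint I) := by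
    intro a ha b hb hab
    have h1 := hρ₂' (a, b) (Finset.mem_offDiag.2 ⟨ha, hb, hab⟩)
    refine Set.disjoint_left.2 fun x hxa hxb => ?_
    have h2 : |a - b| < 2 * ρ := by
      rw [abs_lt]
      constructor <;> linarith [hxa.1, hxa.2, hxb.1, hxb.2]
    simp only at h1
    linarith
  set A : Set ℝ := ⋃ t ∈ S, I t with hA
  have hAm : MeasurableSet A := S.measurableSet_biUnion fun t _ => measurableSet_Ioc
  obtain ⟨m, hm⟩ : ∃ m : ℝ, ∀ t ∈ S, |t| ≤ m := by
    obtain ⟨m, hm⟩ := (S.image fun t => |t|).bddAbove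
    exact ⟨m, fun t ht => hm (by simpa using ⟨t, ht, rfl⟩)⟩
  -- the tails
  obtain ⟨T₂, hT₂, δ₂, hδ₂, C₂, hC₂, e₂, he₂, Htop⟩ := W.exists_tail heps₀ hint hLam (L₀ - 2) (m + 2)
  obtain ⟨T₁, hT₁, δ₃, hδ₃, C₃, hC₃, e₃, he₃, Hbot⟩ :=
    W.exists_tail_atBot heps₀ hint hLam (L₀ - 2) (-m - 2)
  have hAsub : A ⊆ Set.Ioc T₁ T₂ := by
    refine Set.iUnion₂_subset fun t ht x hx => ?_
    have := abs_le.1 (hm t ht)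
    exact ⟨by linarith [hx.1], by linarith [hx.2]⟩
  -- the rest of the contour
  set Mid : Set ℝ := Set.Ioc T₁ T₂ \ A with hMid
  have hMidm : MeasurableSet Mid := measurableSet_Ioc.diff hAm
  -- A gap `3 η` at `Lam₀` is divided as follows: one `η` is lost by moving the spectral parameter
  -- off `Lam₀`, one by moving the critical points, and the last gives the factor `exp(-η / ε)`. The
  -- condition `η ≤ 1` puts the tails, of exponent `L₀ - 2`, below `L₀ - 2 η`.
  obtain ⟨η, hη, hη1, hηle⟩ : ∃ η > 0, η ≤ 1 ∧ ∀ t ∈ Mid, (W.H Lam₀ t).im ≤ L₀ - 3 * η := by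
    have hcomp : IsCompact (Set.Icc T₁ T₂ \ ⋃ t ∈ S, Set.Ioo (t - ρ) (t + ρ)) :=
      isCompact_Icc.diff (isOpen_biUnion fun t _ => isOpen_Ioo)
    have hcont : Continuous fun t => -(W.H Lam₀ t).im := by
      have h1 := W.continuous
      have h2 := W.continuous_F
      unfold H
      fun_prop
    obtain ⟨a', ha', hle⟩ := hcomp.exists_forall_le' hcont.continuousOn (a := -L₀) fun t ht => by
      refine neg_lt_neg (hlt t fun htS => ht.2 ?_)
      exact Set.mem_biUnion htS ⟨by linarith, by linarith⟩
    refine ⟨min ((a' + L₀) / 3) 1, lt_min (by linarith) one_pos, min_le_right _ _, fun t ht => ?_⟩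
    have h1 := hle t ⟨Set.Ioc_subset_Icc_self ht.1, fun h => ht.2 ?_⟩
    · linarith [min_le_left ((a' + L₀) / 3) 1]
    · obtain ⟨i, hi, hx⟩ := Set.mem_iUnion₂.1 h
      exact Set.mem_biUnion hi (Set.Ioo_subset_Ioc_self hx)
  obtain ⟨Bγ, hBγ⟩ := (isCompact_Icc (a := T₁) (b := T₂)).exists_bound_of_continuousOn
    W.continuous.continuousOn
  have hamp : ∀ p, ∃ D : ℝ, ∀ t ∈ Set.Icc T₁ T₂, ‖‖W.γ t - u.z p‖⁻¹ * ‖deriv W.γ t‖‖ ≤ D := fun p => by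
    refine (isCompact_Icc (a := T₁) (b := T₂)).exists_bound_of_continuousOn
      (ContinuousOn.mul (ContinuousOn.inv₀ ?_ fun t _ => ?_) W.continuous_deriv.norm.continuousOn)
    · exact (W.continuous.sub continuous_const).norm.continuousOn
    · exact norm_ne_zero_iff.2 (sub_ne_zero.2 (W.notPole t p).1)
  choose D hD using hamp
  have hT₁₂ : T₁ ≤ T₂ := by
    obtain ⟨t, ht⟩ := hS
    have := (abs_nonneg t).trans (hm t ht)
    linarith
  have hD0 : ∀ p, 0 ≤ D p := fun p => (norm_nonneg _).trans (hD p T₁ ⟨le_rfl, hT₁₂⟩)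
  have hBγ0 : 0 ≤ Bγ := (norm_nonneg _).trans (hBγ T₁ ⟨le_rfl, hT₁₂⟩)
  set δ₄ := η / (Bγ + 1) with hδ₄
  have hδ₄0 : 0 < δ₄ := by positivity
  -- lower bound for the leading exponentials
  have hlow : ∀ t ∈ S, ∃ d > 0, ∀ Lam : ℝ, |Lam - Lam₀| < d → ∀ y ∈ ball (W.γ t) d,
      L₀ - η ≤ (Lam * y + Φ t y).im := by
    intro t ht
    have hc : ContinuousAt (fun q : ℝ × ℂ => (q.1 * q.2 + Φ t q.2).im) (Lam₀, W.γ t) := by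
      have h1 : ContinuousAt (fun q : ℝ × ℂ => Φ t q.2) (Lam₀, W.γ t) :=
        ContinuousAt.comp (g := Φ t) (f := Prod.snd)
          (hΦ t ht _ (mem_ball_self hr)).continuousAt continuousAt_snd
      exact Complex.continuous_im.continuousAt.comp (ContinuousAt.add (by fun_prop) h1)
    have hval : L₀ - η < (fun q : ℝ × ℂ => (q.1 * q.2 + Φ t q.2).im) (Lam₀, W.γ t) := by
      simp only [hΦ₀ t ht]
      have : ((Lam₀ : ℂ) * W.γ t + W.F t).im = L₀ := hL t ht
      rw [this]
      linarith
    obtain ⟨d, hd, hdb⟩ := Metric.eventually_nhds_iff.1 (hc.eventually_const_lt hval)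
    refine ⟨d, hd, fun Lam h1 y hy => (hdb (y := (Lam, y)) ?_).le⟩
    rw [Prod.dist_eq, Real.dist_eq]
    exact max_lt h1 hy
  choose! d hd hlow using hlow
  obtain ⟨δ₅, hδ₅, hδ₅'⟩ := S.exists_pos_forall_le hd
  obtain ⟨Ce, hCe, Hexp⟩ := exists_exp_neg_div_le hη
  set δ := min (min (min δ₁ δ₂) (min δ₃ δ₄)) (min δ₅ (-Lam₀)) with hδdef
  have hδ : 0 < δ := by
    have : 0 < -Lam₀ := by linarith
    positivity
  have hd1 : δ ≤ δ₁ := (min_le_left _ _).trans ((min_le_left _ _).trans (min_le_left _ _))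
  have hd2 : δ ≤ δ₂ := (min_le_left _ _).trans ((min_le_left _ _).trans (min_le_right _ _))
  have hd3 : δ ≤ δ₃ := (min_le_left _ _).trans ((min_le_right _ _).trans (min_le_left _ _))
  have hd4 : δ ≤ δ₄ := (min_le_left _ _).trans ((min_le_right _ _).trans (min_le_right _ _))
  have hd5 : δ ≤ δ₅ := (min_le_right _ _).trans (min_le_left _ _)
  have hd6 : δ ≤ -Lam₀ := (min_le_right _ _).trans (min_le_right _ _)
  set Cm := (∑ p, D p) * (T₂ - T₁) with hCm
  have hCm0 : 0 ≤ Cm := mul_nonneg (Finset.sum_nonneg fun p _ => hD0 p) (by linarith)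
  have hCS : 0 ≤ ∑ t ∈ S, C' t := Finset.sum_nonneg fun t ht => (hC' t ht).le
  refine ⟨δ, hδ, ∑ t ∈ S, C' t + (Cm + C₂ + C₃) * Ce, by positivity,
    min (min (min e₂ e₃) (min 1 eps₀)) (δ / (2 * (|B| + 1))), by positivity, fun t ht y hy =>
      (Hl t ht y (ball_subset_ball (hd1.trans (hδ₁' t ht)) hy)).1, ?_⟩
  intro eps heps hepslt
  have he2 : eps < e₂ := hepslt.trans_le ((min_le_left _ _).trans ((min_le_left _ _).trans (min_le_left _ _)))
  have he3 : eps < e₃ := hepslt.trans_le ((min_le_left _ _).trans ((min_le_left _ _).trans (min_le_right _ _)))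
  have he1 : eps < 1 := hepslt.trans_le ((min_le_left _ _).trans ((min_le_right _ _).trans (min_le_left _ _)))
  have he0 : eps < eps₀ :=
    hepslt.trans_le ((min_le_left _ _).trans ((min_le_right _ _).trans (min_le_right _ _)))
  have heB : eps < δ / (2 * (|B| + 1)) := hepslt.trans_le (min_le_right _ _)
  choose τ₂ hτ₂d hτ₂i hτ₂b using Htop eps heps he2
  choose τ₃ hτ₃d hτ₃i hτ₃b using Hbot eps heps he3
  have hneg : ∀ l ∈ ball (Lam₀ : ℂ) δ, l.re < 0 := fun l hl => by
    rw [mem_ball, dist_eq_norm] at hl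
    have h1 := abs_lt.1 ((Complex.abs_re_le_norm (l - Lam₀)).trans_lt hl)
    rw [Complex.sub_re, Complex.ofReal_re] at h1
    linarith
  refine ⟨fun p l => τ₃ p l + ((∑ t ∈ S, ∫ x in (t - ρ)..(t + ρ), W.integrandC eps l p x) +
    ∫ x in Mid, W.integrandC eps l p x) + τ₂ p l, ?_, ?_, ?_⟩
  · intro p
    refine ((hτ₃d p).mono (ball_subset_ball hd3)).add (DifferentiableOn.add ?_ ?_) |>.add
      ((hτ₂d p).mono (ball_subset_ball hd2))
    · refine DifferentiableOn.fun_sum fun t _ l hl => DifferentiableAt.differentiableWithinAt ?_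
      have h1 := differentiableAt_intervalIntegral_cexp (w := W.γ) (K₀ := W.integrandC eps 0 p) heps
        (a := t - ρ) (b := t + ρ) W.continuous (W.continuous_integrandC eps 0 p).continuousOn (hneg l hl)
      refine h1.congr_of_eventuallyEq (Eventually.of_forall fun l => ?_)
      simp only [W.integrandC_eq eps l]
    · intro l hl
      refine DifferentiableAt.differentiableWithinAt ?_
      have h1 := differentiableAt_integral_cexp (μ := volume.restrict Mid) (w := W.γ)
        (k := W.integrandC eps 0 p) heps (B := Bγ) ?_ W.continuous.aestronglyMeasurable ?_ (hneg l hl)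
      · refine h1.congr_of_eventuallyEq (Eventually.of_forall fun l => ?_)
        simp only [W.integrandC_eq eps l]
      · filter_upwards [ae_restrict_mem hMidm] with t ht
        have h2 := hBγ t (Set.Ioc_subset_Icc_self ht.1)
        exact ⟨(Complex.abs_re_le_norm _).trans h2,
          (abs_le.1 ((Complex.abs_im_le_norm _).trans h2)).1⟩
      · intro x _
        have h2 := W.integrandC_eq eps x p
        rw [← h2, ← IntegrableOn]
        exact ((W.continuous_integrandC eps x p).continuousOn.integrableOn_Icc).mono_set
          (Set.sdiff_subset.trans Set.Ioc_subset_Icc_self)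
  · intro p mu hmu
    have hc : Continuous (W.integrand eps mu p) := by
      rw [← integrandC_ofReal]
      exact W.continuous_integrandC eps mu p
    have hIoc : IntegrableOn (W.integrand eps mu p) (Set.Ioc T₁ T₂) :=
      (hc.continuousOn.integrableOn_Icc).mono_set Set.Ioc_subset_Icc_self
    have e1 : ∫ x in Set.Ioc T₁ T₂, W.integrand eps mu p x =
        (∑ t ∈ S, ∫ x in (t - ρ)..(t + ρ), W.integrandC eps mu p x) +
          ∫ x in Mid, W.integrandC eps mu p x := by
      rw [← integral_inter_add_sdiff hAm hIoc, Set.inter_eq_right.2 hAsub, hA,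
        integral_biUnion_finset S (fun t _ => measurableSet_Ioc) hdisj fun t _ =>
          (hc.continuousOn.integrableOn_Icc).mono_set Set.Ioc_subset_Icc_self]
      congr 1
      refine Finset.sum_congr rfl fun t _ => ?_
      rw [intervalIntegral.integral_of_le (by linarith)]
      rfl
    have hI := hint eps heps he0 mu (by have := (abs_lt.1 hmu).2; linarith) p
    rw [← intervalIntegral.integral_Iic_add_Ioi (b := T₁) hI.integrableOn hI.integrableOn,
      ← Set.Ioc_union_Ioi_eq_Ioi hT₁₂, setIntegral_union Set.Ioc_disjoint_Ioi_same measurableSet_Ioi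
        hI.integrableOn hI.integrableOn, e1, hτ₂i p mu (hmu.trans_le hd2),
      hτ₃i p mu (hmu.trans_le hd3)]
    ring
  · intro Lam hLam' y hy s hs p
    set lam : ℂ := Lam + eps * s with hlam
    have hmem : lam ∈ ball (Lam₀ : ℂ) δ := by
      rw [mem_ball, dist_eq_norm]
      have h1 : lam - Lam₀ = ((Lam - Lam₀ : ℝ) : ℂ) + eps * s := by rw [hlam]; push_cast; ring
      rw [h1]
      have h2 : ‖(eps : ℂ) * s‖ ≤ δ / 2 := by
        rw [norm_mul, Complex.norm_real, Real.norm_eq_abs, abs_of_pos heps]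
        calc eps * ‖s‖ ≤ δ / (2 * (|B| + 1)) * (|B| + 1) := by
              gcongr
              linarith [le_abs_self B]
          _ = δ / 2 := by field_simp
      refine (norm_add_le _ _).trans_lt ?_
      rw [Complex.norm_real, Real.norm_eq_abs]
      linarith
    set X := ∑ t ∈ S, Real.exp ((Lam * y t + Φ t (y t)).im / eps) with hX
    set E := Real.exp ((L₀ - 2 * η) / eps) with hE
    -- Comparison with a single leading exponential, which is at least `exp((L₀ - η) / ε)`.
    have hEX : E ≤ Ce * (eps * √eps) * X := by
      obtain ⟨t, ht⟩ := hS
      have h1 : Real.exp ((L₀ - η) / eps) ≤ X := by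
        refine le_trans ?_ (Finset.single_le_sum
          (f := fun t => Real.exp ((Lam * y t + Φ t (y t)).im / eps))
          (fun t _ => (Real.exp_pos _).le) ht)
        refine Real.exp_le_exp.2 ((div_le_div_iff_of_pos_right heps).2 ?_)
        exact hlow t ht Lam (by linarith [hδ₅' t ht]) (y t)
          (ball_subset_ball (hd5.trans (hδ₅' t ht)) (hy t ht).1)
      have h2 : E = Real.exp (-η / eps) * Real.exp ((L₀ - η) / eps) := by
        rw [hE, ← Real.exp_add]
        congr 1
        ring
      rw [h2]
      gcongr
      exact Hexp eps heps he1
    have htail : Real.exp ((L₀ - 2) / eps) ≤ E := by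
      rw [hE]
      gcongr
      linarith
    have b2 : ‖τ₂ p lam‖ ≤ C₂ * E :=
      (hτ₂b p lam (ball_subset_ball hd2 hmem)).trans (by gcongr)
    have b3 : ‖τ₃ p lam‖ ≤ C₃ * E :=
      (hτ₃b p lam (ball_subset_ball hd3 hmem)).trans (by gcongr)
    have bm : ‖∫ x in Mid, W.integrandC eps lam p x‖ ≤ Cm * E := by
      have hpt : ∀ x ∈ Mid, ‖W.integrandC eps lam p x‖ ≤ E * ∑ p, D p := by
        intro x hx
        have hxI := Set.Ioc_subset_Icc_self hx.1
        rw [W.norm_integrandC]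
        have h1 : (lam * W.γ x + W.F x).im ≤ L₀ - 2 * η := by
          have h2 := hηle x hx
          have h3 : (lam * W.γ x + W.F x).im = (W.H Lam₀ x).im + ((lam - Lam₀) * W.γ x).im := by
            rw [H, ← Complex.add_im]
            congr 1
            ring
          have h4 : ((lam - Lam₀) * W.γ x).im ≤ η := by
            refine (Complex.im_le_norm _).trans ?_
            rw [norm_mul]
            rw [mem_ball, dist_eq_norm] at hmem
            calc _ ≤ η / (Bγ + 1) * (Bγ + 1) := by
                  gcongr
                  · exact hmem.le.trans hd4
                  · linarith [hBγ x hxI]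
              _ = η := by field_simp
          rw [h3]
          linarith
        have h5 : ‖W.γ x - u.z p‖⁻¹ * ‖deriv W.γ x‖ ≤ ∑ p, D p :=
          ((le_abs_self _).trans (hD p x hxI)).trans
            (Finset.single_le_sum (fun p _ => hD0 p) (Finset.mem_univ p))
        have h6 : Real.exp ((lam * W.γ x + W.F x).im / eps) ≤ E := by
          rw [hE]
          gcongr
        gcongr
      have hvol : volume.real Mid ≤ T₂ - T₁ := by
        rw [← Real.volume_real_Ioc_of_le hT₁₂]
        exact measureReal_mono Set.sdiff_subset (by simp)
      have hfin : volume Mid < ⊤ := (measure_mono Set.sdiff_subset).trans_lt (by simp)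
      calc _ ≤ E * (∑ p, D p) * volume.real Mid := norm_setIntegral_le_of_norm_le_const hfin hpt
        _ ≤ E * (∑ p, D p) * (T₂ - T₁) := by
            have := Finset.sum_nonneg fun p (_ : p ∈ Finset.univ) => hD0 p
            gcongr
        _ = Cm * E := by rw [hCm]; ring
    have bl : ‖∑ t ∈ S, ((∫ x in (t - ρ)..(t + ρ), W.integrandC eps lam p x) - √eps *
          (Complex.exp (-Complex.I * (Lam * y t + Φ t (y t)) / eps) *
            (Complex.exp (-Complex.I * s * y t) / (y t - u.z p) *
              laplaceCoeff u.u0C (deriv W.γ t) (y t))))‖ ≤ (∑ t ∈ S, C' t) * (eps * √eps) * X := by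
      refine (norm_sum_le _ _).trans ?_
      rw [hX, Finset.mul_sum]
      refine Finset.sum_le_sum fun t ht => ?_
      refine ((Hl t ht (y t) (ball_subset_ball (hd1.trans (hδ₁' t ht)) (hy t ht).1)).2 Lam
        (hy t ht).2 s hs eps heps he1 p).trans ?_
      gcongr
      exact Finset.single_le_sum (f := C') (fun t ht => (hC' t ht).le) ht
    rw [Finset.sum_sub_distrib] at bl
    set Y₁ := ∑ t ∈ S, ∫ x in (t - ρ)..(t + ρ), W.integrandC eps lam p x
    set Y₂ := ∑ t ∈ S, √eps *
          (Complex.exp (-Complex.I * (Lam * y t + Φ t (y t)) / eps) *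
            (Complex.exp (-Complex.I * s * y t) / (y t - u.z p) *
              laplaceCoeff u.u0C (deriv W.γ t) (y t)))
    have e2 : τ₃ p lam + (Y₁ + ∫ x in Mid, W.integrandC eps lam p x) + τ₂ p lam - Y₂ =
        (Y₁ - Y₂) + ((∫ x in Mid, W.integrandC eps lam p x) + τ₂ p lam + τ₃ p lam) := by ring
    have hC0 : 0 ≤ Cm + C₂ + C₃ := by positivity
    calc ‖τ₃ p lam + (Y₁ + ∫ x in Mid, W.integrandC eps lam p x) + τ₂ p lam - Y₂‖
        ≤ ‖Y₁ - Y₂‖ + (‖∫ x in Mid, W.integrandC eps lam p x‖ + ‖τ₂ p lam‖ + ‖τ₃ p lam‖) := by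
          rw [e2]
          exact (norm_add_le _ _).trans (add_le_add le_rfl (norm_add₃_le))
      _ ≤ (∑ t ∈ S, C' t) * (eps * √eps) * X + (Cm + C₂ + C₃) * E := by linarith
      _ ≤ (∑ t ∈ S, C' t) * (eps * √eps) * X + (Cm + C₂ + C₃) * (Ce * (eps * √eps) * X) := by gcongr
      _ = _ := by ring

end RationalPotential

/-! ### Rational functions with given zeros and Cauchy determinants. -/

section PartialFractions

variable {ι : Type*} [Fintype ι] [DecidableEq ι]

theorem eval_sum_nodal (z v : ι → ℂ) {q : ℂ} (hq : ∀ p, q ≠ z p) :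
    (∑ p, v p • Lagrange.nodal (Finset.univ.erase p) z).eval q =
      (∑ p, v p / (q - z p)) * ∏ p, (q - z p) := by
  rw [Polynomial.eval_finsetSum, Finset.sum_mul]
  refine Finset.sum_congr rfl fun p _ => ?_
  rw [Polynomial.eval_smul, Lagrange.eval_nodal, ← Finset.mul_prod_erase _ _ (Finset.mem_univ p),
    smul_eq_mul]
  have := sub_ne_zero.2 (hq p)
  field_simp

theorem degree_sum_nodal_lt (z v : ι → ℂ) :
    (∑ p, v p • Lagrange.nodal (Finset.univ.erase p) z).degree < Fintype.card ι := by
  refine Polynomial.mem_degreeLT.1 (Submodule.sum_mem _ fun p _ => Submodule.smul_mem _ _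
    (Polynomial.mem_degreeLT.2 ?_))
  rw [Lagrange.degree_nodal]
  exact_mod_cast Finset.card_lt_card (Finset.erase_ssubset (Finset.mem_univ p))

/-- A partial fraction with known zeros `Y m`, `m ≠ Q`, is determined by its value at `Y Q`. -/
theorem sum_div_sub_mul_prod_eq (z v Y : ι → ℂ) (hY : Function.Injective Y)
    (hz : ∀ m p, Y m ≠ z p) {Q : ι} (h : ∀ m, m ≠ Q → ∑ p, v p / (Y m - z p) = 0) {q : ℂ}
    (hq : ∀ p, q ≠ z p) :
    (∑ p, v p / (q - z p)) * (∏ p, (q - z p)) * (∏ m ∈ Finset.univ.erase Q, (Y Q - Y m)) =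
      (∑ p, v p / (Y Q - z p)) * (∏ p, (Y Q - z p)) * (∏ m ∈ Finset.univ.erase Q, (q - Y m)) := by
  set N := ∑ p, v p • Lagrange.nodal (Finset.univ.erase p) z with hN
  set G := Lagrange.nodal (Finset.univ.erase Q) Y with hG
  have hGdeg : G.degree < Fintype.card ι := by
    rw [hG, Lagrange.degree_nodal]
    exact_mod_cast Finset.card_lt_card (Finset.erase_ssubset (Finset.mem_univ Q))
  have key : G.eval (Y Q) • N = N.eval (Y Q) • G := by
    refine Polynomial.eq_of_degrees_lt_of_eval_finset_eq (Finset.univ.image Y) ?_ ?_ ?_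
    · rw [Finset.card_image_of_injective _ hY, Finset.card_univ]
      exact (Polynomial.degree_smul_le _ _).trans_lt (degree_sum_nodal_lt z v)
    · rw [Finset.card_image_of_injective _ hY, Finset.card_univ]
      exact (Polynomial.degree_smul_le _ _).trans_lt hGdeg
    · intro x hx
      obtain ⟨m, -, rfl⟩ := Finset.mem_image.1 hx
      rw [Polynomial.eval_smul, Polynomial.eval_smul, smul_eq_mul, smul_eq_mul]
      by_cases hm : m = Q
      · rw [hm, mul_comm]
      · rw [hN, eval_sum_nodal z v (hz m), h m hm, hG,
          Lagrange.eval_nodal_at_node (Finset.mem_erase.2 ⟨hm, Finset.mem_univ m⟩)]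
        ring
  have := congrArg (Polynomial.eval q) key
  rw [Polynomial.eval_smul, Polynomial.eval_smul, smul_eq_mul, smul_eq_mul, hN,
    eval_sum_nodal z v hq, eval_sum_nodal z v (hz Q), hG, Lagrange.eval_nodal,
    Lagrange.eval_nodal] at this
  linear_combination this

/-- Factorization of a rational function with simple poles `ζ` and known zeros `η`. -/
theorem add_sum_div_sub_mul_prod_eq (ζ r η : ι → ℂ) (hη : Function.Injective η)
    (hηζ : ∀ m p, η m ≠ ζ p) (lam : ℂ) (h : ∀ m, lam + ∑ p, r p / (η m - ζ p) = 0) {q : ℂ}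
    (hq : ∀ p, q ≠ ζ p) :
    (lam + ∑ p, r p / (q - ζ p)) * ∏ p, (q - ζ p) = lam * ∏ m, (q - η m) := by
  set N := lam • Lagrange.nodal Finset.univ ζ + ∑ p, r p • Lagrange.nodal (Finset.univ.erase p) ζ
    with hN
  have heval : ∀ x, (∀ p, x ≠ ζ p) → N.eval x = (lam + ∑ p, r p / (x - ζ p)) * ∏ p, (x - ζ p) := by
    intro x hx
    rw [hN, Polynomial.eval_add, eval_sum_nodal ζ r hx, Polynomial.eval_smul, Lagrange.eval_nodal,
      smul_eq_mul]
    ring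
  -- Both sides have the same coefficient of top degree and agree at as many nodes as that degree.
  have key : N = lam • Lagrange.nodal Finset.univ η := by
    refine Polynomial.eq_of_degree_sub_lt_of_eval_finset_eq (Finset.univ.image η) ?_ ?_
    · rw [Finset.card_image_of_injective _ hη, Finset.card_univ]
      have h1 : N - lam • Lagrange.nodal Finset.univ η =
          lam • (Lagrange.nodal Finset.univ ζ - Lagrange.nodal Finset.univ η) +
            ∑ p, r p • Lagrange.nodal (Finset.univ.erase p) ζ := by
        rw [hN, smul_sub]
        ring
      rw [h1, ← Polynomial.mem_degreeLT]
      refine Submodule.add_mem _ (Submodule.smul_mem _ _ ?_)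
        (Polynomial.mem_degreeLT.2 (degree_sum_nodal_lt ζ r))
      rw [Polynomial.mem_degreeLT]
      have h2 := Polynomial.degree_sub_lt_left (p := Lagrange.nodal Finset.univ ζ)
        (q := Lagrange.nodal Finset.univ η) (by rw [Lagrange.degree_nodal, Lagrange.degree_nodal])
        (Lagrange.nodal_ne_zero) (by
          rw [(Lagrange.nodal_monic).leadingCoeff, (Lagrange.nodal_monic).leadingCoeff])
      rwa [Lagrange.degree_nodal, Finset.card_univ] at h2
    · intro x hx
      obtain ⟨m, -, rfl⟩ := Finset.mem_image.1 hx
      rw [heval _ (hηζ m), h m, Polynomial.eval_smul,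
        Lagrange.eval_nodal_at_node (Finset.mem_univ m), zero_mul, smul_zero]
  have := congrArg (Polynomial.eval q) key
  rwa [heval q hq, Polynomial.eval_smul, Lagrange.eval_nodal, smul_eq_mul] at this

/-- The Cauchy matrix `1 / (Y m - z p)`. -/
noncomputable def cauchyDet (z Y : ι → ℂ) : ℂ := (Matrix.of fun m p => (Y m - z p)⁻¹).det

theorem continuousAt_cauchyDet (z : ι → ℂ) {Y : ι → ℂ} (hz : ∀ m p, Y m ≠ z p) :
    ContinuousAt (cauchyDet z) Y := by
  have h1 : ∀ m p, Y m - z p ≠ 0 := fun m p => sub_ne_zero.2 (hz m p)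
  unfold cauchyDet
  simp only [Matrix.det_apply, Matrix.of_apply]
  refine tendsto_finsetSum _ fun σ _ => Tendsto.const_smul (tendsto_finsetProd _ fun i _ => ?_) _
  exact ContinuousAt.inv₀ (f := fun Y : ι → ℂ => Y (σ i) - z i)
    ((continuous_apply (σ i)).sub continuous_const).continuousAt (h1 _ _)

/-- As a function of the point in row `Q`, the determinant is a partial fraction with poles `z p`
that vanishes whenever this point meets another `Y m`, because two rows coincide. These zeros
determine it up to a constant. -/
theorem cauchyDet_update_mul_prod_eq (z Y : ι → ℂ) (hY : Function.Injective Y)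
    (hz : ∀ m p, Y m ≠ z p) (Q : ι) {q : ℂ} (hq : ∀ p, q ≠ z p) :
    cauchyDet z (Function.update Y Q q) * (∏ p, (q - z p)) *
        (∏ m ∈ Finset.univ.erase Q, (Y Q - Y m)) =
      cauchyDet z Y * (∏ p, (Y Q - z p)) * (∏ m ∈ Finset.univ.erase Q, (q - Y m)) := by
  set M : Matrix ι ι ℂ := Matrix.of fun m p => (Y m - z p)⁻¹ with hM
  -- expansion along the row `Q`
  have hexp : ∀ x, cauchyDet z (Function.update Y Q x) = ∑ p, M.adjugate p Q / (x - z p) := by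
    intro x
    have h1 : (Matrix.of fun m p => (Function.update Y Q x m - z p)⁻¹) =
        M.updateRow Q fun p => (x - z p)⁻¹ := by
      ext m p
      by_cases hm : m = Q
      · subst hm
        simp
      · simp [hm, hM]
    rw [cauchyDet, h1, Matrix.det_eq_sum_mul_adjugate_row _ Q]
    refine Finset.sum_congr rfl fun p _ => ?_
    rw [Matrix.updateRow_self, Matrix.adjugate_apply, Matrix.adjugate_apply, Matrix.updateRow_idem,
      div_eq_mul_inv, mul_comm]
  have h := sum_div_sub_mul_prod_eq z (fun p => M.adjugate p Q) Y hY hz (Q := Q) (fun m hm => ?_) hq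
  · rw [← hexp, ← hexp, Function.update_eq_self] at h
    exact h
  · rw [← hexp]
    exact Matrix.det_zero_of_row_eq hm.symm (by ext p; simp [hm])

end PartialFractions

/-- A kernel vector would be a partial fraction with `P` simple poles and `P` distinct zeros. -/
theorem cauchyDet_ne_zero {P : ℕ} {z Y : Fin P → ℂ} (hzi : Function.Injective z)
    (hY : Function.Injective Y) (hz : ∀ m p, Y m ≠ z p) : cauchyDet z Y ≠ 0 := by
  intro h
  obtain ⟨v, hv0, hv⟩ := Matrix.exists_mulVec_eq_zero_iff.2 h
  refine hv0 (eq_zero_of_sum_div_sub_eq_zero hzi (s := Finset.univ.image Y) ?_ ?_ ?_)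
  · rw [Finset.card_image_of_injective _ hY, Finset.card_univ, Fintype.card_fin]
  · intro y hy p
    obtain ⟨m, -, rfl⟩ := Finset.mem_image.1 hy
    exact hz m p
  · intro y hy
    obtain ⟨m, -, rfl⟩ := Finset.mem_image.1 hy
    have := congrFun hv m
    simp only [Matrix.mulVec, dotProduct, Matrix.of_apply, Pi.zero_apply] at this
    rw [← this]
    exact Finset.sum_congr rfl fun p _ => by rw [div_eq_mul_inv, mul_comm]

theorem eq_sqrt_of_sq_eq {w : ℂ} {t : ℝ} (ht : 0 ≤ t) (hw : w ^ 2 = t) (hre : 0 < w.re) : w = √t := by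
  have h1 : (w - √t) * (w + √t) = 0 := by
    have : ((√t : ℝ) : ℂ) ^ 2 = t := by exact_mod_cast Real.sq_sqrt ht
    linear_combination hw - this
  rcases mul_eq_zero.1 h1 with h | h
  · exact sub_eq_zero.1 h
  · have h2 := congrArg Complex.re h
    rw [Complex.add_re, Complex.ofReal_re, Complex.zero_re] at h2
    linarith [Real.sqrt_nonneg t]

/-- The principal root of a number in the right half-plane lies in the sector `|arg| < π / 4`. This
fixes the sign of the Laplace coefficient, which its square leaves open. -/
theorem cpow_half_props {w : ℂ} (hw : 0 < w.re) :
    (w ^ (1 / 2 : ℂ)) ^ 2 = w ∧ |(w ^ (1 / 2 : ℂ)).im| < (w ^ (1 / 2 : ℂ)).re := by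
  have h0 : w ≠ 0 := fun h => by simp [h] at hw
  have hsq : (w ^ (1 / 2 : ℂ)) ^ 2 = w := by
    rw [← Complex.cpow_nat_mul]
    norm_num
  refine ⟨hsq, ?_⟩
  have hre : 0 < (w ^ (1 / 2 : ℂ)).re := by
    rw [Complex.cpow_def_of_ne_zero h0, Complex.exp_re]
    refine mul_pos (Real.exp_pos _) (Real.cos_pos_of_mem_Ioo ?_)
    have h1 : (Complex.log w * (1 / 2)).im = w.arg / 2 := by
      rw [one_div, ← div_eq_mul_inv, Complex.div_ofNat_im, Complex.log_im]
    have h2 := abs_lt.1 (Complex.abs_arg_lt_pi_div_two_iff.2 (Or.inl hw))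
    rw [h1]
    constructor <;> linarith [Real.pi_pos]
  have h3 : (w ^ (1 / 2 : ℂ)).im ^ 2 < (w ^ (1 / 2 : ℂ)).re ^ 2 := by
    have := congrArg Complex.re hsq
    rw [pow_two, Complex.mul_re] at this
    nlinarith
  exact abs_lt_of_sq_lt_sq h3 hre.le

theorem exp_I_mul_pi_div_four :
    Complex.exp (Complex.I * Real.pi / 4) = ((√2 / 2 : ℝ) : ℂ) * (1 + Complex.I) := by
  have h : Complex.I * Real.pi / 4 = ((Real.pi / 4 : ℝ) : ℂ) * Complex.I := by push_cast; ring
  rw [h, Complex.exp_mul_I, ← Complex.ofReal_cos, ← Complex.ofReal_sin, Real.cos_pi_div_four,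
    Real.sin_pi_div_four]
  ring

theorem exp_neg_I_mul_pi_div_four :
    Complex.exp (-(Complex.I * Real.pi / 4)) = ((√2 / 2 : ℝ) : ℂ) * (1 - Complex.I) := by
  have h : -(Complex.I * Real.pi / 4) = ((-(Real.pi / 4) : ℝ) : ℂ) * Complex.I := by push_cast; ring
  rw [h, Complex.exp_mul_I, ← Complex.ofReal_cos, ← Complex.ofReal_sin, Real.cos_neg, Real.sin_neg,
    Real.cos_pi_div_four, Real.sin_pi_div_four]
  push_cast
  ring

theorem ofReal_sqrt_two_div_two_sq : (((√2 / 2 : ℝ) : ℂ)) ^ 2 = 1 / 2 := by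
  have : (√2 / 2 : ℝ) ^ 2 = 1 / 2 := by
    rw [div_pow, Real.sq_sqrt (by norm_num)]; norm_num
  rw [← Complex.ofReal_pow, this]
  norm_num

/-- The value of the leading Laplace coefficient over a real critical point where `u' > 0`. -/
theorem laplaceCoeff_of_pos {u : ℂ → ℂ} {e x : ℂ} {d : ℝ} (hd : deriv u x = d) (hd0 : 0 < d)
    (he : 0 < e.re) (h : 0 < (Complex.I * deriv u x * e ^ 2 / 2).re) :
    laplaceCoeff u e x = √(2 * Real.pi / d) * Complex.exp (-(Complex.I * Real.pi / 4)) := by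
  set a := Complex.I * deriv u x * e ^ 2 / 2 with ha
  have ha0 : a ≠ 0 := fun h0 => by simp [h0] at h
  have he0 : e ≠ 0 := fun h0 => by simp [h0] at he
  have hdC : (d : ℂ) ≠ 0 := by exact_mod_cast hd0.ne'
  have hpa : 0 < ((Real.pi : ℂ) / a).re := by
    rw [div_eq_mul_inv, Complex.re_ofReal_mul, Complex.inv_re]
    exact mul_pos Real.pi_pos (div_pos h (Complex.normSq_pos.2 ha0))
  obtain ⟨hsq, him⟩ := cpow_half_props hpa
  set ρ := ((Real.pi : ℂ) / a) ^ (1 / 2 : ℂ) with hρ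
  have hare : a.re = -(d * (e.re * e.im)) := by
    have : a = (d / 2 : ℝ) * (Complex.I * e ^ 2) := by rw [ha, hd]; push_cast; ring
    rw [this, Complex.re_ofReal_mul, Complex.I_mul_re, pow_two, Complex.mul_im]
    ring
  have heim : e.im < 0 := by
    rw [hare] at h
    by_contra hc
    nlinarith [mul_nonneg hd0.le (mul_nonneg he.le (not_lt.1 hc))]
  have h2 : 0 < √(2 : ℝ) / 2 := by positivity
  -- The square is immediate. For the sign, `e` is in the fourth quadrant and `|arg ρ| < π / 4`, so
  -- after rotation by `π / 4` the product is in the right half-plane.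
  have key : e * ρ * Complex.exp (Complex.I * Real.pi / 4) = √(2 * Real.pi / d) := by
    refine eq_sqrt_of_sq_eq (by positivity) ?_ ?_
    · rw [exp_I_mul_pi_div_four, mul_pow, mul_pow, mul_pow, hsq, ofReal_sqrt_two_div_two_sq, ha, hd]
      push_cast
      have hI : (1 + Complex.I) ^ 2 = 2 * Complex.I := by
        linear_combination Complex.I_sq
      rw [hI]
      field_simp
    · have h3 : e * ρ * Complex.exp (Complex.I * Real.pi / 4) =
          ((√2 / 2 : ℝ) : ℂ) * (e * ρ * (1 + Complex.I)) := by
        rw [exp_I_mul_pi_div_four]; ring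
      rw [h3, Complex.re_ofReal_mul]
      refine mul_pos h2 ?_
      simp only [Complex.mul_re, Complex.mul_im, Complex.add_re, Complex.add_im, Complex.one_re,
        Complex.one_im, Complex.I_re, Complex.I_im]
      obtain ⟨h4, h5⟩ := abs_lt.1 him
      nlinarith [mul_pos he (sub_pos.2 h5), mul_pos (neg_pos.2 heim) (sub_pos.2 h4)]
  rw [← key, laplaceCoeff, ← ha, ← hρ, mul_assoc, ← Complex.exp_add, add_neg_cancel,
    Complex.exp_zero, mul_one]

/-- The mirror image of the preceding case: where `u' < 0` the valley condition makes the contour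
cross from below to above, and the phase changes sign. -/
theorem laplaceCoeff_of_neg {u : ℂ → ℂ} {e x : ℂ} {d : ℝ} (hd : deriv u x = d) (hd0 : d < 0)
    (he : 0 < e.re) (h : 0 < (Complex.I * deriv u x * e ^ 2 / 2).re) :
    laplaceCoeff u e x = √(2 * Real.pi / -d) * Complex.exp (Complex.I * Real.pi / 4) := by
  set a := Complex.I * deriv u x * e ^ 2 / 2 with ha
  have ha0 : a ≠ 0 := fun h0 => by simp [h0] at h
  have he0 : e ≠ 0 := fun h0 => by simp [h0] at he
  have hdC : (d : ℂ) ≠ 0 := by exact_mod_cast hd0.ne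
  have hpa : 0 < ((Real.pi : ℂ) / a).re := by
    rw [div_eq_mul_inv, Complex.re_ofReal_mul, Complex.inv_re]
    exact mul_pos Real.pi_pos (div_pos h (Complex.normSq_pos.2 ha0))
  obtain ⟨hsq, him⟩ := cpow_half_props hpa
  set ρ := ((Real.pi : ℂ) / a) ^ (1 / 2 : ℂ) with hρ
  have hare : a.re = -(d * (e.re * e.im)) := by
    have : a = (d / 2 : ℝ) * (Complex.I * e ^ 2) := by rw [ha, hd]; push_cast; ring
    rw [this, Complex.re_ofReal_mul, Complex.I_mul_re, pow_two, Complex.mul_im]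
    ring
  have heim : 0 < e.im := by
    rw [hare] at h
    by_contra hc
    nlinarith [mul_nonneg (neg_nonneg.2 hd0.le) (mul_nonneg he.le (neg_nonneg.2 (not_lt.1 hc)))]
  have h2 : 0 < √(2 : ℝ) / 2 := by positivity
  have hnd : 0 < -d := by linarith
  have key : e * ρ * Complex.exp (-(Complex.I * Real.pi / 4)) = √(2 * Real.pi / -d) := by
    refine eq_sqrt_of_sq_eq (by positivity) ?_ ?_
    · rw [exp_neg_I_mul_pi_div_four, mul_pow, mul_pow, mul_pow, hsq, ofReal_sqrt_two_div_two_sq, ha, hd]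
      push_cast
      have hI : (1 - Complex.I) ^ 2 = -2 * Complex.I := by
        linear_combination Complex.I_sq
      rw [hI]
      field_simp
    · have h3 : e * ρ * Complex.exp (-(Complex.I * Real.pi / 4)) =
          ((√2 / 2 : ℝ) : ℂ) * (e * ρ * (1 - Complex.I)) := by
        rw [exp_neg_I_mul_pi_div_four]; ring
      rw [h3, Complex.re_ofReal_mul]
      refine mul_pos h2 ?_
      simp only [Complex.mul_re, Complex.mul_im, Complex.sub_re, Complex.sub_im, Complex.one_re,
        Complex.one_im, Complex.I_re, Complex.I_im]
      obtain ⟨h4, h5⟩ := abs_lt.1 him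
      nlinarith [mul_pos he (sub_pos.2 h4), mul_pos heim (sub_pos.2 h5)]
  rw [← key, laplaceCoeff, ← ha, ← hρ, mul_assoc, ← Complex.exp_add, neg_add_cancel,
    Complex.exp_zero, mul_one]

theorem hasDerivAt_of_eventuallyEq_sub_mul {f k : ℂ → ℂ} {x : ℂ}
    (hf : ∀ᶠ w in 𝓝 x, f w = (w - x) * k w) (hk : ContinuousAt k x) : HasDerivAt f (k x) x := by
  rw [hasDerivAt_iff_tendsto_slope]
  refine (hk.tendsto.mono_left nhdsWithin_le_nhds).congr' ?_
  filter_upwards [nhdsWithin_le_nhds hf, self_mem_nhdsWithin] with w hw hne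
  have hne' : w - x ≠ 0 := sub_ne_zero.2 hne
  rw [slope_def_field, hw, hf.self_of_nhds, sub_self, zero_mul, sub_zero, mul_div_cancel_left₀ _ hne']

/-! ### Critical points and the quantization phase. -/

namespace RationalPotential

variable {P : ℕ} (u : RationalPotential P)

/-- The real critical points `xm < xp` and the critical points `Y m`, `m ≠ Q`, in the upper half
plane; `Y Q = xm`. -/
structure CritSystem (lam xm xp : ℝ) (Q : Fin P) (Y : Fin P → ℂ) : Prop where
  lt : xm < xp
  eq_Q : Y Q = xm
  im_pos : ∀ m, m ≠ Q → 0 < (Y m).im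
  notPole : ∀ m, u.NotPole (Y m)
  crit : ∀ m, (lam : ℂ) + u.u0C (Y m) = 0
  crit_xp : (lam : ℂ) + u.u0C xp = 0
  inj : Function.Injective Y

namespace CritSystem

variable {u} {lam xm xp : ℝ} {Q : Fin P} {Y : Fin P → ℂ}

/-- The function `λ + u₀` has `2 P` simple poles. The points `Y m`, the conjugates of those off the
real axis, and `xp` are `2 P` distinct zeros, so these are all zeros, and the value at infinity is
the remaining constant. -/
theorem factorization (h : u.CritSystem lam xm xp Q Y) {w : ℂ} (hw : u.NotPole w) :
    (lam + u.u0C w) * ((∏ p, (w - u.z p)) * ∏ p, (w - conj (u.z p))) =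
      lam * ((w - xm) * (w - xp) * ((∏ m ∈ Finset.univ.erase Q, (w - Y m)) *
        ∏ m ∈ Finset.univ.erase Q, (w - conj (Y m)))) := by
  set ζ : Fin P ⊕ Fin P → ℂ := Sum.elim u.z fun p => conj (u.z p) with hζ
  set r : Fin P ⊕ Fin P → ℂ := Sum.elim u.c fun p => conj (u.c p) with hr
  -- The conjugate of the real point `Y Q` would repeat it; its slot is taken by `xp`.
  set Y' : Fin P → ℂ := Function.update (fun m => conj (Y m)) Q xp with hY'
  set η : Fin P ⊕ Fin P → ℂ := Sum.elim Y Y' with hη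
  have hu : ∀ x, u.u0C x = ∑ p, r p / (x - ζ p) := fun x => by
    rw [Fintype.sum_sum_type]
    simp only [hr, hζ, Sum.elim_inl, Sum.elim_inr, u0C, Finset.sum_add_distrib]
  have hpole : ∀ x, u.NotPole x → ∀ p, x ≠ ζ p := fun x hx p => by
    rcases p with p | p
    · exact (hx p).1
    · exact (hx p).2
  have hY'im : ∀ m, m ≠ Q → (Y' m).im < 0 := fun m hm => by
    rw [hY', Function.update_of_ne hm, Complex.conj_im]
    linarith [h.im_pos m hm]
  have hY'Q : Y' Q = xp := Function.update_self _ _ _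
  have hYim : ∀ m, 0 ≤ (Y m).im := fun m => by
    by_cases hm : m = Q
    · rw [hm, h.eq_Q, Complex.ofReal_im]
    · exact (h.im_pos m hm).le
  have hnp' : ∀ m, u.NotPole (Y' m) ∧ (lam : ℂ) + u.u0C (Y' m) = 0 := fun m => by
    by_cases hm : m = Q
    · rw [hm, hY'Q]
      exact ⟨u.notPole_ofReal xp, h.crit_xp⟩
    · rw [hY', Function.update_of_ne hm, ← conj_u0C]
      refine ⟨fun p => ⟨fun e => (h.notPole m p).2 ?_, fun e => (h.notPole m p).1 ?_⟩, ?_⟩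
      · rw [← e, Complex.conj_conj]
      · exact (starRingEnd ℂ).injective e
      · have := congrArg conj (h.crit m)
        rwa [map_add, Complex.conj_ofReal, map_zero] at this
  have hinj : Function.Injective η := by
    refine Function.Injective.sumElim h.inj ?_ ?_
    · intro a b hab
      by_cases ha : a = Q <;> by_cases hb : b = Q
      · rw [ha, hb]
      · have := hY'im b hb
        rw [← hab, ha, hY'Q, Complex.ofReal_im] at this
        exact absurd this (lt_irrefl _)
      · have := hY'im a ha
        rw [hab, hb, hY'Q, Complex.ofReal_im] at this
        exact absurd this (lt_irrefl _)
      · rw [hY', Function.update_of_ne ha, Function.update_of_ne hb] at hab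
        exact h.inj ((starRingEnd ℂ).injective hab)
    · intro a b hab
      by_cases hb : b = Q
      · rw [hb, hY'Q] at hab
        by_cases ha : a = Q
        · rw [ha, h.eq_Q] at hab
          exact h.lt.ne (by exact_mod_cast hab)
        · have := h.im_pos a ha
          rw [hab, Complex.ofReal_im] at this
          exact lt_irrefl _ this
      · have := hY'im b hb
        rw [← hab] at this
        exact absurd (hYim a) this.not_ge
  have key := add_sum_div_sub_mul_prod_eq ζ r η hinj (fun m => by
    rcases m with m | m
    · exact hpole _ (h.notPole m)
    · exact hpole _ (hnp' m).1) lam (fun m => by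
    rcases m with m | m
    · rw [← hu]; exact h.crit m
    · rw [← hu]; exact (hnp' m).2) (hpole w hw)
  rw [← hu, Fintype.prod_sum_type, Fintype.prod_sum_type] at key
  simp only [hζ, hη, Sum.elim_inl, Sum.elim_inr] at key
  have hprod : ∏ m ∈ Finset.univ.erase Q, (w - Y' m) =
      ∏ m ∈ Finset.univ.erase Q, (w - conj (Y m)) := Finset.prod_congr rfl fun m hm => by
    rw [hY', Function.update_of_ne (Finset.ne_of_mem_erase hm)]
  rw [key, ← Finset.mul_prod_erase _ (fun m => w - Y m) (Finset.mem_univ Q),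
    ← Finset.mul_prod_erase _ (fun m => w - Y' m) (Finset.mem_univ Q), h.eq_Q, hY'Q, hprod]
  ring

/-- `∏ (x - Y m) / ∏ (x - z p)` over the upper critical points. -/
theorem conj_ratio (xr : ℝ) :
    conj ((∏ m ∈ Finset.univ.erase Q, ((xr : ℂ) - Y m)) / ∏ p, ((xr : ℂ) - u.z p)) =
      (∏ m ∈ Finset.univ.erase Q, ((xr : ℂ) - conj (Y m))) / ∏ p, ((xr : ℂ) - conj (u.z p)) := by
  simp [map_div₀, map_prod]

theorem eventually_add_u0C_eq (h : u.CritSystem lam xm xp Q Y) (x : ℝ) :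
    ∀ᶠ w in 𝓝 (x : ℂ), u.u0C w - -lam = lam * ((w - xm) * (w - xp) *
      (((∏ m ∈ Finset.univ.erase Q, (w - Y m)) / ∏ p, (w - u.z p)) *
        ((∏ m ∈ Finset.univ.erase Q, (w - conj (Y m))) / ∏ p, (w - conj (u.z p))))) := by
  filter_upwards [u.isOpen_notPole.mem_nhds (u.notPole_ofReal x)] with w hw
  have h1 : ∏ p, (w - u.z p) ≠ 0 := Finset.prod_ne_zero_iff.2 fun p _ => sub_ne_zero.2 (hw p).1
  have h2 : ∏ p, (w - conj (u.z p)) ≠ 0 :=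
    Finset.prod_ne_zero_iff.2 fun p _ => sub_ne_zero.2 (hw p).2
  have := h.factorization hw
  field_simp
  linear_combination this

theorem continuousAt_ratio (x : ℝ) :
    ContinuousAt (fun w : ℂ => ((∏ m ∈ Finset.univ.erase Q, (w - Y m)) / ∏ p, (w - u.z p)) *
        ((∏ m ∈ Finset.univ.erase Q, (w - conj (Y m))) / ∏ p, (w - conj (u.z p)))) x := by
  have h1 : ∏ p, ((x : ℂ) - u.z p) ≠ 0 :=
    Finset.prod_ne_zero_iff.2 fun p _ => sub_ne_zero.2 (u.notPole_ofReal x p).1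
  have h2 : ∏ p, ((x : ℂ) - conj (u.z p)) ≠ 0 :=
    Finset.prod_ne_zero_iff.2 fun p _ => sub_ne_zero.2 (u.notPole_ofReal x p).2
  exact ((by fun_prop : ContinuousAt (fun w : ℂ => ∏ m ∈ Finset.univ.erase Q, (w - Y m)) x).div
    (by fun_prop) h1).mul
    ((by fun_prop : ContinuousAt (fun w : ℂ => ∏ m ∈ Finset.univ.erase Q, (w - conj (Y m))) x).div
    (by fun_prop) h2)

/-- The derivative at a zero is the product of the remaining factors; on the real axis the factors
over conjugate points combine to a squared modulus. -/
theorem deriv_xp (h : u.CritSystem lam xm xp Q Y) :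
    deriv u.u0C xp = ((lam * (xp - xm) * ‖(∏ m ∈ Finset.univ.erase Q, ((xp : ℂ) - Y m)) /
      ∏ p, ((xp : ℂ) - u.z p)‖ ^ 2 : ℝ) : ℂ) := by
  have hd := hasDerivAt_of_eventuallyEq_sub_mul (f := fun w => u.u0C w - -lam) (x := (xp : ℂ))
    (k := fun w => lam * ((w - xm) *
      (((∏ m ∈ Finset.univ.erase Q, (w - Y m)) / ∏ p, (w - u.z p)) *
        ((∏ m ∈ Finset.univ.erase Q, (w - conj (Y m))) / ∏ p, (w - conj (u.z p)))))) (by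
      filter_upwards [h.eventually_add_u0C_eq xp] with w hw
      rw [hw]
      ring) (ContinuousAt.mul continuousAt_const
        (ContinuousAt.mul (by fun_prop) (continuousAt_ratio xp)))
  have hd2 := ((u.differentiableAt_u0C (u.notPole_ofReal xp)).hasDerivAt.sub_const (-lam : ℂ)).unique hd
  rw [hd2]
  rw [← conj_ratio, Complex.mul_conj, Complex.normSq_eq_norm_sq]
  push_cast
  ring

theorem deriv_xm (h : u.CritSystem lam xm xp Q Y) :
    deriv u.u0C xm = ((lam * (xm - xp) * ‖(∏ m ∈ Finset.univ.erase Q, ((xm : ℂ) - Y m)) /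
      ∏ p, ((xm : ℂ) - u.z p)‖ ^ 2 : ℝ) : ℂ) := by
  have hd := hasDerivAt_of_eventuallyEq_sub_mul (f := fun w => u.u0C w - -lam) (x := (xm : ℂ))
    (k := fun w => lam * ((w - xp) *
      (((∏ m ∈ Finset.univ.erase Q, (w - Y m)) / ∏ p, (w - u.z p)) *
        ((∏ m ∈ Finset.univ.erase Q, (w - conj (Y m))) / ∏ p, (w - conj (u.z p)))))) (by
      filter_upwards [h.eventually_add_u0C_eq xm] with w hw
      rw [hw]
      ring) (ContinuousAt.mul continuousAt_const
        (ContinuousAt.mul (by fun_prop) (continuousAt_ratio xm)))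
  have hd2 := ((u.differentiableAt_u0C (u.notPole_ofReal xm)).hasDerivAt.sub_const (-lam : ℂ)).unique hd
  rw [hd2]
  rw [← conj_ratio, Complex.mul_conj, Complex.normSq_eq_norm_sq]
  push_cast
  ring

theorem ratio_ne_zero (h : u.CritSystem lam xm xp Q Y) (x : ℝ) :
    (∏ m ∈ Finset.univ.erase Q, ((x : ℂ) - Y m)) / ∏ p, ((x : ℂ) - u.z p) ≠ 0 := by
  refine div_ne_zero (Finset.prod_ne_zero_iff.2 fun m hm => sub_ne_zero.2 fun e => ?_)
    (Finset.prod_ne_zero_iff.2 fun p _ => sub_ne_zero.2 (u.notPole_ofReal x p).1)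
  have := h.im_pos m (Finset.ne_of_mem_erase hm)
  rw [← e, Complex.ofReal_im] at this
  exact lt_irrefl _ this

theorem finprod_eq (hrange : u.upperCritical lam = Y '' {m | m ≠ Q}) (hinj : Function.Injective Y)
    (g : ℂ → ℂ) : ∏ᶠ w ∈ u.upperCritical lam, g w = ∏ m ∈ Finset.univ.erase Q, g (Y m) := by
  have : u.upperCritical lam = ((Finset.univ.erase Q).image Y : Finset ℂ) := by
    rw [hrange, Finset.coe_image]
    congr 1
    ext m
    simp
  rw [this, finprod_mem_coe_finset, Finset.prod_image hinj.injOn]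

/-- The quantization phase in terms of `ψ₊ - ψ₋`. -/
theorem laplaceCoeff_mul_cauchyDet (h : u.CritSystem lam (u.xMinus lam) (u.xPlus lam) Q Y)
    (hlam : lam < 0) (hrange : u.upperCritical lam = Y '' {m | m ≠ Q}) {a b : ℝ}
    (hab : u.IsPhasePair lam a b) {em ep : ℂ} (hem : 0 < em.re) (hep : 0 < ep.re)
    (hm : 0 < (Complex.I * deriv u.u0C (u.xMinus lam) * em ^ 2 / 2).re)
    (hp : 0 < (Complex.I * deriv u.u0C (u.xPlus lam) * ep ^ 2 / 2).re) :
    laplaceCoeff u.u0C ep (u.xPlus lam) * cauchyDet u.z (Function.update Y Q (u.xPlus lam)) =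
      -Complex.exp (-Complex.I * (a - b)) *
        (laplaceCoeff u.u0C em (u.xMinus lam) * cauchyDet u.z Y) := by
  set xm := u.xMinus lam
  set xp := u.xPlus lam
  have hL : 0 < xp - xm := sub_pos.2 h.lt
  set rp := (∏ m ∈ Finset.univ.erase Q, ((xp : ℂ) - Y m)) / ∏ p, ((xp : ℂ) - u.z p) with hrp
  set rm := (∏ m ∈ Finset.univ.erase Q, ((xm : ℂ) - Y m)) / ∏ p, ((xm : ℂ) - u.z p) with hrm
  have hrp0 : rp ≠ 0 := h.ratio_ne_zero xp
  have hrm0 : rm ≠ 0 := h.ratio_ne_zero xm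
  have hPsiM : u.PsiMinus lam xp = (xp - xm : ℝ) * rp := by
    rw [PsiMinus, finprod_eq hrange h.inj, hrp]
    push_cast
    ring
  have hPsiP : u.PsiPlus lam xm = -((xp - xm : ℝ) * conj rm) := by
    rw [PsiPlus, finprod_eq hrange h.inj, hrm, conj_ratio]
    push_cast
    ring
  obtain ⟨ha, hb⟩ := hab
  have hLC : ((xp - xm : ℝ) : ℂ) ≠ 0 := by exact_mod_cast hL.ne'
  have hnp : (‖rp‖ : ℂ) ≠ 0 := by exact_mod_cast norm_ne_zero_iff.2 hrp0
  have hnm : (‖rm‖ : ℂ) ≠ 0 := by exact_mod_cast norm_ne_zero_iff.2 hrm0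
  -- unit phases
  have ha' : rp = ‖rp‖ * Complex.exp (-(Complex.I * a) - Complex.I * Real.pi / 4) := by
    rw [ha, hPsiM, norm_mul, Complex.norm_real, Real.norm_of_nonneg hL.le]
    push_cast at hLC ⊢
    field_simp
  have hb' : rm = -(‖rm‖ * Complex.exp (-(Complex.I * b) + Complex.I * Real.pi / 4)) := by
    have h1 : conj rm = -(‖rm‖ * Complex.exp (Complex.I * b - Complex.I * Real.pi / 4)) := by
      rw [hb, hPsiP, norm_neg, norm_mul, RCLike.norm_conj, Complex.norm_real,
        Real.norm_of_nonneg hL.le]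
      push_cast at hLC ⊢
      field_simp
    have h2 := congrArg conj h1
    rw [Complex.conj_conj] at h2
    have h3 : conj (Complex.I * b - Complex.I * Real.pi / 4) =
        -(Complex.I * b) + Complex.I * Real.pi / 4 := by
      simp only [map_mul, map_sub, map_div₀, Complex.conj_I, Complex.conj_ofReal,
        Complex.conj_ofNat]
      ring
    refine h2.trans ?_
    rw [map_neg, map_mul, Complex.conj_ofReal, ← Complex.exp_conj, h3]
  have hC := cauchyDet_update_mul_prod_eq u.z Y h.inj (fun m p => (h.notPole m p).1) Q
    (q := xp) fun p => (u.notPole_ofReal xp p).1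
  have hzp : ∏ p, ((xp : ℂ) - u.z p) ≠ 0 :=
    Finset.prod_ne_zero_iff.2 fun p _ => sub_ne_zero.2 (u.notPole_ofReal xp p).1
  have hzm : ∏ p, ((xm : ℂ) - u.z p) ≠ 0 :=
    Finset.prod_ne_zero_iff.2 fun p _ => sub_ne_zero.2 (u.notPole_ofReal xm p).1
  rw [h.eq_Q] at hC
  -- Moving row `Q` from `x₋` to `x₊` multiplies the determinant by `rp / rm`. The moduli of `rp`
  -- and `rm` cancel against the square roots in the Laplace coefficients, and the phases `±π / 4`
  -- cancel against those in the definition of `ψ±`.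
  have hC' : cauchyDet u.z (Function.update Y Q xp) * rm = cauchyDet u.z Y * rp := by
    rw [hrp, hrm]
    field_simp
    linear_combination hC
  have hrm2 : 0 < ‖rm‖ := norm_pos_iff.2 hrm0
  have hrp2 : 0 < ‖rp‖ := norm_pos_iff.2 hrp0
  rw [laplaceCoeff_of_neg h.deriv_xp (by
      have := mul_pos (mul_pos (neg_pos.2 hlam) hL) (pow_pos hrp2 2); nlinarith) hep hp,
    laplaceCoeff_of_pos h.deriv_xm (by
      have := mul_pos (mul_pos (neg_pos.2 hlam) hL) (pow_pos hrm2 2); nlinarith) hem hm]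
  have hs : ∀ r : ℝ, 0 < r → √(2 * Real.pi / (-lam * (xp - xm) * r ^ 2)) =
      √(2 * Real.pi / (-lam * (xp - xm))) / r := fun r hr => by
    rw [← div_div, Real.sqrt_div' _ (by positivity), Real.sqrt_sq hr.le]
  rw [show -(lam * (xp - xm) * ‖rp‖ ^ 2) = -lam * (xp - xm) * ‖rp‖ ^ 2 by ring,
    show lam * (xm - xp) * ‖rm‖ ^ 2 = -lam * (xp - xm) * ‖rm‖ ^ 2 by ring, hs _ hrm2, hs _ hrp2]
  set A := √(2 * Real.pi / (-lam * (xp - xm)))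
  push_cast
  refine mul_right_cancel₀ hrm0 ?_
  have e1 : Complex.exp (Complex.I * Real.pi / 4) *
      Complex.exp (-(Complex.I * a) - Complex.I * Real.pi / 4) = Complex.exp (-(Complex.I * a)) := by
    rw [← Complex.exp_add]; congr 1; ring
  have e2 : Complex.exp (-(Complex.I * Real.pi / 4)) *
      Complex.exp (-(Complex.I * b) + Complex.I * Real.pi / 4) = Complex.exp (-(Complex.I * b)) := by
    rw [← Complex.exp_add]; congr 1; ring
  have e3 : Complex.exp (-Complex.I * (a - b)) * Complex.exp (-(Complex.I * b)) =
      Complex.exp (-(Complex.I * a)) := by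
    rw [← Complex.exp_add]; congr 1; ring
  calc _ = cauchyDet u.z Y * A * (Complex.exp (Complex.I * Real.pi / 4) * (rp / ‖rp‖)) := by
        rw [mul_assoc, hC']; ring
    _ = cauchyDet u.z Y * A * Complex.exp (-(Complex.I * a)) := by
        rw [← e1]
        congr 2
        rw [div_eq_iff hnp, mul_comm, ← ha']
    _ = -(Complex.exp (-Complex.I * (a - b)) * cauchyDet u.z Y * A *
          (Complex.exp (-(Complex.I * Real.pi / 4)) * (rm / ‖rm‖))) := by
        have : rm / ‖rm‖ = -Complex.exp (-(Complex.I * b) + Complex.I * Real.pi / 4) := by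
          rw [div_eq_iff hnm]
          linear_combination hb'
        rw [this, mul_neg, e2, ← e3]
        ring
    _ = _ := by ring

end CritSystem

end RationalPotential

/-! ### Normalized rows of the modified matrix. -/

namespace RationalPotential

variable {P : ℕ} (u : RationalPotential P)

open Metric

theorem analyticAt_u0C {w : ℂ} (hw : u.NotPole w) : AnalyticAt ℂ u.u0C w :=
  DifferentiableOn.analyticAt (s := {w | u.NotPole w})
    (fun _ hv => (u.differentiableAt_u0C hv).differentiableWithinAt) (u.isOpen_notPole.mem_nhds hw)

theorem laplaceCoeff_ne_zero {f : ℂ → ℂ} {e x : ℂ} (h : 0 < (Complex.I * deriv f x * e ^ 2 / 2).re) :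
    laplaceCoeff f e x ≠ 0 := by
  have h0 : Complex.I * deriv f x * e ^ 2 / 2 ≠ 0 := fun h' => by simp [h'] at h
  have he : e ≠ 0 := fun he => h0 (by simp [he])
  refine mul_ne_zero he fun h' => ?_
  rw [Complex.cpow_eq_zero_iff] at h'
  exact div_ne_zero (by exact_mod_cast Real.pi_ne_zero) h0 h'.1

theorem continuousAt_laplaceCoeff {f : ℂ → ℂ} {e x : ℂ} (hf : AnalyticAt ℂ f x)
    (h : 0 < (Complex.I * deriv f x * e ^ 2 / 2).re) : ContinuousAt (laplaceCoeff f e) x := by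
  have h0 : Complex.I * deriv f x * e ^ 2 / 2 ≠ 0 := fun h' => by simp [h'] at h
  have hd : ContinuousAt (deriv f) x := hf.deriv.continuousAt
  have h1 : ContinuousAt (fun y => (Real.pi : ℂ) / (Complex.I * deriv f y * e ^ 2 / 2)) x :=
    continuousAt_const.div (((continuousAt_const.mul hd).mul continuousAt_const).div_const 2) h0
  refine continuousAt_const.mul (h1.cpow continuousAt_const (Or.inl ?_))
  rw [Complex.div_re, Complex.ofReal_re, Complex.ofReal_im]
  have := Complex.normSq_pos.2 h0
  have := Real.pi_pos
  rw [zero_mul, zero_div, add_zero]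
  positivity

variable {u}

set_option maxHeartbeats 1000000 in
/-- The integrals over a contour, normalised by the contribution of one of its dominating critical
points. -/
theorem Contour.exists_row (W : u.Contour) {eps₀ Lam₀ : ℝ} (heps₀ : 0 < eps₀)
    (hint : ∀ eps, 0 < eps → eps < eps₀ → ∀ mu < 0, ∀ p,
      MeasureTheory.Integrable (W.integrand eps mu p)) (hLam : Lam₀ < 0)
    {S : Finset ℝ} {t₀ : ℝ} (ht₀ : t₀ ∈ S) {L₀ : ℝ} (hL : ∀ t ∈ S, (W.H Lam₀ t).im = L₀)
    (hlt : ∀ t ∉ S, (W.H Lam₀ t).im < L₀) (hpass : ∀ t ∈ S, W.PassesOver t) {Φ : ℝ → ℂ → ℂ} {r : ℝ}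
    (hr : 0 < r) (hΦ : ∀ t ∈ S, ∀ w ∈ ball (W.γ t) r, HasDerivAt (Φ t) (u.u0C w) w)
    (hΦ₀ : ∀ t ∈ S, Φ t (W.γ t) = W.F t) (B : ℝ) :
    ∃ δ > 0, ∃ C > 0, ∃ eps₁ > 0,
      (∀ t ∈ S, ∀ y ∈ ball (W.γ t) δ, 0 < (Complex.I * deriv u.u0C y * deriv W.γ t ^ 2 / 2).re) ∧
      ∀ eps, 0 < eps → eps < eps₁ → ∃ R : Fin P → ℂ → ℂ,
        (∀ p, DifferentiableOn ℂ (R p) (ball (Lam₀ : ℂ) δ)) ∧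
        (∀ p, ∀ mu : ℝ, |mu - Lam₀| < δ → ∫ t, W.integrand eps mu p t = R p mu) ∧
        ∀ Lam : ℝ, |Lam - Lam₀| < δ → ∀ y : ℝ → ℂ,
          (∀ t ∈ S, y t ∈ ball (W.γ t) δ ∧ (Lam : ℂ) + u.u0C (y t) = 0) →
          (∀ t ∈ S, (Lam * y t + Φ t (y t)).im = (Lam * y t₀ + Φ t₀ (y t₀)).im) →
          ∃ d : ℂ, d ≠ 0 ∧ ∀ s : ℂ, ‖s‖ ≤ B →
            (∀ p, ‖d * Complex.exp (Complex.I * s * y t₀) * R p (Lam + eps * s) -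
              ∑ t ∈ S, (Complex.exp (-Complex.I *
                ((Lam * y t + Φ t (y t)) - (Lam * y t₀ + Φ t₀ (y t₀))) / eps) *
                (laplaceCoeff u.u0C (deriv W.γ t) (y t) /
                  laplaceCoeff u.u0C (deriv W.γ t₀) (y t₀)) *
                Complex.exp (-Complex.I * s * (y t - y t₀))) * (y t - u.z p)⁻¹‖ ≤ C * eps) ∧
            ∀ t ∈ S, ‖Complex.exp (-Complex.I *
                ((Lam * y t + Φ t (y t)) - (Lam * y t₀ + Φ t₀ (y t₀))) / eps) *
                (laplaceCoeff u.u0C (deriv W.γ t) (y t) /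
                  laplaceCoeff u.u0C (deriv W.γ t₀) (y t₀)) *
                Complex.exp (-Complex.I * s * (y t - y t₀))‖ ≤ C := by
  obtain ⟨δ, hδ, C, hC, eps₁, heps₁, hpos, hmain⟩ := W.exists_asymptotics heps₀ hint hLam ⟨t₀, ht₀⟩
    hL hlt hpass hr hΦ hΦ₀ B
  have hκ : ∀ t ∈ S, ∃ ρ > 0, ∀ y ∈ ball (W.γ t) ρ,
      ‖laplaceCoeff u.u0C (deriv W.γ t) (W.γ t)‖ / 2 < ‖laplaceCoeff u.u0C (deriv W.γ t) y‖ ∧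
      ‖laplaceCoeff u.u0C (deriv W.γ t) y‖ < ‖laplaceCoeff u.u0C (deriv W.γ t) (W.γ t)‖ + 1 := by
    intro t ht
    have hp := hpos t ht _ (mem_ball_self hδ)
    have hc := (continuousAt_laplaceCoeff (u.analyticAt_u0C (W.notPole t)) hp).norm
    have h0 := norm_pos_iff.2 (laplaceCoeff_ne_zero hp)
    exact Metric.eventually_nhds_iff_ball.1
      ((hc.eventually_const_lt (half_lt_self h0)).and (hc.eventually_lt_const (lt_add_one _)))
  choose! ρ hρ hρ' using hκ
  obtain ⟨ρ₁, hρ₁, hρ₁'⟩ := S.exists_pos_forall_le hρ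
  set K := ∑ t ∈ S, (‖laplaceCoeff u.u0C (deriv W.γ t) (W.γ t)‖ + 1) with hK
  have hKt : ∀ t ∈ S, ‖laplaceCoeff u.u0C (deriv W.γ t) (W.γ t)‖ + 1 ≤ K := fun t ht =>
    Finset.single_le_sum (f := fun t => ‖laplaceCoeff u.u0C (deriv W.γ t) (W.γ t)‖ + 1)
      (fun i _ => by positivity) ht
  set k := ‖laplaceCoeff u.u0C (deriv W.γ t₀) (W.γ t₀)‖ / 2 with hk
  have hk0 : 0 < k := half_pos (norm_pos_iff.2 (laplaceCoeff_ne_zero (hpos t₀ ht₀ _ (mem_ball_self hδ))))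
  set M := ∑ t ∈ S, (‖W.γ t‖ + 1) with hM
  have hMt : ∀ t ∈ S, ‖W.γ t‖ + 1 ≤ M := fun t ht =>
    Finset.single_le_sum (f := fun t => ‖W.γ t‖ + 1) (fun i _ => by positivity) ht
  have hM0 : 0 < M := (by positivity : 0 < ‖W.γ t₀‖ + 1).trans_le (hMt t₀ ht₀)
  have hK0 : 0 < K :=
    (by positivity : 0 < ‖laplaceCoeff u.u0C (deriv W.γ t₀) (W.γ t₀)‖ + 1).trans_le (hKt t₀ ht₀)
  set δ' := min (min (δ / 2) ρ₁) 1 with hδ'def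
  have hδ' : 0 < δ' := lt_min (lt_min (half_pos hδ) hρ₁) one_pos
  have hδ'1 : δ' ≤ δ / 2 := (min_le_left _ _).trans (min_le_left _ _)
  have hδ'2 : δ' ≤ ρ₁ := (min_le_left _ _).trans (min_le_right _ _)
  have hδ'3 : δ' ≤ 1 := min_le_right _ _
  have hcard : (0 : ℝ) < S.card := by exact_mod_cast Finset.card_pos.2 ⟨t₀, ht₀⟩
  set C₁ := C * S.card * Real.exp (B * M) / k with hC₁
  set C₂ := K / k * Real.exp (B * (2 * M)) with hC₂
  have hC₁0 : 0 < C₁ := by positivity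
  have hC₂0 : 0 < C₂ := by positivity
  refine ⟨δ', hδ', C₁ + C₂, by positivity, eps₁, heps₁, fun t ht y hy =>
    hpos t ht y (ball_subset_ball (by linarith) hy), fun eps he he' => ?_⟩
  obtain ⟨R, hR1, hR2, hR3⟩ := hmain eps he he'
  refine ⟨R, fun p => (hR1 p).mono (ball_subset_ball (by linarith)),
    fun p mu hmu => hR2 p mu (by linarith), fun Lam hL' y hy him => ?_⟩
  set κ : ℝ → ℂ := fun t => laplaceCoeff u.u0C (deriv W.γ t) (y t) with hκdef
  set Hy : ℝ → ℂ := fun t => Lam * y t + Φ t (y t) with hHy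
  have hyball : ∀ t ∈ S, y t ∈ ball (W.γ t) (ρ t) := fun t ht =>
    ball_subset_ball (hδ'2.trans (hρ₁' t ht)) (hy t ht).1
  have hynorm : ∀ t ∈ S, ‖y t‖ ≤ M := fun t ht => by
    have h1 := mem_ball_iff_norm.1 (hy t ht).1
    have h2 := norm_le_norm_add_norm_sub' (y t) (W.γ t)
    linarith [hMt t ht]
  have hκ0 : k ≤ ‖κ t₀‖ := (hρ' t₀ ht₀ _ (hyball t₀ ht₀)).1.le
  have hκ00 : κ t₀ ≠ 0 := norm_pos_iff.1 (hk0.trans_le hκ0)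
  have hκK : ∀ t ∈ S, ‖κ t‖ ≤ K := fun t ht => (hρ' t ht _ (hyball t ht)).2.le.trans (hKt t ht)
  have hsq : (0 : ℝ) < √eps := Real.sqrt_pos.2 he
  have hsqC : ((√eps : ℝ) : ℂ) ≠ 0 := by exact_mod_cast hsq.ne'
  have hexp : ∀ w : ℂ, ‖Complex.exp (-Complex.I * w / eps)‖ = Real.exp (w.im / eps) := fun w =>
    norm_cexp_neg_I_mul w eps
  -- The reciprocal of the leading term at `t₀`, without its factors depending on `s` and `p`; so
  -- the normalization is a nonzero constant in `s`.
  refine ⟨(√eps * Complex.exp (-Complex.I * Hy t₀ / eps) * κ t₀)⁻¹,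
    inv_ne_zero (mul_ne_zero (mul_ne_zero hsqC (Complex.exp_ne_zero _)) hκ00), fun s hs => ⟨fun p => ?_,
    fun t ht => ?_⟩⟩
  · have hB : 0 ≤ B := (norm_nonneg s).trans hs
    have h1 := hR3 Lam (by linarith) y (fun t ht => ⟨ball_subset_ball (by linarith) (hy t ht).1,
      (hy t ht).2⟩) s hs p
    have h2 : ∑ t ∈ S, Real.exp ((Lam * y t + Φ t (y t)).im / eps) =
        S.card * Real.exp ((Hy t₀).im / eps) := by
      rw [Finset.sum_congr rfl fun t ht => by rw [him t ht], Finset.sum_const, nsmul_eq_mul]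
    rw [h2] at h1
    set d := (√eps * Complex.exp (-Complex.I * Hy t₀ / eps) * κ t₀)⁻¹ with hd
    have h3 : ∑ t ∈ S, (Complex.exp (-Complex.I * (Hy t - Hy t₀) / eps) * (κ t / κ t₀) *
          Complex.exp (-Complex.I * s * (y t - y t₀))) * (y t - u.z p)⁻¹ =
        d * Complex.exp (Complex.I * s * y t₀) * ∑ t ∈ S, √eps * (Complex.exp (-Complex.I * Hy t / eps) *
          (Complex.exp (-Complex.I * s * y t) / (y t - u.z p) * κ t)) := by
      rw [Finset.mul_sum]
      refine Finset.sum_congr rfl fun t _ => ?_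
      rw [show -Complex.I * (Hy t - Hy t₀) / eps = -Complex.I * Hy t / eps - -Complex.I * Hy t₀ / eps
        by ring, Complex.exp_sub, show -Complex.I * s * (y t - y t₀) =
          -Complex.I * s * y t + Complex.I * s * y t₀ by ring, Complex.exp_add, hd]
      have := Complex.exp_ne_zero (-Complex.I * Hy t₀ / eps)
      field_simp
    rw [h3, ← mul_sub, norm_mul, norm_mul]
    have h4 : ‖Complex.exp (Complex.I * s * y t₀)‖ ≤ Real.exp (B * M) := by
      refine (Complex.norm_exp_le_exp_norm _).trans (Real.exp_le_exp.2 ?_)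
      rw [norm_mul, norm_mul, Complex.norm_I, one_mul]
      exact mul_le_mul hs (hynorm t₀ ht₀) (norm_nonneg _) hB
    have h5 : ‖d‖ = (√eps * Real.exp ((Hy t₀).im / eps) * ‖κ t₀‖)⁻¹ := by
      rw [hd, norm_inv, norm_mul, norm_mul, hexp, Complex.norm_real, Real.norm_of_nonneg hsq.le]
    have hE := Real.exp_pos ((Hy t₀).im / eps)
    calc _ ≤ ‖d‖ * Real.exp (B * M) * (C * (eps * √eps) * (S.card * Real.exp ((Hy t₀).im / eps))) := by
          gcongr
      _ = C * S.card * Real.exp (B * M) / ‖κ t₀‖ * eps := by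
          rw [h5]
          have : ‖κ t₀‖ ≠ 0 := norm_ne_zero_iff.2 hκ00
          field_simp
      _ ≤ C₁ * eps := by
          rw [hC₁]
          gcongr
      _ ≤ (C₁ + C₂) * eps := by gcongr; linarith
  · have hB : 0 ≤ B := (norm_nonneg s).trans hs
    -- The critical values have equal imaginary parts, so no contribution outweighs another
    -- exponentially.
    have h6 : ‖Complex.exp (-Complex.I * (Hy t - Hy t₀) / eps)‖ = 1 := by
      rw [hexp, Complex.sub_im, him t ht, sub_self, zero_div, Real.exp_zero]
    have h7 : ‖Complex.exp (-Complex.I * s * (y t - y t₀))‖ ≤ Real.exp (B * (2 * M)) := by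
      refine (Complex.norm_exp_le_exp_norm _).trans (Real.exp_le_exp.2 ?_)
      rw [norm_mul, norm_mul, norm_neg, Complex.norm_I, one_mul]
      refine mul_le_mul hs ((norm_sub_le _ _).trans ?_) (norm_nonneg _) hB
      linarith [hynorm t ht, hynorm t₀ ht₀]
    rw [norm_mul, norm_mul, norm_div]
    calc _ ≤ 1 * (K / k) * Real.exp (B * (2 * M)) := by
          gcongr
          · exact h6.le
          · exact hκK t ht
      _ = C₂ := by rw [one_mul]
      _ ≤ C₁ + C₂ := by linarith

end RationalPotential

namespace RationalPotential

variable {P : ℕ} {u : RationalPotential P}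

open Metric

/-- The integrals over `W` at the spectral parameter `Lam + eps * s` are, up to a common factor,
`(y - z p)⁻¹ + X eps Lam s p` with an error `O(eps)`, for the critical points `y` with `G Lam y`. -/
def Contour.RowApprox (W : u.Contour) (Lam₀ B : ℝ) (G : ℝ → ℂ → Prop)
    (X : ℝ → ℝ → ℂ → Fin P → ℂ) (δ C eps₁ : ℝ) : Prop :=
  ∀ eps, 0 < eps → eps < eps₁ → ∃ R : Fin P → ℂ → ℂ,
    (∀ p, DifferentiableOn ℂ (R p) (ball (Lam₀ : ℂ) δ)) ∧
    (∀ p, ∀ mu : ℝ, |mu - Lam₀| < δ → ∫ t, W.integrand eps mu p t = R p mu) ∧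
    ∀ Lam : ℝ, |Lam - Lam₀| < δ → ∀ y : ℂ, G Lam y → ∃ d : ℂ, d ≠ 0 ∧ ∀ s : ℂ, ‖s‖ ≤ B → ∀ p,
      ‖d * Complex.exp (Complex.I * s * y) * R p (Lam + eps * s) -
        ((y - u.z p)⁻¹ + X eps Lam s p)‖ ≤ C * eps

theorem Contour.RowApprox.mono {W : u.Contour} {Lam₀ B : ℝ} {G G' : ℝ → ℂ → Prop}
    {X : ℝ → ℝ → ℂ → Fin P → ℂ} {δ C eps₁ δ' C' eps₁' : ℝ} (h : W.RowApprox Lam₀ B G X δ C eps₁)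
    (hG : ∀ Lam y, |Lam - Lam₀| < δ' → G' Lam y → G Lam y) (hδ : δ' ≤ δ) (hC : C ≤ C')
    (heps : eps₁' ≤ eps₁) : W.RowApprox Lam₀ B G' X δ' C' eps₁' := by
  intro eps he he'
  obtain ⟨R, h1, h2, h3⟩ := h eps he (he'.trans_le heps)
  refine ⟨R, fun p => (h1 p).mono (ball_subset_ball hδ), fun p mu hmu => h2 p mu (hmu.trans_le hδ),
    fun Lam hLam y hy => ?_⟩
  obtain ⟨d, hd, h4⟩ := h3 Lam (hLam.trans_le hδ) y (hG Lam y hLam hy)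
  exact ⟨d, hd, fun s hs p => (h4 s hs p).trans (by gcongr)⟩

theorem neg_I_mul_re (w : ℂ) : (-Complex.I * w).re = w.im := by simp

/-- With a single dominating point the normalized leading term is the Cauchy row itself. Passing
from valley to valley excludes a degenerate critical point, which is what allows following it when
`Lam` varies. -/
theorem Contour.exists_rowApprox (W : u.Contour) {eps₀ Lam₀ : ℝ} (heps₀ : 0 < eps₀)
    (hint : ∀ eps, 0 < eps → eps < eps₀ → ∀ mu < 0, ∀ p,
      MeasureTheory.Integrable (W.integrand eps mu p)) (hLam : Lam₀ < 0) {x : ℂ}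
    (hdom : W.DominatedBy Lam₀ x) (B : ℝ) :
    deriv u.u0C x ≠ 0 ∧ ∃ δ > 0, ∃ C > 0, ∃ eps₁ > 0,
      W.RowApprox Lam₀ B (fun Lam y => y ∈ ball x δ ∧ (Lam : ℂ) + u.u0C y = 0) (fun _ _ _ _ => 0)
        δ C eps₁ := by
  obtain ⟨t, rfl, hpass, hlt⟩ := hdom
  refine ⟨fun h0 => by simp [PassesOver, h0] at hpass, ?_⟩
  obtain ⟨r, hr, hball⟩ := Metric.isOpen_iff.1 u.isOpen_notPole _ (W.notPole t)
  obtain ⟨Γ, hΓ⟩ := hasDerivAt_of_convex_primitive (convex_ball (W.γ t) r) isOpen_ball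
    fun w hw => (u.differentiableAt_u0C (hball hw)).differentiableWithinAt
  obtain ⟨δ, hδ, C, hC, eps₁, heps₁, hpos, hmain⟩ := W.exists_row heps₀ hint hLam
    (Finset.mem_singleton_self t) (L₀ := (W.H Lam₀ t).im)
    (fun t' ht' => by rw [Finset.mem_singleton.1 ht'])
    (fun t' ht' => by
      have := hlt t' fun h => ht' (Finset.mem_singleton.2 h)
      rwa [neg_I_mul_re, neg_I_mul_re] at this)
    (fun t' ht' => by rwa [Finset.mem_singleton.1 ht'])
    (Φ := fun _ w => Γ w + (W.F t - Γ (W.γ t))) hr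
    (fun t' ht' w hw => by
      rw [Finset.mem_singleton.1 ht'] at hw
      exact (hΓ w hw).add_const _)
    (fun t' ht' => by rw [Finset.mem_singleton.1 ht']; ring) B
  refine ⟨δ, hδ, C, hC, eps₁, heps₁, fun eps he he' => ?_⟩
  obtain ⟨R, h1, h2, h3⟩ := hmain eps he he'
  refine ⟨R, h1, h2, fun Lam hL y hy => ?_⟩
  obtain ⟨d, hd, h4⟩ := h3 Lam hL (fun _ => y)
    (fun t' ht' => by rw [Finset.mem_singleton.1 ht']; exact hy)
    (fun t' _ => rfl)
  refine ⟨d, hd, fun s hs p => ?_⟩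
  have h5 := (h4 s hs).1 p
  have hk := laplaceCoeff_ne_zero (hpos t (Finset.mem_singleton_self t) y hy.1)
  rw [Finset.sum_singleton, sub_self, sub_self, mul_zero, mul_zero, zero_div, Complex.exp_zero,
    div_self hk, one_mul, one_mul, one_mul] at h5
  rwa [add_zero]

variable (u)

/-- The ratio of the contributions of `x₊` and `x₋` to an integral over a contour that passes over
them in the directions `ep`, `em`. -/
noncomputable def rowRatio (em ep : ℂ) (eps Lam : ℝ) (s : ℂ) : ℂ :=
  Complex.exp (-Complex.I * (u.h Lam (u.xPlus Lam) - u.h Lam (u.xMinus Lam)) / eps) *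
    (laplaceCoeff u.u0C ep (u.xPlus Lam) / laplaceCoeff u.u0C em (u.xMinus Lam)) *
    Complex.exp (-Complex.I * s * (u.xPlus Lam - u.xMinus Lam))

variable {u}

theorem IsPeak.add_u0C_eq_zero {xc lam : ℝ} (hpk : u.IsPeak xc) (h1 : -u.u0 xc < lam)
    (h2 : lam < 0) : (lam : ℂ) + u.u0C (u.xMinus lam) = 0 ∧ (lam : ℂ) + u.u0C (u.xPlus lam) = 0 := by
  obtain ⟨ha, hb, -, -⟩ := hpk.turning h1 h2
  rw [u0C_ofReal, u0C_ofReal, ha, hb]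
  simp

theorem exists_hasDerivAt_f_ball (u : RationalPotential P) : ∃ r > 0, ∀ x : ℝ, ∀ w ∈ ball (x : ℂ) r,
    HasDerivAt u.f (u.u0C w) w := by
  obtain ⟨r, hr, hr'⟩ := Finset.univ.exists_pos_forall_le (f := fun p => (u.z p).im)
    fun p _ => u.z_im_pos p
  refine ⟨r, hr, fun x w hw => ?_⟩
  have him : |w.im| < r := by
    have := (Complex.abs_im_le_norm (w - x)).trans_lt (mem_ball_iff_norm.1 hw)
    simpa using this
  rw [abs_lt] at him
  exact u.hasDerivAt_f (fun p => by linarith [hr' p (Finset.mem_univ p)])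
    fun p => Or.inl (by linarith [hr' p (Finset.mem_univ p)])

/-- Since `f` is real on the real axis, both turning points remain on the zero level of `Re(-ih)`
for every real `Lam` nearby. Both contributions survive, and their interference is the source of
quantization. -/
theorem Contour.exists_rowApprox_real (W : u.Contour) {xc eps₀ Lam₀ : ℝ} (hpk : u.IsPeak xc)
    (hbulk : -u.u0 xc < Lam₀) (heps₀ : 0 < eps₀)
    (hint : ∀ eps, 0 < eps → eps < eps₀ → ∀ mu < 0, ∀ p,
      MeasureTheory.Integrable (W.integrand eps mu p)) (hLam : Lam₀ < 0)
    (hdom : W.DominatedByReal Lam₀) (B : ℝ) :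
    ∃ em ep : ℂ, 0 < em.re ∧ 0 < ep.re ∧ ∃ δ > 0, ∃ C > 0, ∃ eps₁ > 0,
      (∀ Lam : ℝ, |Lam - Lam₀| < δ →
        0 < (Complex.I * deriv u.u0C (u.xMinus Lam) * em ^ 2 / 2).re ∧
        0 < (Complex.I * deriv u.u0C (u.xPlus Lam) * ep ^ 2 / 2).re) ∧
      (∀ eps, 0 < eps → eps < eps₁ → ∀ Lam : ℝ, |Lam - Lam₀| < δ → ∀ s : ℂ, ‖s‖ ≤ B →
        ‖u.rowRatio em ep eps Lam s‖ ≤ C) ∧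
      W.RowApprox Lam₀ B (fun Lam y => y = u.xMinus Lam)
        (fun eps Lam s p => u.rowRatio em ep eps Lam s * (u.xPlus Lam - u.z p)⁻¹) δ C eps₁ := by
  obtain ⟨t₁, t₂, ⟨hγ₁, hF₁, hp₁, he₁⟩, ⟨hγ₂, hF₂, hp₂, he₂⟩, hlt⟩ := hdom
  obtain ⟨-, -, hlt₁, hlt₂⟩ := hpk.turning hbulk hLam
  have hne : t₁ ≠ t₂ := fun h => by
    rw [h, hγ₂] at hγ₁
    exact (hlt₁.trans hlt₂).ne' (by exact_mod_cast hγ₁)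
  obtain ⟨r, hr, hball⟩ := u.exists_hasDerivAt_f_ball
  have hcases : ∀ t ∈ ({t₁, t₂} : Finset ℝ), t = t₁ ∨ t = t₂ := fun t ht => by simpa using ht
  obtain ⟨δ, hδ, C, hC, eps₁, heps₁, hpos, hmain⟩ := W.exists_row heps₀ hint hLam
    (S := {t₁, t₂}) (t₀ := t₁) (by simp) (L₀ := 0)
    (fun t ht => by
      rcases hcases t ht with rfl | rfl
      · rw [H, hγ₁, hF₁, Complex.add_im, f_ofReal_im, add_zero, ← Complex.ofReal_mul,
          Complex.ofReal_im]
      · rw [H, hγ₂, hF₂, Complex.add_im, f_ofReal_im, add_zero, ← Complex.ofReal_mul,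
          Complex.ofReal_im])
    (fun t ht => by
      have := hlt t (fun h => ht (by simp [h])) fun h => ht (by simp [h])
      rwa [neg_I_mul_re] at this)
    (fun t ht => by rcases hcases t ht with rfl | rfl <;> assumption)
    (Φ := fun _ => u.f) hr
    (fun t ht w hw => by
      rcases hcases t ht with rfl | rfl
      · rw [hγ₁] at hw; exact hball _ w hw
      · rw [hγ₂] at hw; exact hball _ w hw)
    (fun t ht => by
      rcases hcases t ht with rfl | rfl
      · rw [hγ₁, hF₁]
      · rw [hγ₂, hF₂]) B
  have ev : ∀ᶠ Lam in 𝓝 Lam₀, |u.xMinus Lam - u.xMinus Lam₀| < δ ∧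
      |u.xPlus Lam - u.xPlus Lam₀| < δ ∧ -u.u0 xc < Lam ∧ Lam < 0 :=
    ((Metric.tendsto_nhds.1 (hpk.continuousAt_xMinus hbulk hLam) δ hδ).and
      ((Metric.tendsto_nhds.1 (hpk.continuousAt_xPlus hbulk hLam) δ hδ).and
      (Ioo_mem_nhds hbulk hLam)))
  obtain ⟨δ₁, hδ₁, hev⟩ := Metric.eventually_nhds_iff.1 ev
  have hb₁ : ∀ Lam : ℝ, |Lam - Lam₀| < δ₁ → (u.xMinus Lam : ℂ) ∈ ball (W.γ t₁) δ := fun Lam hL => by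
    rw [mem_ball_iff_norm, hγ₁, ← Complex.ofReal_sub, Complex.norm_real]
    exact (hev hL).1
  have hb₂ : ∀ Lam : ℝ, |Lam - Lam₀| < δ₁ → (u.xPlus Lam : ℂ) ∈ ball (W.γ t₂) δ := fun Lam hL => by
    rw [mem_ball_iff_norm, hγ₂, ← Complex.ofReal_sub, Complex.norm_real]
    exact (hev hL).2.1
  have key : ∀ eps, 0 < eps → eps < eps₁ → ∃ R : Fin P → ℂ → ℂ,
      (∀ p, DifferentiableOn ℂ (R p) (ball (Lam₀ : ℂ) δ)) ∧
      (∀ p, ∀ mu : ℝ, |mu - Lam₀| < δ → ∫ t, W.integrand eps mu p t = R p mu) ∧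
      ∀ Lam : ℝ, |Lam - Lam₀| < min δ δ₁ → ∃ d : ℂ, d ≠ 0 ∧ ∀ s : ℂ, ‖s‖ ≤ B →
        (∀ p, ‖d * Complex.exp (Complex.I * s * u.xMinus Lam) * R p (Lam + eps * s) -
          ((u.xMinus Lam - u.z p)⁻¹ + u.rowRatio (deriv W.γ t₁) (deriv W.γ t₂) eps Lam s *
            (u.xPlus Lam - u.z p)⁻¹)‖ ≤ C * eps) ∧
        ‖u.rowRatio (deriv W.γ t₁) (deriv W.γ t₂) eps Lam s‖ ≤ C := by
    intro eps he he'
    obtain ⟨R, h1, h2, h3⟩ := hmain eps he he'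
    refine ⟨R, h1, h2, fun Lam hL => ?_⟩
    have hLδ := hL.trans_le (min_le_left _ _)
    have hLδ₁ := hL.trans_le (min_le_right _ _)
    obtain ⟨hz₁, hz₂⟩ := hpk.add_u0C_eq_zero (hev hLδ₁).2.2.1 (hev hLδ₁).2.2.2
    have hy₁ : (fun t => if t = t₁ then (u.xMinus Lam : ℂ) else u.xPlus Lam) t₁ = u.xMinus Lam :=
      if_pos rfl
    have hy₂ : (fun t => if t = t₁ then (u.xMinus Lam : ℂ) else u.xPlus Lam) t₂ = u.xPlus Lam :=
      if_neg hne.symm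
    set y : ℝ → ℂ := fun t => if t = t₁ then (u.xMinus Lam : ℂ) else u.xPlus Lam
    obtain ⟨d, hd, h4⟩ := h3 Lam hLδ y
      (fun t ht => by
        rcases hcases t ht with rfl | rfl
        · rw [hy₁]; exact ⟨hb₁ Lam hLδ₁, hz₁⟩
        · rw [hy₂]; exact ⟨hb₂ Lam hLδ₁, hz₂⟩)
      (fun t ht => by
        have him : ∀ x : ℝ, ((Lam : ℂ) * x + u.f x).im = 0 := fun x => by
          rw [Complex.add_im, f_ofReal_im, add_zero, ← Complex.ofReal_mul, Complex.ofReal_im]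
        rcases hcases t ht with rfl | rfl
        · rfl
        · rw [hy₁, hy₂, him, him])
    refine ⟨d, hd, fun s hs => ⟨fun p => ?_, ?_⟩⟩
    · have h5 := (h4 s hs).1 p
      have hk := laplaceCoeff_ne_zero (hpos t₁ (by simp) _ (hb₁ Lam hLδ₁))
      rw [Finset.sum_pair hne, hy₁, hy₂, sub_self, sub_self, mul_zero, mul_zero, zero_div,
        Complex.exp_zero, div_self hk, one_mul, one_mul, one_mul] at h5
      exact h5
    · have h5 := (h4 s hs).2 t₂ (by simp)
      rw [hy₁, hy₂] at h5
      exact h5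
  refine ⟨deriv W.γ t₁, deriv W.γ t₂, he₁, he₂, min δ δ₁, lt_min hδ hδ₁, C, hC, eps₁, heps₁,
    fun Lam hL => ⟨hpos t₁ (by simp) _ (hb₁ Lam (hL.trans_le (min_le_right _ _))),
      hpos t₂ (by simp) _ (hb₂ Lam (hL.trans_le (min_le_right _ _)))⟩,
    fun eps he he' Lam hL s hs => ?_, fun eps he he' => ?_⟩
  · obtain ⟨R, -, -, h⟩ := key eps he he'
    obtain ⟨d, -, h'⟩ := h Lam hL
    exact (h' s hs).2
  · obtain ⟨R, h1, h2, h⟩ := key eps he he'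
    refine ⟨R, fun p => (h1 p).mono (ball_subset_ball (min_le_left _ _)),
      fun p mu hmu => h2 p mu (hmu.trans_le (min_le_left _ _)), fun Lam hL y hy => ?_⟩
    obtain ⟨d, hd, h'⟩ := h Lam hL
    rw [hy]
    exact ⟨d, hd, fun s hs p => (h' s hs).1 p⟩

/-- The turning points move continuously and the simple critical points persist. The remaining
requirements, and the lower bound for the Cauchy determinant that makes later constants uniform, are
open conditions. -/
theorem exists_critSystem_near {xc Lam₀ : ℝ} (hpk : u.IsPeak xc) (hbulk : -u.u0 xc < Lam₀)
    (hLam : Lam₀ < 0) {Q : Fin P} {Y₀ : Fin P → ℂ}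
    (h : u.CritSystem Lam₀ (u.xMinus Lam₀) (u.xPlus Lam₀) Q Y₀)
    (hd : ∀ m, m ≠ Q → deriv u.u0C (Y₀ m) ≠ 0) {ρ : ℝ} (hρ : 0 < ρ) :
    ∃ δ > 0, ∀ Lam : ℝ, |Lam - Lam₀| < δ → -u.u0 xc < Lam ∧ Lam < 0 ∧ ∃ Y : Fin P → ℂ,
      u.CritSystem Lam (u.xMinus Lam) (u.xPlus Lam) Q Y ∧ (∀ m, Y m ∈ ball (Y₀ m) ρ) ∧
      ‖cauchyDet u.z Y₀‖ / 2 < ‖cauchyDet u.z Y‖ := by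
  have hC0 : 0 < ‖cauchyDet u.z Y₀‖ :=
    norm_pos_iff.2 (cauchyDet_ne_zero u.z_injective h.inj fun m p => (h.notPole m p).1)
  have hev : ∀ᶠ Y in 𝓝 Y₀, (∀ m, m ≠ Q → 0 < (Y m).im) ∧ (∀ m, u.NotPole (Y m)) ∧
      (∀ m m', m ≠ m' → Y m ≠ Y m') ∧ ‖cauchyDet u.z Y₀‖ / 2 < ‖cauchyDet u.z Y‖ := by
    have happ : ∀ m, ContinuousAt (fun Y : Fin P → ℂ => Y m) Y₀ := fun m =>
      (continuous_apply m).continuousAt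
    refine (eventually_all.2 fun m => ?_).and ((eventually_all.2 fun m => ?_).and
      ((eventually_all.2 fun m => eventually_all.2 fun m' => ?_).and ?_))
    · by_cases hm : m = Q
      · exact Eventually.of_forall fun Y h' => absurd hm h'
      · filter_upwards [(Complex.continuous_im.continuousAt.comp (happ m)).eventually_const_lt
          (h.im_pos m hm)] with Y hY _ using hY
    · exact (happ m).eventually (u.isOpen_notPole.mem_nhds (h.notPole m))
    · by_cases hm : m = m'
      · exact Eventually.of_forall fun Y h' => absurd hm h'
      · filter_upwards [((happ m).sub (happ m')).eventually_ne (sub_ne_zero.2 (h.inj.ne hm))] with Y hY _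
        using sub_ne_zero.1 hY
    · exact (continuousAt_cauchyDet u.z fun m p => (h.notPole m p).1).norm.eventually_const_lt
        (half_lt_self hC0)
  obtain ⟨ρ₁, hρ₁, hρ₁'⟩ := Metric.eventually_nhds_iff.1 hev
  set ρ₂ := min ρ ρ₁ with hρ₂def
  have hρ₂ : 0 < ρ₂ := lt_min hρ hρ₁
  have hsol : ∀ m, ∀ᶠ Lam : ℝ in 𝓝 Lam₀, ∃ y ∈ ball (Y₀ m) ρ₂, (m = Q → y = u.xMinus Lam) ∧
      (Lam : ℂ) + u.u0C y = 0 := by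
    intro m
    have hI : ∀ᶠ Lam in 𝓝 Lam₀, -u.u0 xc < Lam ∧ Lam < 0 := Ioo_mem_nhds hbulk hLam
    by_cases hm : m = Q
    · filter_upwards [Metric.tendsto_nhds.1 (hpk.continuousAt_xMinus hbulk hLam) ρ₂ hρ₂, hI]
        with Lam h1 h2
      refine ⟨u.xMinus Lam, ?_, fun _ => rfl, (hpk.add_u0C_eq_zero h2.1 h2.2).1⟩
      rw [hm, h.eq_Q, mem_ball_iff_norm, ← Complex.ofReal_sub, Complex.norm_real]
      exact h1
    · have hs := (u.analyticAt_u0C (h.notPole m)).hasStrictDerivAt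
      have hmap := hs.map_nhds_eq (hd m hm)
      have h1 : u.u0C '' ball (Y₀ m) ρ₂ ∈ 𝓝 (-(Lam₀ : ℂ)) := by
        rw [← eq_neg_of_add_eq_zero_right (h.crit m), ← hmap]
        exact image_mem_map (ball_mem_nhds _ hρ₂)
      have h2 : ContinuousAt (fun Lam : ℝ => -(Lam : ℂ)) Lam₀ := by fun_prop
      filter_upwards [h2 h1] with Lam hL
      obtain ⟨y, hy, hy'⟩ := hL
      exact ⟨y, hy, fun h' => absurd h' hm, by rw [hy']; ring⟩
  have hI : ∀ᶠ Lam in 𝓝 Lam₀, -u.u0 xc < Lam ∧ Lam < 0 := Ioo_mem_nhds hbulk hLam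
  obtain ⟨δ, hδ, hδ'⟩ := Metric.eventually_nhds_iff.1 (hI.and (eventually_all.2 hsol))
  refine ⟨δ, hδ, fun Lam hL => ⟨(hδ' hL).1.1, (hδ' hL).1.2, ?_⟩⟩
  obtain ⟨⟨hb1, hb2⟩, hex⟩ := hδ' hL
  choose Y hY hYQ hYc using hex
  obtain ⟨g1, g2, g3, g4⟩ := hρ₁' (y := Y) (((dist_pi_lt_iff hρ₁).2 fun m =>
    (hY m).trans_le (min_le_right _ _)))
  obtain ⟨-, -, k1, k2⟩ := hpk.turning hb1 hb2
  exact ⟨Y, ⟨k1.trans k2, hYQ Q rfl, g1, g2, hYc, (hpk.add_u0C_eq_zero hb1 hb2).2,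
    fun m m' hmm => by_contra fun hne => g3 m m' hne hmm⟩,
    fun m => ball_subset_ball (min_le_left _ _) (hY m), g4⟩

/-- By counting: suitability at `lam` gives exactly `P - 1` critical points above the axis, and the
system already contains that many. So the phase functions at `lam` are built from these points. -/
theorem CritSystem.upperCritical_eq {lam xm xp : ℝ} {Q : Fin P} {Y : Fin P → ℂ}
    (h : u.CritSystem lam xm xp Q Y) (hs : u.HasSuitableModification lam) :
    u.upperCritical lam = Y '' {m | m ≠ Q} := by
  obtain ⟨W, Q', x, -, -, hinj, hrange, -⟩ := hs
  have hfin : (u.upperCritical lam).Finite := hrange ▸ Set.finite_range x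
  refine (Set.eq_of_subset_of_ncard_le ?_ ?_ hfin).symm
  · rintro _ ⟨m, hm, rfl⟩
    exact ⟨h.im_pos m hm, h.notPole m, h.crit m⟩
  · rw [← hrange, ← Set.image_univ, Set.ncard_image_of_injective _ hinj,
      Set.ncard_image_of_injective _ h.inj, Set.ncard_univ, Nat.card_eq_fintype_card,
      ← Nat.card_coe_set_eq, Nat.card_eq_fintype_card]
    have : ∀ q : Fin P, Fintype.card {m : Fin P // m ≠ q} = P - 1 := fun q => by
      rw [Fintype.card_subtype_compl]; simp
    rw [this]
    exact (this Q).symm.le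

end RationalPotential

/-! ### The rescaled Evans function near a point of the bulk. -/

/-- Multilinearity in the rows gives a Lipschitz bound whose constant depends only on the size and
on the bound of the entries, so `O(ε)` errors in the entries stay `O(ε)` in the determinant. -/
theorem Matrix.exists_norm_det_sub_le (ι : Type*) [Fintype ι] [DecidableEq ι] {K : ℝ} (hK : 0 ≤ K) :
    ∃ C > 0, ∀ (M N : Matrix ι ι ℂ) (e : ℝ), 0 ≤ e → (∀ i j, ‖M i j‖ ≤ K) → (∀ i j, ‖N i j‖ ≤ K) →
      (∀ i j, ‖M i j - N i j‖ ≤ e) → ‖M.det - N.det‖ ≤ C * e := by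
  have hb : ∀ m : Matrix ι ι ℂ, ‖m.det‖ ≤ (Fintype.card ι).factorial * ∏ i, ‖fun j => m i j‖ :=
      fun m => by
    rw [Matrix.det_apply]
    refine (norm_sum_le _ _).trans ?_
    have : ∀ σ ∈ (Finset.univ : Finset (Equiv.Perm ι)),
        ‖Equiv.Perm.sign σ • ∏ i, m (σ i) i‖ ≤ ∏ i, ‖fun j => m i j‖ := fun σ _ => by
      have h1 : ‖Equiv.Perm.sign σ • ∏ i, m (σ i) i‖ = ∏ i, ‖m (σ i) i‖ := by
        rcases Int.units_eq_one_or (Equiv.Perm.sign σ) with h | h <;> simp [h, norm_prod]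
      rw [h1, ← Equiv.prod_comp σ fun i => ‖fun j => m i j‖]
      exact Finset.prod_le_prod (fun _ _ => norm_nonneg _) fun i _ =>
        norm_le_pi_norm (fun j => m (σ i) j) i
    refine (Finset.sum_le_sum this).trans_eq ?_
    rw [Finset.sum_const, Finset.card_univ, Fintype.card_perm, nsmul_eq_mul]
  refine ⟨(Fintype.card ι).factorial * Fintype.card ι * K ^ (Fintype.card ι - 1) + 1, by positivity,
    fun M N e he hM hN hMN => ?_⟩
  have h := MultilinearMap.norm_image_sub_le_of_bound
    (Matrix.detRowAlternating : (ι → ℂ) [⋀^ι]→ₗ[ℂ] ℂ).toMultilinearMap (Nat.cast_nonneg _)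
    (fun m => hb (Matrix.of m)) (fun i j => M i j) fun i j => N i j
  have h1 : max ‖fun i j => M i j‖ ‖fun i j => N i j‖ ≤ K :=
    max_le ((pi_norm_le_iff_of_nonneg hK).2 fun i => (pi_norm_le_iff_of_nonneg hK).2 (hM i))
      ((pi_norm_le_iff_of_nonneg hK).2 fun i => (pi_norm_le_iff_of_nonneg hK).2 (hN i))
  have h2 : ‖(fun i j => M i j) - fun i j => N i j‖ ≤ e :=
    (pi_norm_le_iff_of_nonneg he).2 fun i => (pi_norm_le_iff_of_nonneg he).2 (hMN i)
  refine le_trans h ?_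
  calc _ ≤ (Fintype.card ι).factorial * Fintype.card ι * K ^ (Fintype.card ι - 1) * e := by gcongr
    _ ≤ _ := by gcongr; linarith

theorem DifferentiableOn.matrix_det {ι : Type*} [Fintype ι] [DecidableEq ι] {M : ℂ → Matrix ι ι ℂ}
    {D : Set ℂ} (h : ∀ i j, DifferentiableOn ℂ (fun s => M s i j) D) :
    DifferentiableOn ℂ (fun s => (M s).det) D := by
  simp only [Matrix.det_apply']
  exact DifferentiableOn.fun_sum fun σ _ => (DifferentiableOn.fun_finsetProd fun i _ => h _ _).const_mul _

/-- The determinant of the Cauchy matrix with a multiple of a row `1 / (q - z p)` added to its row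
`Q`. -/
theorem det_cauchy_add_row {ι : Type*} [Fintype ι] [DecidableEq ι] (z Y : ι → ℂ) (Q : ι) (q r : ℂ) :
    (Matrix.of fun m p => (Y m - z p)⁻¹ + if m = Q then r * (q - z p)⁻¹ else 0).det =
      cauchyDet z Y + r * cauchyDet z (Function.update Y Q q) := by
  have h1 : (Matrix.of fun m p => (Y m - z p)⁻¹ + if m = Q then r * (q - z p)⁻¹ else 0) =
      (Matrix.of fun m p => (Y m - z p)⁻¹).updateRow Q
        ((Matrix.of fun m p => (Y m - z p)⁻¹) Q + r • fun p => (q - z p)⁻¹) := by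
    ext m p
    by_cases hm : m = Q
    · subst hm; simp
    · simp [hm]
  have h2 : (Matrix.of fun m p => (Y m - z p)⁻¹).updateRow Q (fun p => (q - z p)⁻¹) =
      Matrix.of fun m p => (Function.update Y Q q m - z p)⁻¹ := by
    ext m p
    by_cases hm : m = Q
    · subst hm; simp
    · simp [hm]
  rw [h1, Matrix.det_updateRow_add, Matrix.updateRow_eq_self, Matrix.det_updateRow_smul, h2, cauchyDet,
    cauchyDet]

namespace RationalPotential

variable {P : ℕ} {u : RationalPotential P}

open Metric

/-- The action, the difference of the phases and the dependence on `s` are collected in one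
exponential; at `s = 0` its argument is, up to the factor `-i`, the angle `2π T`. -/
theorem CritSystem.rowRatio_mul_cauchyDet {lam : ℝ} {Q : Fin P} {Y : Fin P → ℂ}
    (h : u.CritSystem lam (u.xMinus lam) (u.xPlus lam) Q Y)
    (hlam : lam < 0) (hrange : u.upperCritical lam = Y '' {m | m ≠ Q}) {a b : ℝ}
    (hab : u.IsPhasePair lam a b) {em ep : ℂ} (hem : 0 < em.re) (hep : 0 < ep.re)
    (hm : 0 < (Complex.I * deriv u.u0C (u.xMinus lam) * em ^ 2 / 2).re)
    (hp : 0 < (Complex.I * deriv u.u0C (u.xPlus lam) * ep ^ 2 / 2).re) (eps : ℝ) (s : ℂ) :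
    u.rowRatio em ep eps lam s * cauchyDet u.z (Function.update Y Q (u.xPlus lam)) =
      -Complex.exp (-Complex.I * (s * (u.xPlus lam - u.xMinus lam : ℝ) +
        ((∫ t in (u.xMinus lam)..(u.xPlus lam), (lam + u.u0 t)) / eps + a - b : ℝ))) *
        cauchyDet u.z Y := by
  have key := h.laplaceCoeff_mul_cauchyDet hlam hrange hab hem hep hm hp
  have hk := laplaceCoeff_ne_zero hm
  rw [rowRatio, h_sub_h]
  set I₀ := ∫ t in (u.xMinus lam)..(u.xPlus lam), (lam + u.u0 t)
  have e1 : Complex.exp (-Complex.I * (s * (u.xPlus lam - u.xMinus lam : ℝ) +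
      (I₀ / eps + a - b : ℝ))) = Complex.exp (-Complex.I * I₀ / eps) *
        Complex.exp (-Complex.I * s * (u.xPlus lam - u.xMinus lam)) *
        Complex.exp (-Complex.I * (a - b)) := by
    rw [← Complex.exp_add, ← Complex.exp_add]
    congr 1
    push_cast
    ring
  rw [e1]
  calc _ = Complex.exp (-Complex.I * I₀ / eps) *
        Complex.exp (-Complex.I * s * (u.xPlus lam - u.xMinus lam)) /
        laplaceCoeff u.u0C em (u.xMinus lam) * (laplaceCoeff u.u0C ep (u.xPlus lam) *
          cauchyDet u.z (Function.update Y Q (u.xPlus lam))) := by ring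
    _ = _ := by
      rw [key]
      field_simp

end RationalPotential

namespace RationalPotential

variable {P : ℕ} {u : RationalPotential P}

open Metric

set_option maxHeartbeats 1000000 in
/-- Near a point of the bulk with a suitable modification, the Evans function at `Lam + eps * s`
vanishes where a small perturbation of `exp(-i (s L + θ)) - 1` does. -/
theorem HasSuitableModification.exists_local {xc Lam₀ : ℝ} (hpk : u.IsPeak xc)
    (hbulk : -u.u0 xc < Lam₀) (hLam : Lam₀ < 0) (hs : u.HasSuitableModification Lam₀) (B : ℝ) :
    ∃ δ > 0, ∃ C > 0, ∃ eps₁ > 0, ∀ eps, 0 < eps → eps < eps₁ → ∀ Lam : ℝ, |Lam - Lam₀| < δ →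
      u.HasSuitableModification Lam → ∀ a b, u.IsPhasePair Lam a b → ∃ g : ℂ → ℂ,
        DifferentiableOn ℂ g (ball 0 B) ∧ (∀ s ∈ ball 0 B, ‖g s‖ ≤ C * eps) ∧
        ∀ s ∈ ball (0 : ℂ) B, (u.AC eps (Lam + eps * s)).det = 0 ↔
          Complex.exp (-Complex.I * (s * (u.xPlus Lam - u.xMinus Lam : ℝ) +
            ((∫ t in (u.xMinus Lam)..(u.xPlus Lam), (Lam + u.u0 t)) / eps + a - b : ℝ))) - 1 + g s = 0 := by
  obtain ⟨W, Q, x, hreal, hdom, hinj, hrange, eps₀, heps₀, hsm⟩ := hs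
  have hint : ∀ m, ∀ eps, 0 < eps → eps < eps₀ → ∀ mu < 0, ∀ p,
      MeasureTheory.Integrable ((W m).integrand eps mu p) := fun m eps he he' mu hmu p =>
    (hsm eps he he').1 mu hmu m p
  -- the critical points at the centre
  set Y₀ : Fin P → ℂ := fun m => if h : m ≠ Q then x ⟨m, h⟩ else u.xMinus Lam₀ with hY₀
  have hY₀Q : Y₀ Q = u.xMinus Lam₀ := dif_neg (by simp)
  have hY₀m : ∀ m (h : m ≠ Q), Y₀ m = x ⟨m, h⟩ := fun m h => dif_pos h
  have hmem : ∀ m, m ≠ Q → Y₀ m ∈ u.upperCritical Lam₀ := fun m h => by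
    rw [hY₀m m h, ← hrange]; exact Set.mem_range_self _
  obtain ⟨-, -, hlt₁, hlt₂⟩ := hpk.turning hbulk hLam
  have hcs : u.CritSystem Lam₀ (u.xMinus Lam₀) (u.xPlus Lam₀) Q Y₀ := by
    refine ⟨hlt₁.trans hlt₂, hY₀Q, fun m hm => (hmem m hm).1, fun m => ?_, fun m => ?_,
      (hpk.add_u0C_eq_zero hbulk hLam).2, fun m m' h => ?_⟩
    · by_cases hm : m = Q
      · rw [hm, hY₀Q]; exact u.notPole_ofReal _
      · exact (hmem m hm).2.1
    · by_cases hm : m = Q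
      · rw [hm, hY₀Q]; exact (hpk.add_u0C_eq_zero hbulk hLam).1
      · exact (hmem m hm).2.2
    · by_cases hm : m = Q <;> by_cases hm' : m' = Q
      · rw [hm, hm']
      · have := (hmem m' hm').1
        rw [← h, hm, hY₀Q, Complex.ofReal_im] at this
        exact absurd this (lt_irrefl _)
      · have := (hmem m hm).1
        rw [h, hm', hY₀Q, Complex.ofReal_im] at this
        exact absurd this (lt_irrefl _)
      · rw [hY₀m m hm, hY₀m m' hm'] at h
        exact congrArg Subtype.val (hinj h)
  obtain ⟨em, ep, hem, hep, δQ, hδQ, CQ, hCQ, epsQ, hepsQ, hposQ, hratio, hrowQ⟩ :=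
    (W Q).exists_rowApprox_real hpk hbulk heps₀ (hint Q) hLam hreal B
  have hrowm : ∀ m, m ≠ Q → deriv u.u0C (Y₀ m) ≠ 0 ∧ ∃ δ > 0, ∃ C > 0, ∃ eps₁ > 0,
      (W m).RowApprox Lam₀ B (fun Lam y => y ∈ ball (Y₀ m) δ ∧ (Lam : ℂ) + u.u0C y = 0)
        (fun _ _ _ _ => 0) δ C eps₁ := fun m hm => by
    rw [hY₀m m hm]
    exact (W m).exists_rowApprox heps₀ (hint m) hLam (hdom ⟨m, hm⟩) B
  have hrow : ∀ m, ∃ δ > 0, ∃ C > 0, ∃ eps₁ > 0,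
      (W m).RowApprox Lam₀ B (fun Lam y => y ∈ ball (Y₀ m) δ ∧ (Lam : ℂ) + u.u0C y = 0 ∧
        (m = Q → y = u.xMinus Lam))
        (fun eps Lam s p => if m = Q then u.rowRatio em ep eps Lam s * (u.xPlus Lam - u.z p)⁻¹ else 0)
        δ C eps₁ := fun m => by
    by_cases hm : m = Q
    · subst hm
      refine ⟨δQ, hδQ, CQ, hCQ, epsQ, hepsQ, ?_⟩
      simp only [if_true]
      exact hrowQ.mono (fun Lam y _ h => h.2.2 trivial) le_rfl le_rfl le_rfl
    · obtain ⟨-, δ, hδ, C, hC, eps₁, heps₁, h⟩ := hrowm m hm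
      refine ⟨δ, hδ, C, hC, eps₁, heps₁, ?_⟩
      simp only [hm, if_false]
      exact h.mono (fun Lam y _ h => ⟨h.1, h.2.1⟩) le_rfl le_rfl le_rfl
  choose ρ hρ C₁ hC₁ e₁ he₁ hrow using hrow
  obtain ⟨ρ₀, hρ₀, hρ₀'⟩ := Finset.univ.exists_pos_forall_le fun m _ => hρ m
  obtain ⟨e₀, he₀, he₀'⟩ := Finset.univ.exists_pos_forall_le fun m _ => he₁ m
  obtain ⟨η, hη, hη'⟩ := Finset.univ.exists_pos_forall_le
    (f := fun q : Fin P × Fin P => ‖Y₀ q.1 - u.z q.2‖)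
    fun q _ => norm_pos_iff.2 (sub_ne_zero.2 (hcs.notPole q.1 q.2).1)
  obtain ⟨ζ, hζ, hζ'⟩ := Finset.univ.exists_pos_forall_le (f := fun p => (u.z p).im)
    fun p _ => u.z_im_pos p
  set C₂ := ∑ m, C₁ m with hC₂
  have hC₂' : ∀ m, C₁ m ≤ C₂ := fun m =>
    Finset.single_le_sum (f := C₁) (fun i _ => (hC₁ i).le) (Finset.mem_univ m)
  have hC₂0 : 0 < C₂ := (hC₁ Q).trans_le (hC₂' Q)
  obtain ⟨δ₁, hδ₁, hnear⟩ := exists_critSystem_near hpk hbulk hLam hcs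
    (fun m hm => (hrowm m hm).1) (lt_min hρ₀ (half_pos hη))
  have hκ0 : 0 < ‖cauchyDet u.z Y₀‖ :=
    norm_pos_iff.2 (cauchyDet_ne_zero u.z_injective hcs.inj fun m p => (hcs.notPole m p).1)
  set K := 2 / η + CQ / ζ + C₂ with hK
  have hK0 : 0 ≤ K := by positivity
  obtain ⟨C₃, hC₃, hdet⟩ := Matrix.exists_norm_det_sub_le (Fin P) hK0
  set δ := min (min ρ₀ δQ) (min δ₁ (-Lam₀)) with hδdef
  have hδ : 0 < δ := lt_min (lt_min hρ₀ hδQ) (lt_min hδ₁ (neg_pos.2 hLam))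
  have hδ1 : δ ≤ ρ₀ := (min_le_left _ _).trans (min_le_left _ _)
  have hδ2 : δ ≤ δQ := (min_le_left _ _).trans (min_le_right _ _)
  have hδ3 : δ ≤ δ₁ := (min_le_right _ _).trans (min_le_left _ _)
  have hδ4 : δ ≤ -Lam₀ := (min_le_right _ _).trans (min_le_right _ _)
  set eps₁ := min (min e₀ epsQ) (min (min eps₀ 1) (δ / (2 * (|B| + 1)))) with heps₁
  refine ⟨δ / 2, half_pos hδ, C₃ * C₂ / (‖cauchyDet u.z Y₀‖ / 2), by positivity, eps₁,
    lt_min (lt_min he₀ hepsQ) (lt_min (lt_min heps₀ one_pos) (by positivity)),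
    fun eps he he' Lam hL hsuit a b hab => ?_⟩
  have heA : eps < e₀ := he'.trans_le ((min_le_left _ _).trans (min_le_left _ _))
  have heB : eps < epsQ := he'.trans_le ((min_le_left _ _).trans (min_le_right _ _))
  have heC : eps < eps₀ := he'.trans_le ((min_le_right _ _).trans ((min_le_left _ _).trans (min_le_left _ _)))
  have heD : eps < 1 := he'.trans_le ((min_le_right _ _).trans ((min_le_left _ _).trans (min_le_right _ _)))
  have heE : eps < δ / (2 * (|B| + 1)) := he'.trans_le ((min_le_right _ _).trans (min_le_right _ _))
  obtain ⟨hb1, hb2, Y, hY, hYball, hYdet⟩ := hnear Lam (by linarith)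
  have hC0 : cauchyDet u.z Y ≠ 0 := norm_pos_iff.1 ((half_pos hκ0).trans hYdet)
  have hup := hY.upperCritical_eq hsuit
  obtain ⟨hpm, hpp⟩ := hposQ Lam (by linarith)
  obtain ⟨N, hN, hNA⟩ := (hsm eps he heC).2
  choose R hR1 hR2 hR3 using fun m => hrow m eps he (heA.trans_le (he₀' m (Finset.mem_univ m)))
  choose d hd0 hd using fun m => hR3 m Lam (by linarith [hρ₀' m (Finset.mem_univ m)]) (Y m)
    ⟨ball_subset_ball ((min_le_left _ _).trans (hρ₀' m (Finset.mem_univ m))) (hYball m), hY.crit m,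
      fun hm => by rw [hm, hY.eq_Q]⟩
  have hmaps : ∀ s ∈ ball (0 : ℂ) B, (Lam : ℂ) + eps * s ∈ ball (Lam₀ : ℂ) δ := fun s hs => by
    rw [mem_ball_zero_iff] at hs
    have h1 : ‖(Lam : ℂ) - Lam₀‖ < δ / 2 := by
      rw [← Complex.ofReal_sub, Complex.norm_real]; exact hL
    have h2 : eps * ‖s‖ < δ / 2 := by
      have h3 : ‖s‖ ≤ |B| + 1 := by linarith [le_abs_self B]
      calc eps * ‖s‖ ≤ eps * (|B| + 1) := by gcongr
        _ < δ / (2 * (|B| + 1)) * (|B| + 1) := by gcongr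
        _ = δ / 2 := by field_simp
    rw [mem_ball_iff_norm, show (Lam : ℂ) + eps * s - Lam₀ = (Lam - Lam₀) + eps * s by ring]
    refine (norm_add_le _ _).trans_lt ?_
    rw [norm_mul, Complex.norm_real, Real.norm_of_nonneg he.le]
    linarith
  have hNAC : ∀ l ∈ ball (Lam₀ : ℂ) δ, ∀ m p, (N * u.AC eps l) m p = R m p l := fun l hl m p =>
    u.mul_AC_eqOn_ball he N m p hδ (by linarith)
      ((hR1 m p).mono (ball_subset_ball (hδ1.trans (hρ₀' m (Finset.mem_univ m)))))
      (fun mu hmu => by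
        have hneg : mu < 0 := by linarith [(abs_lt.1 hmu).2]
        rw [hNA mu hneg]
        exact hR2 m p mu (by linarith [hρ₀' m (Finset.mem_univ m)])) hl
  -- `M` is `N A` with rows rescaled by nonzero factors, so its determinant has the zeros of the
  -- Evans function. `M₀` is its leading part, with determinant a multiple of `1 - E`.
  set M : ℂ → Matrix (Fin P) (Fin P) ℂ := fun s => Matrix.of fun m p =>
    (d m * Complex.exp (Complex.I * s * Y m)) * R m p (Lam + eps * s) with hM
  set M₀ : ℂ → Matrix (Fin P) (Fin P) ℂ := fun s => Matrix.of fun m p => (Y m - u.z p)⁻¹ +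
    if m = Q then u.rowRatio em ep eps Lam s * (u.xPlus Lam - u.z p)⁻¹ else 0 with hM₀
  set E : ℂ → ℂ := fun s => Complex.exp (-Complex.I * (s * (u.xPlus Lam - u.xMinus Lam : ℝ) +
    ((∫ t in (u.xMinus Lam)..(u.xPlus Lam), (Lam + u.u0 t)) / eps + a - b : ℝ))) with hE
  have hdetM₀ : ∀ s, (M₀ s).det = cauchyDet u.z Y * (1 - E s) := fun s => by
    rw [hM₀, det_cauchy_add_row, hY.rowRatio_mul_cauchyDet hb2 hup hab hem hep hpm hpp eps s]
    ring
  have hdetM : ∀ s ∈ ball (0 : ℂ) B, (M s).det = 0 ↔ (u.AC eps (Lam + eps * s)).det = 0 :=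
      fun s hs => by
    have h1 : M s = Matrix.of fun m p => (d m * Complex.exp (Complex.I * s * Y m)) *
        (N * u.AC eps (Lam + eps * s)) m p := by
      ext m p
      rw [Matrix.of_apply, hNAC _ (hmaps s hs)]
      rfl
    rw [h1, Matrix.det_mul_column, Matrix.det_mul]
    have h2 : ∏ m, d m * Complex.exp (Complex.I * s * Y m) ≠ 0 := Finset.prod_ne_zero_iff.2 fun m _ =>
      mul_ne_zero (hd0 m) (Complex.exp_ne_zero _)
    have h3 : N.det ≠ 0 := ((Matrix.isUnit_iff_isUnit_det N).1 hN).ne_zero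
    simp [h2, h3]
  have hMdiff : ∀ m p, DifferentiableOn ℂ (fun s => M s m p) (ball 0 B) := fun m p => by
    have h1 : DifferentiableOn ℂ (fun s : ℂ => R m p (Lam + eps * s)) (ball 0 B) :=
      (hR1 m p).comp (t := ball (Lam₀ : ℂ) (ρ m)) (by fun_prop) fun s hs =>
        ball_subset_ball (hδ1.trans (hρ₀' m (Finset.mem_univ m))) (hmaps s hs)
    exact DifferentiableOn.mul (by fun_prop) h1
  have hbound : ∀ s ∈ ball (0 : ℂ) B, ‖(M s).det - (M₀ s).det‖ ≤ C₃ * (C₂ * eps) := fun s hs => by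
    have hsB : ‖s‖ ≤ B := (mem_ball_zero_iff.1 hs).le
    have h1 : ∀ m p, ‖M s m p - M₀ s m p‖ ≤ C₂ * eps := fun m p =>
      (hd m s hsB p).trans (by gcongr; exact hC₂' m)
    have h2 : ∀ m p, ‖M₀ s m p‖ ≤ 2 / η + CQ / ζ := fun m p => by
      refine (norm_add_le _ _).trans (add_le_add ?_ ?_)
      · have h3 : η ≤ ‖Y₀ m - u.z p‖ := hη' (m, p) (Finset.mem_univ _)
        have h4 : ‖Y m - Y₀ m‖ < η / 2 :=
          (mem_ball_iff_norm.1 (hYball m)).trans_le (min_le_right _ _)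
        have h5 : η / 2 ≤ ‖Y m - u.z p‖ := by
          have := norm_sub_norm_le (Y₀ m - u.z p) (-(Y m - Y₀ m))
          rw [norm_neg, show Y₀ m - u.z p - -(Y m - Y₀ m) = Y m - u.z p by ring] at this
          linarith
        rw [norm_inv]
        calc _ ≤ (η / 2)⁻¹ := by gcongr
          _ = 2 / η := by rw [inv_div]
      · split_ifs
        · have h6 : ζ ≤ ‖(u.xPlus Lam : ℂ) - u.z p‖ := by
            have := Complex.abs_im_le_norm ((u.xPlus Lam : ℂ) - u.z p)
            rw [Complex.sub_im, Complex.ofReal_im, zero_sub, abs_neg] at this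
            exact (hζ' p (Finset.mem_univ p)).trans ((le_abs_self _).trans this)
          rw [norm_mul, norm_inv, div_eq_mul_inv]
          have := hratio eps he heB Lam (by linarith) s hsB
          gcongr
        · rw [norm_zero]; positivity
    refine hdet _ _ _ (by positivity) (fun m p => ?_) (fun m p => (h2 m p).trans (by linarith)) h1
    have h7 := norm_le_norm_add_norm_sub' (M s m p) (M₀ s m p)
    have h8 : C₂ * eps ≤ C₂ := mul_le_of_le_one_right hC₂0.le heD.le
    linarith [h1 m p, h2 m p]
  -- With this choice the perturbed model is exactly `-det M` divided by the nonzero Cauchy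
  -- determinant.
  refine ⟨fun s => -(M s).det / cauchyDet u.z Y - (E s - 1), ?_, fun s hs => ?_, fun s hs => ?_⟩
  · refine ((DifferentiableOn.matrix_det hMdiff).neg.div_const _).sub (DifferentiableOn.sub_const ?_ _)
    rw [hE]
    fun_prop
  · have h1 : -(M s).det / cauchyDet u.z Y - (E s - 1) = -((M s).det - (M₀ s).det) / cauchyDet u.z Y := by
      rw [hdetM₀]
      field_simp
      ring
    beta_reduce
    rw [h1, norm_div, norm_neg]
    calc _ ≤ C₃ * (C₂ * eps) / (‖cauchyDet u.z Y₀‖ / 2) := by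
          have := hbound s hs
          gcongr
      _ = _ := by ring
  · rw [← hdetM s hs]
    have : Complex.exp (-Complex.I * (s * (u.xPlus Lam - u.xMinus Lam : ℝ) +
        ((∫ t in (u.xMinus Lam)..(u.xPlus Lam), (Lam + u.u0 t)) / eps + a - b : ℝ))) = E s := rfl
    rw [this, show E s - 1 + (-(M s).det / cauchyDet u.z Y - (E s - 1)) =
      -(M s).det / cauchyDet u.z Y by ring]
    simp [hC0]

end RationalPotential

/-! ### Zeros of the perturbed exponential. -/

open Metric in
/-- A small perturbation of `exp (-i (s L + θ)) - 1` has exactly one zero near each zero of this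
function. -/
theorem exists_zero_near {L L₂ θ B c : ℝ} (hL : 0 < L) (hL₂ : L ≤ L₂) {g : ℂ → ℂ}
    (hg : DifferentiableOn ℂ g (ball 0 B)) (hgc : ∀ s ∈ ball (0 : ℂ) B, ‖g s‖ ≤ c) {z₀ : ℂ}
    (hz₀ : ‖z₀‖ ≤ B - 2) (h1 : Complex.exp (-Complex.I * (z₀ * L + θ)) = 1) {r : ℝ} (hr : 0 < r)
    (hr1 : r ≤ 1 / 2) (hr2 : r * L₂ ≤ 1 / 8) (hc : c < L * r / 4) :
    ∃ s, Complex.exp (-Complex.I * (s * L + θ)) - 1 + g s = 0 ∧ ‖s - z₀‖ ≤ 2 * c / L ∧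
      ∀ s', ‖s' - z₀‖ ≤ r → Complex.exp (-Complex.I * (s' * L + θ)) - 1 + g s' = 0 → s' = s := by
  set G : ℂ → ℂ := fun s => Complex.exp (-Complex.I * (s * L + θ)) - 1 + g s with hG
  -- The margin `2` in the bound on `z₀` leaves room for `r ≤ 1 / 2` and for a Cauchy estimate on
  -- unit discs.
  have hin : ∀ s ∈ closedBall z₀ r, ∀ w ∈ closedBall s 1, w ∈ ball (0 : ℂ) B := fun s hs w hw => by
    rw [mem_closedBall_iff_norm] at hs hw
    rw [mem_ball_zero_iff]
    have h2 := norm_le_norm_add_norm_sub' w s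
    have h3 := norm_le_norm_add_norm_sub' s z₀
    linarith
  have hc0 : 0 ≤ c := (norm_nonneg _).trans
    (hgc z₀ (hin z₀ (mem_closedBall_self hr.le) z₀ (mem_closedBall_self zero_le_one)))
  -- `G` is compared with its linearization `-i L s`: their difference has derivative at most `L /
  -- 2`, so `G` expands distances by at least `L / 2`. This gives uniqueness of the zero and its
  -- distance from `z₀`.
  have hdG : ∀ s ∈ closedBall z₀ r, HasDerivAt (fun s => G s + Complex.I * L * s)
      (Complex.exp (-Complex.I * (s * L + θ)) * (-Complex.I * L) + deriv g s + Complex.I * L) s :=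
      fun s hs => by
    have e1 : HasDerivAt (fun s : ℂ => -Complex.I * (s * L + θ)) (-Complex.I * L) s := by
      have := (((hasDerivAt_id s).mul_const (L : ℂ)).add_const (θ : ℂ)).const_mul (-Complex.I)
      simpa using this
    have e2 : HasDerivAt g (deriv g s) s := (hg.differentiableAt
      (isOpen_ball.mem_nhds (hin s hs s (mem_closedBall_self zero_le_one)))).hasDerivAt
    have e3 : HasDerivAt (fun s : ℂ => Complex.I * L * s) (Complex.I * L) s := by
      simpa using (hasDerivAt_id s).const_mul (Complex.I * L)
    exact ((e1.cexp.sub_const 1).add e2).add e3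
  have hbd : ∀ s ∈ closedBall z₀ r,
      ‖Complex.exp (-Complex.I * (s * L + θ)) * (-Complex.I * L) + deriv g s + Complex.I * L‖ ≤ L / 2 :=
      fun s hs => by
    have e1 : ‖deriv g s‖ ≤ c := by
      have := Complex.norm_deriv_le_of_forall_mem_sphere_norm_le (c := s) one_pos
        ((hg.mono fun w hw => hin s hs w
          (closure_ball_subset_closedBall hw)).diffContOnCl) fun w hw =>
            hgc w (hin s hs w (sphere_subset_closedBall hw))
      simpa using this
    have e2 : Complex.exp (-Complex.I * (s * L + θ)) = Complex.exp (-Complex.I * ((s - z₀) * L)) := by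
      rw [show -Complex.I * (s * L + θ) = -Complex.I * ((s - z₀) * L) + -Complex.I * (z₀ * L + θ)
        by ring, Complex.exp_add, h1, mul_one]
    have e3 : ‖-Complex.I * ((s - z₀) * L)‖ ≤ 1 / 8 := by
      rw [norm_mul, norm_mul, norm_neg, Complex.norm_I, one_mul, Complex.norm_real,
        Real.norm_of_nonneg hL.le]
      exact (mul_le_mul (mem_closedBall_iff_norm.1 hs) hL₂ hL.le hr.le).trans hr2
    have e4 : ‖Complex.exp (-Complex.I * (s * L + θ)) - 1‖ ≤ 1 / 4 := by
      rw [e2]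
      refine (Complex.norm_exp_sub_one_le (e3.trans (by norm_num))).trans ?_
      linarith
    rw [show Complex.exp (-Complex.I * (s * L + θ)) * (-Complex.I * L) + deriv g s + Complex.I * L =
      (Complex.exp (-Complex.I * (s * L + θ)) - 1) * (-Complex.I * L) + deriv g s by ring]
    refine (norm_add_le _ _).trans ?_
    rw [norm_mul, norm_mul, norm_neg, Complex.norm_I, one_mul, Complex.norm_real,
      Real.norm_of_nonneg hL.le]
    have e5 : L * r / 4 ≤ L / 8 := by nlinarith
    nlinarith
  have hlow : ∀ s ∈ closedBall z₀ r, ∀ s' ∈ closedBall z₀ r, L / 2 * ‖s - s'‖ ≤ ‖G s - G s'‖ :=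
      fun s hs s' hs' => by
    have e1 := (convex_closedBall z₀ r).norm_image_sub_le_of_norm_hasDerivWithin_le
      (fun w hw => (hdG w hw).hasDerivWithinAt) hbd hs' hs
    have e2 : ‖Complex.I * L * (s - s')‖ = L * ‖s - s'‖ := by
      rw [norm_mul, norm_mul, Complex.norm_I, one_mul, Complex.norm_real, Real.norm_of_nonneg hL.le]
    have e3 := norm_sub_norm_le (Complex.I * L * (s - s')) (-(G s - G s'))
    rw [norm_neg, e2, show Complex.I * L * (s - s') - -(G s - G s') =
      G s + Complex.I * L * s - (G s' + Complex.I * L * s') by ring] at e3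
    linarith
  have hz : z₀ ∈ closedBall z₀ r := mem_closedBall_self hr.le
  have hG₀ : ‖G z₀‖ ≤ c := by
    rw [hG]
    beta_reduce
    rw [h1, sub_self, zero_add]
    exact hgc z₀ (hin z₀ hz z₀ (mem_closedBall_self zero_le_one))
  have hGd : DifferentiableOn ℂ G (closedBall z₀ r) := fun s hs => by
    have := ((hdG s hs).sub ((hasDerivAt_id s).const_mul (Complex.I * L))).differentiableAt
    refine (this.congr_of_eventuallyEq (Eventually.of_forall fun w => ?_)).differentiableWithinAt
    simp
  -- On the circle `G` differs from `G z₀` by at least `L / 2 * r`, so the image contains the ball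
  -- about `G z₀` of half that radius, and `0` belongs to it since `c < L * r / 4`.
  have hsub := (hGd.mono closure_ball_subset_closedBall).diffContOnCl.ball_subset_image_closedBall hr
    (ε := L / 2 * r) (fun w hw => by
      have := hlow w (sphere_subset_closedBall hw) z₀ hz
      rwa [mem_sphere_iff_norm.1 hw] at this) (by
      have e1 : ∃ᶠ w in 𝓝[≠] z₀, w ∈ closedBall z₀ r :=
        Eventually.frequently (nhdsWithin_le_nhds (closedBall_mem_nhds z₀ hr))
      refine ((e1.and_eventually self_mem_nhdsWithin).filter_mono nhdsWithin_le_nhds).mono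
        fun w hw he => ?_
      have := hlow w hw.1 z₀ hz
      rw [he, sub_self, norm_zero] at this
      have h3 : 0 < ‖w - z₀‖ := norm_pos_iff.2 (sub_ne_zero.2 hw.2)
      have := mul_pos (half_pos hL) h3
      linarith)
  obtain ⟨s, hs, hs0⟩ := hsub (show (0 : ℂ) ∈ _ by
    rw [mem_ball_iff_norm, zero_sub, norm_neg]
    exact hG₀.trans_lt (hc.trans_eq (by ring)))
  refine ⟨s, hs0, ?_, fun s' hs' hs'0 => ?_⟩
  · have := hlow s hs z₀ hz
    rw [hs0, zero_sub, norm_neg] at this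
    rw [le_div_iff₀ hL]
    linarith
  · have := hlow s' (mem_closedBall_iff_norm.2 hs') s hs
    rw [show G s' = 0 from hs'0, hs0, sub_zero, norm_zero] at this
    have h3 : ‖s' - s‖ ≤ 0 := by
      by_contra! h
      have := mul_pos (half_pos hL) h
      linarith
    exact sub_eq_zero.1 (norm_le_zero_iff.1 h3)

/-- After reduction to `|ψ| ≤ π`, the left side is `2 |sin(ψ / 2)|`, at least `2 |ψ| / π` by
Jordan's inequality; the constant `π / 2` is rounded up to `2`. -/
theorem exists_int_of_norm_exp_sub_one_le {φ c : ℝ}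
    (h : ‖Complex.exp (-Complex.I * φ) - 1‖ ≤ c) : ∃ k : ℤ, |φ - 2 * Real.pi * k| ≤ 2 * c := by
  have hpi := Real.pi_pos
  set k := round (φ / (2 * Real.pi)) with hk
  refine ⟨k, ?_⟩
  set ψ := φ - 2 * Real.pi * k with hψ
  have h1 : |ψ| ≤ Real.pi := by
    have h2 := abs_sub_round (φ / (2 * Real.pi))
    have h3 : ψ = (2 * Real.pi) * (φ / (2 * Real.pi) - k) := by
      rw [hψ]; field_simp
    rw [h3, abs_mul, abs_of_pos (by positivity)]
    calc _ ≤ 2 * Real.pi * (1 / 2) := by gcongr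
      _ = Real.pi := by ring
  have h2 : Complex.exp (-Complex.I * φ) = Complex.exp (Complex.I * (-ψ : ℝ)) := by
    rw [Complex.exp_eq_exp_iff_exists_int]
    refine ⟨-k, ?_⟩
    rw [hψ]
    push_cast
    ring
  rw [h2, Complex.norm_exp_I_mul_ofReal_sub_one] at h
  have h3 := Real.mul_abs_le_abs_sin (x := -ψ / 2) (by
    rw [abs_div, abs_neg, abs_two]; linarith)
  rw [norm_mul, Real.norm_eq_abs, Real.norm_eq_abs, abs_two] at h
  rw [abs_div, abs_neg, abs_two] at h3
  have h4 : 2 / Real.pi * (|ψ| / 2) * 2 ≤ c := by linarith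
  have h5 : 2 / Real.pi * (|ψ| / 2) * 2 = 2 * |ψ| / Real.pi := by ring
  rw [h5, div_le_iff₀ hpi] at h4
  have hc : 0 ≤ c := by
    refine le_trans ?_ h
    positivity
  nlinarith [Real.pi_le_four]

/-! ### From zeros to eigenvalues close to a given point. -/

namespace RationalPotential

variable {P : ℕ} (u : RationalPotential P)

open Metric

/-- There are `2 J + 1` consecutive eigenvalues approximated with error `C eps ^ 2` by equally spaced
points around `Lam`, the offset being determined by `τ`, and they are the closest ones to `Lam`. -/
def EigenvaluesNear (J : ℕ) (C eps Lam τ : ℝ) : Prop :=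
  ∃ lam : ℤ → ℝ,
    StrictMonoOn lam (Set.Icc (-(J : ℤ)) J) ∧
    (∀ j ∈ Set.Icc (-(J : ℤ)) J,
      u.IsEigenvalue eps (lam j) ∧
      |lam j - (Lam + 2 * Real.pi * eps *
          (((j : ℝ) + (round τ : ℝ) - τ) / (u.xPlus Lam - u.xMinus Lam)))| ≤ C * eps ^ 2) ∧
    ∀ mu, u.IsEigenvalue eps mu → mu ∉ lam '' Set.Icc (-(J : ℤ)) J →
      ∀ j ∈ Set.Icc (-(J : ℤ)) J,
        |lam j - Lam| ≤ |mu - Lam| + C * eps ^ 2 ∧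
        (|(round τ : ℝ) - τ| ≤ 1 / 2 - C * eps → |lam j - Lam| < |mu - Lam|)

variable {u}

theorem EigenvaluesNear.mono {J : ℕ} {C C' eps Lam τ : ℝ} (h : u.EigenvaluesNear J C eps Lam τ)
    (hC : C ≤ C') (heps : 0 < eps) : u.EigenvaluesNear J C' eps Lam τ := by
  obtain ⟨lam, h1, h2, h3⟩ := h
  have hC2 : C * eps ^ 2 ≤ C' * eps ^ 2 := by gcongr
  have hC1 : C * eps ≤ C' * eps := by gcongr
  refine ⟨lam, h1, fun j hj => ⟨(h2 j hj).1, (h2 j hj).2.trans hC2⟩, fun mu hmu hmu' j hj => ?_⟩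
  obtain ⟨h4, h5⟩ := h3 mu hmu hmu' j hj
  exact ⟨by linarith, fun h => h5 (by linarith)⟩

set_option maxHeartbeats 1000000 in
/-- The eigenvalues near `Lam`, from the zeros of the rescaled Evans function. -/
theorem eigenvaluesNear_of_zeros {J : ℕ} {L₁ L₂ B C r eps Lam a : ℝ} (hL₁ : 0 < L₁)
    (hLl : L₁ ≤ u.xPlus Lam - u.xMinus Lam) (hLu : u.xPlus Lam - u.xMinus Lam ≤ L₂)
    (hB : B = 2 * Real.pi * (J + 2) / L₁ + 4) (hC : 0 < C) (hr : 0 < r) (hr1 : r ≤ 1 / 2)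
    (hr2 : r * L₂ ≤ 1 / 8) (heps : 0 < eps) (he1 : C * eps < L₁ * r / 4)
    (he2 : 2 * C / L₁ * eps < r) (he3 : 2 * (2 * C / L₁ * eps) < Real.pi / L₂) (he4 : B * eps < -Lam)
    {g : ℂ → ℂ} (hg : DifferentiableOn ℂ g (ball 0 B)) (hgC : ∀ s ∈ ball (0 : ℂ) B, ‖g s‖ ≤ C * eps)
    (hG : ∀ s ∈ ball (0 : ℂ) B, (u.AC eps (Lam + eps * s)).det = 0 ↔
      Complex.exp (-Complex.I * (s * (u.xPlus Lam - u.xMinus Lam : ℝ) + (a : ℝ))) - 1 + g s = 0) :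
    u.EigenvaluesNear J (4 * C / L₁ + 2 * C / L₁ * L₂) eps Lam (a / (2 * Real.pi)) := by
  have hpi := Real.pi_pos
  set L := u.xPlus Lam - u.xMinus Lam with hLdef
  have hL : 0 < L := hL₁.trans_le hLl
  have hL₂ : 0 < L₂ := hL.trans_le hLu
  set τ := a / (2 * Real.pi) with hτ
  have haτ : a = 2 * Real.pi * τ := by rw [hτ]; field_simp
  set D := 2 * C / L₁ with hD
  have hD0 : 0 < D := by positivity
  have hDe : 0 < D * eps := by positivity
  have hround : |(round τ : ℝ) - τ| ≤ 1 / 2 := by rw [abs_sub_comm]; exact abs_sub_round τ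
  set N := round τ
  -- The zeros of the unperturbed exponential, with the rounding `N` making `z 0` one of smallest
  -- modulus.
  set z : ℤ → ℝ := fun j => 2 * Real.pi * (j + N - τ) / L with hz
  have hneg : ∀ s ∈ ball (0 : ℂ) B, ((Lam : ℂ) + eps * s).re < 0 := fun s hs => by
    have h1 := (Complex.re_le_norm s).trans_lt (mem_ball_zero_iff.1 hs)
    rw [Complex.add_re, Complex.ofReal_re, Complex.re_ofReal_mul]
    nlinarith
  -- A zero found in the complex disc is automatically real, hence an eigenvalue.
  have hreal : ∀ s ∈ ball (0 : ℂ) B, (u.AC eps (Lam + eps * s)).det = 0 → s = (s.re : ℂ) :=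
      fun s hs h0 => by
    have h1 := u.im_eq_zero_of_det_eq_zero heps (hneg s hs) h0
    rw [Complex.add_im, Complex.ofReal_im, Complex.im_ofReal_mul, zero_add] at h1
    exact Complex.ext rfl (by rw [Complex.ofReal_im]; exact (mul_eq_zero.1 h1).resolve_left heps.ne')
  have hball : ∀ t : ℝ, |t| < B → (t : ℂ) ∈ ball (0 : ℂ) B := fun t ht => by
    rwa [mem_ball_zero_iff, Complex.norm_real]
  have heig : ∀ t : ℝ, |t| < B → (u.IsEigenvalue eps (Lam + eps * t) ↔
      (u.AC eps (Lam + eps * (t : ℂ))).det = 0) := fun t ht => by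
    have h1 := hneg t (hball t ht)
    rw [IsEigenvalue, evans, ← AC_ofReal]
    push_cast
    refine and_iff_right ?_
    rwa [Complex.add_re, Complex.ofReal_re, Complex.re_ofReal_mul, Complex.ofReal_re] at h1
  have habs : ∀ j : ℤ, |j| ≤ J → |z j| ≤ 2 * Real.pi * (J + |(N : ℝ) - τ|) / L := fun j hj => by
    rw [hz]
    beta_reduce
    rw [abs_div, abs_mul, abs_of_pos (by positivity : 0 < 2 * Real.pi), abs_of_pos hL,
      show (j : ℝ) + N - τ = j + (N - τ) by ring]
    have hj' : |(j : ℝ)| ≤ J := by exact_mod_cast hj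
    gcongr
    exact (abs_add_le _ _).trans (by gcongr)
  have habs' : ∀ j : ℤ, |j| ≤ J → |z j| ≤ B - 2 := fun j hj => by
    refine (habs j hj).trans ?_
    calc 2 * Real.pi * (J + |(N : ℝ) - τ|) / L ≤ 2 * Real.pi * (J + 2) / L₁ := by
          gcongr
          linarith
      _ ≤ B - 2 := by rw [hB]; linarith
  have hexp : ∀ k : ℤ, Complex.exp (-Complex.I * ((z k : ℂ) * L + a)) = 1 := fun k => by
    rw [Complex.exp_eq_one_iff]
    refine ⟨-(k + N), ?_⟩
    have : z k * L + a = 2 * Real.pi * (k + N) := by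
      rw [hz, haτ]; field_simp; ring
    rw [← Complex.ofReal_mul, ← Complex.ofReal_add, this]
    push_cast
    ring
  have hDle : 2 * (C * eps) / L ≤ D * eps := by
    rw [hD, div_mul_eq_mul_div, mul_assoc]
    gcongr
  have hex : ∀ j : ℤ, |j| ≤ J → ∃ σ : ℝ, u.IsEigenvalue eps (Lam + eps * σ) ∧ |σ - z j| ≤ D * eps ∧
      ∀ t : ℝ, |t| < B → u.IsEigenvalue eps (Lam + eps * t) → |t - z j| ≤ r → t = σ := fun j hj => by
    have hc : C * eps < L * r / 4 := he1.trans_le (by gcongr)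
    obtain ⟨s, hs0, hsz, hsu⟩ := exists_zero_near hL hLu hg hgC (z₀ := (z j : ℂ))
      (by rw [Complex.norm_real]; exact habs' j hj) (hexp j) hr hr1 hr2 hc
    have hsB : s ∈ ball (0 : ℂ) B := by
      rw [mem_ball_zero_iff]
      have h1 := norm_le_norm_add_norm_sub' s (z j : ℂ)
      rw [Complex.norm_real, Real.norm_eq_abs] at h1
      linarith [habs' j hj]
    have hsdet := (hG s hsB).2 hs0
    have hsre := hreal s hsB hsdet
    rw [hsre] at hsB hsdet hsz
    have hsB' : |s.re| < B := by rwa [mem_ball_zero_iff, Complex.norm_real] at hsB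
    refine ⟨s.re, (heig _ hsB').2 hsdet, ?_, fun t ht htE htz => ?_⟩
    · rw [← Complex.ofReal_sub, Complex.norm_real] at hsz
      exact hsz.trans hDle
    · have h2 := hsu t (by rw [← Complex.ofReal_sub, Complex.norm_real]; exact htz)
        ((hG t (hball t ht)).1 ((heig t ht).1 htE))
      rw [← h2, Complex.ofReal_re]
  choose! σ hσE hσz hσu using hex
  have hmemJ : ∀ j : ℤ, j ∈ Set.Icc (-(J : ℤ)) J ↔ |j| ≤ J := fun j => by
    rw [Set.mem_Icc, abs_le]
  have hσabs : ∀ j : ℤ, |j| ≤ J → |σ j| ≤ 2 * Real.pi * (J + |(N : ℝ) - τ|) / L + D * eps :=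
      fun j hj => by
    have := abs_add_le (σ j - z j) (z j)
    rw [sub_add_cancel] at this
    linarith [habs j hj, hσz j hj]
  have hpiL : Real.pi / L₂ ≤ Real.pi / L := by gcongr
  refine ⟨fun j => Lam + eps * σ j, ?_, fun j hj => ?_, fun mu hmu hmu' j hj => ?_⟩
  · intro j hj k hk hjk
    rw [hmemJ] at hj hk
    have h1 := (abs_le.1 (hσz j hj)).2
    have h2 := (abs_le.1 (hσz k hk)).1
    have h3 : z j + 2 * Real.pi / L ≤ z k := by
      have : (j : ℝ) + 1 ≤ k := by exact_mod_cast hjk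
      have e : z k - z j = 2 * Real.pi / L * (k - j) := by rw [hz]; ring
      have e2 : 2 * Real.pi / L * 1 ≤ 2 * Real.pi / L * (k - j) := by gcongr; linarith
      linarith
    have h4 : 2 * Real.pi / L = Real.pi / L + Real.pi / L := by ring
    have h5 : 0 < Real.pi / L := by positivity
    have h6 : σ j < σ k := by linarith
    beta_reduce
    gcongr
  · rw [hmemJ] at hj
    refine ⟨hσE j hj, ?_⟩
    have e : Lam + eps * σ j - (Lam + 2 * Real.pi * eps * (((j : ℝ) + N - τ) / L)) =
        eps * (σ j - z j) := by rw [hz]; ring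
    rw [e, abs_mul, abs_of_pos heps]
    calc _ ≤ eps * (D * eps) := by gcongr; exact hσz j hj
      _ = D * eps ^ 2 := by ring
      _ ≤ _ := by
        gcongr
        have e2 : 4 * C / L₁ = D + D := by rw [hD]; ring
        rw [e2]
        have := mul_pos hD0 hL₂
        linarith
  · rw [hmemJ] at hj
    set t := (mu - Lam) / eps with ht
    have hmt : mu = Lam + eps * t := by rw [ht]; field_simp; ring
    have hσj := hσabs j hj
    have e1 : |Lam + eps * σ j - Lam| = eps * |σ j| := by
      rw [add_sub_cancel_left, abs_mul, abs_of_pos heps]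
    have e2 : |mu - Lam| = eps * |t| := by
      rw [hmt, add_sub_cancel_left, abs_mul, abs_of_pos heps]
    have e3 : 4 * C / L₁ = 2 * D := by rw [hD]; ring
    rw [e1, e2, e3]
    -- An unlisted eigenvalue, rescaled to `t`, either satisfies `|t| > B - 2` or lies close to some
    -- `z (k - N)`. In the second case local uniqueness excludes `|k - N| ≤ J`, which leaves `|k -
    -- N| ≥ J + 1`.
    have hfin : |t| ≥ 2 * Real.pi * (J + 1 - |(N : ℝ) - τ|) / L - D * eps := by
      by_cases htB : |t| ≤ B - 2
      · have htB' : |t| < B := by linarith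
        have h0 := (hG t (hball t htB')).1 ((heig t htB').1 (hmt ▸ hmu))
        have h1 : ‖Complex.exp (-Complex.I * ((t * L + a : ℝ) : ℂ)) - 1‖ ≤ C * eps := by
          have h2 := eq_neg_of_add_eq_zero_left h0
          push_cast
          rw [h2, norm_neg]
          exact hgC t (hball t htB')
        obtain ⟨k, hk⟩ := exists_int_of_norm_exp_sub_one_le h1
        have h3 : t - z (k - N) = (t * L + a - 2 * Real.pi * k) / L := by
          rw [hz, haτ]
          push_cast
          field_simp
          ring
        have h4 : |t - z (k - N)| ≤ D * eps := by
          rw [h3, abs_div, abs_of_pos hL]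
          refine le_trans ?_ hDle
          gcongr
        have h5 : (J : ℤ) < |k - N| := by
          by_contra! h5
          refine hmu' ⟨k - N, (hmemJ _).2 h5, ?_⟩
          rw [hmt, hσu _ h5 t htB' (hmt ▸ hmu) (h4.trans he2.le)]
        have h6 : (J : ℝ) + 1 ≤ |((k - N : ℤ) : ℝ)| := by exact_mod_cast h5
        have h7 : 2 * Real.pi * (J + 1 - |(N : ℝ) - τ|) / L ≤ |z (k - N)| := by
          rw [hz]
          beta_reduce
          rw [abs_div, abs_mul, abs_of_pos (by positivity : 0 < 2 * Real.pi), abs_of_pos hL,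
            show ((k - N : ℤ) : ℝ) + N - τ = ((k - N : ℤ) : ℝ) - -(N - τ) by ring]
          gcongr
          have := abs_sub_abs_le_abs_sub ((k - N : ℤ) : ℝ) (-((N : ℝ) - τ))
          rw [abs_neg] at this
          linarith
        have h8 := abs_sub_abs_le_abs_sub (z (k - N)) t
        rw [abs_sub_comm] at h8
        linarith
      · push Not at htB
        have h1 : 2 * Real.pi * (J + 1 - |(N : ℝ) - τ|) / L ≤ 2 * Real.pi * (J + 2) / L₁ := by
          have := abs_nonneg ((N : ℝ) - τ)
          have h2 : (J : ℝ) + 1 - |(N : ℝ) - τ| ≤ J + 2 := by linarith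
          calc _ ≤ 2 * Real.pi * (J + 2) / L := by gcongr
            _ ≤ _ := by gcongr
        rw [hB] at htB
        linarith
    -- The gap between the bounds for unlisted and listed model zeros. It is never negative, which
    -- gives the comparison up to an error; it beats the error when `τ` is not too close to a
    -- half-integer.
    have e4 : 2 * Real.pi * (J + 1 - |(N : ℝ) - τ|) / L - 2 * Real.pi * (J + |(N : ℝ) - τ|) / L =
        4 * Real.pi / L * (1 / 2 - |(N : ℝ) - τ|) := by ring
    constructor
    · have h1 : 0 ≤ 4 * Real.pi / L * (1 / 2 - |(N : ℝ) - τ|) :=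
        mul_nonneg (by positivity) (by linarith)
      have h2 : |σ j| ≤ |t| + 2 * D * eps := by linarith
      have h3 : 0 ≤ D * L₂ * eps ^ 2 := by positivity
      calc eps * |σ j| ≤ eps * (|t| + 2 * D * eps) := by gcongr
        _ = eps * |t| + 2 * D * eps ^ 2 := by ring
        _ ≤ _ := by linarith
    · intro h
      have h1 : 4 * Real.pi / L * ((2 * D + D * L₂) * eps) ≤
          4 * Real.pi / L * (1 / 2 - |(N : ℝ) - τ|) := by gcongr; linarith
      -- The summand `D * L₂` in the constant serves here, since the gap is divided by `L ≤ L₂`.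
      have h2 : 4 * (D * eps) < 4 * Real.pi / L * ((2 * D + D * L₂) * eps) := by
        have h3 : L < Real.pi * (2 + L₂) := by nlinarith [Real.pi_gt_three]
        calc 4 * (D * eps) = 4 / L * L * (D * eps) := by field_simp
          _ < 4 / L * (Real.pi * (2 + L₂)) * (D * eps) := by gcongr
          _ = _ := by ring
      have h3 : |σ j| < |t| := by linarith
      gcongr

end RationalPotential

/-! ### Local uniformity and compactness. -/

namespace RationalPotential

variable {P : ℕ} {u : RationalPotential P}

/-- Suitability at the centre provides the contours and constants for all nearby `Lam`. Suitability
at `Lam` itself is needed only to identify the upper critical points in its phases. -/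
theorem HasSuitableModification.exists_eigenvaluesNear {xc Lam₀ : ℝ} (hpk : u.IsPeak xc)
    (hbulk : -u.u0 xc < Lam₀) (hLam : Lam₀ < 0) (hs : u.HasSuitableModification Lam₀) (J : ℕ) :
    ∃ δ > 0, ∃ C > 0, ∃ eps₁ > 0, ∀ Lam : ℝ, |Lam - Lam₀| < δ → u.HasSuitableModification Lam →
      ∀ psiP psiM : ℝ → ℝ, u.IsPhasePair Lam (psiP Lam) (psiM Lam) → ∀ eps, 0 < eps → eps < eps₁ →
        u.EigenvaluesNear J C eps Lam (u.T psiP psiM eps Lam) := by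
  have hpi := Real.pi_pos
  obtain ⟨-, -, hlt₁, hlt₂⟩ := hpk.turning hbulk hLam
  set L₀ := u.xPlus Lam₀ - u.xMinus Lam₀ with hL₀
  have hL₀p : 0 < L₀ := sub_pos.2 (hlt₁.trans hlt₂)
  set L₁ := L₀ / 2
  set L₂ := 2 * L₀
  have hL₁ : 0 < L₁ := half_pos hL₀p
  have hL₂ : 0 < L₂ := by positivity
  -- Large enough for all model zeros with `|j| ≤ J` to have modulus at most `B - 2`, and for an
  -- eigenvalue beyond that radius to be farther away than the listed ones.
  set B := 2 * Real.pi * (J + 2) / L₁ + 4 with hB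
  obtain ⟨δ₁, hδ₁, C, hC, e₁, he₁, hloc⟩ := hs.exists_local hpk hbulk hLam B
  set r := min (1 / (8 * L₂)) (1 / 2)
  have hr : 0 < r := lt_min (by positivity) (by norm_num)
  have hr1 : r ≤ 1 / 2 := min_le_right _ _
  have hr2 : r * L₂ ≤ 1 / 8 := by
    calc r * L₂ ≤ 1 / (8 * L₂) * L₂ := by gcongr; exact min_le_left _ _
      _ = 1 / 8 := by field_simp
  have hLc : ContinuousAt (fun l => u.xPlus l - u.xMinus l) Lam₀ :=
    (hpk.continuousAt_xPlus hbulk hLam).sub (hpk.continuousAt_xMinus hbulk hLam)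
  have hev : ∀ᶠ l in 𝓝 Lam₀, L₁ < u.xPlus l - u.xMinus l ∧ u.xPlus l - u.xMinus l < L₂ ∧
      -u.u0 xc < l ∧ l < Lam₀ / 2 :=
    (hLc.eventually_const_lt (half_lt_self hL₀p)).and
      ((hLc.eventually_lt_const (by change L₀ < L₂; simp only [L₂]; linarith)).and
        (Ioo_mem_nhds hbulk (by linarith)))
  obtain ⟨δ₂, hδ₂, hev⟩ := Metric.eventually_nhds_iff.1 hev
  have hsmall : ∀ K M : ℝ, 0 < M → ∀ᶠ e in 𝓝[>] (0 : ℝ), K * e < M := fun K M hM => by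
    have h1 : Tendsto (fun e : ℝ => K * e) (𝓝 0) (𝓝 (K * 0)) := tendsto_id.const_mul K
    rw [mul_zero] at h1
    exact (h1.mono_left nhdsWithin_le_nhds).eventually_lt_const hM
  have hall := (hsmall C (L₁ * r / 4) (by positivity)).and ((hsmall (2 * C / L₁) r hr).and
    ((hsmall (2 * (2 * C / L₁)) (Real.pi / L₂) (by positivity)).and
      ((hsmall B (-(Lam₀ / 2)) (by linarith)).and (hsmall 1 e₁ he₁))))
  obtain ⟨eps₁, heps₁, hall⟩ := mem_nhdsGT_iff_exists_Ioo_subset.1 hall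
  refine ⟨min δ₁ δ₂, lt_min hδ₁ hδ₂, 4 * C / L₁ + 2 * C / L₁ * L₂, by positivity, eps₁, heps₁,
    fun Lam hL hsuit psiP psiM hphase eps he he' => ?_⟩
  obtain ⟨k1, k2, k3, k4, k5⟩ := hall ⟨he, he'⟩
  rw [one_mul] at k5
  obtain ⟨l1, l2, l3, l4⟩ := hev (y := Lam) (hL.trans_le (min_le_right _ _))
  obtain ⟨g, hg, hgC, hG⟩ := hloc eps he k5 Lam (hL.trans_le (min_le_left _ _)) hsuit _ _ hphase
  have hneg : Lam < 0 := by linarith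
  -- By the area identity, the angle of the model exponential is `2π T`.
  have hT : u.T psiP psiM eps Lam = ((∫ t in (u.xMinus Lam)..(u.xPlus Lam), (Lam + u.u0 t)) / eps +
      psiP Lam - psiM Lam) / (2 * Real.pi) := by
    rw [T, hpk.integral_turning l3 hneg]
    field_simp
    ring
  rw [hT]
  exact eigenvaluesNear_of_zeros hL₁ l1.le l2.le hB hC hr hr1 hr2 he k1 k2
    (by rw [← mul_assoc]; exact k3) (by linarith) hg hgC hG

/-- The existence of common constants passes to subsets and to unions of two sets, by taking the
larger `C` and the smaller threshold, and it holds near each point of `K`. -/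
theorem exists_eigenvaluesNear_of_isCompact (hu : u.IsPositiveKlausShaw) {K : Set ℝ} (hK : IsCompact K)
    (hKb : K ⊆ u.bulk) (hsuit : ∀ lam ∈ K, u.HasSuitableModification lam) (J : ℕ) :
    ∃ C > 0, ∃ eps₀ > 0, ∀ Lam ∈ K, ∀ psiP psiM : ℝ → ℝ, u.IsPhasePair Lam (psiP Lam) (psiM Lam) →
      ∀ eps, 0 < eps → eps < eps₀ → u.EigenvaluesNear J C eps Lam (u.T psiP psiM eps Lam) := by
  obtain ⟨xc, hpk⟩ := IsPositiveKlausShaw.exists_isPeak u hu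
  refine hK.induction_on (p := fun S => ∃ C > 0, ∃ eps₀ > 0, ∀ Lam ∈ S, ∀ psiP psiM : ℝ → ℝ,
      u.IsPhasePair Lam (psiP Lam) (psiM Lam) → ∀ eps, 0 < eps → eps < eps₀ →
        u.EigenvaluesNear J C eps Lam (u.T psiP psiM eps Lam)) ?_ ?_ ?_ ?_
  · exact ⟨1, one_pos, 1, one_pos, fun Lam h => absurd h (Set.notMem_empty _)⟩
  · rintro s t hst ⟨C, hC, e, he, h⟩
    exact ⟨C, hC, e, he, fun Lam hL => h Lam (hst hL)⟩
  · rintro s t ⟨C, hC, e, he, h⟩ ⟨C', hC', e', he', h'⟩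
    refine ⟨max C C', lt_max_of_lt_left hC, min e e', lt_min he he', ?_⟩
    rintro Lam (hL | hL) psiP psiM hp eps h0 h1
    · exact (h Lam hL psiP psiM hp eps h0 (h1.trans_le (min_le_left _ _))).mono (le_max_left _ _) h0
    · exact (h' Lam hL psiP psiM hp eps h0 (h1.trans_le (min_le_right _ _))).mono (le_max_right _ _) h0
  · intro Lam₀ hL₀
    obtain ⟨h1, h2⟩ := hpk.mem_bulk (hKb hL₀)
    obtain ⟨δ, hδ, C, hC, e, he, h⟩ := (hsuit Lam₀ hL₀).exists_eigenvaluesNear hpk h1 h2 J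
    exact ⟨K ∩ Metric.ball Lam₀ δ, inter_mem_nhdsWithin K (Metric.ball_mem_nhds _ hδ), C, hC, e, he,
      fun Lam hL => h Lam hL.2 (hsuit Lam hL.1)⟩

end RationalPotential

theorem mainTheorem5 {P : ℕ} (u : RationalPotential P) (hu : u.IsPositiveKlausShaw)
    (a b : ℝ) (hab : a ≤ b) (hK : Set.Icc a b ⊆ u.bulk)
    (hsuit : ∀ lam ∈ Set.Icc a b, u.HasSuitableModification lam)
    (J : ℕ) (hJ : 0 < J) :
    ∃ C > (0 : ℝ), ∃ eps₀ > (0 : ℝ),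
      ∀ psiP psiM : ℝ → ℝ,
      (∀ lam ∈ Set.Icc a b, u.IsPhasePair lam (psiP lam) (psiM lam)) →
      ∀ eps : ℝ, 0 < eps → eps < eps₀ →
      ∀ Lam ∈ Set.Icc a b,
        |(round (u.T psiP psiM eps Lam) : ℝ) - u.T psiP psiM eps Lam| ≤ 1 / 2 ∧
        ∃ lam : ℤ → ℝ,
          StrictMonoOn lam (Set.Icc (-(J : ℤ)) J) ∧
          (∀ j ∈ Set.Icc (-(J : ℤ)) J,
            u.IsEigenvalue eps (lam j) ∧
            |lam j - (Lam + 2 * Real.pi * eps *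
                (((j : ℝ) + (round (u.T psiP psiM eps Lam) : ℝ) - u.T psiP psiM eps Lam) /
                  (u.xPlus Lam - u.xMinus Lam)))| ≤ C * eps ^ 2) ∧
          ∀ mu, u.IsEigenvalue eps mu → mu ∉ lam '' Set.Icc (-(J : ℤ)) J →
            ∀ j ∈ Set.Icc (-(J : ℤ)) J,
              |lam j - Lam| ≤ |mu - Lam| + C * eps ^ 2 ∧
              (|(round (u.T psiP psiM eps Lam) : ℝ) - u.T psiP psiM eps Lam| ≤ 1 / 2 - C * eps →
                |lam j - Lam| < |mu - Lam|) := by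
  obtain ⟨C, hC, eps₀, heps₀, h⟩ :=
    RationalPotential.exists_eigenvaluesNear_of_isCompact hu isCompact_Icc hK hsuit J
  refine ⟨C, hC, eps₀, heps₀, fun psiP psiM hphase eps he he' Lam hLam => ⟨?_,
    h Lam hLam psiP psiM (hphase Lam hLam) eps he he'⟩⟩
  rw [abs_sub_comm]
  exact abs_sub_round _
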